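/- Let $\mathbb F$ be a field, $R=\mathbb F[U,V]$, $A=R[X]/((X-U)(X-V))$, made into a Frobenius algebra over $R$ by the trace $\varepsilon(1)=0$, $\varepsilon(X)=1$; thus $\Delta(1)=X\otimes 1+1\otimes X-(U+V)\,1\otimes 1$ and $\Delta(X)=X\otimes X-UV\,1\otimes 1$. For an oriented link diagram $D$ with $n_+$ positive and $n_-$ negative crossings, let $CKh(D)$ be the complex of free $R$-modules obtained from the cube of resolutions of $D$ with the $(1+1)$-dimensional TQFT of $A$ (with the usual signs on the edges of the cube), let $Kh(D)$ be its homology, and let $T(D)\subset Kh(D)$ be the $R$-torsion submodule. A Khovanov generator $g$ of $CKh(D)$ is a vertex $u\in\{0,1\}^{n_++n_-}$ of the cube together with a label $1$ or $X$ on each circle of the resolution $D_u$; its quantum grading is $$\operatorname{gr}_q(g)=\#\{\text{labels }1\}-\#\{\text{labels }X\}+\textstyle\sum_i u_i+n_+-2n_- .$$ Fix $t\in[0,2]$. For $\lambda\in\mathbb R$ let $F^t_\lambda\subset CKh(D)$ be the $\mathbb F$-span of all $U^mV^ng$ with $m,n\ge 0$ and $g$ a Khovanov generator such that $\operatorname{gr}_q(g)-(tm+(2-t)n)\ge\lambda$.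 This filtration induces one on cycles by intersection, then one on $Kh(D)$ and one on $Kh(D)/T(D)$ by taking images. For $\bar\eta\in Kh(D)/T(D)$ let $\operatorname{gr}_t(\bar\eta)$ be the supremum of all $\lambda$ such that $\bar\eta$ lies in the $\lambda$-th step of the filtration, and put $$\operatorname{gr}_t(D)=\sup\{\operatorname{gr}_t(\bar\eta)\mid 0\ne\bar\eta\in Kh(D)/T(D)\},\qquad s_t(D)=\operatorname{gr}_t(D)-1,$$ with suprema taken in the extended real line. **Proposition.** Let $t\in[0,2]$. If two oriented link diagrams $D$ and $D'$ differ by a Reidemeister move, then $\operatorname{gr}_t(D)=\operatorname{gr}_t(D')$. Hence $\operatorname{gr}_t(D)$ and $s_t(D)$ depend only on the oriented link presented by $D$, that is, on the class of $D$ under finite sequences of Reidemeister moves, and so define link invariants $\operatorname{gr}_t(L)$ and $s_t(L)$. -/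

import Mathlib

noncomputable section

open scoped Classical

namespace Khovanov

/-! ## Filtrations indexed by the reals and the gradings they induce -/

section Filtrations

variable {F : Type*} [Field F] {M : Type*} [AddCommGroup M] [Module F M]

/-- The grading induced by a family of subspaces: `gr m = sup {lam | m ∈ Fil lam}`. -/
def gradingOf (Fil : ℝ → Submodule F M) (m : M) : EReal :=
  ⨆ lam : ℝ, ⨆ _ : m ∈ Fil lam, (lam : EReal)

/-- The supremum of the induced grading over all nonzero elements. -/
def maxGradingOf (Fil : ℝ → Submodule F M) : EReal :=
  ⨆ m : M, ⨆ _ : m ≠ 0, gradingOf Fil m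

/-- The filtration induced along an injection `N → M` (for instance a subspace): preimages. -/
def inducedSub {N : Type*} [AddCommGroup N] [Module F N] (i : N →ₗ[F] M)
    (Fil : ℝ → Submodule F M) : ℝ → Submodule F N :=
  fun lam => (Fil lam).comap i

/-- The filtration induced along a surjection `M → Q` (for instance a quotient map): images. -/
def inducedQuot {Q : Type*} [AddCommGroup Q] [Module F Q] (q : M →ₗ[F] Q)
    (Fil : ℝ → Submodule F M) : ℝ → Submodule F Q :=
  fun lam => (Fil lam).map q

end Filtrations

/-! ## Homology modulo torsion -/

section Homology

variable {S : Type*} [CommRing S] {M : Type*} [AddCommGroup M] [Module S M]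

/-- The homology of a module with a differential `d` (an endomorphism with `d ∘ d = 0`): cycles
modulo boundaries, in all homological degrees together. -/
abbrev Homology (d : M →ₗ[S] M) : Type _ :=
  LinearMap.ker d ⧸ (LinearMap.range d).submoduleOf (LinearMap.ker d)

/-- The quotient of the homology by its torsion submodule. -/
abbrev HomologyModTorsion (d : M →ₗ[S] M) : Type _ :=
  Homology d ⧸ Submodule.torsion S (Homology d)

variable {F : Type*} [Field F] [Algebra F S] [Module F M] [IsScalarTower F S M]

/-- The filtration that a filtration of `M` induces on the homology modulo torsion: restrict to
cycles, pass to the homology, and then to the quotient by torsion. -/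
def homologyFiltration (d : M →ₗ[S] M) (Fil : ℝ → Submodule F M) :
    ℝ → Submodule F (HomologyModTorsion d) :=
  inducedQuot ((Submodule.mkQ (Submodule.torsion S (Homology d))).restrictScalars F)
    (inducedQuot
      ((Submodule.mkQ ((LinearMap.range d).submoduleOf (LinearMap.ker d))).restrictScalars F)
      (inducedSub ((LinearMap.ker d).subtype.restrictScalars F) Fil))

end Homology

/-! ## Oriented link diagrams

A diagram is recorded by walking along the link in the direction of its orientation and listing
the vertices one passes. There are two kinds of vertices: crossings, each of which is passed twice
(once on the over-strand, once on the under-strand), and marked points, which are passed once and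
have no effect on the link; they are there to allow components without crossings (a crossingless
circle is a cyclic chain of one or more marked points).

The counterclockwise cyclic order of the four half-edges at a crossing is determined by its sign,
so the data describe a ribbon graph, that is, a cellularly embedded graph in a closed oriented
surface. The diagram is planar if all components of this surface are spheres. -/

/-- Combinatorial oriented diagrams, not necessarily planar. -/
structure GaussDiagram where
  /-- number of crossings -/
  n : ℕ
  /-- number of marked points -/
  m : ℕ
  /-- the sign of a crossing: `true` for a positive, `false` for a negative one -/
  sign : Fin n → Bool
  /-- The passage that follows a given passage along the oriented link. The passage `inl (c, true)`
  goes through the crossing `c` on the over-strand, `inl (c, false)` on the under-strand, and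
  `inr p` goes through the marked point `p`. -/
  next : Equiv.Perm ((Fin n × Bool) ⊕ Fin m)

namespace GaussDiagram

variable (D : GaussDiagram)

/-- Passages of the oriented link through vertices. The arcs (edges) of the diagram correspond to
passages as well: the arc of `s` leaves the passage `s` and enters the passage `D.next s`. -/
abbrev Passage : Type := (Fin D.n × Bool) ⊕ Fin D.m

/-- Half-edges: `(s, true)` is the outgoing and `(s, false)` the incoming half-edge at the
passage `s`. -/
abbrev HalfEdge : Type := D.Passage × Bool

/-- The other half-edge of the same arc. -/
def opposite : D.HalfEdge → D.HalfEdge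
  | (s, true) => (D.next s, false)
  | (s, false) => (D.next.symm s, true)

/-- The next half-edge in counterclockwise order around the same vertex. At a positive crossing
the order is over-out, under-out, over-in, under-in; at a negative crossing it is
over-out, under-in, over-in, under-out. -/
def rotate : D.HalfEdge → D.HalfEdge
  | (Sum.inl (c, b), d) => (Sum.inl (c, !b), if b = D.sign c then d else !d)
  | (Sum.inr p, d) => (Sum.inr p, !d)

/-- Faces of the ribbon graph: orbits of the permutation `rotate ∘ opposite` of half-edges. -/
def Face : Type := Quot fun h h' : D.HalfEdge => h' = D.rotate (D.opposite h)

/-- Two passages are adjacent if they are joined by an arc or go through the same crossing. -/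
inductive Adjacent : D.Passage → D.Passage → Prop
  | arc (s : D.Passage) : Adjacent s (D.next s)
  | crossing (c : Fin D.n) : Adjacent (Sum.inl (c, true)) (Sum.inl (c, false))

/-- Connected components of the underlying graph of the diagram. -/
def Component : Type := Quot D.Adjacent

/-- Planarity, by Euler's formula: the ribbon graph has `D.n + D.m` vertices and one edge for each
passage, and all the components of its surface are spheres. -/
def IsPlanar : Prop :=
  (D.n + D.m) + Nat.card D.Face = Nat.card D.Passage + 2 * Nat.card D.Component

end GaussDiagram

/-- Oriented link diagrams. -/
structure LinkDiagram extends GaussDiagram where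
  planar : toGaussDiagram.IsPlanar

/-! ## Reidemeister moves -/

namespace GaussDiagram

/-- The map on passages induced by maps of crossings and of marked points. -/
def passageMap {D D' : GaussDiagram} (f : Fin D.n → Fin D'.n) (g : Fin D.m → Fin D'.m) :
    D.Passage → D'.Passage :=
  Sum.map (Prod.map f id) g

/-- `D'` is `D` with crossings and marked points relabelled. -/
def Relabel (D D' : GaussDiagram) : Prop :=
  ∃ (f : Fin D.n ≃ Fin D'.n) (g : Fin D.m ≃ Fin D'.m),
    (∀ c, D'.sign (f c) = D.sign c) ∧
    ∀ s, D'.next (passageMap f g s) = passageMap f g (D.next s)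

/-- `D'` is `D` with one more marked point `p`, put on the arc of `s`. -/
def Subdivide (D D' : GaussDiagram) : Prop :=
  ∃ (f : Fin D.n ≃ Fin D'.n) (g : Fin D.m ↪ Fin D'.m) (p : Fin D'.m) (s : D.Passage),
    Set.range g = {p}ᶜ ∧
    (∀ c, D'.sign (f c) = D.sign c) ∧
    D'.next (passageMap f g s) = Sum.inr p ∧
    D'.next (Sum.inr p) = passageMap f g (D.next s) ∧
    ∀ x, x ≠ s → D'.next (passageMap f g x) = passageMap f g (D.next x)

/-- First Reidemeister move: a kink with the new crossing `c` is put into the arc of `s`. The kink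
is of any sign, and its over-strand comes first (`b = true`) or second (`b = false`). -/
def MoveOne (D D' : GaussDiagram) : Prop :=
  ∃ (f : Fin D.n ↪ Fin D'.n) (g : Fin D.m ≃ Fin D'.m) (c : Fin D'.n) (s : D.Passage) (b : Bool),
    Set.range f = {c}ᶜ ∧
    (∀ a, D'.sign (f a) = D.sign a) ∧
    D'.next (passageMap f g s) = Sum.inl (c, b) ∧
    D'.next (Sum.inl (c, b)) = Sum.inl (c, !b) ∧
    D'.next (Sum.inl (c, !b)) = passageMap f g (D.next s) ∧
    ∀ x, x ≠ s → D'.next (passageMap f g x) = passageMap f g (D.next x)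

/-- Second Reidemeister move: the arc of `s` is pushed over the (distinct) arc of `r`. This creates
two crossings of opposite signs; the upper strand passes `c₁` and then `c₂`, and the lower strand
passes them in the same order (`c₃ = c₁`, `c₄ = c₂`) if the strands are parallel, and in the
opposite order if they are antiparallel. -/
def MoveTwo (D D' : GaussDiagram) : Prop :=
  ∃ (f : Fin D.n ↪ Fin D'.n) (g : Fin D.m ≃ Fin D'.m) (c₁ c₂ c₃ c₄ : Fin D'.n)
    (s r : D.Passage),
    c₁ ≠ c₂ ∧ s ≠ r ∧ ((c₃ = c₁ ∧ c₄ = c₂) ∨ (c₃ = c₂ ∧ c₄ = c₁)) ∧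
    Set.range f = {c₁, c₂}ᶜ ∧
    (∀ a, D'.sign (f a) = D.sign a) ∧
    D'.sign c₂ = !D'.sign c₁ ∧
    D'.next (passageMap f g s) = Sum.inl (c₁, true) ∧
    D'.next (Sum.inl (c₁, true)) = Sum.inl (c₂, true) ∧
    D'.next (Sum.inl (c₂, true)) = passageMap f g (D.next s) ∧
    D'.next (passageMap f g r) = Sum.inl (c₃, false) ∧
    D'.next (Sum.inl (c₃, false)) = Sum.inl (c₄, false) ∧
    D'.next (Sum.inl (c₄, false)) = passageMap f g (D.next r) ∧
    ∀ x, x ≠ s → x ≠ r → D'.next (passageMap f g x) = passageMap f g (D.next x)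

/-- The passages `a`, `b` follow each other directly, `a` first if `o = true` and `b` first if
`o = false`. -/
def Consecutive (D : GaussDiagram) (o : Bool) (a b : D.Passage) : Prop :=
  if o = true then D.next a = b else D.next b = a

/-- Third Reidemeister move. There are three strands: the top one passes over the middle one at `x`
and over the bottom one at `y`, and the middle one passes over the bottom one at `z`. The Booleans
`o₁`, `o₂`, `o₃` say in which order each strand passes its two crossings. Three arcs of this kind
bound a triangular face exactly under the two conditions that relate the orders to the signs
(intersect three oriented lines in general position). The move reverses the order of the two
crossings on each strand and keeps the signs. -/
def MoveThree (D D' : GaussDiagram) : Prop :=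
  ∃ (f : Fin D.n ≃ Fin D'.n) (g : Fin D.m ≃ Fin D'.m) (x y z : Fin D.n) (o₁ o₂ o₃ : Bool),
    x ≠ y ∧ y ≠ z ∧ x ≠ z ∧
    D.Consecutive o₁ (Sum.inl (x, true)) (Sum.inl (y, true)) ∧
    D.Consecutive o₂ (Sum.inl (x, false)) (Sum.inl (z, true)) ∧
    D.Consecutive o₃ (Sum.inl (y, false)) (Sum.inl (z, false)) ∧
    (o₁ = o₂ ↔ D.sign y = D.sign z) ∧
    (o₁ = o₃ ↔ D.sign x = D.sign z) ∧
    (∀ c, D'.sign (f c) = D.sign c) ∧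
    let flip : Equiv.Perm D.Passage :=
      Equiv.swap (Sum.inl (x, true)) (Sum.inl (y, true)) *
      Equiv.swap (Sum.inl (x, false)) (Sum.inl (z, true)) *
      Equiv.swap (Sum.inl (y, false)) (Sum.inl (z, false))
    ∀ s, D'.next (passageMap f g s) = passageMap f g (flip (D.next (flip s)))

end GaussDiagram

namespace LinkDiagram

/-- Two diagrams are the same up to the labels and the marked points. -/
def Same : LinkDiagram → LinkDiagram → Prop :=
  Relation.EqvGen fun D D' =>
    D.toGaussDiagram.Relabel D'.toGaussDiagram ∨ D.toGaussDiagram.Subdivide D'.toGaussDiagram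

/-- `D'` is obtained from `D` by one of the three local moves. -/
def Move (D D' : LinkDiagram) : Prop :=
  D.toGaussDiagram.MoveOne D'.toGaussDiagram ∨
  D.toGaussDiagram.MoveTwo D'.toGaussDiagram ∨
  D.toGaussDiagram.MoveThree D'.toGaussDiagram

/-- `D` and `D'` differ by a Reidemeister move, performed in either direction. Marked points may be
put in and taken out before and after the move. -/
def ReidemeisterMove (D D' : LinkDiagram) : Prop :=
  ∃ E E' : LinkDiagram, D.Same E ∧ (E.Move E' ∨ E'.Move E) ∧ E'.Same D'

/-- One step between two diagrams of the same link. -/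
def Step (D D' : LinkDiagram) : Prop := D.Same D' ∨ D.ReidemeisterMove D'

end LinkDiagram

/-- Oriented links in three-space up to isotopy, in their combinatorial description: diagrams up to
finite sequences of Reidemeister moves. -/
def Link : Type := Quot LinkDiagram.Step

/-- The oriented link presented by a diagram. -/
def LinkDiagram.link (D : LinkDiagram) : Link := Quot.mk _ D

/-! ## The Frobenius algebra -/

section Frobenius

variable (F : Type*) [Field F]

/-- The ground ring `R = F[U, V]`. -/
abbrev R : Type _ := MvPolynomial (Fin 2) F

/-- The variable `U`. -/
abbrev U : R F := MvPolynomial.X 0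

/-- The variable `V`. -/
abbrev V : R F := MvPolynomial.X 1

/-- The algebra `A = R[X] / ((X - U) (X - V))`. -/
abbrev A : Type _ :=
  AdjoinRoot ((Polynomial.X - Polynomial.C (U F)) * (Polynomial.X - Polynomial.C (V F)))

/-- The two elements of the `R`-basis of `A`: the label `false` stands for `1`, and the label
`true` stands for `X`. -/
def basisElt : Bool → A F
  | false => 1
  | true => AdjoinRoot.root _

/-- `mulCoeff a b c` is the coefficient of the basis element `c` in the product of the basis
elements `a` and `b`; here `X * X = (U + V) X - U V`. -/
def mulCoeff : Bool → Bool → Bool → R F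
  | false, false, false => 1
  | false, true, true => 1
  | true, false, true => 1
  | true, true, true => U F + V F
  | true, true, false => -(U F * V F)
  | _, _, _ => 0

/-- `comulCoeff a b c` is the coefficient of `b ⊗ c` in the coproduct of `a`; here
`Δ 1 = X ⊗ 1 + 1 ⊗ X - (U + V) 1 ⊗ 1` and `Δ X = X ⊗ X - U V 1 ⊗ 1`. -/
def comulCoeff : Bool → Bool → Bool → R F
  | false, true, false => 1
  | false, false, true => 1
  | false, false, false => -(U F + V F)
  | true, true, true => 1
  | true, false, false => -(U F * V F)
  | _, _, _ => 0

/-- `mulCoeff` are the structure constants of the multiplication of `A`. -/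
theorem basisElt_mul (a b : Bool) :
    basisElt F a * basisElt F b = ∑ c : Bool, mulCoeff F a b c • basisElt F c := by
  have h : (AdjoinRoot.root _ - AdjoinRoot.of _ (U F)) *
      (AdjoinRoot.root _ - AdjoinRoot.of _ (V F)) = (0 : A F) := by
    have h0 := AdjoinRoot.mk_self
      (f := (Polynomial.X - Polynomial.C (U F)) * (Polynomial.X - Polynomial.C (V F)))
    rwa [map_mul, map_sub, map_sub, AdjoinRoot.mk_X, AdjoinRoot.mk_C, AdjoinRoot.mk_C] at h0
  cases a <;> cases b <;>
    simp [basisElt, mulCoeff, Algebra.smul_def, AdjoinRoot.algebraMap_eq]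
  linear_combination h

end Frobenius

/-! ## The chain complex -/

namespace GaussDiagram

variable (D : GaussDiagram)

/-- Vertices of the cube of resolutions; `u c = false` is the `0`-smoothing at `c` and `u c = true`
the `1`-smoothing. -/
abbrev Vertex : Type := Fin D.n → Bool

/-- Half-edges that are joined in the resolution at `u`. The smoothing that respects the
orientation is the `0`-smoothing at a positive crossing and the `1`-smoothing at a negative one. -/
inductive Joined (u : D.Vertex) : D.HalfEdge → D.HalfEdge → Prop
  | arc (s : D.Passage) : Joined u (s, true) (D.next s, false)
  | mark (p : Fin D.m) : Joined u (Sum.inr p, false) (Sum.inr p, true)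
  | oriented (c : Fin D.n) (b : Bool) (h : u c ≠ D.sign c) :
      Joined u (Sum.inl (c, b), false) (Sum.inl (c, !b), true)
  | unoriented (c : Fin D.n) (d : Bool) (h : u c = D.sign c) :
      Joined u (Sum.inl (c, true), d) (Sum.inl (c, false), d)

/-- The circles of the resolution at `u`. -/
def Circle (u : D.Vertex) : Type := Quot (D.Joined u)

/-- The circle through a half-edge. -/
def circleOf (u : D.Vertex) (h : D.HalfEdge) : D.Circle u := Quot.mk _ h

instance (u : D.Vertex) : Finite (D.Circle u) := Quot.finite _

instance (u : D.Vertex) : Fintype (D.Circle u) := Fintype.ofFinite _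

/-- Khovanov generators: a vertex `u` of the cube of resolutions and a label, `1` or `X`, for each
circle of the resolution at `u`. They are the standard basis of the direct sum over `u` of the
tensor powers of `A` with one factor for each circle. -/
abbrev Gen : Type := (u : D.Vertex) × (D.Circle u → Bool)

instance : Fintype D.Gen := Fintype.ofFinite _

variable (F : Type*) [Field F]

/-- The underlying module of the chain complex: the free `R`-module on the Khovanov generators.
The generator `x` is the function `Pi.single x 1`. -/
abbrev Chain : Type _ := D.Gen → R F

/-- The sign of the edge of the cube that starts at `u` and changes the smoothing at `i`. -/
def edgeSign (u : D.Vertex) (i : Fin D.n) : R F :=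
  (-1) ^ (Finset.univ.filter fun j : Fin D.n => j < i ∧ u j = true).card

/-- The coefficient of `y` in the image of `x` under the saddle map at the crossing `i`.
It vanishes unless the vertex of `y` arises from that of `x` by changing the smoothing at `i` from
`0` to `1` and the labels agree on all circles that do not pass by `i`. The two local strands at
`i` are represented, in either smoothing, by the two half-edges of the over-strand. If they lie on
two circles before the saddle, then these are merged by the multiplication of `A`; if they lie on
one circle, then it is split by the comultiplication. -/
def saddleCoeff (i : Fin D.n) (x y : D.Gen) : R F :=
  let hout : D.HalfEdge := (Sum.inl (i, true), true)
  let hin : D.HalfEdge := (Sum.inl (i, true), false)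
  if x.1 i = false ∧ y.1 = Function.update x.1 i true ∧
      (∀ h : D.HalfEdge, D.circleOf x.1 h ≠ D.circleOf x.1 hout →
        D.circleOf x.1 h ≠ D.circleOf x.1 hin →
        x.2 (D.circleOf x.1 h) = y.2 (D.circleOf y.1 h)) then
    if D.circleOf x.1 hout ≠ D.circleOf x.1 hin then
      mulCoeff F (x.2 (D.circleOf x.1 hout)) (x.2 (D.circleOf x.1 hin))
        (y.2 (D.circleOf y.1 hout))
    else
      comulCoeff F (x.2 (D.circleOf x.1 hout)) (y.2 (D.circleOf y.1 hout))
        (y.2 (D.circleOf y.1 hin))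
  else 0

/-- The differential: the signed sum of the saddle maps along the edges of the cube. -/
def differential : D.Chain F →ₗ[R F] D.Chain F :=
  Matrix.mulVecLin (Matrix.of fun y x : D.Gen =>
    ∑ i : Fin D.n, D.edgeSign F x.1 i * D.saddleCoeff F i x y)

/-! ### Gradings -/

/-- The number of positive crossings. -/
def nPos : ℕ := (Finset.univ.filter fun c : Fin D.n => D.sign c = true).card

/-- The number of negative crossings. -/
def nNeg : ℕ := (Finset.univ.filter fun c : Fin D.n => D.sign c = false).card

/-- The quantum grading of a Khovanov generator; the label `1` contributes `1` and the label `X`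
contributes `-1`. -/
def qGrading (x : D.Gen) : ℤ :=
  (∑ c : D.Circle x.1, if x.2 c = true then (-1 : ℤ) else 1)
    + ((Finset.univ.filter fun c : Fin D.n => x.1 c = true).card : ℤ)
    + (D.nPos : ℤ) - 2 * (D.nNeg : ℤ)

/-- The mixed grading of `U ^ a * V ^ b * x` for a Khovanov generator `x`. -/
def tGrading (t : ℝ) (a b : ℕ) (x : D.Gen) : ℝ :=
  (D.qGrading x : ℝ) - (t * a + (2 - t) * b)

/-- The filtration of the chain complex: `tFiltration t lam` is the `F`-span of all
`U ^ a * V ^ b * x` of mixed grading at least `lam`. -/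
def tFiltration (t lam : ℝ) : Submodule F (D.Chain F) :=
  Submodule.span F {z | ∃ (a b : ℕ) (x : D.Gen),
    lam ≤ D.tGrading t a b x ∧ z = Pi.single x (U F ^ a * V F ^ b)}

end GaussDiagram

/-- `gr_t(D)`: the largest induced grading of a nonzero class in the homology modulo torsion. -/
def LinkDiagram.gr (F : Type*) [Field F] (t : ℝ) (D : LinkDiagram) : EReal :=
  maxGradingOf
    (homologyFiltration (D.toGaussDiagram.differential F) (D.toGaussDiagram.tFiltration F t))

/-- `s_t(D) = gr_t(D) - 1`. -/
def LinkDiagram.sInv (F : Type*) [Field F] (t : ℝ) (D : LinkDiagram) : EReal :=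
  D.gr F t - 1

end Khovanov

end

noncomputable section

open scoped Classical

namespace Khovanov

/-! ## Partitions and their two-colorings -/

section Partitions

variable {H H' : Type*}

/-! Over a field `K` containing `F[U, V]` the polynomial `(X - U)(X - V)` has two distinct roots, so
`A` becomes a product of two copies of `K`, and a state of a resolution becomes a function on the
two-colorings of its circles: at a color, `X` takes the value `U` or `V`. Colorings of circles are
recorded as colorings of the arcs of the diagram, so that all vertices of the cube can be compared
at one coloring. The functions are divided by one square root of `U - V` or `V - U` for each circle
(`RootData.wt`). After this normalization multiplication and comultiplication look alike: both
multiply by the root `rt` of the common color at the saddle, and both give zero at colorings that do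
not fit the target. The integral structure and the filtration survive as the `F`-spans
`RootData.Lat` of monomials. The condition `0 ≤ t ≤ 2` says that `U` and `V` cost at most as much as
`X`, so that neither `Δ 1` nor the reduction of `X ^ 2` loses more than expected.

Planarity enters once: every edge of the cube unites two circles or divides one
(`GaussDiagram.pd_alternating`). Euler's formula gives a checkerboard coloring of the faces; this
orients the circles of every resolution as the cycles of a permutation of the arcs, and a change of
smoothing composes the permutation with a transposition.

Torsion is visible on colorings. Call a coloring a Lee coloring if it changes along the over-strand
at every crossing. No saddle respects such a coloring, so boundaries vanish there. At any other
coloring there is a crossing where the reversed saddle is a contracting homotopy up to a factor `±(U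
- V)`. Hence a cycle is torsion in homology exactly if it vanishes at all Lee colorings
(`PD.exists_boundary`, `GaussDiagram.mem_torsion_iff`), and `gr_t` is the supremum of the levels,
shifted by `n_+ - 2 n_-`, at which there is a filtered cycle with a nonzero Lee value (`PD.Good`,
`LinkDiagram.gr_eq`).

Invariance therefore needs no homotopy equivalences. For each move and each direction it is enough
to turn filtered cycles into filtered cycles, with the right shift, and to keep some Lee value
nonzero. For kinks (`PD.Kink`) and bigons (`PD.Bigon`) the constructions are the usual inclusions
and projections, composed of births, deaths and saddles. For a triangle (`PD.Triangle`) one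
smoothing at the crossing of the two lower strands leaves a bigon; cancelling it on both sides of
the move gives the same reduced data (`PD.Triangle.Reduced`), up to signs and the exchange of two
crossings. -/

/-- The two-colorings that are constant on the classes of a partition. -/
def Respects (σ : Setoid H) (κ : H → Bool) : Prop := ∀ a b, σ a b → κ a = κ b

/-- The indicator function of the class of `a` is an admissible coloring. So a partition is
determined by its colorings, and relations between arcs can be tested on them. -/
theorem rel_of_respects {σ : Setoid H} {a b : H} (h : ∀ κ, Respects σ κ → κ a = κ b) :
    σ a b := by
  have := h (fun x => decide (σ a x)) (fun x y hxy => by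
    have : σ a x ↔ σ a y := ⟨fun h => σ.trans h hxy, fun h => σ.trans h (σ.symm hxy)⟩
    simp [this])
  simpa [σ.refl a] using this

theorem respects_const (σ : Setoid H) (b : Bool) : Respects σ (fun _ => b) := fun _ _ _ => rfl

instance instFintypeQuotient [Finite H] (σ : Setoid H) : Fintype (Quotient σ) :=
  Fintype.ofFinite _

/-- The number of classes of a partition. -/
def numClasses [Finite H] (σ : Setoid H) : ℕ := Fintype.card (Quotient σ)

theorem Respects.out {σ : Setoid H} {κ : H → Bool} (hκ : Respects σ κ) (h : H) :
    κ (Quotient.out (Quotient.mk σ h)) = κ h :=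
  hκ _ _ (Quotient.mk_out (s := σ) h)

/-- A map of the underlying sets that pulls colorings back to colorings respects the partitions. -/
theorem rel_map {σ : Setoid H} {σ' : Setoid H'} {p : H → H'}
    (hp : ∀ κ', Respects σ' κ' → Respects σ (κ' ∘ p)) {a b : H} (h : σ a b) : σ' (p a) (p b) :=
  rel_of_respects fun κ' hκ' => hp κ' hκ' a b h

/-- Mutually inverse maps, up to the partitions, identify the sets of classes. -/
def quotientEquivOfRespects {σ : Setoid H} {σ' : Setoid H'} (p : H → H') (q : H' → H)
    (hp : ∀ κ', Respects σ' κ' → Respects σ (κ' ∘ p))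
    (hq : ∀ κ, Respects σ κ → Respects σ' (κ ∘ q))
    (hpq : ∀ κ', Respects σ' κ' → ∀ h, κ' (p (q h)) = κ' h)
    (hqp : ∀ κ, Respects σ κ → ∀ h, κ (q (p h)) = κ h) : Quotient σ' ≃ Quotient σ where
  toFun := Quotient.map q fun _ _ h => rel_map hq h
  invFun := Quotient.map p fun _ _ h => rel_map hp h
  left_inv := by
    rintro ⟨h⟩
    exact Quotient.sound (rel_of_respects fun κ' hκ' => hpq κ' hκ' h)
  right_inv := by
    rintro ⟨h⟩
    exact Quotient.sound (rel_of_respects fun κ' hκ' => hqp κ' hκ' h)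

/-- The partition `σ'` has one class more than `σ`, the class of `ℓ`. -/
structure AddsClass (σ : Setoid H) (σ' : Setoid H') (p : H → H') (q : H' → Option H) (ℓ : H') :
    Prop where
  pull : ∀ κ', Respects σ' κ' → Respects σ (κ' ∘ p)
  extend : ∀ κ b, Respects σ κ → Respects σ' fun h => (q h).elim b κ
  eq_extend : ∀ κ', Respects σ' κ' → ∀ h, (q h).elim (κ' ℓ) (κ' ∘ p) = κ' h
  extend_pull : ∀ κ b, Respects σ κ → ∀ h, (q (p h)).elim b κ = κ h
  loop : q ℓ = none

namespace AddsClass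

variable {σ : Setoid H} {σ' : Setoid H'} {p : H → H'} {q : H' → Option H} {ℓ : H'}

/-- One color on the new class and the other on everything old separates the two kinds; among old
elements the relation is tested on the colorings of `σ`. -/
theorem map_eq (A : AddsClass σ σ' p q ℓ) {a b : H'} (h : σ' a b) :
    (q a).map (Quotient.mk σ) = (q b).map (Quotient.mk σ) := by
  have key := fun κ b' hκ => A.extend κ b' hκ a b h
  cases ha : q a with
  | none =>
    cases hb : q b with
    | none => rfl
    | some y => simpa [ha, hb] using key _ false (respects_const σ true)
  | some x =>
    cases hb : q b with
    | none => simpa [ha, hb] using key _ false (respects_const σ true)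
    | some y =>
      simp only [Option.map_some, Option.some.injEq]
      exact Quotient.sound (rel_of_respects fun κ hκ => by
        simpa [ha, hb] using key κ true hκ)

/-- The classes of the larger partition. -/
def equiv (A : AddsClass σ σ' p q ℓ) : Quotient σ' ≃ Option (Quotient σ) where
  toFun := Quotient.lift (fun h => (q h).map (Quotient.mk σ)) fun _ _ h => A.map_eq h
  invFun c := c.elim (Quotient.mk σ' ℓ) (Quotient.map p fun _ _ h => rel_map A.pull h)
  left_inv := by
    rintro ⟨h⟩
    change Option.elim ((q h).map (Quotient.mk σ)) _ _ = Quotient.mk σ' h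
    have key := fun κ' hκ' => A.eq_extend κ' hκ' h
    cases hh : q h with
    | none => exact Quotient.sound (rel_of_respects fun κ' hκ' => by simpa [hh] using key κ' hκ')
    | some x => exact Quotient.sound (rel_of_respects fun κ' hκ' => by simpa [hh] using key κ' hκ')
  right_inv := by
    rintro (_ | c)
    · change (q ℓ).map _ = none
      simp [A.loop]
    · induction c using Quotient.ind with | _ h
      change (q (p h)).map (Quotient.mk σ) = some (Quotient.mk σ h)
      have key := fun κ b hκ => A.extend_pull κ b hκ h
      cases hh : q (p h) with
      | none =>
        have := key _ false (respects_const σ true)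
        simp [hh] at this
      | some x =>
        simp only [Option.map_some, Option.some.injEq]
        exact Quotient.sound (rel_of_respects fun κ hκ => by simpa [hh] using key κ true hκ)

end AddsClass

/-- The partition `τ` arises from `σ` by uniting the distinct classes of `a` and `b`. -/
structure Merges (σ τ : Setoid H) (a b : H) : Prop where
  respects_iff : ∀ κ, Respects τ κ ↔ Respects σ κ ∧ κ a = κ b
  not_rel : ¬ σ a b

namespace Merges

variable {σ τ : Setoid H} {a b : H}

theorem le (m : Merges σ τ a b) {x y : H} (h : σ x y) : τ x y :=
  rel_of_respects fun κ hκ => ((m.respects_iff κ).1 hκ).1 x y h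

theorem rel (m : Merges σ τ a b) : τ a b :=
  rel_of_respects fun κ hκ => ((m.respects_iff κ).1 hκ).2

/-- The indicator of the `σ`-class of `x` is false at both `a` and `b`, hence it is a coloring for
`τ` too. -/
theorem rel_of_not (m : Merges σ τ a b) {x y : H} (h : τ x y) (hx : ¬ τ a x) : σ x y := by
  have hax : ¬ σ x a := fun h' => hx (m.le (σ.symm h'))
  have hbx : ¬ σ x b := fun h' => hx (τ.trans m.rel (m.le (σ.symm h')))
  have hres : Respects σ fun z => decide (σ x z) := fun z w hzw => by
    have : σ x z ↔ σ x w := ⟨fun h => σ.trans h hzw, fun h => σ.trans h (σ.symm hzw)⟩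
    simp [this]
  have := ((m.respects_iff _).2 ⟨hres, by simp [hax, hbx]⟩) x y h
  simpa [σ.refl x] using this

/-- The indicator of the union of the `σ`-classes of `a` and `b` takes one value on both, so it is a
coloring for `τ`. -/
theorem rel_cases (m : Merges σ τ a b) {x : H} (h : τ a x) : σ a x ∨ σ b x := by
  by_contra hcon
  push Not at hcon
  have hres : Respects σ fun z => decide (σ a z ∨ σ b z) := fun z w hzw => by
    have h1 : σ a z ↔ σ a w := ⟨fun h => σ.trans h hzw, fun h => σ.trans h (σ.symm hzw)⟩
    have h2 : σ b z ↔ σ b w := ⟨fun h => σ.trans h hzw, fun h => σ.trans h (σ.symm hzw)⟩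
    simp [h1, h2]
  have := ((m.respects_iff _).2 ⟨hres, by simp⟩) a x h
  simp [hcon.1, hcon.2] at this

/-- Products over the classes before and after uniting two classes. -/
theorem prod_eq [Finite H] (m : Merges σ τ a b) {N : Type*} [CommMonoid N]
    (G : Quotient σ → N) (G' : Quotient τ → N)
    (hG : ∀ x, ¬ τ a x → G (Quotient.mk σ x) = G' (Quotient.mk τ x)) :
    (∏ c, G c) * G' (Quotient.mk τ a) =
      (∏ c, G' c) * (G (Quotient.mk σ a) * G (Quotient.mk σ b)) := by
  have hab : Quotient.mk σ a ≠ Quotient.mk σ b := fun h => m.not_rel (Quotient.exact h)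
  have h1 : ∏ c, G c = (G (Quotient.mk σ a) * G (Quotient.mk σ b)) *
      ∏ c ∈ ((Finset.univ.erase (Quotient.mk σ a)).erase (Quotient.mk σ b)), G c := by
    rw [mul_assoc, Finset.mul_prod_erase _ _ (by simp [hab.symm]),
      Finset.mul_prod_erase _ _ (by simp)]
  have h2 : ∏ c, G' c = G' (Quotient.mk τ a) *
      ∏ c ∈ (Finset.univ.erase (Quotient.mk τ a)), G' c := by
    rw [Finset.mul_prod_erase _ _ (by simp)]
  -- Away from the classes involved, the map of quotients is a bijection.
  have h3 : ∏ c ∈ ((Finset.univ.erase (Quotient.mk σ a)).erase (Quotient.mk σ b)), G c =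
      ∏ c ∈ (Finset.univ.erase (Quotient.mk τ a)), G' c := by
    refine Finset.prod_bij (fun c _ => Quotient.map id (fun _ _ h => m.le h) c) ?_ ?_ ?_ ?_
    · intro c hx
      induction c using Quotient.ind with | _ x
      simp only [Finset.mem_erase, Finset.mem_univ, and_true] at hx ⊢
      intro h
      have h' : τ a x := τ.symm (Quotient.exact h)
      rcases m.rel_cases h' with h'' | h''
      · exact hx.2 (Quotient.sound (σ.symm h''))
      · exact hx.1 (Quotient.sound (σ.symm h''))
    · intro c hx c' hy h
      induction c using Quotient.ind with | _ x
      induction c' using Quotient.ind with | _ y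
      simp only [Finset.mem_erase, Finset.mem_univ, and_true] at hx
      have hxy : τ x y := Quotient.exact h
      refine Quotient.sound (m.rel_of_not hxy fun h' => ?_)
      rcases m.rel_cases h' with h'' | h''
      · exact hx.2 (Quotient.sound (σ.symm h''))
      · exact hx.1 (Quotient.sound (σ.symm h''))
    · intro c hx
      induction c using Quotient.ind with | _ x
      simp only [Finset.mem_erase, Finset.mem_univ, and_true] at hx
      refine ⟨Quotient.mk σ x, ?_, rfl⟩
      simp only [Finset.mem_erase, Finset.mem_univ, and_true]
      constructor
      · exact fun h => hx (Quotient.sound (τ.trans (m.le (Quotient.exact h)) (τ.symm m.rel)))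
      · exact fun h => hx (Quotient.sound (m.le (Quotient.exact h)))
    · intro c hx
      induction c using Quotient.ind with | _ x
      simp only [Finset.mem_erase, Finset.mem_univ, and_true] at hx
      refine hG x fun h => ?_
      rcases m.rel_cases h with h'' | h''
      · exact hx.2 (Quotient.sound (σ.symm h''))
      · exact hx.1 (Quotient.sound (σ.symm h''))
  rw [h1, h2, h3]
  ac_rfl

/-- Counting is the product formula in `Multiplicative ℕ` with every factor equal to the generator.
-/
theorem numClasses_eq [Finite H] (m : Merges σ τ a b) : numClasses σ = numClasses τ + 1 := by
  have := m.prod_eq (N := Multiplicative ℕ) (fun _ => Multiplicative.ofAdd 1)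
    (fun _ => Multiplicative.ofAdd 1) (fun _ _ => rfl)
  simp only [Finset.prod_const, Finset.card_univ, ← ofAdd_nsmul, ← ofAdd_add,
    Multiplicative.ofAdd.injective.eq_iff, smul_eq_mul, mul_one] at this
  unfold numClasses
  omega

end Merges

end Partitions

/-! ## Filtered lattices of functions on colorings -/

/-- The roots `U`, `V` of the polynomial defining `A`, and square roots of its derivative there. -/
structure RootData (K : Type*) [Field K] where
  U : K
  V : K
  rt : Bool → K
  rt_ne : ∀ b, rt b ≠ 0
  rt_false : rt false ^ 2 = U - V
  rt_true : rt true ^ 2 = V - U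

namespace RootData

variable {K : Type*} [Field K] (ω : RootData K)

/-- The value of `X` at a color. -/
def val (b : Bool) : K := if b = true then ω.V else ω.U

theorem sub_ne : ω.U - ω.V ≠ 0 := by
  rw [← ω.rt_false]
  exact pow_ne_zero _ (ω.rt_ne _)

/-- This is `Δ 1` at a pair of colors: the derivative of `(X - U)(X - V)` on the diagonal and zero
off it. -/
theorem val_add (a b : Bool) :
    ω.val a + ω.val b - ω.U - ω.V = if a = b then ω.rt a ^ 2 else 0 := by
  cases a <;> cases b <;> simp [val, ω.rt_true, ω.rt_false] <;> ring

/-- This is `X ⊗ 1 - 1 ⊗ X` at a pair of colors. It is supported off the diagonal and serves to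
select the colorings in which two circles differ. -/
theorem val_sub (a b : Bool) : ω.val a - ω.val b = if a = b then 0 else ω.rt a ^ 2 := by
  cases a <;> cases b <;> simp [val, ω.rt_true, ω.rt_false]

theorem val_sq (a : Bool) : ω.val a * ω.val a = (ω.U + ω.V) * ω.val a - ω.U * ω.V := by
  cases a <;> simp [val] <;> ring

theorem rt_sq_true : ω.rt true ^ 2 = - ω.rt false ^ 2 := by
  rw [ω.rt_true, ω.rt_false]; ring

/-! ### Weights of colorings -/

section Weights

variable {H H' : Type*} [Finite H] [Finite H']

/-- The product of the square roots over all classes. -/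
def wt (σ : Setoid H) (κ : H → Bool) : K := ∏ c : Quotient σ, ω.rt (κ c.out)

theorem wt_ne (σ : Setoid H) (κ : H → Bool) : ω.wt σ κ ≠ 0 :=
  Finset.prod_ne_zero_iff.2 fun _ _ => ω.rt_ne _

theorem wt_of_equiv {σ : Setoid H} {σ' : Setoid H'} (p : H → H') (q : H' → H)
    (hp : ∀ κ', Respects σ' κ' → Respects σ (κ' ∘ p))
    (hq : ∀ κ, Respects σ κ → Respects σ' (κ ∘ q))
    (hpq : ∀ κ', Respects σ' κ' → ∀ h, κ' (p (q h)) = κ' h)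
    (hqp : ∀ κ, Respects σ κ → ∀ h, κ (q (p h)) = κ h) {κ' : H' → Bool} (hκ : Respects σ' κ') :
    ω.wt σ' κ' = ω.wt σ (κ' ∘ p) := by
  refine Fintype.prod_equiv (quotientEquivOfRespects p q hp hq hpq hqp) _ _ fun c => ?_
  induction c using Quotient.ind with | _ h
  rw [hκ.out]
  change _ = ω.rt ((κ' ∘ p) (Quotient.out (Quotient.mk σ (q h))))
  rw [(hp κ' hκ).out, Function.comp_apply, hpq κ' hκ]

theorem wt_of_addsClass {σ : Setoid H} {σ' : Setoid H'} {p : H → H'} {q : H' → Option H} {ℓ : H'}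
    (A : AddsClass σ σ' p q ℓ) {κ' : H' → Bool} (hκ : Respects σ' κ') :
    ω.wt σ' κ' = ω.rt (κ' ℓ) * ω.wt σ (κ' ∘ p) := by
  have : ω.wt σ' κ' = ∏ c : Option (Quotient σ),
      c.elim (ω.rt (κ' ℓ)) fun c => ω.rt ((κ' ∘ p) c.out) := by
    refine Fintype.prod_equiv A.equiv _ _ fun c => ?_
    induction c using Quotient.ind with | _ h
    rw [hκ.out]
    change _ = Option.elim ((q h).map (Quotient.mk σ)) _ _
    have key := A.eq_extend κ' hκ h
    cases hh : q h with
    | none => simpa [hh] using congrArg ω.rt key.symm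
    | some x =>
      rw [Option.map_some, Option.elim_some, (A.pull κ' hκ).out]
      simpa [hh] using congrArg ω.rt key.symm
  rw [this, Fintype.prod_option]
  rfl

/-- Uniting two circles of one color removes one root from the weight. This root is the factor that
a saddle acquires in either direction. -/
theorem wt_of_merges {σ τ : Setoid H} {a b : H} (m : Merges σ τ a b) {κ : H → Bool}
    (hκ : Respects τ κ) : ω.wt σ κ = ω.wt τ κ * ω.rt (κ a) := by
  have hσ := ((m.respects_iff κ).1 hκ).1
  have := m.prod_eq (fun c => ω.rt (κ c.out)) (fun c => ω.rt (κ c.out)) fun x _ => by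
    rw [hσ.out, hκ.out]
  rw [hσ.out, hσ.out, hκ.out, ← ((m.respects_iff κ).1 hκ).2, ← mul_assoc] at this
  exact mul_right_cancel₀ (ω.rt_ne _) this

end Weights

theorem numClasses_of_equiv {H H' : Type*} [Finite H] [Finite H']
    {σ : Setoid H} {σ' : Setoid H'} (p : H → H') (q : H' → H)
    (hp : ∀ κ', Respects σ' κ' → Respects σ (κ' ∘ p))
    (hq : ∀ κ, Respects σ κ → Respects σ' (κ ∘ q))
    (hpq : ∀ κ', Respects σ' κ' → ∀ h, κ' (p (q h)) = κ' h)
    (hqp : ∀ κ, Respects σ κ → ∀ h, κ (q (p h)) = κ h) : numClasses σ' = numClasses σ :=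
  Fintype.card_congr (quotientEquivOfRespects p q hp hq hpq hqp)

theorem numClasses_of_addsClass {H H' : Type*} [Finite H] [Finite H'] {σ : Setoid H}
    {σ' : Setoid H'} {p : H → H'} {q : H' → Option H} {ℓ : H'}
    (A : AddsClass σ σ' p q ℓ) : numClasses σ' = numClasses σ + 1 := by
  unfold numClasses
  rw [Fintype.card_congr A.equiv, Fintype.card_option]

/-- The function on colorings given by a monomial, in the normalization by `wt`. -/
def mono {H : Type*} [Finite H] (σ : Setoid H) (a b : ℕ) (S : Multiset H) : (H → Bool) → K :=
  fun κ => if Respects σ κ then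
    ω.U ^ a * ω.V ^ b * (S.map fun h => ω.val (κ h)).prod / ω.wt σ κ else 0

/-- The filtration by `F`-spans of monomials. -/
def Lat (F : Type*) [Field F] [Algebra F K] (t : ℝ) {H : Type*} [Finite H] (σ : Setoid H)
    (lam : ℝ) : Submodule F ((H → Bool) → K) :=
  Submodule.span F {g | ∃ (a b : ℕ) (S : Multiset H),
    lam ≤ (numClasses σ : ℝ) - 2 * (S.card : ℝ) - (t * a + (2 - t) * b) ∧ g = ω.mono σ a b S}

/-! ### Filtered operations: multiplication, birth, death, saddle -/

section Lat

variable (F : Type*) [Field F] [Algebra F K] (t : ℝ) {H H' : Type*} [Finite H] [Finite H']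
  {σ : Setoid H}

variable {F t} {ω}

theorem mono_mem {lam : ℝ} {a b : ℕ} {S : Multiset H}
    (h : lam ≤ (numClasses σ : ℝ) - 2 * (S.card : ℝ) - (t * a + (2 - t) * b)) :
    ω.mono σ a b S ∈ ω.Lat F t σ lam :=
  Submodule.subset_span ⟨a, b, S, h, rfl⟩

theorem Lat_anti {lam mu : ℝ} (h : mu ≤ lam) : ω.Lat F t σ lam ≤ ω.Lat F t σ mu :=
  Submodule.span_mono fun _ ⟨a, b, S, h', e⟩ => ⟨a, b, S, h.trans h', e⟩

theorem Lat_map {M : Type*} [AddCommGroup M] [Module F M] {N : Submodule F M}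
    (T : ((H → Bool) → K) →ₗ[F] M) {lam : ℝ}
    (h : ∀ (a b : ℕ) (S : Multiset H),
      lam ≤ (numClasses σ : ℝ) - 2 * (S.card : ℝ) - (t * a + (2 - t) * b) → T (ω.mono σ a b S) ∈ N)
    {φ : (H → Bool) → K} (hφ : φ ∈ ω.Lat F t σ lam) : T φ ∈ N := by
  have : ω.Lat F t σ lam ≤ N.comap T := Submodule.span_le.2 (by
    rintro _ ⟨a, b, S, h', rfl⟩
    exact h a b S h')
  exact this hφ

theorem eq_zero_of_not_respects {lam : ℝ} {φ : (H → Bool) → K} (hφ : φ ∈ ω.Lat F t σ lam)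
    {κ : H → Bool} (hκ : ¬ Respects σ κ) : φ κ = 0 := by
  have := Lat_map (N := (⊥ : Submodule F K)) (LinearMap.proj κ) (fun a b S _ => by
    simp [mono, hκ]) hφ
  simpa using this

/-- The operator that pulls a function back and multiplies it by a coefficient. -/
def coeffOp (F : Type*) [Field F] [Algebra F K] (c : (H' → Bool) → K)
    (ρ : (H' → Bool) → H → Bool) : ((H → Bool) → K) →ₗ[F] ((H' → Bool) → K) where
  toFun φ κ := c κ * φ (ρ κ)
  map_add' φ ψ := by ext κ; simp [mul_add]
  map_smul' r φ := by ext κ; simp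

@[simp]
theorem coeffOp_apply (c : (H' → Bool) → K) (ρ : (H' → Bool) → H → Bool) (φ : (H → Bool) → K)
    (κ : H' → Bool) : coeffOp F c ρ φ κ = c κ * φ (ρ κ) := rfl

theorem mono_cons (a b : ℕ) (h : H) (S : Multiset H) :
    (fun κ => ω.val (κ h) * ω.mono σ a b S κ) = ω.mono σ a b (h ::ₘ S) := by
  ext κ
  simp only [mono, Multiset.map_cons, Multiset.prod_cons]
  split_ifs <;> ring

/-- Monomials are indexed by multisets, so a repeated `X` on one circle needs no reduction here. -/
theorem mul_val_mem {lam mu : ℝ} {φ : (H → Bool) → K} (hφ : φ ∈ ω.Lat F t σ lam) (h : H)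
    (hm : mu ≤ lam - 2) : (fun κ => ω.val (κ h) * φ κ) ∈ ω.Lat F t σ mu := by
  refine Lat_map (N := ω.Lat F t σ mu) (coeffOp F (fun κ => ω.val (κ h)) id) (fun a b S h' => ?_) hφ
  have : coeffOp F (fun κ => ω.val (κ h)) id (ω.mono σ a b S) = ω.mono σ a b (h ::ₘ S) :=
    mono_cons a b h S
  rw [this]
  refine mono_mem ?_
  rw [Multiset.card_cons]
  push_cast
  linarith

theorem mul_U_mem {lam mu : ℝ} {φ : (H → Bool) → K} (hφ : φ ∈ ω.Lat F t σ lam)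
    (hm : mu ≤ lam - t) : (fun κ => ω.U * φ κ) ∈ ω.Lat F t σ mu := by
  refine Lat_map (N := ω.Lat F t σ mu) (coeffOp F (fun κ => ω.U) id) (fun a b S h' => ?_) hφ
  have : coeffOp F (fun κ => ω.U) id (ω.mono σ a b S) = ω.mono σ (a + 1) b S := by
    ext κ
    simp only [coeffOp_apply, mono, id]
    split_ifs <;> ring
  rw [this]
  refine mono_mem ?_
  push_cast
  linarith

theorem mul_V_mem {lam mu : ℝ} {φ : (H → Bool) → K} (hφ : φ ∈ ω.Lat F t σ lam)
    (hm : mu ≤ lam - (2 - t)) : (fun κ => ω.V * φ κ) ∈ ω.Lat F t σ mu := by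
  refine Lat_map (N := ω.Lat F t σ mu) (coeffOp F (fun κ => ω.V) id) (fun a b S h' => ?_) hφ
  have : coeffOp F (fun κ => ω.V) id (ω.mono σ a b S) = ω.mono σ a (b + 1) S := by
    ext κ
    simp only [coeffOp_apply, mono, id]
    split_ifs <;> ring
  rw [this]
  refine mono_mem ?_
  push_cast
  linarith

/-- Multiplication by `Δ 1`. The terms with `U` and `V` lose `t` and `2 - t`, and both are at most
the loss `2` of the terms with `X`. -/
theorem mul_val_add_mem (ht : t ∈ Set.Icc (0 : ℝ) 2) {lam mu : ℝ} {φ : (H → Bool) → K}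
    (hφ : φ ∈ ω.Lat F t σ lam) (a b : H) (hm : mu ≤ lam - 2) :
    (fun κ => (ω.val (κ a) + ω.val (κ b) - ω.U - ω.V) * φ κ) ∈ ω.Lat F t σ mu := by
  have h1 := mul_val_mem hφ a hm
  have h2 := mul_val_mem hφ b hm
  have h3 := mul_U_mem (mu := mu) hφ (by linarith [ht.2])
  have h4 := mul_V_mem (mu := mu) hφ (by linarith [ht.1])
  convert Submodule.sub_mem _ (Submodule.sub_mem _ (Submodule.add_mem _ h1 h2) h3) h4 using 1
  ext κ
  simp only [Pi.sub_apply, Pi.add_apply]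
  ring

theorem mul_val_sub_mem {lam mu : ℝ} {φ : (H → Bool) → K}
    (hφ : φ ∈ ω.Lat F t σ lam) (a b : H) (hm : mu ≤ lam - 2) :
    (fun κ => (ω.val (κ a) - ω.val (κ b)) * φ κ) ∈ ω.Lat F t σ mu := by
  convert Submodule.sub_mem _ (mul_val_mem hφ a hm) (mul_val_mem hφ b hm) using 1
  ext κ
  simp only [Pi.sub_apply]
  ring

/-- Pullback along an identification of partitions. -/
theorem pull_mem {σ' : Setoid H'} (p : H → H') (q : H' → H)
    (hp : ∀ κ', Respects σ' κ' → Respects σ (κ' ∘ p))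
    (hq : ∀ κ, Respects σ κ → Respects σ' (κ ∘ q))
    (hpq : ∀ κ', Respects σ' κ' → ∀ h, κ' (p (q h)) = κ' h)
    (hqp : ∀ κ, Respects σ κ → ∀ h, κ (q (p h)) = κ h) {lam : ℝ} {φ : (H → Bool) → K}
    (hφ : φ ∈ ω.Lat F t σ lam) :
    (fun κ' => if Respects σ' κ' then φ (κ' ∘ p) else 0) ∈ ω.Lat F t σ' lam := by
  have key : coeffOp F (fun κ' => if Respects σ' κ' then (1 : K) else 0) (fun κ' => κ' ∘ p) φ ∈
      ω.Lat F t σ' lam := by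
    refine Lat_map _ (fun a b S h' => ?_) hφ
    have : coeffOp F (fun κ' => if Respects σ' κ' then (1 : K) else 0) (fun κ' => κ' ∘ p)
        (ω.mono σ a b S) = ω.mono σ' a b (S.map p) := by
      ext κ'
      simp only [coeffOp_apply, mono]
      split_ifs with h1 h2
      · simp [ω.wt_of_equiv p q hp hq hpq hqp h1]
      · exact absurd (hp κ' h1) h2
      · simp
      · simp
    rw [this]
    refine mono_mem ?_
    rwa [numClasses_of_equiv p q hp hq hpq hqp, Multiset.card_map]
  convert key using 1
  ext κ'
  simp

/-- The birth of a circle. -/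
theorem birth_mem {σ' : Setoid H'} {p : H → H'} {q : H' → Option H} {ℓ : H'}
    (A : AddsClass σ σ' p q ℓ) {lam mu : ℝ} {φ : (H → Bool) → K}
    (hφ : φ ∈ ω.Lat F t σ lam) (hm : mu ≤ lam + 1) :
    (fun κ' => if Respects σ' κ' then φ (κ' ∘ p) / ω.rt (κ' ℓ) else 0) ∈ ω.Lat F t σ' mu := by
  have key : coeffOp F (fun κ' => if Respects σ' κ' then (ω.rt (κ' ℓ))⁻¹ else 0)
      (fun κ' => κ' ∘ p) φ ∈ ω.Lat F t σ' mu := by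
    refine Lat_map _ (fun a b S h' => ?_) hφ
    have : coeffOp F (fun κ' => if Respects σ' κ' then (ω.rt (κ' ℓ))⁻¹ else 0)
        (fun κ' => κ' ∘ p) (ω.mono σ a b S) = ω.mono σ' a b (S.map p) := by
      ext κ'
      simp only [coeffOp_apply, mono]
      split_ifs with h1 h2
      · have := ω.rt_ne (κ' ℓ)
        have := ω.wt_ne σ (κ' ∘ p)
        rw [ω.wt_of_addsClass A h1]
        simp only [Multiset.map_map, Function.comp_apply]
        field_simp
      · exact absurd (A.pull κ' h1) h2
      · simp
      · simp
    rw [this]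
    refine mono_mem ?_
    rw [numClasses_of_addsClass A, Multiset.card_map]
    push_cast
    linarith
  convert key using 1
  ext κ'
  simp only [coeffOp_apply]
  split_ifs
  · rw [div_eq_mul_inv, mul_comm]
  · simp

/-- The trace as a sum of residues: `ε (X ^ n)` is the sum of `x ^ n / f' x` over the roots of `f =
(X - U)(X - V)`. This is the complete homogeneous polynomial of degree `n - 1`, and zero for `n =
0`. -/
theorem sum_val_pow (n : ℕ) :
    ∑ b : Bool, ω.val b ^ n / ω.rt b ^ 2 =
      ∑ i ∈ Finset.range n, ω.U ^ i * ω.V ^ (n - 1 - i) := by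
  have h1 := ω.sub_ne
  have h2 : ω.V - ω.U ≠ 0 := by rw [← neg_sub]; exact neg_ne_zero.2 h1
  have := (Commute.all ω.U ω.V).geom_sum₂_mul n
  simp only [Fintype.sum_bool, val, ω.rt_true, ω.rt_false, if_true, Bool.false_eq_true, if_false]
  rw [eq_div_of_mul_eq h1 this, ← neg_sub ω.U ω.V]
  field_simp
  ring

/-- The death of a circle. -/
theorem death_mem (ht : t ∈ Set.Icc (0 : ℝ) 2) {σ' : Setoid H'} {p : H → H'} {q : H' → Option H}
    {ℓ : H'} (A : AddsClass σ σ' p q ℓ) {lam mu : ℝ} {φ : (H' → Bool) → K}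
    (hφ : φ ∈ ω.Lat F t σ' lam) (hm : mu ≤ lam + 1) :
    (fun κ => if Respects σ κ then ∑ b : Bool, φ (fun h => (q h).elim b κ) / ω.rt b else 0) ∈
      ω.Lat F t σ mu := by
  -- `T n` is the death of the circle after multiplication by `X ^ n` on it. Going through a
  -- monomial factor by factor, those on the dying circle raise `n`, and the others commute with `T
  -- n`.
  let T : ℕ → ((H' → Bool) → K) →ₗ[F] ((H → Bool) → K) := fun n => ∑ b : Bool,
    coeffOp F (fun κ => if Respects σ κ then ω.val b ^ n / ω.rt b else 0)
      (fun κ h => (q h).elim b κ)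
  have hT : ∀ n φ κ, T n φ κ = if Respects σ κ then
      ∑ b : Bool, ω.val b ^ n * φ (fun h => (q h).elim b κ) / ω.rt b else 0 := by
    intro n φ κ
    simp only [T, LinearMap.sum_apply, Finset.sum_apply, coeffOp_apply]
    split_ifs
    · exact Finset.sum_congr rfl fun b _ => by ring
    · simp
  have key : ∀ (S : Multiset H') (a b n : ℕ) (nu : ℝ),
      nu ≤ (numClasses σ : ℝ) + 2 - 2 * (S.card + n) - (t * a + (2 - t) * b) →
      T n (ω.mono σ' a b S) ∈ ω.Lat F t σ nu := by
    intro S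
    induction S using Multiset.induction_on with
    | empty =>
      intro a b n nu hnu
      have : T n (ω.mono σ' a b 0) = ∑ i ∈ Finset.range n,
          ω.mono σ (a + i) (b + (n - 1 - i)) 0 := by
        ext κ
        rw [hT, Finset.sum_apply]
        by_cases hκ : Respects σ κ
        · have h2 : ∀ c, Respects σ' fun h => (q h).elim c κ := fun c => A.extend κ c hκ
          have h3 : ∀ c, ((fun h => (q h).elim c κ) ∘ p) = κ :=
            fun c => funext fun h => A.extend_pull κ c hκ h
          have h4 : ∀ c, ω.wt σ' (fun h => (q h).elim c κ) = ω.rt c * ω.wt σ κ := by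
            intro c
            rw [ω.wt_of_addsClass A (h2 c), h3 c, A.loop]
            rfl
          simp only [mono, h2, hκ, if_true, h4, Multiset.map_zero, Multiset.prod_zero, mul_one]
          have h5 := ω.sum_val_pow n
          calc ∑ c : Bool, ω.val c ^ n * (ω.U ^ a * ω.V ^ b / (ω.rt c * ω.wt σ κ)) / ω.rt c
              = (ω.U ^ a * ω.V ^ b / ω.wt σ κ) * ∑ c : Bool, ω.val c ^ n / ω.rt c ^ 2 := by
                rw [Finset.mul_sum]
                refine Finset.sum_congr rfl fun c _ => ?_
                have := ω.rt_ne c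
                have := ω.wt_ne σ κ
                field_simp
            _ = _ := by
                rw [h5, Finset.mul_sum]
                refine Finset.sum_congr rfl fun c _ => ?_
                ring
        · simp [hκ, mono]
      rw [this]
      refine Submodule.sum_mem _ fun i hi => mono_mem ?_
      -- The term `U ^ i V ^ j` with `i + j + 1 = n` loses at most `2 (n - 1)`, while the `n`
      -- factors `X` were counted with `2 n` and the vanished circle with one.
      have hi' : i + (n - 1 - i) + 1 = n := by
        have := Finset.mem_range.1 hi
        omega
      have hn : (n : ℝ) = i + ((n - 1 - i : ℕ) : ℝ) + 1 := by exact_mod_cast hi'.symm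
      simp only [Multiset.card_zero] at hnu ⊢
      push_cast at hnu ⊢
      rw [hn] at hnu
      set j : ℝ := ((n - 1 - i : ℕ) : ℝ)
      have hj : 0 ≤ j := Nat.cast_nonneg _
      have hi0 : (0 : ℝ) ≤ i := Nat.cast_nonneg _
      nlinarith [mul_nonneg ht.1 hj, mul_nonneg (sub_nonneg.2 ht.2) hi0]
    | cons h S ih =>
      intro a b n nu hnu
      rw [Multiset.card_cons] at hnu
      push_cast at hnu
      cases hh : q h with
      | none =>
        have : T n (ω.mono σ' a b (h ::ₘ S)) = T (n + 1) (ω.mono σ' a b S) := by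
          ext κ
          rw [hT, hT, ← mono_cons]
          split_ifs
          · refine Finset.sum_congr rfl fun c _ => ?_
            simp only [hh, Option.elim_none]
            ring
          · rfl
        rw [this]
        refine ih a b (n + 1) nu ?_
        push_cast
        linarith
      | some x =>
        have : T n (ω.mono σ' a b (h ::ₘ S)) =
            fun κ => ω.val (κ x) * T n (ω.mono σ' a b S) κ := by
          ext κ
          rw [hT, hT, ← mono_cons]
          split_ifs
          · rw [Finset.mul_sum]
            refine Finset.sum_congr rfl fun c _ => ?_
            simp only [hh, Option.elim_some]
            ring
          · simp
        rw [this]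
        exact mul_val_mem (ih a b n (nu + 2) (by linarith)) x (by linarith)
  have hfin : T 0 φ ∈ ω.Lat F t σ mu := by
    refine Lat_map _ (fun a b S h' => key S a b 0 mu ?_) hφ
    rw [numClasses_of_addsClass A] at h'
    push_cast at h' ⊢
    linarith
  convert hfin using 1
  ext κ
  rw [hT]
  simp

/-- Two partitions are related by a saddle that involves the classes of `a` and `b`. -/
def Saddle (σ τ : Setoid H) (a b : H) : Prop := Merges σ τ a b ∨ Merges τ σ a b

theorem Saddle.symm {σ τ : Setoid H} {a b : H} (h : Saddle σ τ a b) : Saddle τ σ a b := Or.symm h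

/-- A merge keeps the monomial, since the factor `rt` cancels against the weight, and loses one
circle. A split multiplies by `Δ 1`, which loses two, and gains one circle. The total loss is one in
both cases. -/
theorem saddle_mem (ht : t ∈ Set.Icc (0 : ℝ) 2) {τ : Setoid H} {a b : H} (s : Saddle σ τ a b)
    {lam mu : ℝ} {φ : (H → Bool) → K} (hφ : φ ∈ ω.Lat F t σ lam) (hm : mu ≤ lam - 1) :
    (fun κ => if Respects τ κ then ω.rt (κ a) * φ κ else 0) ∈ ω.Lat F t τ mu := by
  have key : coeffOp F (fun κ => if Respects τ κ then ω.rt (κ a) else 0) id φ ∈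
      ω.Lat F t τ mu := by
    refine Lat_map _ (fun i j S h' => ?_) hφ
    rcases s with m | m
    · have : coeffOp F (fun κ => if Respects τ κ then ω.rt (κ a) else 0) id (ω.mono σ i j S) =
          ω.mono τ i j S := by
        ext κ
        simp only [coeffOp_apply, mono, id]
        by_cases hτ : Respects τ κ
        · have hσ := ((m.respects_iff κ).1 hτ).1
          have := ω.rt_ne (κ a)
          have := ω.wt_ne τ κ
          simp only [hτ, hσ, if_true, ω.wt_of_merges m hτ]
          field_simp
        · simp [hτ]
      rw [this]
      refine mono_mem ?_
      rw [m.numClasses_eq] at h'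
      push_cast at h'
      linarith
    · have : coeffOp F (fun κ => if Respects τ κ then ω.rt (κ a) else 0) id (ω.mono σ i j S) =
          fun κ => (ω.val (κ a) + ω.val (κ b) - ω.U - ω.V) * ω.mono τ i j S κ := by
        ext κ
        simp only [coeffOp_apply, mono, id, ω.val_add]
        by_cases hτ : Respects τ κ
        · by_cases hab : κ a = κ b
          · have hσ := (m.respects_iff κ).2 ⟨hτ, hab⟩
            have := ω.rt_ne (κ b)
            have := ω.wt_ne σ κ
            simp only [hτ, hσ, if_true, ω.wt_of_merges m hσ, hab]
            field_simp
          · have hσ : ¬ Respects σ κ := fun h => hab ((m.respects_iff κ).1 h).2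
            simp [hτ, hσ, hab]
        · simp [hτ]
      rw [this]
      refine mul_val_add_mem ht (lam := mu + 2) (mono_mem ?_) a b (by linarith)
      rw [m.numClasses_eq]
      push_cast
      linarith
  convert key using 1
  ext κ
  simp

end Lat

end RootData

/-! ## The cube complex of a planar diagram in terms of colorings -/

/-- Crossings given by the arcs at their ends. The smoothing `v` at `i` joins `ov i e` with
`un i (v ^^ e)`. The relation `glue` joins further pairs of arcs. -/
structure PD (I H : Type*) where
  ov : I → Bool → H
  un : I → Bool → H
  glue : H → H → Prop

theorem update_update_self {I : Type*} {u : I → Bool} {i : I} {w : Bool} (h : u i = w) (v : Bool) :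
    Function.update (Function.update u i v) i w = u := by
  rw [Function.update_idem, ← h, Function.update_eq_self]

/-! ### Signs on the edges of the cube -/

section Signs

variable {K : Type*} [Field K] {I : Type*} [Fintype I]

/-- An orientation of the complete graph. -/
structure IsTournament (T : I → I → Prop) : Prop where
  irrefl : ∀ i, ¬ T i i
  total : ∀ i j, i ≠ j → (T i j ↔ ¬ T j i)

/-- The sign of the edge of the cube at `u` in the direction `i`. -/
def sgn (K : Type*) [Field K] (T : I → I → Prop) (u : I → Bool) (i : I) : K :=
  ∏ j, if T j i ∧ u j = true then -1 else 1

variable {T T' : I → I → Prop} {u : I → Bool}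

theorem sgn_mul_self (i : I) : sgn K T u i * sgn K T u i = 1 := by
  unfold sgn
  rw [← Finset.prod_mul_distrib]
  refine Finset.prod_eq_one fun j _ => ?_
  split_ifs <;> simp

theorem sgn_eq_or (i : I) : sgn K T u i = 1 ∨ sgn K T u i = -1 :=
  mul_self_eq_one_iff.1 (sgn_mul_self i)

theorem sgn_update_self (hT : IsTournament T) (i : I) (v : Bool) :
    sgn K T (Function.update u i v) i = sgn K T u i := by
  unfold sgn
  refine Finset.prod_congr rfl fun j _ => ?_
  by_cases h : j = i
  · subst h
    simp [hT.irrefl]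
  · simp [h]

theorem sgn_update_true (k i : I) : sgn K T (Function.update u k true) i =
    (if T k i then -1 else 1) * sgn K T (Function.update u k false) i := by
  unfold sgn
  rw [← Finset.mul_prod_erase _ _ (Finset.mem_univ k),
    ← Finset.mul_prod_erase _ (fun j => if T j i ∧ Function.update u k false j = true then
      (-1 : K) else 1) (Finset.mem_univ k)]
  simp only [Function.update_self, and_true, Bool.false_eq_true, and_false, if_false, one_mul]
  congr 1
  refine Finset.prod_congr rfl fun j hj => ?_
  have : j ≠ k := (Finset.mem_erase.1 hj).1
  simp [this]

/-- Exactly one of `T i j` and `T j i` holds, so exactly one of the two pairs of parallel edges in a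
square changes its sign. -/
theorem sgn_anticomm (hT : IsTournament T) {i j : I} (hij : i ≠ j) (hi : u i = false)
    (hj : u j = true) :
    sgn K T u j * sgn K T (Function.update u j false) i =
      - (sgn K T u i * sgn K T (Function.update u i true) j) := by
  have h1 : sgn K T u i = (if T j i then -1 else 1) * sgn K T (Function.update u j false) i := by
    rw [← sgn_update_true, ← hj, Function.update_eq_self]
  have h2 : sgn K T (Function.update u i true) j = (if T i j then -1 else 1) * sgn K T u j := by
    rw [sgn_update_true, ← hi, Function.update_eq_self]
  rw [h1, h2]
  by_cases h : T i j
  · have := (hT.total i j hij).1 h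
    simp [h, this, mul_comm]
  · have : T j i := by
      by_contra h'
      exact h ((hT.total i j hij).2 h')
    simp [h, this, mul_comm]

/-- The signs that compare two tournaments. -/
def gauge (K : Type*) [Field K] (T T' : I → I → Prop) (u : I → Bool) : K :=
  ∏ i, ∏ j, if u i = true ∧ u j = true ∧ T j i ∧ T' i j then -1 else 1

theorem gauge_mul_self : gauge K T T' u * gauge K T T' u = 1 := by
  unfold gauge
  simp only [← Finset.prod_mul_distrib]
  refine Finset.prod_eq_one fun i _ => Finset.prod_eq_one fun j _ => ?_
  split_ifs <;> simp

theorem gauge_ne : gauge K T T' u ≠ 0 := fun h => by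
  have := gauge_mul_self (K := K) (T := T) (T' := T') (u := u)
  simp [h] at this

/-- The factors of `gauge` that involve `k` come from the `j` for which the tournaments disagree on
the pair `j`, `k`. Up to squares this is the product of the two edge signs at `k`. -/
theorem gauge_update (hT : IsTournament T) (hT' : IsTournament T') {k : I} (hk : u k = true) :
    gauge K T T' u * sgn K T u k * sgn K T' u k = gauge K T T' (Function.update u k false) := by
  have h1 : ∀ i j, (if u i = true ∧ u j = true ∧ T j i ∧ T' i j then (-1 : K) else 1) =
      (if Function.update u k false i = true ∧ Function.update u k false j = true ∧
        T j i ∧ T' i j then (-1 : K) else 1) *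
      (if i = k then (if u j = true ∧ T j k ∧ T' k j then (-1 : K) else 1) else 1) *
      (if j = k then (if u i = true ∧ T k i ∧ T' i k then (-1 : K) else 1) else 1) := by
    intro i j
    by_cases hi : i = k
    · subst hi
      by_cases hj : j = i
      · subst hj
        simp [hT.irrefl]
      · simp [hj, hk]
    · by_cases hj : j = k
      · subst hj
        simp [hi, hk]
      · simp [hi, hj]
  have h2 : gauge K T T' u = gauge K T T' (Function.update u k false) *
      ((∏ j, if u j = true ∧ T j k ∧ T' k j then (-1 : K) else 1) *
      (∏ i, if u i = true ∧ T k i ∧ T' i k then (-1 : K) else 1)) := by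
    unfold gauge
    simp only [h1, Finset.prod_mul_distrib]
    rw [mul_assoc]
    congr 2
    · rw [Finset.prod_eq_single k] <;> simp +contextual
    · refine Finset.prod_congr rfl fun i _ => ?_
      rw [Finset.prod_eq_single k] <;> simp +contextual
  have h3 : (∏ j, if u j = true ∧ T j k ∧ T' k j then (-1 : K) else 1) *
      (∏ i, if u i = true ∧ T k i ∧ T' i k then (-1 : K) else 1) =
      sgn K T u k * sgn K T' u k := by
    unfold sgn
    rw [← Finset.prod_mul_distrib, ← Finset.prod_mul_distrib]
    refine Finset.prod_congr rfl fun j _ => ?_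
    by_cases hj : j = k
    · subst hj
      simp [hT.irrefl, hT'.irrefl]
    · have e1 := hT.total j k hj
      have e2 := hT'.total j k hj
      by_cases a : T j k <;> by_cases b : T' j k <;> by_cases c : u j = true <;>
        simp_all
  rw [h2, h3]
  have e1 := sgn_mul_self (K := K) (T := T) (u := u) k
  have e2 := sgn_mul_self (K := K) (T := T') (u := u) k
  linear_combination (gauge K T T' (Function.update u k false)) * (sgn K T' u k) ^ 2 * e1 +
    (gauge K T T' (Function.update u k false)) * e2

end Signs

/-- The number of crossings with a `1`-smoothing. -/
def height {I : Type*} [Fintype I] (u : I → Bool) : ℕ := (Finset.univ.filter fun i => u i = true).card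

theorem height_update {I : Type*} [Fintype I] {u : I → Bool} {i : I} (h : u i = true) :
    height u = height (Function.update u i false) + 1 := by
  unfold height
  have : (Finset.univ.filter fun j => Function.update u i false j = true) =
      (Finset.univ.filter fun j => u j = true).erase i := by
    ext j
    by_cases hj : j = i <;> simp [hj]
  rw [this, Finset.card_erase_add_one]
  simp [h]

namespace PD

variable {I H : Type*} (P : PD I H)

/-- A coloring is compatible with the smoothing `v` at the crossing `i`. -/
def Smooth (v : Bool) (κ : H → Bool) (i : I) : Prop :=
  ∀ e, κ (P.ov i e) = κ (P.un i (v ^^ e))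

/-- A coloring is constant on the circles of the resolution at `u`. -/
def Cons (u : I → Bool) (κ : H → Bool) : Prop :=
  (∀ i, P.Smooth (u i) κ i) ∧ ∀ a b, P.glue a b → κ a = κ b

/-- The partition of the arcs into the circles of the resolution at `u`. -/
def res (u : I → Bool) : Setoid H where
  r a b := ∀ κ, P.Cons u κ → κ a = κ b
  iseqv := ⟨fun _ _ _ => rfl, fun h κ hκ => (h κ hκ).symm,
    fun h h' κ hκ => (h κ hκ).trans (h' κ hκ)⟩

/-- Consistency is a list of equalities between colors of two arcs, so the partition generated by it
has no further colorings. -/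
theorem respects_res {u : I → Bool} {κ : H → Bool} : Respects (P.res u) κ ↔ P.Cons u κ := by
  constructor
  · intro h
    exact ⟨fun i e => h _ _ fun κ' hκ' => hκ'.1 i e, fun a b hab => h _ _ fun κ' hκ' => hκ'.2 a b hab⟩
  · intro h a b hab
    exact hab κ h

theorem res_iff {u : I → Bool} {a b : H} : P.res u a b ↔ ∀ κ, P.Cons u κ → κ a = κ b := Iff.rfl

theorem eq_of_smooth {κ : H → Bool} {i : I} {v w : Bool} (hv : P.Smooth v κ i)
    (hw : P.Smooth w κ i) (hvw : v ≠ w) : κ (P.ov i false) = κ (P.ov i true) := by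
  have h1 := hv false
  have h2 := hw true
  have : (v ^^ false) = (w ^^ true) := by
    cases v <;> cases w <;> simp_all
  rw [h1, h2, this]

theorem smooth_of_eq {κ : H → Bool} {i : I} {v : Bool} (hv : P.Smooth v κ i)
    (h : κ (P.ov i false) = κ (P.ov i true)) (w : Bool) : P.Smooth w κ i := by
  have h1 := hv false
  have h2 := hv true
  intro e
  cases v <;> cases w <;> cases e <;> simp_all

/-- The two smoothings pair the four ends at a crossing differently. A coloring that fits one of
them fits the other exactly if all four ends have one color, which can be read off the over-strand.
-/
theorem cons_update {u : I → Bool} {κ : H → Bool} (h : P.Cons u κ) {i : I} {v : Bool} :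
    P.Cons (Function.update u i v) κ ↔ v = u i ∨ κ (P.ov i false) = κ (P.ov i true) := by
  constructor
  · intro h'
    by_cases hv : v = u i
    · exact Or.inl hv
    · right
      have := h'.1 i
      rw [Function.update_self] at this
      exact P.eq_of_smooth this (h.1 i) hv
  · rintro (rfl | h')
    · rwa [Function.update_eq_self]
    · refine ⟨fun j => ?_, h.2⟩
      by_cases hj : j = i
      · subst hj
        rw [Function.update_self]
        exact P.smooth_of_eq (h.1 j) h' v
      · rw [Function.update_of_ne hj]
        exact h.1 j

/-- Every saddle of the cube unites two circles or divides a circle into two. -/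
def Alternating : Prop := ∀ (u : I → Bool) (i : I), u i = false →
  (P.res u (P.ov i false) (P.ov i true) ↔
    ¬ P.res (Function.update u i true) (P.ov i false) (P.ov i true))

variable {P}

/-- The colorings that fit both smoothings are those with one color at the crossing. The resolution
in which this equality holds automatically is the one with the united circle. -/
theorem Alternating.saddle (hP : P.Alternating) {u : I → Bool} {i : I} (hi : u i = false) :
    RootData.Saddle (P.res u) (P.res (Function.update u i true)) (P.ov i false) (P.ov i true) := by
  have hi' : u = Function.update (Function.update u i true) i false := by
    rw [update_update_self hi]
  by_cases h : P.res u (P.ov i false) (P.ov i true)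
  · refine Or.inr ⟨fun κ => ?_, (hP u i hi).1 h⟩
    simp only [respects_res]
    constructor
    · intro hκ
      have := h κ hκ
      exact ⟨(P.cons_update hκ).2 (Or.inr this), this⟩
    · rintro ⟨hκ, h'⟩
      rw [hi']
      exact (P.cons_update hκ).2 (Or.inr h')
  · have h2 : P.res (Function.update u i true) (P.ov i false) (P.ov i true) := by
      by_contra h'
      exact h ((hP u i hi).2 h')
    refine Or.inl ⟨fun κ => ?_, h⟩
    simp only [respects_res]
    constructor
    · intro hκ
      have := h2 κ hκ
      refine ⟨?_, this⟩
      rw [hi']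
      exact (P.cons_update hκ).2 (Or.inr this)
    · rintro ⟨hκ, h'⟩
      exact (P.cons_update hκ).2 (Or.inr h')

theorem Alternating.saddle' (hP : P.Alternating) {u : I → Bool} {i : I} (hi : u i = true) :
    RootData.Saddle (P.res (Function.update u i false)) (P.res u) (P.ov i false) (P.ov i true) := by
  have := hP.saddle (u := Function.update u i false) (i := i) (by simp)
  rwa [update_update_self hi] at this

variable (P)

/-! ### Cycles, filtration and torsion on colorings -/

section Complex

variable [Fintype I] [Finite H] {K : Type*} [Field K] (ω : RootData K) (T : I → I → Prop)
  (F : Type*) [Field F] [Algebra F K] (t : ℝ)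

/-- The differential in terms of functions on colorings. -/
def dif (φ : (I → Bool) → (H → Bool) → K) (u : I → Bool) (κ : H → Bool) : K :=
  ∑ i, if u i = true then
    sgn K T u i * (ω.rt (κ (P.ov i false)) * φ (Function.update u i false) κ) else 0

/-- The cycles of the complex. -/
def IsCycle (φ : (I → Bool) → (H → Bool) → K) : Prop :=
  ∀ u κ, P.Cons u κ → P.dif ω T φ u κ = 0

/-- The filtration of the complex. -/
def InFil (lam : ℝ) (φ : (I → Bool) → (H → Bool) → K) : Prop :=
  ∀ u, φ u ∈ ω.Lat F t (P.res u) (lam - height u)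

/-- The colorings that change along every strand at every crossing. -/
def IsLee (u : I → Bool) (κ : H → Bool) : Prop :=
  P.Cons u κ ∧ ∀ i, κ (P.ov i false) ≠ κ (P.ov i true)

/-- There is a cycle in the given step of the filtration that represents a nonzero class modulo
torsion. -/
def Good (lam : ℝ) : Prop :=
  ∃ φ : (I → Bool) → (H → Bool) → K, P.InFil ω F t lam φ ∧ P.IsCycle ω T φ ∧
    ∃ u κ, P.IsLee u κ ∧ φ u κ ≠ 0

variable {P ω T F t}

theorem InFil.eq_zero {lam : ℝ} {φ : (I → Bool) → (H → Bool) → K} (hφ : P.InFil ω F t lam φ)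
    {u : I → Bool} {κ : H → Bool} (h : ¬ P.Cons u κ) : φ u κ = 0 :=
  RootData.eq_zero_of_not_respects (hφ u) (by rwa [respects_res])

theorem InFil.anti {lam mu : ℝ} {φ : (I → Bool) → (H → Bool) → K} (hφ : P.InFil ω F t lam φ)
    (h : mu ≤ lam) : P.InFil ω F t mu φ :=
  fun u => RootData.Lat_anti (by linarith) (hφ u)

/-- Multiplication by the signs `gauge` is an isomorphism between the complexes for two sign
conventions and affects neither the filtration nor nonvanishing. So crossings can be reordered
freely. -/
theorem Good.change_tournament {T' : I → I → Prop} (hT : IsTournament T) (hT' : IsTournament T')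
    {lam : ℝ} (h : P.Good ω T F t lam) : P.Good ω T' F t lam := by
  obtain ⟨φ, h1, h2, u, κ, h3, h4⟩ := h
  refine ⟨fun u κ => gauge K T T' u * φ u κ, fun u => ?_, fun u κ hκ => ?_, u, κ, h3,
    mul_ne_zero gauge_ne h4⟩
  · rcases mul_self_eq_one_iff.1 (gauge_mul_self (K := K) (T := T) (T' := T') (u := u)) with h | h
    · simpa [h] using h1 u
    · convert Submodule.neg_mem _ (h1 u) using 1
      ext κ
      simp [h]
  · have : P.dif ω T' (fun u κ => gauge K T T' u * φ u κ) u κ = gauge K T T' u * P.dif ω T φ u κ := by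
      unfold dif
      rw [Finset.mul_sum]
      refine Finset.sum_congr rfl fun i _ => ?_
      split_ifs with hi
      · simp only [← gauge_update hT hT' hi]
        linear_combination gauge K T T' u * sgn K T u i * ω.rt (κ (P.ov i false)) *
          φ (Function.update u i false) κ * sgn_mul_self (K := K) (T := T') (u := u) i
      · simp
    rw [this, h2 u κ hκ, mul_zero]

theorem sgn_mul_mem {σ : Setoid H} {lam : ℝ} {φ : (H → Bool) → K} (hφ : φ ∈ ω.Lat F t σ lam)
    (u : I → Bool) (i : I) : (fun κ => sgn K T u i * φ κ) ∈ ω.Lat F t σ lam := by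
  rcases sgn_eq_or (K := K) (T := T) (u := u) i with h | h
  · simpa [h] using hφ
  · convert Submodule.neg_mem _ hφ using 1
    ext κ
    simp [h]

/-- The loss of one at a saddle is made up for by the height of the vertex. -/
theorem InFil.dif (ht : t ∈ Set.Icc (0 : ℝ) 2) (hP : P.Alternating) {lam : ℝ}
    {φ : (I → Bool) → (H → Bool) → K} (hφ : P.InFil ω F t lam φ) :
    P.InFil ω F t lam fun u κ => if P.Cons u κ then P.dif ω T φ u κ else 0 := by
  intro u
  have key : (∑ i, fun κ => if u i = true then sgn K T u i * (if Respects (P.res u) κ then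
      ω.rt (κ (P.ov i false)) * φ (Function.update u i false) κ else 0) else 0) ∈
      ω.Lat F t (P.res u) (lam - height u) := by
    refine Submodule.sum_mem _ fun i _ => ?_
    by_cases hi : u i = true
    · simp only [hi, if_true]
      refine sgn_mul_mem (RootData.saddle_mem ht (hP.saddle' hi) (hφ _) ?_) u i
      rw [height_update hi]
      push_cast
      linarith
    · simp only [hi]
      exact Submodule.zero_mem _
  convert key using 1
  ext κ
  rw [Finset.sum_apply]
  simp only [respects_res, PD.dif]
  split_ifs with h
  · rfl
  · simp

/-- The homotopy given by the reversed saddle. -/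
def homotopy (P : PD I H) (ω : RootData K) (T : I → I → Prop) (i : I)
    (φ : (I → Bool) → (H → Bool) → K) (u : I → Bool) (κ : H → Bool) : K :=
  if u i = false ∧ P.Cons u κ then
    sgn K T u i * (ω.rt (κ (P.ov i false)) * φ (Function.update u i true) κ) else 0

/-- A reversed saddle loses one as a saddle and one more because the height decreases. -/
theorem InFil.homotopy (ht : t ∈ Set.Icc (0 : ℝ) 2) (hP : P.Alternating) {lam : ℝ}
    {φ : (I → Bool) → (H → Bool) → K} (hφ : P.InFil ω F t lam φ) (i : I) :
    P.InFil ω F t (lam - 2) (P.homotopy ω T i φ) := by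
  intro u
  by_cases hi : u i = false
  · have hh : height (Function.update u i true) = height u + 1 := by
      rw [height_update (i := i) (by simp), update_update_self hi]
    have := sgn_mul_mem (T := T) (RootData.saddle_mem ht (hP.saddle hi).symm (hφ _)
      (mu := lam - 2 - height u) (by rw [hh]; push_cast; linarith)) u i
    convert this using 1
    ext κ
    simp only [PD.homotopy, hi, true_and, respects_res]
    split_ifs <;> simp
  · have : P.homotopy ω T i φ u = 0 := by
      ext κ
      simp [PD.homotopy, hi]
    rw [this]
    exact Submodule.zero_mem _

/-- With `h` the reversed saddle at `i`, the operator `d h + h d` multiplies by the square of the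
edge factor wherever the coloring admits this saddle, and by zero elsewhere. On cycles the term `h
d` drops out. -/
theorem dif_homotopy (hT : IsTournament T) {φ : (I → Bool) → (H → Bool) → K}
    (hs : ∀ u κ, ¬ P.Cons u κ → φ u κ = 0) (hφ : P.IsCycle ω T φ) (i : I) {u : I → Bool}
    {κ : H → Bool} (hκ : P.Cons u κ) : P.dif ω T (P.homotopy ω T i φ) u κ =
      (if κ (P.ov i false) = κ (P.ov i true) then ω.rt (κ (P.ov i false)) ^ 2 else 0) * φ u κ := by
  by_cases hm : κ (P.ov i false) = κ (P.ov i true)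
  · rw [if_pos hm]
    -- If `u i` is already `1`, only the edge at `i` comes from a vertex where the homotopy is
    -- nonzero. If it is `0`, the cycle condition at the neighbouring vertex with `1` at `i` is
    -- used, and anticommuting squares carry one sum over the to the other.
    by_cases hi : u i = true
    · unfold dif
      rw [Finset.sum_eq_single i]
      · have : P.Cons (Function.update u i false) κ := (P.cons_update hκ).2 (Or.inr hm)
        rw [if_pos hi, PD.homotopy, if_pos ⟨by simp, this⟩, update_update_self hi,
          sgn_update_self hT]
        linear_combination ω.rt (κ (P.ov i false)) ^ 2 * φ u κ *
          sgn_mul_self (K := K) (T := T) (u := u) i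
      · intro j _ hj
        simp [PD.homotopy, Function.update_of_ne hj.symm, hi]
      · simp
    · rw [Bool.not_eq_true] at hi
      have hc : P.Cons (Function.update u i true) κ := (P.cons_update hκ).2 (Or.inr hm)
      have h0 := hφ _ _ hc
      unfold dif at h0 ⊢
      rw [← Finset.add_sum_erase _ _ (Finset.mem_univ i)] at h0 ⊢
      rw [if_pos (by simp), sgn_update_self hT, update_update_self hi] at h0
      rw [if_neg (by simp [hi]), zero_add]
      have : ∑ x ∈ Finset.univ.erase i, (if u x = true then sgn K T u x *
          (ω.rt (κ (P.ov x false)) * P.homotopy ω T i φ (Function.update u x false) κ) else 0) =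
          - (sgn K T u i * ω.rt (κ (P.ov i false)) *
          ∑ x ∈ Finset.univ.erase i, (if Function.update u i true x = true then
            sgn K T (Function.update u i true) x * (ω.rt (κ (P.ov x false)) *
              φ (Function.update (Function.update u i true) x false) κ) else 0)) := by
        rw [Finset.mul_sum, ← Finset.sum_neg_distrib]
        refine Finset.sum_congr rfl fun j hj => ?_
        have hji : j ≠ i := (Finset.mem_erase.1 hj).1
        rw [Function.update_of_ne hji]
        split_ifs with huj
        · by_cases hcj : P.Cons (Function.update u j false) κ
          · rw [PD.homotopy, if_pos ⟨by simp [Function.update_of_ne hji.symm, hi], hcj⟩,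
              Function.update_comm hji.symm]
            linear_combination ω.rt (κ (P.ov j false)) * ω.rt (κ (P.ov i false)) *
              φ (Function.update (Function.update u j false) i true) κ *
              sgn_anticomm (K := K) hT hji.symm hi huj
          · have : ¬ P.Cons (Function.update (Function.update u i true) j false) κ := by
              intro h
              rw [Function.update_comm hji.symm] at h
              have h' := (P.cons_update h (i := i) (v := false)).2 (Or.inr hm)
              rw [update_update_self (by simp [Function.update_of_ne hji.symm, hi])] at h'
              exact hcj h'
            simp [PD.homotopy, hcj, hs _ _ this]
        · simp
      rw [this]
      linear_combination (- sgn K T u i * ω.rt (κ (P.ov i false))) * h0 +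
        ω.rt (κ (P.ov i false)) ^ 2 * φ u κ * sgn_mul_self (K := K) (T := T) (u := u) i
  · rw [if_neg hm, zero_mul]
    refine Finset.sum_eq_zero fun j _ => ?_
    split_ifs with huj
    · have : P.homotopy ω T i φ (Function.update u j false) κ = 0 := by
        unfold PD.homotopy
        split_ifs with h
        · have : ¬ P.Cons (Function.update (Function.update u j false) i true) κ := fun h' =>
            hm (by
              rcases (P.cons_update h.2).1 h' with h'' | h''
              · rw [h.1] at h''
                exact absurd h'' (by simp)
              · exact h'')
          rw [hs _ _ this, mul_zero, mul_zero]
        · rfl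
      rw [this, mul_zero, mul_zero]
    · rfl

/-- A cycle that vanishes at the colorings changing at every crossing becomes a boundary after
multiplication by a power of the discriminant. -/
theorem exists_boundary (ht : t ∈ Set.Icc (0 : ℝ) 2) (hP : P.Alternating) (hT : IsTournament T)
    {lam : ℝ} {φ : (I → Bool) → (H → Bool) → K} (hφ : P.InFil ω F t lam φ)
    (hc : P.IsCycle ω T φ) (h0 : ∀ u κ, P.IsLee u κ → φ u κ = 0) :
    ∃ (n : ℕ) (mu : ℝ) (ψ : (I → Bool) → (H → Bool) → K), P.InFil ω F t mu ψ ∧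
      ∀ u κ, P.Cons u κ → P.dif ω T ψ u κ = (ω.U - ω.V) ^ n * φ u κ := by
  let θ : I → (H → Bool) → K := fun i κ =>
    if κ (P.ov i false) = κ (P.ov i true) then ω.rt (κ (P.ov i false)) ^ 2 else 0
  have hmul : ∀ (c : (H → Bool) → K) (χ : (I → Bool) → (H → Bool) → K), P.IsCycle ω T χ →
      P.IsCycle ω T fun u κ => c κ * χ u κ := by
    intro c χ hχ u κ hκ
    have : P.dif ω T (fun u κ => c κ * χ u κ) u κ = c κ * P.dif ω T χ u κ := by
      unfold dif
      rw [Finset.mul_sum]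
      refine Finset.sum_congr rfl fun i _ => ?_
      split_ifs <;> ring
    rw [this, hχ u κ hκ, mul_zero]
  have hdadd : ∀ (χ χ' : (I → Bool) → (H → Bool) → K) u κ,
      P.dif ω T (fun u κ => χ u κ + χ' u κ) u κ = P.dif ω T χ u κ + P.dif ω T χ' u κ := by
    intro χ χ' u κ
    unfold dif
    rw [← Finset.sum_add_distrib]
    refine Finset.sum_congr rfl fun i _ => ?_
    split_ifs <;> ring
  have hdsmul : ∀ (c : K) (χ : (I → Bool) → (H → Bool) → K) u κ,
      P.dif ω T (fun u κ => c * χ u κ) u κ = c * P.dif ω T χ u κ := by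
    intro c χ u κ
    unfold dif
    rw [Finset.mul_sum]
    refine Finset.sum_congr rfl fun i _ => ?_
    split_ifs <;> ring
  have hθ : ∀ (i : I) (mu : ℝ) (χ : (I → Bool) → (H → Bool) → K), P.InFil ω F t mu χ →
      P.IsCycle ω T χ → P.InFil ω F t (mu - 2) fun u κ => θ i κ * χ u κ := by
    intro i mu χ hχ hχc
    have := (hχ.homotopy (T := T) ht hP i).dif (T := T) ht hP
    convert this using 3 with u κ
    split_ifs with h
    · rw [dif_homotopy hT (fun u κ h => hχ.eq_zero h) hχc i h]
    · rw [hχ.eq_zero h, mul_zero]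
  -- Here `θ` is `U - V` or `V - U`; its square no longer depends on the color.
  have hdisc : ∀ i κ, κ (P.ov i false) = κ (P.ov i true) → θ i κ ^ 2 = (ω.U - ω.V) ^ 2 := by
    intro i κ h
    simp only [θ, h, if_true]
    cases κ (P.ov i true)
    · rw [ω.rt_false]
    · rw [ω.rt_true]; ring
  have hU : ∀ (mu : ℝ) (χ : (I → Bool) → (H → Bool) → K), P.InFil ω F t mu χ →
      P.InFil ω F t (mu - 4) fun u κ => (ω.U - ω.V) ^ 2 * χ u κ := by
    intro mu χ hχ u
    have key : ∀ (nu : ℝ) (g : (H → Bool) → K), g ∈ ω.Lat F t (P.res u) nu →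
        (fun κ => (ω.U - ω.V) * g κ) ∈ ω.Lat F t (P.res u) (nu - 2) := by
      intro nu g hg
      convert Submodule.sub_mem _ (RootData.mul_U_mem (mu := nu - 2) hg (by linarith [ht.2]))
        (RootData.mul_V_mem (mu := nu - 2) hg (by linarith [ht.1])) using 1
      ext κ
      simp only [Pi.sub_apply]
      ring
    convert key _ _ (key _ _ (hχ u)) using 1
    · ring_nf
    · ext κ
      ring
  -- Put `D = (U - V) ^ 2`. Modulo boundaries, `D ^ |s| φ` equals `φ` times the product of `D - θ_i
  -- ^ 2` over `s`. The product over all crossings vanishes at every coloring that is not a Lee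
  -- coloring.
  have key : ∀ s : Finset I, ∃ (mu : ℝ) (ψ : (I → Bool) → (H → Bool) → K), P.InFil ω F t mu ψ ∧
      P.InFil ω F t mu (fun u κ => (∏ i ∈ s, ((ω.U - ω.V) ^ 2 - θ i κ ^ 2)) * φ u κ) ∧
      ∀ u κ, P.Cons u κ → P.dif ω T ψ u κ = ((ω.U - ω.V) ^ 2) ^ s.card * φ u κ -
        (∏ i ∈ s, ((ω.U - ω.V) ^ 2 - θ i κ ^ 2)) * φ u κ := by
    intro s
    induction s using Finset.induction_on with
    | empty =>
      refine ⟨lam, fun _ _ => 0, fun u => Submodule.zero_mem _, by simpa using hφ, fun u κ _ => ?_⟩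
      simp [dif]
    | insert i s hi ih =>
      obtain ⟨mu, ψ, h1, h2, h3⟩ := ih
      set χ : (I → Bool) → (H → Bool) → K :=
        fun u κ => (∏ i ∈ s, ((ω.U - ω.V) ^ 2 - θ i κ ^ 2)) * φ u κ with hχ
      have hχc : P.IsCycle ω T χ := hmul _ _ hc
      have h4 := hθ i mu χ h2 hχc
      have h4c : P.IsCycle ω T fun u κ => θ i κ * χ u κ := hmul _ _ hχc
      have h5 := h4.homotopy (T := T) ht hP i
      have h6 := hθ i _ _ h4 h4c
      -- If `d ψ = D ^ |s| φ - χ`, then the differential of `D ψ + h_i (θ_i χ)` is `D ^ (|s| + 1) φ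
      -- - (D - θ_i ^ 2) χ`.
      refine ⟨mu - 4, fun u κ => (ω.U - ω.V) ^ 2 * ψ u κ +
        P.homotopy ω T i (fun u κ => θ i κ * χ u κ) u κ, fun u => ?_, fun u => ?_,
        fun u κ hκ => ?_⟩
      · exact Submodule.add_mem _ (hU _ _ h1 u) ((h5.anti (mu := mu - 4) (by linarith)) u)
      · convert Submodule.sub_mem _ (hU _ _ h2 u) ((h6.anti (mu := mu - 4) (by linarith)) u) using 1
        ext κ
        simp only [Pi.sub_apply, hχ, Finset.prod_insert hi]
        ring
      · rw [hdadd, hdsmul, h3 u κ hκ, dif_homotopy hT (fun u κ h => h4.eq_zero h) h4c i hκ,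
          Finset.prod_insert hi, Finset.card_insert_of_notMem hi]
        change _ + θ i κ * (θ i κ * χ u κ) = _
        simp only [hχ]
        ring
  obtain ⟨mu, ψ, h1, -, h3⟩ := key Finset.univ
  refine ⟨2 * (Finset.univ : Finset I).card, mu, ψ, h1, fun u κ hκ => ?_⟩
  rw [h3 u κ hκ, pow_mul]
  have : (∏ i, ((ω.U - ω.V) ^ 2 - θ i κ ^ 2)) * φ u κ = 0 := by
    by_cases hL : P.IsLee u κ
    · rw [h0 u κ hL, mul_zero]
    · have : ∃ i, κ (P.ov i false) = κ (P.ov i true) := by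
        by_contra hcon
        push Not at hcon
        exact hL ⟨hκ, hcon⟩
      obtain ⟨i, hi⟩ := this
      rw [Finset.prod_eq_zero (Finset.mem_univ i), zero_mul]
      rw [hdisc i κ hi, sub_self]
  rw [this, sub_zero]

/-- A Lee coloring fits only one smoothing at each crossing, so all terms of the differential are
values at inconsistent colorings. -/
theorem dif_eq_zero_of_isLee {φ : (I → Bool) → (H → Bool) → K}
    (hs : ∀ u κ, ¬ P.Cons u κ → φ u κ = 0) {u : I → Bool} {κ : H → Bool} (h : P.IsLee u κ) :
    P.dif ω T φ u κ = 0 := by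
  refine Finset.sum_eq_zero fun i _ => ?_
  split_ifs with hi
  · rw [hs, mul_zero, mul_zero]
    intro h'
    rcases (P.cons_update h.1).1 h' with h'' | h''
    · rw [hi] at h''
      exact absurd h'' (by simp)
    · exact h.2 i h''
  · rfl

end Complex

end PD

namespace PD

/-! ### Identifications of diagram data -/

section Equivalences

variable {I I' H H' : Type*}

/-- An identification of diagrams, up to the partitions of the arcs into circles. -/
structure Equivalent (P : PD I H) (P' : PD I' H') (e : I ≃ I') (p : H → H') (q : H' → H) :
    Prop where
  pull : ∀ u κ', P'.Cons u κ' → P.Cons (u ∘ e) (κ' ∘ p)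
  push : ∀ u κ, P.Cons (u ∘ e) κ → P'.Cons u (κ ∘ q)
  pq : ∀ u κ', P'.Cons u κ' → ∀ h, κ' (p (q h)) = κ' h
  qp : ∀ u κ, P.Cons (u ∘ e) κ → ∀ h, κ (q (p h)) = κ h
  ov : ∀ u κ', P'.Cons u κ' → ∀ i b, κ' (p (P.ov i b)) = κ' (P'.ov (e i) b)

variable {P : PD I H} {P' : PD I' H'} {e : I ≃ I'} {p : H → H'} {q : H' → H}

theorem Equivalent.symm (E : Equivalent P P' e p q) : Equivalent P' P e.symm q p where
  pull u κ hκ := E.push (u ∘ e.symm) κ (by simpa [Function.comp_assoc] using hκ)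
  push u κ' hκ' := by simpa [Function.comp_assoc] using E.pull (u ∘ e.symm) κ' hκ'
  pq u κ hκ := E.qp (u ∘ e.symm) κ (by simpa [Function.comp_assoc] using hκ)
  qp u κ' hκ' := E.pq (u ∘ e.symm) κ' hκ'
  ov u κ hκ i b := by
    have hκ' : P.Cons ((u ∘ e.symm) ∘ e) κ := by simpa [Function.comp_assoc] using hκ
    have h1 := E.ov (u ∘ e.symm) _ (E.push _ κ hκ') (e.symm i) b
    have h2 := E.qp _ κ hκ' (P.ov (e.symm i) b)
    rw [e.apply_symm_apply] at h1
    simp only [Function.comp_apply] at h1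
    rw [← h1, h2]

theorem height_comp_equiv [Fintype I] [Fintype I'] (e : I ≃ I') (u : I' → Bool) :
    height (u ∘ e) = height u := by
  unfold height
  refine Finset.card_bij (fun i _ => e i) ?_ ?_ ?_
  · intro i hi
    simpa using hi
  · intro i _ j _ h
    exact e.injective h
  · intro j hj
    exact ⟨e.symm j, by simpa using hj, by simp⟩

/-- The same diagram with other labels of the crossings. -/
def reindex (P : PD I' H) (e : I ≃ I') : PD I H where
  ov i := P.ov (e i)
  un i := P.un (e i)
  glue := P.glue

theorem reindex_cons {P : PD I' H} {e : I ≃ I'} {u : I' → Bool} {κ : H → Bool} :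
    (P.reindex e).Cons (u ∘ e) κ ↔ P.Cons u κ := by
  unfold Cons Smooth reindex
  simp only [Function.comp_apply]
  rw [e.forall_congr_left]
  simp

theorem reindex_cons' {P : PD I' H} {e : I ≃ I'} {u : I → Bool} {κ : H → Bool} :
    (P.reindex e).Cons u κ ↔ P.Cons (u ∘ e.symm) κ := by
  rw [← reindex_cons (e := e)]
  simp [Function.comp_assoc]

theorem reindex_equivalent (P : PD I' H) (e : I ≃ I') : Equivalent (P.reindex e) P e id id where
  pull _ _ h := reindex_cons.2 h
  push _ _ h := reindex_cons.1 h
  pq _ _ _ _ := rfl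
  qp _ _ _ _ := rfl
  ov _ _ _ _ _ := rfl

theorem _root_.Khovanov.IsTournament.comp {T : I' → I' → Prop} (hT : IsTournament T) (e : I ≃ I') :
    IsTournament fun i j => T (e i) (e j) where
  irrefl _ := hT.irrefl _
  total _ _ h := hT.total _ _ fun h' => h (e.injective h')

variable [Fintype I] [Fintype I'] [Finite H] [Finite H'] {K : Type*} [Field K] {ω : RootData K}
  {F : Type*} [Field F] [Algebra F K] {t : ℝ}

theorem Equivalent.good (E : Equivalent P P' e p q) {T : I' → I' → Prop} {lam : ℝ}
    (h : P.Good ω (fun i j => T (e i) (e j)) F t lam) : P'.Good ω T F t lam := by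
  obtain ⟨φ, h1, h2, u, κ, h3, h4⟩ := h
  refine ⟨fun u κ => if P'.Cons u κ then φ (u ∘ e) (κ ∘ p) else 0, fun u => ?_, fun u κ hκ => ?_,
    u ∘ e.symm, κ ∘ q, ?_, ?_⟩
  · have := RootData.pull_mem (σ' := P'.res u) p q
      (fun κ' h => (respects_res _).2 (E.pull u κ' ((respects_res _).1 h)))
      (fun κ h => (respects_res _).2 (E.push u κ ((respects_res _).1 h)))
      (fun κ' h => E.pq u κ' ((respects_res _).1 h)) (fun κ h => E.qp u κ ((respects_res _).1 h)) (h1 (u ∘ e))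
    simpa only [respects_res, height_comp_equiv] using this
  · have := h2 (u ∘ e) (κ ∘ p) (E.pull u κ hκ)
    refine Eq.trans ?_ this
    refine (Fintype.sum_equiv e _ _ fun i => ?_).symm
    have e1 : sgn K (fun i j => T (e i) (e j)) (u ∘ e) i = sgn K T u (e i) :=
      Fintype.prod_equiv e _ _ fun j => rfl
    have e2 : Function.update u (e i) false ∘ e = Function.update (u ∘ e) i false := by
      ext j
      by_cases hj : j = i
      · subst hj; simp
      · simp [hj]
    rw [e1, ← e2]
    simp only [Function.comp_apply]
    rw [E.ov u κ hκ]
    split_ifs with hi hc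
    · rfl
    · rw [h1.eq_zero]
      rintro hc'
      rw [e2] at hc'
      apply hc
      rw [P'.cons_update hκ]
      rcases (P.cons_update (E.pull u κ hκ)).1 hc' with h | h
      · exact Or.inl h
      · right
        simpa only [Function.comp_apply, E.ov u κ hκ] using h
    · rfl
  · have hκ : P.Cons ((u ∘ e.symm) ∘ e) κ := by simpa [Function.comp_assoc] using h3.1
    refine ⟨E.push _ κ hκ, fun i => ?_⟩
    have h5 := E.symm.ov u κ h3.1 i
    have h6 := h3.2 (e.symm i)
    rwa [← h5, ← h5] at h6
  · have hκ : P.Cons ((u ∘ e.symm) ∘ e) κ := by simpa [Function.comp_assoc] using h3.1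
    have e1 : (κ ∘ q) ∘ p = κ := funext fun h => E.qp _ κ hκ h
    have e2 : (u ∘ e.symm) ∘ e = u := by simp [Function.comp_assoc]
    simpa only [if_pos (E.push _ κ hκ), e1, e2] using h4

/-- The sign conventions on the two sides are arbitrary, so `e` need not be compatible with any
order of the crossings. -/
theorem good_reindex {P : PD I' H} (e : I ≃ I') {T : I → I → Prop} {T' : I' → I' → Prop}
    (hT : IsTournament T) (hT' : IsTournament T') {lam : ℝ} :
    (P.reindex e).Good ω T F t lam ↔ P.Good ω T' F t lam := by
  constructor
  · intro h
    exact (reindex_equivalent P e).good (h.change_tournament hT (hT'.comp e))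
  · intro h
    have := (reindex_equivalent P e).symm.good (T := fun i j => T' (e i) (e j)) (ω := ω) (F := F)
      (t := t) (lam := lam) (by simpa using h)
    exact this.change_tournament (hT'.comp e) hT

theorem Alternating.reindex {P : PD I' H} (hP : P.Alternating) (e : I ≃ I') :
    (P.reindex e).Alternating := by
  intro u i hi
  have := hP (u ∘ e.symm) (e i) (by simpa using hi)
  have e2 : Function.update (u ∘ e.symm) (e i) true = Function.update u i true ∘ e.symm := by
    ext j
    by_cases hj : j = e i
    · subst hj; simp
    · have : e.symm j ≠ i := fun h => hj (by simp [← h])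
      simp [hj, this]
  rw [e2] at this
  simp only [res_iff, reindex_cons'] at this ⊢
  exact this

end Equivalences

/-! ### Separating the first crossing of the cube -/

section Tail

variable {I H : Type*}

/-- A vertex of the cube with one more crossing. -/
def vcons (x : Bool) (u : I → Bool) : Option I → Bool := fun o => o.elim x u

@[simp] theorem vcons_none (x : Bool) (u : I → Bool) : vcons x u none = x := rfl

@[simp] theorem vcons_some (x : Bool) (u : I → Bool) (i : I) : vcons x u (some i) = u i := rfl

theorem vcons_eta (w : Option I → Bool) : vcons (w none) (fun i => w (some i)) = w := by
  ext (_ | i) <;> rfl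

theorem update_vcons_none {_ : DecidableEq (Option I)} (x y : Bool) (u : I → Bool) :
    Function.update (vcons x u) none y = vcons y u := by
  ext (_ | i) <;> simp

theorem update_vcons_some {_ : DecidableEq (Option I)} {_ : DecidableEq I} (x y : Bool) (u : I → Bool) (i : I) :
    Function.update (vcons x u) (some i) y = vcons x (Function.update u i y) := by
  ext (_ | j)
  · simp
  · by_cases h : j = i
    · subst h; simp
    · simp [h]

/-- The additional crossing comes first. -/
def optT (T : I → I → Prop) : Option I → Option I → Prop
  | none, some _ => True
  | some i, some j => T i j
  | _, none => False

theorem optT_isTournament {T : I → I → Prop} (hT : IsTournament T) : IsTournament (optT T) where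
  irrefl i := by cases i <;> simp [optT, hT.irrefl]
  total i j h := by
    cases i <;> cases j
    · exact absurd rfl h
    · simp [optT]
    · simp [optT]
    · exact hT.total _ _ fun h' => h (by rw [h'])

/-- The sign of passing a `1`-smoothing. -/
def sg (K : Type*) [Field K] (x : Bool) : K := if x = true then -1 else 1

@[simp] theorem sg_true {K : Type*} [Field K] : sg K true = -1 := rfl

@[simp] theorem sg_false {K : Type*} [Field K] : sg K false = 1 := rfl

theorem height_vcons [Fintype I] (x : Bool) (u : I → Bool) :
    height (vcons x u) = x.toNat + height u := by
  unfold height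
  simp only [Finset.card_filter, Fintype.sum_option, vcons_none, vcons_some]
  congr 1
  cases x <;> rfl

/-- The crossings other than the first one. -/
def tail (P : PD (Option I) H) : PD I H where
  ov i := P.ov (some i)
  un i := P.un (some i)
  glue := P.glue

variable (P : PD (Option I) H)

theorem cons_vcons {x : Bool} {u : I → Bool} {κ : H → Bool} :
    P.Cons (vcons x u) κ ↔ P.Smooth x κ none ∧ P.tail.Cons u κ := by
  unfold Cons
  rw [Option.forall]
  exact and_assoc

theorem isLee_vcons {x : Bool} {u : I → Bool} {κ : H → Bool} :
    P.IsLee (vcons x u) κ ↔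
      P.Smooth x κ none ∧ κ (P.ov none false) ≠ κ (P.ov none true) ∧ P.tail.IsLee u κ := by
  unfold IsLee
  rw [Option.forall, cons_vcons]
  exact ⟨fun ⟨⟨a, b⟩, c, d⟩ => ⟨a, c, b, d⟩, fun ⟨a, c, b, d⟩ => ⟨⟨a, b⟩, c, d⟩⟩

variable [Fintype I] {K : Type*} [Field K] {ω : RootData K} {T : I → I → Prop}

/-- The complex is the cone of the saddle at the first crossing. This crossing precedes all others,
so its own edges carry no sign, and it contributes `sg x` to all other edges. -/
theorem dif_vcons (φ : (Option I → Bool) → (H → Bool) → K) (x : Bool) (u : I → Bool)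
    (κ : H → Bool) : P.dif ω (optT T) φ (vcons x u) κ =
      (if x = true then ω.rt (κ (P.ov none false)) * φ (vcons false u) κ else 0) +
      sg K x * P.tail.dif ω T (fun u => φ (vcons x u)) u κ := by
  unfold dif
  rw [Fintype.sum_option]
  congr 1
  · have : sgn K (optT T) (vcons x u) none = 1 :=
      Finset.prod_eq_one fun j _ => by cases j <;> simp [optT]
    simp [this, update_vcons_none]
  · rw [Finset.mul_sum]
    refine Finset.sum_congr rfl fun i _ => ?_
    have : sgn K (optT T) (vcons x u) (some i) = sg K x * sgn K T u i := by
      unfold sgn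
      rw [Fintype.prod_option]
      congr 1
      simp [optT, sg]
    rw [this, vcons_some, update_vcons_some]
    split_ifs
    · simp only [tail]
      ring
    · simp

end Tail

/-! ### Linearity of the differential -/

section Linearity

variable {I H H' : Type*} [Fintype I] {K : Type*} [Field K] {ω : RootData K} {T : I → I → Prop}

/-- At one coloring the differential only sees the colors of the over-strands. They have to agree
only where the constant is nonzero, so a constant may also encode the support of a construction. -/
theorem dif_coeff {P : PD I H} {Q : PD I H'} (c : K) (φ : (I → Bool) → (H → Bool) → K)
    (ψ : (I → Bool) → (H' → Bool) → K) {u : I → Bool} {κ : H → Bool} {κ' : H' → Bool}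
    (hψ : ∀ u, ψ u κ' = c * φ u κ) (h : c ≠ 0 → ∀ i, κ' (Q.ov i false) = κ (P.ov i false)) :
    Q.dif ω T ψ u κ' = c * P.dif ω T φ u κ := by
  unfold dif
  rw [Finset.mul_sum]
  refine Finset.sum_congr rfl fun i _ => ?_
  rw [hψ]
  by_cases hc : c = 0
  · simp [hc]
  · rw [h hc]
    split_ifs <;> ring

theorem dif_add {P : PD I H} (φ φ' ψ : (I → Bool) → (H → Bool) → K) {u : I → Bool} {κ : H → Bool}
    (h : ∀ u, ψ u κ = φ u κ + φ' u κ) :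
    P.dif ω T ψ u κ = P.dif ω T φ u κ + P.dif ω T φ' u κ := by
  unfold dif
  rw [← Finset.sum_add_distrib]
  refine Finset.sum_congr rfl fun i _ => ?_
  rw [h]
  split_ifs <;> ring

end Linearity

/-! ### Collapsing arcs -/

section Collapse

variable {I H H' : Type*}

/-- The crossings of `P` are the images of those of `Q` under the map `q` of arcs, which does not
matter on the set `N` of arcs away from these crossings. -/
structure Collapse (P : PD I H) (Q : PD I H') (q : H' → H) (p : H → H') (N : Set H') : Prop where
  qp : ∀ h, q (p h) = h
  p_notMem : ∀ h, p h ∉ N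
  ov : ∀ i e, q (Q.ov i e) = P.ov i e
  un : ∀ i e, q (Q.un i e) = P.un i e
  ov_notMem : ∀ i e, Q.ov i e ∉ N
  un_notMem : ∀ i e, Q.un i e ∉ N
  glue : ∀ a b, P.glue a b → ∃ a' b', Q.glue a' b' ∧ q a' = a ∧ q b' = b
  glue' : ∀ a b, Q.glue a b → P.glue (q a) (q b) ∧ a ∉ N ∧ b ∉ N

variable {P : PD I H} {Q : PD I H'} {q : H' → H} {p : H → H'} {N : Set H'}

theorem Collapse.cons_iff (C : Collapse P Q q p N) {κ' : H' → Bool} {κ : H → Bool}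
    (h : ∀ h', h' ∉ N → κ' h' = κ (q h')) {u : I → Bool} : Q.Cons u κ' ↔ P.Cons u κ := by
  unfold Cons Smooth
  constructor
  · rintro ⟨h1, h2⟩
    refine ⟨fun i e => ?_, fun a b hab => ?_⟩
    · have := h1 i e
      rwa [h _ (C.ov_notMem _ _), h _ (C.un_notMem _ _), C.ov, C.un] at this
    · obtain ⟨a', b', h3, rfl, rfl⟩ := C.glue a b hab
      have := h2 a' b' h3
      rwa [h _ (C.glue' _ _ h3).2.1, h _ (C.glue' _ _ h3).2.2] at this
  · rintro ⟨h1, h2⟩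
    refine ⟨fun i e => ?_, fun a b hab => ?_⟩
    · rw [h _ (C.ov_notMem _ _), h _ (C.un_notMem _ _), C.ov, C.un]
      exact h1 i e
    · rw [h _ (C.glue' _ _ hab).2.1, h _ (C.glue' _ _ hab).2.2]
      exact h2 _ _ (C.glue' _ _ hab).1

theorem Collapse.ov_eq (C : Collapse P Q q p N) {κ' : H' → Bool} {κ : H → Bool}
    (h : ∀ h', h' ∉ N → κ' h' = κ (q h')) (i : I) (e : Bool) : κ' (Q.ov i e) = κ (P.ov i e) := by
  rw [h _ (C.ov_notMem _ _), C.ov]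

theorem Collapse.isLee_iff (C : Collapse P Q q p N) {κ' : H' → Bool} {κ : H → Bool}
    (h : ∀ h', h' ∉ N → κ' h' = κ (q h')) {u : I → Bool} : Q.IsLee u κ' ↔ P.IsLee u κ := by
  unfold IsLee
  rw [C.cons_iff h]
  simp only [C.ov_eq h]

end Collapse

end PD

namespace PD

/-! ### Kinks -/

section Kink

variable {I H H' : Type*}

theorem exists_vcons (w : Option I → Bool) : ∃ x u, w = vcons x u :=
  ⟨_, _, (vcons_eta w).symm⟩

/-- The first crossing of `Q` is a kink with loop `ℓ` between the arcs `s₁` and `s₂`; removing it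
gives `P`. The smoothing `v₀` splits off the loop. -/
structure Kink (P : PD I H) (Q : PD (Option I) H') (v₀ : Bool) (q : H' → H) (p : H → H')
    (s₁ s₂ ℓ : H') : Prop where
  collapse : Collapse P Q.tail q p {ℓ}
  ends : ∀ h, h ≠ ℓ → h = p (q h) ∨ ((h = s₁ ∨ h = s₂) ∧ (p (q h) = s₁ ∨ p (q h) = s₂))
  ne₁ : s₁ ≠ ℓ
  ne₂ : s₂ ≠ ℓ
  q_eq : q s₁ = q s₂
  smooth : ∀ v κ, Q.Smooth v κ none ↔
    if v = v₀ then κ s₁ = κ s₂ else κ s₁ = κ ℓ ∧ κ s₂ = κ ℓ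
  strand : (Q.ov none false = s₁ ∧ Q.ov none true = ℓ) ∨ (Q.ov none false = ℓ ∧ Q.ov none true = s₂)

namespace Kink

variable {P : PD I H} {Q : PD (Option I) H'} {v₀ : Bool} {q : H' → H} {p : H → H'} {s₁ s₂ ℓ : H'}

/-- The extension of a coloring by a color of the loop. -/
def ext (q : H' → H) (ℓ : H') (κ : H → Bool) (b : Bool) (h : H') : Bool :=
  (if h = ℓ then none else some (q h)).elim b κ

theorem ext_loop (κ : H → Bool) (b : Bool) : ext q ℓ κ b ℓ = b := by simp [ext]

theorem ext_of_ne (κ : H → Bool) (b : Bool) {h : H'} (hh : h ≠ ℓ) : ext q ℓ κ b h = κ (q h) := by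
  simp [ext, hh]

theorem compat (k : Kink P Q v₀ q p s₁ s₂ ℓ) {κ : H' → Bool} (h : κ s₁ = κ s₂) :
    ∀ h', h' ∉ ({ℓ} : Set H') → κ h' = (κ ∘ p) (q h') := by
  intro h' hh'
  rcases k.ends h' hh' with h1 | ⟨h1 | h1, h2 | h2⟩
  · exact congrArg κ h1
  all_goals
    subst h1
    simp [h2, h]

theorem ext_eq (k : Kink P Q v₀ q p s₁ s₂ ℓ) {κ : H' → Bool} (h : κ s₁ = κ s₂) :
    ext q ℓ (κ ∘ p) (κ ℓ) = κ := by
  ext h'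
  by_cases hh : h' = ℓ
  · subst hh; rw [ext_loop]
  · rw [ext_of_ne _ _ hh, ← k.compat h h' hh]

theorem cons_ext (k : Kink P Q v₀ q p s₁ s₂ ℓ) {u : I → Bool} {κ : H → Bool} {b : Bool} :
    Q.Cons (vcons v₀ u) (ext q ℓ κ b) ↔ P.Cons u κ := by
  rw [cons_vcons, k.smooth, if_pos rfl, k.collapse.cons_iff (κ := κ) fun h hh => ext_of_ne _ _ hh,
    ext_of_ne _ _ k.ne₁, ext_of_ne _ _ k.ne₂, k.q_eq]
  simp

theorem ext_pull (k : Kink P Q v₀ q p s₁ s₂ ℓ) (κ : H → Bool) (b : Bool) :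
    ext q ℓ κ b ∘ p = κ := by
  ext h
  have : p h ≠ ℓ := k.collapse.p_notMem h
  rw [Function.comp_apply, ext_of_ne _ _ this, k.collapse.qp]

theorem cons_iff (k : Kink P Q v₀ q p s₁ s₂ ℓ) {u : I → Bool} {κ : H' → Bool} :
    Q.Cons (vcons v₀ u) κ ↔ κ s₁ = κ s₂ ∧ P.Cons u (κ ∘ p) := by
  rw [cons_vcons, k.smooth, if_pos rfl]
  constructor
  · rintro ⟨h1, h2⟩
    exact ⟨h1, (k.collapse.cons_iff (k.compat h1)).1 h2⟩
  · rintro ⟨h1, h2⟩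
    exact ⟨h1, (k.collapse.cons_iff (k.compat h1)).2 h2⟩

theorem addsClass (k : Kink P Q v₀ q p s₁ s₂ ℓ) (u : I → Bool) :
    AddsClass (P.res u) (Q.res (vcons v₀ u)) p (fun h => if h = ℓ then none else some (q h)) ℓ where
  pull κ hκ := by
    rw [respects_res] at hκ ⊢
    exact (k.cons_iff.1 hκ).2
  extend κ b hκ := by
    rw [respects_res] at hκ ⊢
    exact k.cons_ext.2 hκ
  eq_extend κ hκ h := by
    rw [respects_res] at hκ
    exact congrFun (k.ext_eq (k.cons_iff.1 hκ).1) h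
  extend_pull κ b _ h := congrFun (k.ext_pull κ b) h
  loop := by simp

theorem over_iff (k : Kink P Q v₀ q p s₁ s₂ ℓ) {κ : H' → Bool} (h : κ s₁ = κ s₂) :
    κ (Q.ov none false) = κ (Q.ov none true) ↔ κ s₁ = κ ℓ := by
  rcases k.strand with ⟨h1, h2⟩ | ⟨h1, h2⟩
  · rw [h1, h2]
  · rw [h1, h2, h, eq_comm]

/-- A Lee coloring extends over the kink by giving the loop the color opposite to the strand. -/
theorem isLee_ext (k : Kink P Q v₀ q p s₁ s₂ ℓ) {u : I → Bool} {κ : H → Bool} (h : P.IsLee u κ) :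
    Q.IsLee (vcons v₀ u) (ext q ℓ κ (!κ (q s₁))) := by
  have hs : ext q ℓ κ (!κ (q s₁)) s₁ = ext q ℓ κ (!κ (q s₁)) s₂ := by
    rw [ext_of_ne _ _ k.ne₁, ext_of_ne _ _ k.ne₂, k.q_eq]
  rw [isLee_vcons, k.smooth, if_pos rfl, Ne, k.over_iff hs,
    k.collapse.isLee_iff (κ := κ) fun h hh => ext_of_ne _ _ hh]
  refine ⟨hs, ?_, h⟩
  rw [ext_of_ne _ _ k.ne₁, ext_loop]
  simp

/-- The smoothing that does not split off the loop forces one color on strand and loop, which a Lee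
coloring does not allow. So every Lee coloring arises from one of `P`. -/
theorem of_isLee (k : Kink P Q v₀ q p s₁ s₂ ℓ) {w : Option I → Bool} {κ : H' → Bool}
    (h : Q.IsLee w κ) : ∃ u, w = vcons v₀ u ∧ κ s₁ = κ s₂ ∧ κ ℓ = !κ s₁ ∧ P.IsLee u (κ ∘ p) ∧
      Q.tail.IsLee u κ := by
  obtain ⟨x, u, rfl⟩ := exists_vcons w
  rw [isLee_vcons, k.smooth] at h
  by_cases hx : x = v₀
  · subst hx
    rw [if_pos rfl] at h
    obtain ⟨h1, h2, h3⟩ := h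
    rw [Ne, k.over_iff h1] at h2
    refine ⟨u, rfl, h1, ?_, (k.collapse.isLee_iff (k.compat h1)).1 h3, h3⟩
    cases h4 : κ ℓ <;> cases h5 : κ s₁ <;> simp_all
  · rw [if_neg hx] at h
    obtain ⟨h1, h2, -⟩ := h
    rw [Ne, k.over_iff (h1.1.trans h1.2.symm)] at h2
    exact absurd h1.1 h2

variable [Fintype I] [Finite H] [Finite H'] {K : Type*} [Field K] {ω : RootData K}
  {T : I → I → Prop} {F : Type*} [Field F] [Algebra F K] {t lam : ℝ}

/-- The loop is born at the `0`-smoothing and then multiplied by `X` on the loop minus `X` on the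
strand. This difference is killed by the merge, so nothing is needed at the `1`-smoothing. The birth
gains one and the factor loses two. -/
theorem good_of_false (k : Kink P Q false q p s₁ s₂ ℓ) (h : P.Good ω T F t lam) :
    Q.Good ω (optT T) F t (lam - 1) := by
  obtain ⟨φ, h1, h2, u, κ, h3, h4⟩ := h
  let c : Bool → (H' → Bool) → K := fun x κ => if x = false ∧ κ s₁ = κ s₂ then
    (ω.val (κ ℓ) - ω.val (κ s₁)) / ω.rt (κ ℓ) else 0
  have hc : ∀ x κ, c x κ = if x = false ∧ κ s₁ = κ s₂ then
    (ω.val (κ ℓ) - ω.val (κ s₁)) / ω.rt (κ ℓ) else 0 := fun _ _ => rfl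
  refine ⟨fun w κ => c (w none) κ * φ (fun i => w (some i)) (κ ∘ p), fun w => ?_, fun w κ hκ => ?_,
    vcons false u, ext q ℓ κ (!κ (q s₁)), k.isLee_ext h3, ?_⟩
  · obtain ⟨x, u, rfl⟩ := exists_vcons w
    simp only [vcons_none, vcons_some]
    cases x
    · have := RootData.mul_val_sub_mem (RootData.birth_mem (k.addsClass u) (h1 u) le_rfl) ℓ s₁
        (mu := lam - 1 - height (vcons false u)) (by rw [height_vcons]; push_cast; simp; linarith)
      convert this using 1
      ext κ
      simp only [respects_res, hc]
      by_cases hs : κ s₁ = κ s₂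
      · by_cases hP : P.Cons u (κ ∘ p)
        · have : Q.Cons (vcons false u) κ := k.cons_iff.2 ⟨hs, hP⟩
          simp only [this, hs, if_true, true_and]
          ring
        · rw [h1.eq_zero hP]
          simp
      · have : ¬ Q.Cons (vcons false u) κ := fun h => hs (k.cons_iff.1 h).1
        simp [hs, this]
    · convert Submodule.zero_mem _ using 1
      ext κ
      simp [hc]
  · obtain ⟨x, u, rfl⟩ := exists_vcons w
    rw [dif_vcons]
    simp only [vcons_none, vcons_some]
    rw [dif_coeff (P := P) (κ := κ ∘ p) (c x κ) φ _ fun u => rfl]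
    · cases x
      · simp [h2 u (κ ∘ p) (k.cons_iff.1 hκ).2]
      · rw [cons_vcons, k.smooth, if_neg (by simp)] at hκ
        simp [hc, hκ.1]
    · intro hne i
      refine k.collapse.ov_eq (k.compat ?_) i false
      by_contra hs
      simp [hc, hs] at hne
  · have hs : ext q ℓ κ (!κ (q s₁)) s₁ = ext q ℓ κ (!κ (q s₁)) s₂ := by
      rw [ext_of_ne _ _ k.ne₁, ext_of_ne _ _ k.ne₂, k.q_eq]
    simp only [vcons_none, vcons_some, hc, k.ext_pull]
    refine mul_ne_zero ?_ h4
    rw [if_pos ⟨trivial, hs⟩, ω.val_sub, ext_loop, ext_of_ne _ _ k.ne₁, if_neg (by simp)]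
    exact div_ne_zero (pow_ne_zero _ (ω.rt_ne _)) (ω.rt_ne _)

/-- The trace is applied to the loop at the `0`-smoothing, which gains one. Of the two colors of the
loop only the one opposite to the strand contributes at a Lee coloring. -/
theorem good_false_of (ht : t ∈ Set.Icc (0 : ℝ) 2) (k : Kink P Q false q p s₁ s₂ ℓ)
    (h : Q.Good ω (optT T) F t lam) : P.Good ω T F t (lam + 1) := by
  obtain ⟨φ, h1, h2, w, κ', h3, h4⟩ := h
  obtain ⟨u, rfl, hs, hl, h5, h6⟩ := k.of_isLee h3
  refine ⟨fun u κ => ∑ b : Bool, φ (vcons false u) (ext q ℓ κ b) / ω.rt b, fun u => ?_,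
    fun u κ hκ => ?_, u, κ' ∘ p, h5, ?_⟩
  · have := RootData.death_mem ht (k.addsClass u) (h1 (vcons false u))
      (mu := lam + 1 - height u) (by rw [height_vcons]; push_cast; simp; linarith)
    convert this using 1
    ext κ
    simp only [respects_res]
    split_ifs with hP
    · rfl
    · refine Finset.sum_eq_zero fun b _ => ?_
      rw [h1.eq_zero, zero_div]
      rwa [k.cons_ext]
  · simp only [Fintype.sum_bool]
    rw [dif_add (fun u κ => φ (vcons false u) (ext q ℓ κ true) / ω.rt true)
      (fun u κ => φ (vcons false u) (ext q ℓ κ false) / ω.rt false) _ fun u => rfl]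
    have key : ∀ b, P.dif ω T (fun u κ => φ (vcons false u) (ext q ℓ κ b) / ω.rt b) u κ = 0 := by
      intro b
      rw [dif_coeff (P := Q.tail) (κ := ext q ℓ κ b) (ω.rt b)⁻¹ (fun u => φ (vcons false u)) _
        (fun u => by rw [div_eq_mul_inv, mul_comm])]
      · have := h2 _ _ (k.cons_ext (b := b) |>.2 hκ)
        rw [dif_vcons] at this
        have h0 : Q.tail.dif ω T (fun u => φ (vcons false u)) u (ext q ℓ κ b) = 0 := by
          simpa using this
        rw [h0, mul_zero]
      · exact fun _ i => (k.collapse.ov_eq (fun h hh => ext_of_ne _ _ hh) i false).symm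
    rw [key, key, add_zero]
  · have e1 : ext q ℓ (κ' ∘ p) (κ' ℓ) = κ' := k.ext_eq hs
    -- With the loop colored like the strand the merge is allowed. In the cycle condition at the
    -- `1`-smoothing the other terms vanish, as the remaining crossings have a Lee coloring.
    have e2 : φ (vcons false u) (ext q ℓ (κ' ∘ p) (κ' s₁)) = 0 := by
      set κ := ext q ℓ (κ' ∘ p) (κ' s₁) with hκ
      have a0 : ∀ h, h ≠ ℓ → κ h = κ' h := fun h hh => by
        rw [hκ, ext_of_ne _ _ hh, ← k.compat hs h hh]
      have al : κ ℓ = κ' s₁ := ext_loop _ _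
      have hLee : Q.tail.IsLee u κ := (k.collapse.isLee_iff (κ := κ' ∘ p)
        fun h hh => ext_of_ne _ _ hh).2 h5
      have hC : Q.Cons (vcons true u) κ := by
        rw [cons_vcons, k.smooth, if_neg (by simp), a0 _ k.ne₁, a0 _ k.ne₂, al]
        exact ⟨⟨rfl, hs.symm⟩, hLee.1⟩
      have := h2 _ _ hC
      rw [dif_vcons, if_pos rfl, dif_eq_zero_of_isLee (P := Q.tail) (fun u κ h => h1.eq_zero fun h' =>
        h ((cons_vcons Q).1 h').2) hLee, mul_zero, add_zero] at this
      exact (mul_eq_zero.1 this).resolve_left (ω.rt_ne _)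
    have e3 : ∀ f : Bool → K, ∑ b, f b = f (κ' ℓ) + f (κ' s₁) := by
      intro f
      rw [hl]
      cases κ' s₁ <;> simp [add_comm]
    change ∑ b, φ (vcons false u) (ext q ℓ (κ' ∘ p) b) / ω.rt b ≠ 0
    rw [e3, e1, e2, zero_div, add_zero]
    exact div_ne_zero h4 (ω.rt_ne _)

/-- The loop now splits off at the `1`-smoothing, where the newborn loop alone gives a cycle. The
birth gains one and the height another one. -/
theorem good_of_true (k : Kink P Q true q p s₁ s₂ ℓ) (h : P.Good ω T F t lam) :
    Q.Good ω (optT T) F t (lam + 2) := by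
  obtain ⟨φ, h1, h2, u, κ, h3, h4⟩ := h
  let c : Bool → (H' → Bool) → K := fun x κ => if x = true ∧ κ s₁ = κ s₂ then
    (ω.rt (κ ℓ))⁻¹ else 0
  have hc : ∀ x κ, c x κ = if x = true ∧ κ s₁ = κ s₂ then
    (ω.rt (κ ℓ))⁻¹ else 0 := fun _ _ => rfl
  refine ⟨fun w κ => c (w none) κ * φ (fun i => w (some i)) (κ ∘ p), fun w => ?_, fun w κ hκ => ?_,
    vcons true u, ext q ℓ κ (!κ (q s₁)), k.isLee_ext h3, ?_⟩
  · obtain ⟨x, u, rfl⟩ := exists_vcons w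
    simp only [vcons_none, vcons_some]
    cases x
    · convert Submodule.zero_mem _ using 1
      ext κ
      simp [hc]
    · have := RootData.birth_mem (k.addsClass u) (h1 u)
        (mu := lam + 2 - height (vcons true u)) (by rw [height_vcons]; push_cast; simp; linarith)
      convert this using 1
      ext κ
      simp only [respects_res, hc]
      by_cases hs : κ s₁ = κ s₂
      · by_cases hP : P.Cons u (κ ∘ p)
        · have : Q.Cons (vcons true u) κ := k.cons_iff.2 ⟨hs, hP⟩
          simp only [this, hs, if_true, true_and]
          ring
        · rw [h1.eq_zero hP]
          simp
      · have : ¬ Q.Cons (vcons true u) κ := fun h => hs (k.cons_iff.1 h).1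
        simp [hs, this]
  · obtain ⟨x, u, rfl⟩ := exists_vcons w
    rw [dif_vcons]
    simp only [vcons_none, vcons_some]
    rw [dif_coeff (P := P) (κ := κ ∘ p) (c x κ) φ _ fun u => rfl]
    · cases x
      · simp [hc]
      · simp [h2 u (κ ∘ p) (k.cons_iff.1 hκ).2, hc]
    · intro hne i
      refine k.collapse.ov_eq (k.compat ?_) i false
      by_contra hs
      simp [hc, hs] at hne
  · have hs : ext q ℓ κ (!κ (q s₁)) s₁ = ext q ℓ κ (!κ (q s₁)) s₂ := by
      rw [ext_of_ne _ _ k.ne₁, ext_of_ne _ _ k.ne₂, k.q_eq]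
    simp only [vcons_none, vcons_some, hc, k.ext_pull]
    refine mul_ne_zero ?_ h4
    rw [if_pos ⟨trivial, hs⟩]
    exact inv_ne_zero (ω.rt_ne _)

/-- Evaluating the loop at the color opposite to the strand kills everything that comes from the
split, so cycles go to cycles. Up to normalization this evaluation is the trace after multiplication
by `X` on the loop minus `X` on the strand; hence it is filtered. -/
theorem good_true_of (ht : t ∈ Set.Icc (0 : ℝ) 2) (k : Kink P Q true q p s₁ s₂ ℓ)
    (h : Q.Good ω (optT T) F t lam) : P.Good ω T F t (lam - 2) := by
  obtain ⟨φ, h1, h2, w, κ', h3, h4⟩ := h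
  obtain ⟨u, rfl, hs, hl, h5, h6⟩ := k.of_isLee h3
  refine ⟨fun u κ => ω.rt (!κ (q s₁)) * φ (vcons true u) (ext q ℓ κ (!κ (q s₁))), fun u => ?_,
    fun u κ hκ => ?_, u, κ' ∘ p, h5, ?_⟩
  · have := RootData.death_mem ht (k.addsClass u)
      (RootData.mul_val_sub_mem (h1 (vcons true u)) ℓ s₁ le_rfl)
      (mu := lam - 2 - height u) (by rw [height_vcons]; push_cast; simp; linarith)
    convert this using 1
    ext κ
    change _ = if Respects (P.res u) κ then ∑ b, ((ω.val (ext q ℓ κ b ℓ) -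
      ω.val (ext q ℓ κ b s₁)) * φ (vcons true u) (ext q ℓ κ b)) / ω.rt b else 0
    simp only [respects_res]
    split_ifs with hP
    · have e3 : ∀ f : Bool → K, ∑ b, f b = f (!κ (q s₁)) + f (κ (q s₁)) := by
        intro f
        cases κ (q s₁) <;> simp [add_comm]
      have e4 := ω.rt_ne (!κ (q s₁))
      rw [e3]
      simp only [ext_loop, ext_of_ne _ _ k.ne₁, ω.val_sub, if_true]
      rw [if_neg (by simp)]
      field_simp
      ring
    · rw [h1.eq_zero, mul_zero]
      rwa [k.cons_ext]
  · rw [dif_coeff (P := Q.tail) (κ := ext q ℓ κ (!κ (q s₁))) (ω.rt (!κ (q s₁)))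
      (fun u => φ (vcons true u)) _ (fun u => rfl)]
    · have := h2 _ _ (k.cons_ext (b := !κ (q s₁)) |>.2 hκ)
      rw [dif_vcons, if_pos rfl, h1.eq_zero] at this
      · have h0 : Q.tail.dif ω T (fun u => φ (vcons true u)) u (ext q ℓ κ (!κ (q s₁))) = 0 := by
          simpa using this
        rw [h0, mul_zero]
      · rw [cons_vcons, k.smooth, if_neg (by simp), ext_loop, ext_of_ne _ _ k.ne₁]
        simp
    · exact fun _ i => (k.collapse.ov_eq (fun h hh => ext_of_ne _ _ hh) i false).symm
  · have e1 : (κ' ∘ p) (q s₁) = κ' s₁ := (k.compat hs s₁ k.ne₁).symm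
    have e2 : ext q ℓ (κ' ∘ p) (!(κ' ∘ p) (q s₁)) = κ' := by
      rw [e1, ← hl]
      exact k.ext_eq hs
    change (ω.rt _) * φ (vcons true u) (ext q ℓ (κ' ∘ p) (!(κ' ∘ p) (q s₁))) ≠ 0
    rw [e2]
    exact mul_ne_zero (ω.rt_ne _) h4

end Kink

end Kink

end PD

/-! ### Births and deaths on a fixed set of arcs -/

/-- Recoloring a set of arcs. -/
def recolor {H : Type*} (N : Set H) (κ : H → Bool) (b : Bool) (h : H) : Bool :=
  if h ∈ N then b else κ h

section Recolor

variable {H : Type*} {N : Set H} {κ : H → Bool} {b : Bool} {h : H}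

theorem recolor_mem (hh : h ∈ N) : recolor N κ b h = b := if_pos hh

theorem recolor_notMem (hh : h ∉ N) : recolor N κ b h = κ h := if_neg hh

/-- Both partitions live on the same arcs: in `σ` the arcs of `N` belong to the circle of `b₀`, in
`σ'` they form a circle of their own. -/
theorem addsClass_recolor {σ σ' : Setoid H} {ℓ b₀ : H} (hℓ : ℓ ∈ N) (hb : b₀ ∉ N)
    (h1 : ∀ κ, Respects σ' κ → Respects σ (recolor N κ (κ b₀)))
    (h2 : ∀ κ b, Respects σ κ → Respects σ' (recolor N κ b))
    (h3 : ∀ κ, Respects σ' κ → ∀ h ∈ N, κ h = κ ℓ)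
    (h4 : ∀ κ, Respects σ κ → ∀ h ∈ N, κ h = κ b₀) :
    AddsClass σ σ' (fun h => if h ∈ N then b₀ else h) (fun h => if h ∈ N then none else some h) ℓ where
  pull κ hκ := by
    convert h1 κ hκ using 1
    ext h
    by_cases hh : h ∈ N <;> simp [recolor, hh]
  extend κ b hκ := by
    convert h2 κ b hκ using 1
    ext h
    by_cases hh : h ∈ N <;> simp [recolor, hh]
  eq_extend κ hκ h := by
    by_cases hh : h ∈ N
    · simp [hh, h3 κ hκ h hh]
    · simp [hh]
  extend_pull κ b hκ h := by
    by_cases hh : h ∈ N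
    · simp [hh, hb, h4 κ hκ h hh]
    · simp [hh]
  loop := by simp [hℓ]

variable [Finite H] {K : Type*} [Field K] {ω : RootData K}
  {F : Type*} [Field F] [Algebra F K] {t : ℝ}

theorem birth_recolor {σ σ' : Setoid H} {ℓ b₀ : H} (hℓ : ℓ ∈ N) (hb : b₀ ∉ N)
    (h1 : ∀ κ, Respects σ' κ → Respects σ (recolor N κ (κ b₀)))
    (h2 : ∀ κ b, Respects σ κ → Respects σ' (recolor N κ b))
    (h3 : ∀ κ, Respects σ' κ → ∀ h ∈ N, κ h = κ ℓ)
    (h4 : ∀ κ, Respects σ κ → ∀ h ∈ N, κ h = κ b₀) {lam mu : ℝ} {φ : (H → Bool) → K}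
    (hφ : φ ∈ ω.Lat F t σ lam) (hm : mu ≤ lam + 1) :
    (fun κ => if Respects σ' κ then φ (recolor N κ (κ b₀)) / ω.rt (κ ℓ) else 0) ∈
      ω.Lat F t σ' mu := by
  convert RootData.birth_mem (addsClass_recolor hℓ hb h1 h2 h3 h4) hφ hm using 5 with κ
  ext h
  by_cases hh : h ∈ N <;> simp [recolor, hh]

theorem death_recolor (ht : t ∈ Set.Icc (0 : ℝ) 2) {σ σ' : Setoid H} {ℓ b₀ : H}
    (hℓ : ℓ ∈ N) (hb : b₀ ∉ N)
    (h1 : ∀ κ, Respects σ' κ → Respects σ (recolor N κ (κ b₀)))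
    (h2 : ∀ κ b, Respects σ κ → Respects σ' (recolor N κ b))
    (h3 : ∀ κ, Respects σ' κ → ∀ h ∈ N, κ h = κ ℓ)
    (h4 : ∀ κ, Respects σ κ → ∀ h ∈ N, κ h = κ b₀) {lam mu : ℝ} {φ : (H → Bool) → K}
    (hφ : φ ∈ ω.Lat F t σ' lam) (hm : mu ≤ lam + 1) :
    (fun κ => if Respects σ κ then ∑ b : Bool, φ (recolor N κ b) / ω.rt b else 0) ∈
      ω.Lat F t σ mu := by
  convert RootData.death_mem ht (addsClass_recolor hℓ hb h1 h2 h3 h4) hφ hm using 6 with κ _ b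
  ext h
  by_cases hh : h ∈ N <;> simp [recolor, hh]

end Recolor

namespace PD

/-- No crossing and no gluing of `Q` involves the arcs in `N`. -/
structure Avoids {I H : Type*} (Q : PD I H) (N : Set H) : Prop where
  ov_notMem : ∀ i e, Q.ov i e ∉ N
  un_notMem : ∀ i e, Q.un i e ∉ N
  glue_notMem : ∀ a b, Q.glue a b → a ∉ N ∧ b ∉ N

namespace Avoids

variable {I H : Type*} {Q : PD I H} {N : Set H}

theorem cons_congr (A : Q.Avoids N) {κ κ' : H → Bool} (h : ∀ a, a ∉ N → κ a = κ' a)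
    {u : I → Bool} : Q.Cons u κ ↔ Q.Cons u κ' := by
  unfold Cons Smooth
  refine and_congr (forall_congr' fun i => forall_congr' fun e => ?_)
    (forall_congr' fun a => forall_congr' fun b => forall_congr' fun hab => ?_)
  · rw [h _ (A.ov_notMem _ _), h _ (A.un_notMem _ _)]
  · rw [h _ (A.glue_notMem _ _ hab).1, h _ (A.glue_notMem _ _ hab).2]

theorem isLee_congr (A : Q.Avoids N) {κ κ' : H → Bool} (h : ∀ a, a ∉ N → κ a = κ' a)
    {u : I → Bool} : Q.IsLee u κ ↔ Q.IsLee u κ' := by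
  unfold IsLee
  rw [A.cons_congr h]
  simp only [h _ (A.ov_notMem _ _)]

theorem cons_recolor (A : Q.Avoids N) {κ : H → Bool} {b : Bool} {u : I → Bool} :
    Q.Cons u (recolor N κ b) ↔ Q.Cons u κ :=
  A.cons_congr fun _ h => recolor_notMem h

end Avoids

theorem Collapse.avoids {I H H' : Type*} {P : PD I H} {Q : PD I H'} {q : H' → H} {p : H → H'}
    {N : Set H'} (C : Collapse P Q q p N) : Q.Avoids N where
  ov_notMem := C.ov_notMem
  un_notMem := C.un_notMem
  glue_notMem a b h := (C.glue' a b h).2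

theorem dif_add₃ {I H : Type*} [Fintype I] {K : Type*} [Field K] {ω : RootData K}
    {T : I → I → Prop} {P : PD I H} (φ₁ φ₂ φ₃ : (I → Bool) → (H → Bool) → K) {u : I → Bool}
    {κ : H → Bool} : P.dif ω T (fun u κ => φ₁ u κ + (φ₂ u κ + φ₃ u κ)) u κ =
      P.dif ω T φ₁ u κ + (P.dif ω T φ₂ u κ + P.dif ω T φ₃ u κ) := by
  rw [← dif_add φ₂ φ₃ (fun u κ => φ₂ u κ + φ₃ u κ) fun _ => rfl]
  exact dif_add _ _ _ fun _ => rfl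

/-! ### Bigons -/

section Bigon

variable {I H H' : Type*}

/-- The first two crossings of `Q` bound a bigon with the sides `m₁` (over) and `m₂` (under). The
first crossing has the further ends `s₁` (over) and `r₁` (under), the second one `s₂` and `r₂`. -/
structure Bigon (P : PD I H) (Q : PD (Option (Option I)) H') (q : H' → H) (p : H → H')
    (s₁ s₂ r₁ r₂ m₁ m₂ : H') : Prop where
  collapse : Collapse P Q.tail.tail q p {m₁, m₂}
  ends : ∀ h, h ∉ ({m₁, m₂} : Set H') → h = p (q h) ∨
    ((h = s₁ ∨ h = s₂) ∧ (p (q h) = s₁ ∨ p (q h) = s₂)) ∨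
    ((h = r₁ ∨ h = r₂) ∧ (p (q h) = r₁ ∨ p (q h) = r₂))
  s₁_notMem : s₁ ∉ ({m₁, m₂} : Set H')
  s₂_notMem : s₂ ∉ ({m₁, m₂} : Set H')
  r₁_notMem : r₁ ∉ ({m₁, m₂} : Set H')
  r₂_notMem : r₂ ∉ ({m₁, m₂} : Set H')
  m_ne : m₁ ≠ m₂
  qs : q s₁ = q s₂
  qr : q r₁ = q r₂
  smooth₁ : ∀ v κ, Q.Smooth v κ none ↔
    if v = true then κ s₁ = κ r₁ ∧ κ m₁ = κ m₂ else κ s₁ = κ m₂ ∧ κ r₁ = κ m₁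
  smooth₂ : ∀ v κ, Q.tail.Smooth v κ none ↔
    if v = false then κ m₁ = κ m₂ ∧ κ s₂ = κ r₂ else κ m₁ = κ r₂ ∧ κ m₂ = κ s₂
  strand₁ : (Q.ov none false = s₁ ∧ Q.ov none true = m₁) ∨
    (Q.ov none false = m₁ ∧ Q.ov none true = s₁)
  strand₂ : (Q.tail.ov none false = s₂ ∧ Q.tail.ov none true = m₁) ∨
    (Q.tail.ov none false = m₁ ∧ Q.tail.ov none true = s₂)

namespace Bigon

variable {P : PD I H} {Q : PD (Option (Option I)) H'} {q : H' → H} {p : H → H'}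
  {s₁ s₂ r₁ r₂ m₁ m₂ : H'}

theorem compat (k : Bigon P Q q p s₁ s₂ r₁ r₂ m₁ m₂) {κ : H' → Bool} (hs : κ s₁ = κ s₂)
    (hr : κ r₁ = κ r₂) : ∀ h', h' ∉ ({m₁, m₂} : Set H') → κ h' = (κ ∘ p) (q h') := by
  intro h' hh'
  rcases k.ends h' hh' with h1 | ⟨h1 | h1, h2 | h2⟩ | ⟨h1 | h1, h2 | h2⟩
  · exact congrArg κ h1
  all_goals
    subst h1
    simp [h2, hs, hr]

/-- The collapse of the bigon when both strands run through. -/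
def through (q : H' → H) (s₁ r₁ m₁ m₂ : H') (h : H') : H :=
  if h = m₁ then q r₁ else if h = m₂ then q s₁ else q h

theorem through_m₁ : through q s₁ r₁ m₁ m₂ m₁ = q r₁ := if_pos rfl

theorem through_m₂ (k : Bigon P Q q p s₁ s₂ r₁ r₂ m₁ m₂) : through q s₁ r₁ m₁ m₂ m₂ = q s₁ := by
  rw [through, if_neg k.m_ne.symm, if_pos rfl]

theorem through_of_notMem {h : H'} (hh : h ∉ ({m₁, m₂} : Set H')) :
    through q s₁ r₁ m₁ m₂ h = q h := by
  rw [Set.mem_insert_iff, Set.mem_singleton_iff, not_or] at hh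
  rw [through, if_neg hh.1, if_neg hh.2]

/-- The coloring around the circle. -/
def around (q : H' → H) (m₁ m₂ : H') (κ : H → Bool) (b : Bool) : H' → Bool :=
  recolor {m₁, m₂} (κ ∘ q) b

theorem around_m₁ (κ : H → Bool) (b : Bool) : around q m₁ m₂ κ b m₁ = b :=
  recolor_mem (by simp)

theorem around_m₂ (κ : H → Bool) (b : Bool) : around q m₁ m₂ κ b m₂ = b :=
  recolor_mem (by simp)

theorem around_of_notMem (κ : H → Bool) (b : Bool) {h : H'} (hh : h ∉ ({m₁, m₂} : Set H')) :
    around q m₁ m₂ κ b h = κ (q h) :=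
  recolor_notMem hh

theorem through_eq_around (k : Bigon P Q q p s₁ s₂ r₁ r₂ m₁ m₂) {κ : H → Bool}
    (h : κ (q s₁) = κ (q r₁)) :
    κ ∘ through q s₁ r₁ m₁ m₂ = around q m₁ m₂ κ (κ (q s₁)) := by
  ext x
  by_cases hx : x ∈ ({m₁, m₂} : Set H')
  · rcases hx with rfl | rfl
    · rw [Function.comp_apply, through_m₁, around_m₁, h]
    · rw [Function.comp_apply, k.through_m₂, around_m₂]
  · rw [Function.comp_apply, through_of_notMem hx, around_of_notMem _ _ hx]

theorem around_pull (k : Bigon P Q q p s₁ s₂ r₁ r₂ m₁ m₂) (κ : H → Bool) (b : Bool) :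
    around q m₁ m₂ κ b ∘ p = κ := by
  ext h
  rw [Function.comp_apply, around_of_notMem _ _ (k.collapse.p_notMem h), k.collapse.qp]

theorem through_pull (k : Bigon P Q q p s₁ s₂ r₁ r₂ m₁ m₂) (κ : H → Bool) :
    (κ ∘ through q s₁ r₁ m₁ m₂) ∘ p = κ := by
  ext h
  rw [Function.comp_apply, Function.comp_apply, through_of_notMem (k.collapse.p_notMem h),
    k.collapse.qp]

theorem eq_around (k : Bigon P Q q p s₁ s₂ r₁ r₂ m₁ m₂) {κ : H' → Bool} (hs : κ s₁ = κ s₂)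
    (hr : κ r₁ = κ r₂) (hm : κ m₁ = κ m₂) : around q m₁ m₂ (κ ∘ p) (κ m₁) = κ := by
  ext x
  by_cases hx : x ∈ ({m₁, m₂} : Set H')
  · rcases hx with rfl | rfl
    · rw [around_m₁]
    · rw [around_m₂, hm]
  · rw [around_of_notMem _ _ hx, ← k.compat hs hr x hx]

theorem eq_through (k : Bigon P Q q p s₁ s₂ r₁ r₂ m₁ m₂) {κ : H' → Bool} (hs : κ s₁ = κ s₂)
    (hr : κ r₁ = κ r₂) (hm₁ : κ m₁ = κ r₁) (hm₂ : κ m₂ = κ s₁) :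
    (κ ∘ p) ∘ through q s₁ r₁ m₁ m₂ = κ := by
  ext x
  by_cases hx : x ∈ ({m₁, m₂} : Set H')
  · rcases hx with rfl | rfl
    · rw [Function.comp_apply, through_m₁, ← k.compat hs hr _ k.r₁_notMem, hm₁]
    · rw [Function.comp_apply, k.through_m₂, ← k.compat hs hr _ k.s₁_notMem, hm₂]
  · rw [Function.comp_apply, through_of_notMem hx, ← k.compat hs hr x hx]

/-- The four resolutions of the bigon: `(0, 1)` lets both strands through and is that of `P`; in
`(1, 0)` the sides form a separate circle; in `(0, 0)` they belong to the arc joining `s₁` and `r₁`,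
in `(1, 1)` to the one joining `s₂` and `r₂`. -/
theorem cons_iff (k : Bigon P Q q p s₁ s₂ r₁ r₂ m₁ m₂) {x y : Bool} {u : I → Bool}
    {κ : H' → Bool} : Q.Cons (vcons x (vcons y u)) κ ↔
      (if x = true then κ s₁ = κ r₁ ∧ κ m₁ = κ m₂ else κ s₁ = κ m₂ ∧ κ r₁ = κ m₁) ∧
      (if y = false then κ m₁ = κ m₂ ∧ κ s₂ = κ r₂ else κ m₁ = κ r₂ ∧ κ m₂ = κ s₂) ∧
      Q.tail.tail.Cons u κ := by
  rw [cons_vcons, cons_vcons, k.smooth₁, k.smooth₂]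

theorem cons_through_iff (k : Bigon P Q q p s₁ s₂ r₁ r₂ m₁ m₂) {u : I → Bool} {κ : H' → Bool} :
    Q.Cons (vcons false (vcons true u)) κ ↔
      (κ s₁ = κ s₂ ∧ κ r₁ = κ r₂ ∧ κ m₁ = κ r₁ ∧ κ m₂ = κ s₁) ∧ P.Cons u (κ ∘ p) := by
  rw [k.cons_iff]
  simp only [Bool.false_eq_true, if_false, Bool.true_eq_false]
  constructor
  · rintro ⟨⟨h1, h2⟩, ⟨h3, h4⟩, h5⟩
    have hs := h1.trans h4
    have hr := h2.trans h3
    exact ⟨⟨hs, hr, h2.symm, h1.symm⟩, (k.collapse.cons_iff (k.compat hs hr)).1 h5⟩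
  · rintro ⟨⟨hs, hr, h1, h2⟩, h5⟩
    exact ⟨⟨h2.symm, h1.symm⟩, ⟨h1.trans hr, h2.trans hs⟩,
      (k.collapse.cons_iff (k.compat hs hr)).2 h5⟩

theorem cons_through (k : Bigon P Q q p s₁ s₂ r₁ r₂ m₁ m₂) {u : I → Bool} {κ : H → Bool} :
    Q.Cons (vcons false (vcons true u)) (κ ∘ through q s₁ r₁ m₁ m₂) ↔ P.Cons u κ := by
  rw [k.cons_through_iff, k.through_pull]
  simp only [Function.comp_apply, through_m₁, k.through_m₂, through_of_notMem k.s₁_notMem,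
    through_of_notMem k.s₂_notMem, through_of_notMem k.r₁_notMem, through_of_notMem k.r₂_notMem,
    k.qs, k.qr, and_self, true_and]

theorem strand₁_iff (k : Bigon P Q q p s₁ s₂ r₁ r₂ m₁ m₂) {κ : H' → Bool} :
    κ (Q.ov none false) = κ (Q.ov none true) ↔ κ s₁ = κ m₁ := by
  rcases k.strand₁ with ⟨h1, h2⟩ | ⟨h1, h2⟩
  · rw [h1, h2]
  · rw [h1, h2, eq_comm]

theorem strand₂_iff (k : Bigon P Q q p s₁ s₂ r₁ r₂ m₁ m₂) {κ : H' → Bool} :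
    κ (Q.tail.ov none false) = κ (Q.tail.ov none true) ↔ κ s₂ = κ m₁ := by
  rcases k.strand₂ with ⟨h1, h2⟩ | ⟨h1, h2⟩
  · rw [h1, h2]
  · rw [h1, h2, eq_comm]

theorem ov₁ (k : Bigon P Q q p s₁ s₂ r₁ r₂ m₁ m₂) {κ : H' → Bool} (h : κ s₁ = κ m₁) :
    κ (Q.ov none false) = κ m₁ := by
  rcases k.strand₁ with ⟨h1, h2⟩ | ⟨h1, h2⟩ <;> rw [h1]
  exact h

theorem ov₂ (k : Bigon P Q q p s₁ s₂ r₁ r₂ m₁ m₂) {κ : H' → Bool} (h : κ s₂ = κ m₁) :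
    κ (Q.tail.ov none false) = κ m₁ := by
  rcases k.strand₂ with ⟨h1, h2⟩ | ⟨h1, h2⟩ <;> rw [h1]
  exact h

theorem isLee_iff (k : Bigon P Q q p s₁ s₂ r₁ r₂ m₁ m₂) {x y : Bool} {u : I → Bool}
    {κ : H' → Bool} : Q.IsLee (vcons x (vcons y u)) κ ↔
      (if x = true then κ s₁ = κ r₁ ∧ κ m₁ = κ m₂ else κ s₁ = κ m₂ ∧ κ r₁ = κ m₁) ∧
      κ s₁ ≠ κ m₁ ∧
      (if y = false then κ m₁ = κ m₂ ∧ κ s₂ = κ r₂ else κ m₁ = κ r₂ ∧ κ m₂ = κ s₂) ∧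
      κ s₂ ≠ κ m₁ ∧ Q.tail.tail.IsLee u κ := by
  rw [isLee_vcons, isLee_vcons, k.smooth₁, k.smooth₂, Ne, k.strand₁_iff, Ne, k.strand₂_iff]

variable [Fintype I] [Finite H] [Finite H'] {K : Type*} [Field K] {ω : RootData K}
  {T : I → I → Prop} {F : Type*} [Field F] [Algebra F K] {t lam : ℝ}

/-- Cutting the sides off the arc from `s₂` to `r₂` turns the resolution `(1, 1)` into `(1, 0)`. -/
theorem birth (k : Bigon P Q q p s₁ s₂ r₁ r₂ m₁ m₂) {u : I → Bool} {g : (H' → Bool) → K} {mu : ℝ}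
    (hg : g ∈ ω.Lat F t (Q.res (vcons true (vcons true u))) lam) (hm : mu ≤ lam + 1) :
    (fun κ => if Q.Cons (vcons true (vcons false u)) κ then
      g (recolor {m₁, m₂} κ (κ s₂)) / ω.rt (κ m₁) else 0) ∈
      ω.Lat F t (Q.res (vcons true (vcons false u))) mu := by
  have A := k.collapse.avoids
  have := birth_recolor (σ' := Q.res (vcons true (vcons false u))) (N := {m₁, m₂}) (ℓ := m₁)
    (b₀ := s₂) (by simp) k.s₂_notMem ?_ ?_ ?_ ?_ hg hm
  · simpa only [respects_res] using this
  all_goals simp only [respects_res, k.cons_iff, A.cons_recolor]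
  · rintro κ ⟨⟨h1, h2⟩, ⟨-, h3⟩, h4⟩
    simp [recolor_notMem k.s₁_notMem, recolor_notMem k.s₂_notMem, recolor_notMem k.r₁_notMem,
      recolor_notMem k.r₂_notMem, recolor_mem, h1, h3, h4]
  · rintro κ b ⟨⟨h1, h2⟩, ⟨h3, h5⟩, h4⟩
    have : κ s₂ = κ r₂ := by rw [← h5, ← h2, h3]
    simp [recolor_notMem k.s₁_notMem, recolor_notMem k.s₂_notMem, recolor_notMem k.r₁_notMem,
      recolor_notMem k.r₂_notMem, recolor_mem, h1, this, h4]
  · rintro κ ⟨⟨-, h2⟩, -, -⟩ h (rfl | rfl)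
    · rfl
    · exact h2.symm
  · rintro κ ⟨⟨-, h2⟩, ⟨h3, h5⟩, -⟩ h (rfl | rfl)
    · rw [h2, h5]
    · exact h5

/-- Dropping the separate circle of `(1, 0)` and attaching the sides to the arc from `s₁` to `r₁`
gives `(0, 0)`. -/
theorem death (ht : t ∈ Set.Icc (0 : ℝ) 2) (k : Bigon P Q q p s₁ s₂ r₁ r₂ m₁ m₂) {u : I → Bool}
    {g : (H' → Bool) → K} {mu : ℝ}
    (hg : g ∈ ω.Lat F t (Q.res (vcons true (vcons false u))) lam) (hm : mu ≤ lam + 1) :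
    (fun κ => if Q.Cons (vcons false (vcons false u)) κ then
      ∑ b, g (recolor {m₁, m₂} κ b) / ω.rt b else 0) ∈
      ω.Lat F t (Q.res (vcons false (vcons false u))) mu := by
  have A := k.collapse.avoids
  have := death_recolor ht (σ := Q.res (vcons false (vcons false u))) (N := {m₁, m₂}) (ℓ := m₁)
    (b₀ := s₁) (by simp) k.s₁_notMem ?_ ?_ ?_ ?_ hg hm
  · simpa only [respects_res] using this
  all_goals simp only [respects_res, k.cons_iff, A.cons_recolor]
  · rintro κ ⟨⟨h1, h2⟩, ⟨-, h3⟩, h4⟩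
    simp [recolor_notMem k.s₁_notMem, recolor_notMem k.s₂_notMem, recolor_notMem k.r₁_notMem,
      recolor_notMem k.r₂_notMem, recolor_mem, h1, h3, h4]
  · rintro κ b ⟨⟨h1, h2⟩, ⟨h3, h5⟩, h4⟩
    have : κ s₁ = κ r₁ := by rw [h1, ← h3, h2]
    simp [recolor_notMem k.s₁_notMem, recolor_notMem k.s₂_notMem, recolor_notMem k.r₁_notMem,
      recolor_notMem k.r₂_notMem, recolor_mem, h5, this, h4]
  · rintro κ ⟨⟨-, h2⟩, -, -⟩ h (rfl | rfl)
    · rfl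
    · exact h2.symm
  · rintro κ ⟨⟨h2, h3⟩, ⟨h5, -⟩, -⟩ h (rfl | rfl)
    · rw [h5, h2]
    · exact h2.symm

/-- A cycle of `P` is placed at `(0, 1)` and completed at `(1, 0)` by the birth of a circle after
the saddle to `(1, 1)`. The two maps to `(1, 1)` then cancel. Both vertices have one more
`1`-smoothing, which is the shift. -/
theorem good_of (ht : t ∈ Set.Icc (0 : ℝ) 2) (hQ : Q.Alternating)
    (k : Bigon P Q q p s₁ s₂ r₁ r₂ m₁ m₂) (h : P.Good ω T F t lam) :
    Q.Good ω (optT (optT T)) F t (lam + 1) := by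
  obtain ⟨φ, h1, h2, u, κ, h3, h4⟩ := h
  -- The first case is the identification of `(0, 1)` with `P`; in the second the numerator comes
  -- from the saddle and the denominator from the birth.
  let c : Bool → Bool → (H' → Bool) → K := fun x y κ =>
    if κ s₁ = κ s₂ ∧ κ r₁ = κ r₂ then
      if x = false ∧ y = true ∧ κ m₁ = κ r₁ ∧ κ m₂ = κ s₁ then 1
      else if x = true ∧ y = false ∧ κ m₁ = κ m₂ ∧ κ s₁ = κ r₁ then ω.rt (κ s₁) / ω.rt (κ m₁)
      else 0
    else 0
  have hc : ∀ x y κ, c x y κ = if κ s₁ = κ s₂ ∧ κ r₁ = κ r₂ then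
      if x = false ∧ y = true ∧ κ m₁ = κ r₁ ∧ κ m₂ = κ s₁ then 1
      else if x = true ∧ y = false ∧ κ m₁ = κ m₂ ∧ κ s₁ = κ r₁ then ω.rt (κ s₁) / ω.rt (κ m₁)
      else 0
    else 0 := fun _ _ _ => rfl
  have hI : ∀ u, (fun κ => c false true κ * φ u (κ ∘ p)) ∈
      ω.Lat F t (Q.res (vcons false (vcons true u))) (lam - height u) := by
    intro u
    have := RootData.pull_mem (σ' := Q.res (vcons false (vcons true u))) p (through q s₁ r₁ m₁ m₂)
      (fun κ' h => by
        rw [respects_res] at h ⊢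
        exact (k.cons_through_iff.1 h).2)
      (fun κ h => by
        rw [respects_res] at h ⊢
        exact k.cons_through.2 h)
      (fun κ' h h' => by
        rw [respects_res] at h
        obtain ⟨⟨a, b, c, d⟩, -⟩ := k.cons_through_iff.1 h
        exact congrFun (k.eq_through a b c d) h')
      (fun κ _ h' => congrFun (k.through_pull κ) h') (h1 u)
    convert this using 1
    ext κ
    simp only [respects_res, hc]
    by_cases hP : P.Cons u (κ ∘ p)
    · simp only [k.cons_through_iff, hP, and_true]
      simp only [true_and, Bool.false_eq_true, false_and, if_false, ite_mul, one_mul, zero_mul]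
      split_ifs <;> tauto
    · simp [h1.eq_zero hP]
  refine ⟨fun w κ => c (w none) (w (some none)) κ * φ (fun i => w (some (some i))) (κ ∘ p),
    fun w => ?_, fun w κ hκ => ?_, ?_⟩
  · obtain ⟨x, w, rfl⟩ := exists_vcons w
    obtain ⟨y, u, rfl⟩ := exists_vcons w
    simp only [vcons_none, vcons_some]
    cases x <;> cases y
    · convert Submodule.zero_mem _ using 1
      ext κ
      simp [hc]
    · refine RootData.Lat_anti ?_ (hI u)
      simp only [height_vcons]
      push_cast
      simp
    · have s := hQ.saddle (u := vcons false (vcons true u)) (i := none) rfl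
      rw [update_vcons_none] at s
      have := k.birth (RootData.saddle_mem ht s (hI u) le_rfl)
        (mu := lam + 1 - height (vcons true (vcons false u))) (by
          simp only [height_vcons]
          push_cast
          simp)
      convert this using 1
      ext κ
      by_cases hE : Q.Cons (vcons true (vcons false u)) κ
      · rw [if_pos hE]
        rw [k.cons_iff] at hE
        simp only [if_true] at hE
        obtain ⟨⟨a1, a2⟩, ⟨-, a3⟩, a4⟩ := hE
        have hR : Respects (Q.res (vcons true (vcons true u))) (recolor {m₁, m₂} κ (κ s₂)) := by
          rw [respects_res, k.cons_iff, k.collapse.avoids.cons_recolor]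
          simp [recolor_notMem k.s₁_notMem, recolor_notMem k.s₂_notMem, recolor_notMem k.r₁_notMem,
            recolor_notMem k.r₂_notMem, recolor_mem, a1, a3, a4]
        rw [if_pos hR]
        have hp : recolor {m₁, m₂} κ (κ s₂) ∘ p = κ ∘ p := by
          ext h
          exact recolor_notMem (k.collapse.p_notMem h)
        rw [hp]
        by_cases hs : κ s₁ = κ s₂
        · have hr : κ r₁ = κ r₂ := by rw [← a1, ← a3, hs]
          rw [k.ov₁ (κ := recolor {m₁, m₂} κ (κ s₂))
            (by rw [recolor_notMem k.s₁_notMem, recolor_mem (by simp), hs])]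
          simp only [hc, recolor_notMem k.s₁_notMem, recolor_notMem k.s₂_notMem,
            recolor_notMem k.r₁_notMem, recolor_notMem k.r₂_notMem, recolor_mem, Set.mem_insert_iff,
            Set.mem_singleton_iff, true_or, or_true, hs, hr, a2, a3, and_self, if_true,
            Bool.true_eq_false, Bool.false_eq_true, false_and, if_false]
          ring
        · simp [hc, hs, recolor_notMem k.s₁_notMem, recolor_notMem k.s₂_notMem]
      · rw [if_neg hE]
        by_cases hP : P.Cons u (κ ∘ p)
        · have : c true false κ = 0 := by
            rw [hc]
            split_ifs with h5 h6 h7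
            · exact absurd h6.1 (by simp)
            · refine absurd ?_ hE
              rw [k.cons_iff]
              refine ⟨?_, ?_, (k.collapse.cons_iff (k.compat h5.1 h5.2)).2 hP⟩
              · exact ⟨h7.2.2.2, h7.2.2.1⟩
              · exact ⟨h7.2.2.1, by rw [← h5.1, ← h5.2]; exact h7.2.2.2⟩
            · rfl
            · rfl
          rw [this, zero_mul]
        · rw [h1.eq_zero hP, mul_zero]
    · convert Submodule.zero_mem _ using 1
      ext κ
      simp [hc]
  · obtain ⟨x, w, rfl⟩ := exists_vcons w
    obtain ⟨y, u, rfl⟩ := exists_vcons w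
    rw [dif_vcons, dif_vcons]
    simp only [vcons_none, vcons_some]
    rw [dif_coeff (P := P) (κ := κ ∘ p) (c x y κ) φ _ fun u => rfl]
    · have h0 : c x y κ * P.dif ω T φ u (κ ∘ p) = 0 := by
        by_cases hs : κ s₁ = κ s₂ ∧ κ r₁ = κ r₂
        · rw [k.cons_iff] at hκ
          rw [h2 u (κ ∘ p) ((k.collapse.cons_iff (k.compat hs.1 hs.2)).1 hκ.2.2), mul_zero]
        · simp [hc, hs]
      rw [h0]
      rw [k.cons_iff] at hκ
      cases x <;> cases y
      · simp
      · simp [hc]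
      · simp [hc]
      · simp only [if_true, Bool.true_eq_false, if_false] at hκ
        obtain ⟨⟨a1, a2⟩, ⟨a3, a4⟩, a5⟩ := hκ
        by_cases hs : κ s₁ = κ s₂
        · have e1 : κ (Q.ov none false) = κ m₁ := k.ov₁ (by rw [hs, ← a4, a2])
          have e2 : κ (Q.tail.ov none false) = κ m₁ := k.ov₂ (by rw [← a4, a2])
          have e3 : κ r₁ = κ r₂ := by rw [← a1, ← a3, hs, ← a4, a2]
          have e4 : κ s₁ = κ m₁ := by rw [hs, ← a4, a2]
          have := ω.rt_ne (κ m₁)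
          have f1 : c false true κ = 1 := by
            rw [hc, if_pos ⟨hs, e3⟩, if_pos ⟨rfl, rfl, by rw [← e4, a1], by rw [← a2, e4]⟩]
          have f2 : c true false κ = 1 := by
            rw [hc, if_pos ⟨hs, e3⟩, if_neg (by simp), if_pos ⟨rfl, rfl, a2, a1⟩, e4, div_self this]
          simp [e1, e2, f1, f2]
        · simp [hc, hs]
    · intro hne i
      have hs : κ s₁ = κ s₂ ∧ κ r₁ = κ r₂ := by
        by_contra hs
        simp [hc, hs] at hne
      exact k.collapse.ov_eq (k.compat hs.1 hs.2) i false
  -- A Lee coloring of `P` with different colors on the strands continues through the bigon at `(0,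
  -- 1)`. With equal colors it has to move to `(1, 0)`, where the circle gets the other color.
  · by_cases hab : κ (q s₁) = κ (q r₁)
    · refine ⟨vcons true (vcons false u), around q m₁ m₂ κ (!κ (q s₁)), ?_, ?_⟩
      · rw [k.isLee_iff, k.collapse.isLee_iff (κ := κ) fun h hh => around_of_notMem _ _ hh]
        simp [around_m₁, around_m₂, around_of_notMem _ _ k.s₁_notMem,
          around_of_notMem _ _ k.s₂_notMem, around_of_notMem _ _ k.r₁_notMem,
          around_of_notMem _ _ k.r₂_notMem, ← k.qs, ← k.qr, ← hab, h3]
      · simp only [vcons_none, vcons_some, k.around_pull]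
        refine mul_ne_zero ?_ h4
        simp only [hc, around_m₁, around_m₂, around_of_notMem _ _ k.s₁_notMem,
          around_of_notMem _ _ k.s₂_notMem, around_of_notMem _ _ k.r₁_notMem,
          around_of_notMem _ _ k.r₂_notMem, ← k.qs, ← k.qr, ← hab]
        simp [ω.rt_ne]
    · refine ⟨vcons false (vcons true u), κ ∘ through q s₁ r₁ m₁ m₂, ?_, ?_⟩
      · rw [k.isLee_iff, k.collapse.isLee_iff (κ := κ) fun h hh => by
          rw [Function.comp_apply, through_of_notMem hh]]
        simp [through_m₁, k.through_m₂, through_of_notMem k.s₁_notMem,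
          through_of_notMem k.s₂_notMem, through_of_notMem k.r₁_notMem,
          through_of_notMem k.r₂_notMem, ← k.qs, ← k.qr, hab, h3]
      · simp only [vcons_none, vcons_some, k.through_pull]
        refine mul_ne_zero ?_ h4
        simp [hc, through_m₁, k.through_m₂, through_of_notMem k.s₁_notMem,
          through_of_notMem k.s₂_notMem, through_of_notMem k.r₁_notMem,
          through_of_notMem k.r₂_notMem, ← k.qs, ← k.qr]

/-- From the component at `(0, 1)` the component at `(1, 0)` is subtracted after the death of its
circle and the saddle from `(0, 0)` to `(0, 1)`. -/
theorem good_back (ht : t ∈ Set.Icc (0 : ℝ) 2) (hQ : Q.Alternating)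
    (k : Bigon P Q q p s₁ s₂ r₁ r₂ m₁ m₂) (h : Q.Good ω (optT (optT T)) F t lam) :
    P.Good ω T F t (lam - 1) := by
  obtain ⟨φ, h1, h2, w, κ', h3, h4⟩ := h
  have hsum : ∀ (f : Bool → K) (a : Bool), ∑ b, f b = f a + f (!a) := by
    intro f a
    cases a <;> simp [add_comm]
  -- By the cycle conditions at `(0, 1)` and `(1, 0)`, the derivatives of both components are given
  -- by the component at `(0, 0)`; they cancel in the difference.
  have hI : ∀ u κ, P.Cons u κ → Q.tail.tail.dif ω T (fun u => φ (vcons false (vcons true u))) u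
      (κ ∘ through q s₁ r₁ m₁ m₂) =
      ω.rt ((κ ∘ through q s₁ r₁ m₁ m₂) (Q.tail.ov none false)) *
        φ (vcons false (vcons false u)) (κ ∘ through q s₁ r₁ m₁ m₂) := by
    intro u κ hκ
    have := h2 _ _ (k.cons_through.2 hκ)
    rw [dif_vcons, dif_vcons] at this
    simp only [Bool.false_eq_true, if_false, if_true, sg_true, sg_false] at this
    linear_combination -this
  have hE : ∀ u κ b, P.Cons u κ → κ (q s₁) = κ (q r₁) →
      Q.tail.tail.dif ω T (fun u => φ (vcons true (vcons false u))) u (around q m₁ m₂ κ b) =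
      ω.rt (around q m₁ m₂ κ b (Q.ov none false)) *
        φ (vcons false (vcons false u)) (around q m₁ m₂ κ b) := by
    intro u κ b hκ hab
    have := h2 (vcons true (vcons false u)) (around q m₁ m₂ κ b) (by
      rw [k.cons_iff, k.collapse.cons_iff (κ := κ) fun h hh => around_of_notMem _ _ hh]
      simp [around_m₁, around_m₂, around_of_notMem _ _ k.s₁_notMem,
        around_of_notMem _ _ k.s₂_notMem, around_of_notMem _ _ k.r₁_notMem,
        around_of_notMem _ _ k.r₂_notMem, ← k.qs, ← k.qr, ← hab, hκ])
    rw [dif_vcons, dif_vcons] at this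
    simp only [Bool.false_eq_true, if_false, if_true, sg_true, sg_false] at this
    linear_combination -this
  have hff : ∀ u κ, φ (vcons false (vcons false u)) κ ≠ 0 → κ s₁ = κ m₁ ∧ κ r₁ = κ m₁ ∧
      κ m₂ = κ m₁ := by
    intro u κ hne
    by_contra hc
    refine hne (h1.eq_zero ?_)
    rw [k.cons_iff]
    simp only [Bool.false_eq_true, if_false, if_true]
    rintro ⟨⟨a1, a2⟩, ⟨a3, a4⟩, -⟩
    exact hc ⟨by rw [a1, a3], a2, a3.symm⟩
  refine ⟨fun u κ => φ (vcons false (vcons true u)) (κ ∘ through q s₁ r₁ m₁ m₂) +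
      ((-if κ (q s₁) = κ (q r₁) then 1 else 0) *
          φ (vcons true (vcons false u)) (around q m₁ m₂ κ (κ (q s₁))) +
        (-if κ (q s₁) = κ (q r₁) then ω.rt (κ (q s₁)) / ω.rt (!κ (q s₁)) else 0) *
          φ (vcons true (vcons false u)) (around q m₁ m₂ κ (!κ (q s₁)))),
    fun u => ?_, fun u κ hκ => ?_, ?_⟩
  · have s : RootData.Saddle (Q.res (vcons false (vcons false u)))
        (Q.res (vcons false (vcons true u))) (Q.ov (some none) false) (Q.ov (some none) true) := by
      convert hQ.saddle (u := vcons false (vcons false u)) (i := some none) rfl using 2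
      ext (_ | _ | i) <;> simp
    have hd := k.death ht (h1 (vcons true (vcons false u))) le_rfl
    have hs := RootData.saddle_mem ht s hd
      (mu := lam - height (vcons false (vcons true u))) (by
        simp only [height_vcons]
        push_cast
        simp)
    have hg := Submodule.sub_mem _ (h1 (vcons false (vcons true u))) hs
    have := RootData.pull_mem (σ' := P.res u) (through q s₁ r₁ m₁ m₂) p
      (fun κ h => by
        rw [respects_res] at h ⊢
        exact k.cons_through.2 h)
      (fun κ' h => by
        rw [respects_res] at h ⊢
        exact (k.cons_through_iff.1 h).2)
      (fun κ _ h' => congrFun (k.through_pull κ) h')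
      (fun κ' h h' => by
        rw [respects_res] at h
        obtain ⟨⟨a, b, c, d⟩, -⟩ := k.cons_through_iff.1 h
        exact congrFun (k.eq_through a b c d) h') hg
    refine RootData.Lat_anti (lam := lam - height (vcons false (vcons true u))) ?_ ?_
    · simp only [height_vcons]
      push_cast
      simp
      linarith
    convert this using 1
    ext κ
    simp only [respects_res, Pi.sub_apply]
    by_cases hP : P.Cons u κ
    · rw [if_pos hP, if_pos (k.cons_through.2 hP), sub_eq_add_neg]
      congr 1
      by_cases hab : κ (q s₁) = κ (q r₁)
      · have hc : Q.Cons (vcons false (vcons false u)) (κ ∘ through q s₁ r₁ m₁ m₂) := by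
          rw [k.through_eq_around hab, k.cons_iff,
            k.collapse.cons_iff (κ := κ) fun h hh => around_of_notMem _ _ hh]
          simp [around_m₁, around_m₂, around_of_notMem _ _ k.s₁_notMem,
            around_of_notMem _ _ k.s₂_notMem, around_of_notMem _ _ k.r₁_notMem,
            around_of_notMem _ _ k.r₂_notMem, ← k.qs, ← k.qr, ← hab, hP]
        have e : ∀ b, recolor {m₁, m₂} (κ ∘ through q s₁ r₁ m₁ m₂) b = around q m₁ m₂ κ b := by
          intro b
          ext x
          by_cases hx : x ∈ ({m₁, m₂} : Set H')
          · rw [recolor_mem hx, around, recolor_mem hx]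
          · rw [recolor_notMem hx, around, recolor_notMem hx, Function.comp_apply,
              through_of_notMem hx, Function.comp_apply]
        have e2 : (κ ∘ through q s₁ r₁ m₁ m₂) ((Q.ov (some none) false)) = κ (q s₁) := by
          refine (k.ov₂ (κ := κ ∘ through q s₁ r₁ m₁ m₂) ?_).trans ?_
          · simp [through_m₁, through_of_notMem k.s₂_notMem, ← k.qs, hab]
          · simp [through_m₁, hab]
        have := ω.rt_ne (κ (q s₁))
        have := ω.rt_ne (!κ (q s₁))
        rw [if_pos hc, hsum _ (κ (q s₁)), e, e, e2, if_pos hab, if_pos hab]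
        field_simp
        ring
      · rw [if_neg hab, if_neg hab, if_neg]
        · simp
        · rw [k.cons_iff]
          simp [through_m₁, k.through_m₂, through_of_notMem k.s₁_notMem,
            through_of_notMem k.s₂_notMem, through_of_notMem k.r₁_notMem,
            through_of_notMem k.r₂_notMem, ← k.qs, ← k.qr, Ne.symm hab]
    · rw [if_neg hP, h1.eq_zero, h1.eq_zero, h1.eq_zero]
      · simp
      · rw [k.cons_iff, k.collapse.cons_iff (κ := κ) fun h hh => around_of_notMem _ _ hh]
        exact fun h => hP h.2.2
      · rw [k.cons_iff, k.collapse.cons_iff (κ := κ) fun h hh => around_of_notMem _ _ hh]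
        exact fun h => hP h.2.2
      · rwa [k.cons_through]
  · have d1 : P.dif ω T (fun u κ => φ (vcons false (vcons true u)) (κ ∘ through q s₁ r₁ m₁ m₂)) u κ =
        Q.tail.tail.dif ω T (fun u => φ (vcons false (vcons true u))) u
          (κ ∘ through q s₁ r₁ m₁ m₂) := by
      refine (dif_coeff 1 _ _ (fun u => (one_mul _).symm) fun _ i => ?_).trans (one_mul _)
      exact (k.collapse.ov_eq (fun h hh => by
          rw [Function.comp_apply, through_of_notMem hh]) i false).symm
    have d2 : ∀ (c : Bool → Bool → K) (b : Bool → Bool), P.dif ω T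
        (fun u κ => c (κ (q s₁)) (κ (q r₁)) * φ (vcons true (vcons false u))
          (around q m₁ m₂ κ (b (κ (q s₁))))) u κ =
        c (κ (q s₁)) (κ (q r₁)) * Q.tail.tail.dif ω T (fun u => φ (vcons true (vcons false u))) u
          (around q m₁ m₂ κ (b (κ (q s₁)))) := by
      intro c b
      exact dif_coeff _ _ _ (fun u => rfl) fun _ i =>
        (k.collapse.ov_eq (fun h hh => around_of_notMem _ _ hh) i false).symm
    rw [dif_add₃ (fun u κ => φ (vcons false (vcons true u)) (κ ∘ through q s₁ r₁ m₁ m₂))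
        (fun u κ => ((-if κ (q s₁) = κ (q r₁) then 1 else 0) *
          φ (vcons true (vcons false u)) (around q m₁ m₂ κ (κ (q s₁)))))
        (fun u κ => (-if κ (q s₁) = κ (q r₁) then ω.rt (κ (q s₁)) / ω.rt (!κ (q s₁)) else 0) *
          φ (vcons true (vcons false u)) (around q m₁ m₂ κ (!κ (q s₁)))),
      d1, d2 (fun x y => -if x = y then 1 else 0) (fun x => x),
      d2 (fun x y => -if x = y then ω.rt x / ω.rt (!x) else 0) (!·), hI u κ hκ]
    by_cases hab : κ (q s₁) = κ (q r₁)
    · rw [hE u κ _ hκ hab, hE u κ _ hκ hab, k.through_eq_around hab]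
      have e1 : φ (vcons false (vcons false u)) (around q m₁ m₂ κ (!κ (q s₁))) = 0 := by
        by_contra hne
        have := (hff _ _ hne).1
        rw [around_m₁, around_of_notMem _ _ k.s₁_notMem] at this
        simp at this
      have e2 : around q m₁ m₂ κ (κ (q s₁)) (Q.ov none false) = κ (q s₁) := by
        rw [k.ov₁ (κ := around q m₁ m₂ κ (κ (q s₁))), around_m₁]
        rw [around_m₁, around_of_notMem _ _ k.s₁_notMem]
      have e3 : around q m₁ m₂ κ (κ (q s₁)) (Q.tail.ov none false) = κ (q s₁) := by
        rw [k.ov₂ (κ := around q m₁ m₂ κ (κ (q s₁))), around_m₁]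
        rw [around_m₁, around_of_notMem _ _ k.s₂_notMem, k.qs]
      rw [e1, e2, e3, if_pos hab]
      ring
    · have e1 : φ (vcons false (vcons false u)) (κ ∘ through q s₁ r₁ m₁ m₂) = 0 := by
        by_contra hne
        have := hff _ _ hne
        simp only [Function.comp_apply, through_m₁, through_of_notMem k.s₁_notMem] at this
        exact hab this.1
      rw [e1, if_neg hab, if_neg hab]
      ring
  · obtain ⟨x, w, rfl⟩ := exists_vcons w
    obtain ⟨y, u, rfl⟩ := exists_vcons w
    rw [k.isLee_iff] at h3
    cases x <;> cases y <;>
      simp only [Bool.false_eq_true, Bool.true_eq_false, if_false, if_true] at h3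
    · obtain ⟨⟨a1, a2⟩, a3, ⟨a4, -⟩, -⟩ := h3
      exact absurd (a1.trans a4.symm) a3
    · obtain ⟨⟨a1, a2⟩, a3, ⟨a4, a5⟩, a6, a7⟩ := h3
      have hs := a1.trans a5
      have hr := a2.trans a4
      refine ⟨u, κ' ∘ p, (k.collapse.isLee_iff (k.compat hs hr)).1 a7, ?_⟩
      have e1 : (κ' ∘ p) (q s₁) = κ' s₁ := (k.compat hs hr _ k.s₁_notMem).symm
      have e2 : (κ' ∘ p) (q r₁) = κ' r₁ := (k.compat hs hr _ k.r₁_notMem).symm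
      have hne : ¬ (κ' ∘ p) (q s₁) = (κ' ∘ p) (q r₁) := by
        rw [e1, e2, a2]
        exact a3
      dsimp only
      rw [if_neg hne, if_neg hne, k.eq_through hs hr a2.symm a1.symm]
      simpa using h4
    · obtain ⟨⟨a1, a2⟩, a3, ⟨a4, a5⟩, a6, a7⟩ := h3
      have hs : κ' s₁ = κ' s₂ := by
        rw [Bool.eq_not_of_ne a3, Bool.eq_not_of_ne a6]
      have hr : κ' r₁ = κ' r₂ := by rw [← a1, ← a5, hs]
      have hP := (k.collapse.isLee_iff (k.compat hs hr)).1 a7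
      refine ⟨u, κ' ∘ p, hP, ?_⟩
      have e1 : (κ' ∘ p) (q s₁) = κ' s₁ := (k.compat hs hr _ k.s₁_notMem).symm
      have e2 : (κ' ∘ p) (q r₁) = κ' r₁ := (k.compat hs hr _ k.r₁_notMem).symm
      have hab : (κ' ∘ p) (q s₁) = (κ' ∘ p) (q r₁) := by
        rw [e1, e2, a1]
      have e3 : around q m₁ m₂ (κ' ∘ p) (!(κ' ∘ p) (q s₁)) = κ' := by
        rw [e1, ← Bool.eq_not_of_ne (Ne.symm a3)]
        exact k.eq_around hs hr a2
      dsimp only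
      rw [e3, if_pos hab, if_pos hab, k.through_eq_around hab]
      set a := (κ' ∘ p) (q s₁) with ha
      -- With the circle colored like the strands, the cycle condition at `(1, 1)` identifies the
      -- values at `(0, 1)` and `(1, 0)`. They cancel, and only the term with the opposite color of
      -- the circle remains.
      have hc := h2 (vcons true (vcons true u)) (around q m₁ m₂ (κ' ∘ p) a) (by
        rw [k.cons_iff, k.collapse.cons_iff (κ := κ' ∘ p) fun h hh => around_of_notMem _ _ hh]
        simp only [around_m₁, around_m₂, around_of_notMem _ _ k.s₁_notMem,
          around_of_notMem _ _ k.s₂_notMem, around_of_notMem _ _ k.r₁_notMem,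
          around_of_notMem _ _ k.r₂_notMem, ← k.qs, ← k.qr, ← hab, ← ha, hP.1]
        simp)
      rw [dif_vcons, dif_vcons, dif_eq_zero_of_isLee (P := Q.tail.tail)] at hc
      · rw [k.ov₁ (κ := around q m₁ m₂ (κ' ∘ p) a), k.ov₂ (κ := around q m₁ m₂ (κ' ∘ p) a),
          around_m₁] at hc
        · simp only [if_true, sg_true, mul_zero, add_zero] at hc
          have hn := ω.rt_ne a
          have : φ (vcons false (vcons true u)) (around q m₁ m₂ (κ' ∘ p) a) =
              φ (vcons true (vcons false u)) (around q m₁ m₂ (κ' ∘ p) a) := by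
            refine mul_left_cancel₀ hn ?_
            linear_combination hc
          rw [this]
          have : ω.rt a / ω.rt (!a) * φ (vcons true (vcons false u)) κ' ≠ 0 :=
            mul_ne_zero (div_ne_zero hn (ω.rt_ne _)) h4
          intro h0
          apply this
          linear_combination -h0
        · rw [around_m₁, around_of_notMem _ _ k.s₂_notMem, ← k.qs]
        · rw [around_m₁, around_of_notMem _ _ k.s₁_notMem]
      · intro v κ hv
        refine h1.eq_zero ?_
        rw [k.cons_iff]
        exact fun h => hv h.2.2
      · exact (k.collapse.isLee_iff fun h hh => around_of_notMem _ _ hh).2 hP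
    · obtain ⟨⟨a1, a2⟩, a3, ⟨a4, a5⟩, a6, -⟩ := h3
      exact absurd (a5.symm.trans a2.symm) a6

end Bigon

end Bigon

end PD

namespace PD

/-! ### Triangles -/

/-- The derivative along the cube at a fixed coloring. -/
def der {I H : Type*} [Fintype I] {K : Type*} [Field K] (Q : PD I H) (ω : RootData K)
    (T : I → I → Prop) (κ : H → Bool) (u : I → Bool) : ((I → Bool) → K) →ₗ[K] K where
  toFun g := ∑ i, if u i = true then
    sgn K T u i * (ω.rt (κ (Q.ov i false)) * g (Function.update u i false)) else 0
  map_add' g g' := by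
    rw [← Finset.sum_add_distrib]
    refine Finset.sum_congr rfl fun i _ => ?_
    split_ifs
    · simp only [Pi.add_apply]; ring
    · simp
  map_smul' c g := by
    rw [RingHom.id_apply, smul_eq_mul, Finset.mul_sum]
    refine Finset.sum_congr rfl fun i _ => ?_
    split_ifs
    · simp only [Pi.smul_apply, smul_eq_mul]; ring
    · simp

theorem dif_eq_der {I H : Type*} [Fintype I] {K : Type*} [Field K] (Q : PD I H) (ω : RootData K)
    (T : I → I → Prop) (φ : (I → Bool) → (H → Bool) → K) (u : I → Bool) (κ : H → Bool) :
    Q.dif ω T φ u κ = Q.der ω T κ u fun v => φ v κ := rfl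

theorem der_congr {I H : Type*} [Fintype I] {K : Type*} [Field K] {Q : PD I H} {ω : RootData K}
    {T : I → I → Prop} {κ κ' : H → Bool} (h : ∀ i, κ (Q.ov i false) = κ' (Q.ov i false))
    (u : I → Bool) : Q.der ω T κ u = Q.der ω T κ' u := by
  ext g
  simp only [der, LinearMap.coe_comp, LinearMap.coe_mk, AddHom.coe_mk, Function.comp_apply, h]

/-- The arcs at three crossings `x`, `y`, `z` that bound a triangle: the sides `t` (top strand, from
`x` to `y`), `m` (middle strand, from `x` to `z`), `b` (bottom strand, from `y` to `z`), and the
further ends of the strands. -/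
structure Arcs (H : Type*) where
  (t m b Tx Ty Mx Mz By Bz : H)

namespace Arcs

variable {H : Type*} (A : Arcs H)

/-- The arcs on the other side of the move. -/
def swap : Arcs H := ⟨A.t, A.m, A.b, A.Ty, A.Tx, A.Mz, A.Mx, A.Bz, A.By⟩

/-- The sides of the triangle are distinct from each other and from the further arcs. -/
structure Distinct : Prop where
  tm : A.t ≠ A.m
  tb : A.t ≠ A.b
  mb : A.m ≠ A.b
  Tx : A.Tx ≠ A.t ∧ A.Tx ≠ A.m ∧ A.Tx ≠ A.b
  Ty : A.Ty ≠ A.t ∧ A.Ty ≠ A.m ∧ A.Ty ≠ A.b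
  Mx : A.Mx ≠ A.t ∧ A.Mx ≠ A.m ∧ A.Mx ≠ A.b
  Mz : A.Mz ≠ A.t ∧ A.Mz ≠ A.m ∧ A.Mz ≠ A.b
  By : A.By ≠ A.t ∧ A.By ≠ A.m ∧ A.By ≠ A.b
  Bz : A.Bz ≠ A.t ∧ A.Bz ≠ A.m ∧ A.Bz ≠ A.b

/-- Changing the colors of the sides. -/
def fill (κ : H → Bool) (t m b : Bool) (h : H) : Bool :=
  if h = A.t then t else if h = A.m then m else if h = A.b then b else κ h

section Fill

variable {A} (κ : H → Bool) (t m b : Bool)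

theorem fill_t : A.fill κ t m b A.t = t := if_pos rfl

theorem fill_m (D : A.Distinct) : A.fill κ t m b A.m = m := by
  rw [fill, if_neg D.tm.symm, if_pos rfl]

theorem fill_b (D : A.Distinct) : A.fill κ t m b A.b = b := by
  rw [fill, if_neg D.tb.symm, if_neg D.mb.symm, if_pos rfl]

theorem fill_of_ne {h : H} (hh : h ≠ A.t ∧ h ≠ A.m ∧ h ≠ A.b) : A.fill κ t m b h = κ h := by
  rw [fill, if_neg hh.1, if_neg hh.2.1, if_neg hh.2.2]

theorem fill_fill (t' m' b' : Bool) : A.fill (A.fill κ t m b) t' m' b' = A.fill κ t' m' b' := by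
  ext h
  simp only [fill]
  split_ifs <;> rfl

theorem fill_eq {t m b : Bool} {κ : H → Bool} (ht : t = κ A.t) (hm : m = κ A.m) (hb : b = κ A.b) :
    A.fill κ t m b = κ := by
  ext h
  simp only [fill]
  split_ifs with h1 h2 h3
  · rw [h1, ht]
  · rw [h2, hm]
  · rw [h3, hb]
  · rfl

theorem recolor_eq_fill (c : Bool) :
    recolor {A.t, A.m, A.b} κ c = A.fill κ c c c := by
  ext h
  by_cases hh : h ∈ ({A.t, A.m, A.b} : Set H)
  · rw [recolor_mem hh, fill]
    rcases hh with rfl | rfl | rfl <;> simp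
  · rw [recolor_notMem hh]
    simp only [Set.mem_insert_iff, Set.mem_singleton_iff, not_or] at hh
    rw [fill_of_ne _ _ _ _ hh]

/-- The values of a changed coloring. -/
theorem fill_vals (D : A.Distinct) : A.fill κ t m b A.t = t ∧ A.fill κ t m b A.m = m ∧
    A.fill κ t m b A.b = b ∧ A.fill κ t m b A.Tx = κ A.Tx ∧ A.fill κ t m b A.Ty = κ A.Ty ∧
    A.fill κ t m b A.Mx = κ A.Mx ∧ A.fill κ t m b A.Mz = κ A.Mz ∧
    A.fill κ t m b A.By = κ A.By ∧ A.fill κ t m b A.Bz = κ A.Bz :=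
  ⟨fill_t _ _ _ _, fill_m _ _ _ _ D, fill_b _ _ _ _ D, fill_of_ne _ _ _ _ D.Tx,
    fill_of_ne _ _ _ _ D.Ty, fill_of_ne _ _ _ _ D.Mx, fill_of_ne _ _ _ _ D.Mz,
    fill_of_ne _ _ _ _ D.By, fill_of_ne _ _ _ _ D.Bz⟩

end Fill

/-- The coloring is compatible with the smoothings at the three crossings. -/
def Loc (a z x y : Bool) (κ : H → Bool) : Prop :=
  (if z = a then κ A.m = κ A.b ∧ κ A.Mz = κ A.Bz else κ A.m = κ A.Bz ∧ κ A.Mz = κ A.b) ∧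
  (if x = a then κ A.t = κ A.m ∧ κ A.Tx = κ A.Mx else κ A.Tx = κ A.m ∧ κ A.t = κ A.Mx) ∧
  (if y = (!a) then κ A.t = κ A.b ∧ κ A.Ty = κ A.By else κ A.t = κ A.By ∧ κ A.Ty = κ A.b)

end Arcs

/-- A vertex of the cube with three more crossings. -/
abbrev v3 {I : Type*} (z x y : Bool) (u : I → Bool) : Option (Option (Option I)) → Bool :=
  vcons z (vcons x (vcons y u))

/-- The first three crossings `z`, `x`, `y` of `P` bound a triangle with the arcs `A`, and `Q`
describes the further crossings. The smoothings that cut off the corner of the triangle are `a` at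
`x` and `z` and `!a` at `y`. -/
structure Triangle {I H : Type*} (P : PD (Option (Option (Option I))) H) (Q : PD I H) (A : Arcs H)
    (a : Bool) : Prop where
  tail : P.tail.tail.tail = Q
  avoids : Q.Avoids {A.t, A.m, A.b}
  distinct : A.Distinct
  smooth_z : ∀ v κ, P.Smooth v κ none ↔
    if v = a then κ A.m = κ A.b ∧ κ A.Mz = κ A.Bz else κ A.m = κ A.Bz ∧ κ A.Mz = κ A.b
  smooth_x : ∀ v κ, P.tail.Smooth v κ none ↔
    if v = a then κ A.t = κ A.m ∧ κ A.Tx = κ A.Mx else κ A.Tx = κ A.m ∧ κ A.t = κ A.Mx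
  smooth_y : ∀ v κ, P.tail.tail.Smooth v κ none ↔
    if v = (!a) then κ A.t = κ A.b ∧ κ A.Ty = κ A.By else κ A.t = κ A.By ∧ κ A.Ty = κ A.b
  strand_z : (P.ov none false = A.m ∧ P.ov none true = A.Mz) ∨
    (P.ov none false = A.Mz ∧ P.ov none true = A.m)
  strand_x : (P.tail.ov none false = A.Tx ∧ P.tail.ov none true = A.t) ∨
    (P.tail.ov none false = A.t ∧ P.tail.ov none true = A.Tx)
  strand_y : (P.tail.tail.ov none false = A.t ∧ P.tail.tail.ov none true = A.Ty) ∨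
    (P.tail.tail.ov none false = A.Ty ∧ P.tail.tail.ov none true = A.t)

namespace Triangle

variable {I H : Type*} {P : PD (Option (Option (Option I))) H} {Q : PD I H} {A : Arcs H} {a : Bool}

theorem cons_iff (k : P.Triangle Q A a) {z x y : Bool} {u : I → Bool} {κ : H → Bool} :
    P.Cons (v3 z x y u) κ ↔ A.Loc a z x y κ ∧ Q.Cons u κ := by
  rw [cons_vcons, cons_vcons, cons_vcons, k.smooth_z, k.smooth_x, k.smooth_y, k.tail, Arcs.Loc]
  tauto

theorem fill_congr (t m b : Bool) (κ : H → Bool) :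
    ∀ h, h ∉ ({A.t, A.m, A.b} : Set H) → A.fill κ t m b h = κ h := by
  intro h hh
  simp only [Set.mem_insert_iff, Set.mem_singleton_iff, not_or] at hh
  exact Arcs.fill_of_ne _ _ _ _ hh

theorem cons_fill (k : P.Triangle Q A a) {t m b : Bool} {u : I → Bool} {κ : H → Bool} :
    Q.Cons u (A.fill κ t m b) ↔ Q.Cons u κ :=
  k.avoids.cons_congr (fill_congr t m b κ)

theorem isLee_fill (k : P.Triangle Q A a) {t m b : Bool} {u : I → Bool} {κ : H → Bool} :
    Q.IsLee u (A.fill κ t m b) ↔ Q.IsLee u κ :=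
  k.avoids.isLee_congr (fill_congr t m b κ)

theorem isLee_iff (k : P.Triangle Q A a) {z x y : Bool} {u : I → Bool} {κ : H → Bool} :
    P.IsLee (v3 z x y u) κ ↔ A.Loc a z x y κ ∧ κ A.m ≠ κ A.Mz ∧ κ A.t ≠ κ A.Tx ∧ κ A.t ≠ κ A.Ty ∧
      Q.IsLee u κ := by
  rw [isLee_vcons, isLee_vcons, isLee_vcons, k.smooth_z, k.smooth_x, k.smooth_y, k.tail, Arcs.Loc]
  have h1 : κ (P.ov none false) ≠ κ (P.ov none true) ↔ κ A.m ≠ κ A.Mz := by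
    rcases k.strand_z with ⟨h1, h2⟩ | ⟨h1, h2⟩ <;> rw [h1, h2]
    exact ne_comm
  have h2 : κ (P.tail.ov none false) ≠ κ (P.tail.ov none true) ↔ κ A.t ≠ κ A.Tx := by
    rcases k.strand_x with ⟨h1, h2⟩ | ⟨h1, h2⟩ <;> rw [h1, h2]
    exact ne_comm
  have h3 : κ (P.tail.tail.ov none false) ≠ κ (P.tail.tail.ov none true) ↔ κ A.t ≠ κ A.Ty := by
    rcases k.strand_y with ⟨h1, h2⟩ | ⟨h1, h2⟩ <;> rw [h1, h2]
    exact ne_comm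
  rw [h1, h2, h3]
  tauto

/-- A coloring that fits both smoothings has one color at the crossing, so either end of the
over-strand may serve for the edge factor. -/
theorem loc_z {x y : Bool} {κ : H → Bool} (h0 : A.Loc a false x y κ) (h1 : A.Loc a true x y κ) :
    κ A.m = κ A.Mz := by
  have h0 := h0.1
  have h1 := h1.1
  cases a <;> simp at h0 h1 <;> grind

theorem loc_x {z y : Bool} {κ : H → Bool} (h0 : A.Loc a z false y κ) (h1 : A.Loc a z true y κ) :
    κ A.t = κ A.Tx := by
  have h0 := h0.2.1
  have h1 := h1.2.1
  cases a <;> simp at h0 h1 <;> grind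

theorem loc_y {z x : Bool} {κ : H → Bool} (h0 : A.Loc a z x false κ) (h1 : A.Loc a z x true κ) :
    κ A.t = κ A.Ty := by
  have h0 := h0.2.2
  have h1 := h1.2.2
  cases a <;> simp at h0 h1 <;> grind

theorem ov_z (k : P.Triangle Q A a) {κ : H → Bool} (h : κ A.m = κ A.Mz) :
    κ (P.ov none false) = κ A.m := by
  rcases k.strand_z with ⟨h1, -⟩ | ⟨h1, -⟩ <;> rw [h1]
  exact h.symm

theorem ov_x (k : P.Triangle Q A a) {κ : H → Bool} (h : κ A.t = κ A.Tx) :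
    κ (P.tail.ov none false) = κ A.t := by
  rcases k.strand_x with ⟨h1, -⟩ | ⟨h1, -⟩ <;> rw [h1]
  exact h.symm

theorem ov_y (k : P.Triangle Q A a) {κ : H → Bool} (h : κ A.t = κ A.Ty) :
    κ (P.tail.tail.ov none false) = κ A.t := by
  rcases k.strand_y with ⟨h1, -⟩ | ⟨h1, -⟩ <;> rw [h1]
  exact h.symm

variable [Fintype I] [Finite H] {K : Type*} [Field K] {ω : RootData K}
  {T : I → I → Prop} {F : Type*} [Field F] [Algebra F K] {t lam : ℝ}

theorem der_fill (k : P.Triangle Q A a) (t m b : Bool) (κ : H → Bool) (u : I → Bool) :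
    Q.der ω T (A.fill κ t m b) u = Q.der ω T κ u :=
  der_congr (fun i => fill_congr t m b κ _ (k.avoids.ov_notMem i false)) u

/-- The differential in terms of the colors of the sides. -/
theorem dif_eq (k : P.Triangle Q A a) {φ : (Option (Option (Option I)) → Bool) → (H → Bool) → K}
    (h0 : ∀ z x y u κ, ¬ A.Loc a z x y κ → φ (v3 z x y u) κ = 0) {z x y : Bool} {κ : H → Bool}
    (h : A.Loc a z x y κ) (u : I → Bool) :
    P.dif ω (optT (optT (optT T))) φ (v3 z x y u) κ =
      (if z = true then ω.rt (κ A.m) * φ (v3 false x y u) κ else 0) + sg K z *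
      ((if x = true then ω.rt (κ A.t) * φ (v3 z false y u) κ else 0) + sg K x *
      ((if y = true then ω.rt (κ A.t) * φ (v3 z x false u) κ else 0) + sg K y *
      Q.der ω T κ u fun v => φ (v3 z x y v) κ)) := by
  rw [dif_vcons, dif_vcons, dif_vcons, k.tail, dif_eq_der]
  congr 1
  · split_ifs with hz
    · subst hz
      by_cases h1 : A.Loc a false x y κ
      · rw [k.ov_z (loc_z h1 h)]
      · rw [h0 _ _ _ _ _ h1, mul_zero, mul_zero]
    · rfl
  congr 2
  · split_ifs with hz
    · subst hz
      by_cases h1 : A.Loc a z false y κ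
      · rw [k.ov_x (loc_x h1 h)]
      · rw [h0 _ _ _ _ _ h1, mul_zero, mul_zero]
    · rfl
  congr 2
  · split_ifs with hz
    · subst hz
      by_cases h1 : A.Loc a z x false κ
      · rw [k.ov_y (loc_y h1 h)]
      · rw [h0 _ _ _ _ _ h1, mul_zero, mul_zero]
    · rfl

theorem height_v3 (z x y : Bool) (u : I → Bool) :
    height (v3 z x y u) = z.toNat + (x.toNat + (y.toNat + height u)) := by
  rw [height_vcons, height_vcons, height_vcons]

theorem saddle_z_mem (ht : t ∈ Set.Icc (0 : ℝ) 2) (hP : P.Alternating) (k : P.Triangle Q A a)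
    {x y : Bool} {u : I → Bool} {g : (H → Bool) → K}
    (hg : g ∈ ω.Lat F t (P.res (v3 false x y u)) lam) {mu : ℝ} (hm : mu ≤ lam - 1) :
    (fun κ => if A.Loc a true x y κ then ω.rt (κ A.m) * g κ else 0) ∈
      ω.Lat F t (P.res (v3 true x y u)) mu := by
  have s : RootData.Saddle (P.res (v3 false x y u)) (P.res (v3 true x y u)) (P.ov none false)
      (P.ov none true) := by
    convert hP.saddle (u := v3 false x y u) (i := none) rfl using 2
    ext (_ | _ | _ | i) <;> simp
  convert RootData.saddle_mem ht s hg hm using 1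
  ext κ
  rw [respects_res, k.cons_iff]
  by_cases hc : P.Cons (v3 false x y u) κ
  · rw [k.cons_iff] at hc
    by_cases h : A.Loc a true x y κ
    · rw [if_pos h, if_pos ⟨h, hc.2⟩, k.ov_z (loc_z hc.1 h)]
    · rw [if_neg h, if_neg fun h' => h h'.1]
  · rw [RootData.eq_zero_of_not_respects hg (by rwa [respects_res])]
    simp

theorem saddle_x_mem (ht : t ∈ Set.Icc (0 : ℝ) 2) (hP : P.Alternating) (k : P.Triangle Q A a)
    {z y : Bool} {u : I → Bool} {g : (H → Bool) → K}
    (hg : g ∈ ω.Lat F t (P.res (v3 z false y u)) lam) {mu : ℝ} (hm : mu ≤ lam - 1) :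
    (fun κ => if A.Loc a z true y κ then ω.rt (κ A.t) * g κ else 0) ∈
      ω.Lat F t (P.res (v3 z true y u)) mu := by
  have s : RootData.Saddle (P.res (v3 z false y u)) (P.res (v3 z true y u))
      (P.tail.ov none false) (P.tail.ov none true) := by
    convert hP.saddle (u := v3 z false y u) (i := some none) rfl using 2
    · ext (_ | _ | _ | i) <;> simp
    · rfl
    · rfl
  convert RootData.saddle_mem ht s hg hm using 1
  ext κ
  rw [respects_res, k.cons_iff]
  by_cases hc : P.Cons (v3 z false y u) κ
  · rw [k.cons_iff] at hc
    by_cases h : A.Loc a z true y κ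
    · rw [if_pos h, if_pos ⟨h, hc.2⟩, k.ov_x (loc_x hc.1 h)]
    · rw [if_neg h, if_neg fun h' => h h'.1]
  · rw [RootData.eq_zero_of_not_respects hg (by rwa [respects_res])]
    simp

theorem saddle_y_mem (ht : t ∈ Set.Icc (0 : ℝ) 2) (hP : P.Alternating) (k : P.Triangle Q A a)
    {z x : Bool} {u : I → Bool} {g : (H → Bool) → K}
    (hg : g ∈ ω.Lat F t (P.res (v3 z x false u)) lam) {mu : ℝ} (hm : mu ≤ lam - 1) :
    (fun κ => if A.Loc a z x true κ then ω.rt (κ A.t) * g κ else 0) ∈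
      ω.Lat F t (P.res (v3 z x true u)) mu := by
  have s : RootData.Saddle (P.res (v3 z x false u)) (P.res (v3 z x true u))
      (P.tail.tail.ov none false) (P.tail.tail.ov none true) := by
    convert hP.saddle (u := v3 z x false u) (i := some (some none)) rfl using 2
    · ext (_ | _ | _ | i) <;> simp
    · rfl
    · rfl
  convert RootData.saddle_mem ht s hg hm using 1
  ext κ
  rw [respects_res, k.cons_iff]
  by_cases hc : P.Cons (v3 z x false u) κ
  · rw [k.cons_iff] at hc
    by_cases h : A.Loc a z x true κ
    · rw [if_pos h, if_pos ⟨h, hc.2⟩, k.ov_y (loc_y hc.1 h)]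
    · rw [if_neg h, if_neg fun h' => h h'.1]
  · rw [RootData.eq_zero_of_not_respects hg (by rwa [respects_res])]
    simp

/-- In the face `z = a` the first two crossings of the top strand form a bigon whose circle is the
closed triangle, at `x = a`, `y = !a`. At `x = y = true` the sides belong to the circle of the outer
arc `r`, from which they are cut off here. -/
theorem birth_mem (k : P.Triangle Q A a) {u : I → Bool} {g : (H → Bool) → K}
    (hg : g ∈ ω.Lat F t (P.res (v3 a true true u)) lam) {mu : ℝ} (hm : mu ≤ lam + 1) (r : H)
    (hr : r = if a = true then A.By else A.Mx) :
    (fun κ => if A.Loc a a a (!a) κ then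
      g (A.fill κ (κ r) (κ r) (κ r)) / ω.rt (κ A.m) else 0) ∈
      ω.Lat F t (P.res (v3 a a (!a) u)) mu := by
  have D := k.distinct
  have hr' : r ∉ ({A.t, A.m, A.b} : Set H) := by
    rw [hr]
    split_ifs
    · simpa using D.By
    · simpa using D.Mx
  have := birth_recolor (σ' := P.res (v3 a a (!a) u)) (N := {A.t, A.m, A.b}) (ℓ := A.m)
    (b₀ := r) (by simp) hr' ?_ ?_ ?_ ?_ hg hm
  · convert this using 1
    ext κ
    rw [respects_res, k.cons_iff, Arcs.recolor_eq_fill]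
    by_cases hc : Q.Cons u κ
    · simp [hc]
    · rw [RootData.eq_zero_of_not_respects hg]
      · simp
      · rw [respects_res, k.cons_iff, k.cons_fill]
        exact fun h => hc h.2
  all_goals simp only [respects_res, k.cons_iff, Arcs.recolor_eq_fill, k.cons_fill]
  · rintro κ ⟨h, h'⟩
    refine ⟨?_, h'⟩
    obtain ⟨e1, e2, e3, e4, e5, e6, e7, e8, e9⟩ := Arcs.fill_vals κ (κ r) (κ r) (κ r) D
    unfold Arcs.Loc at h ⊢
    rw [e1, e2, e3, e4, e5, e6, e7, e8, e9]
    cases a <;> simp at h hr ⊢ <;> subst hr <;> grind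
  · rintro κ c ⟨h, h'⟩
    refine ⟨?_, h'⟩
    obtain ⟨e1, e2, e3, e4, e5, e6, e7, e8, e9⟩ := Arcs.fill_vals κ c c c D
    unfold Arcs.Loc at h ⊢
    rw [e1, e2, e3, e4, e5, e6, e7, e8, e9]
    cases a <;> simp at h hr ⊢ <;> grind
  · rintro κ ⟨h, h'⟩
    unfold Arcs.Loc at h
    rintro h (rfl | rfl | rfl) <;> cases a <;> simp at h hr ⊢ <;> grind
  · rintro κ ⟨h, h'⟩
    unfold Arcs.Loc at h
    rintro h (rfl | rfl | rfl) <;> cases a <;> simp at h hr ⊢ <;> subst hr <;> grind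

theorem death_mem (ht : t ∈ Set.Icc (0 : ℝ) 2) (k : P.Triangle Q A a) {u : I → Bool}
    {g : (H → Bool) → K}
    (hg : g ∈ ω.Lat F t (P.res (v3 a a (!a) u)) lam) {mu : ℝ} (hm : mu ≤ lam + 1) :
    (fun κ => if A.Loc a a false false κ then ∑ c, g (A.fill κ c c c) / ω.rt c else 0) ∈
      ω.Lat F t (P.res (v3 a false false u)) mu := by
  have D := k.distinct
  -- The outer arc whose circle contains the sides of the triangle at `x = y = false`.
  obtain ⟨r, hr⟩ : ∃ r, r = if a = true then A.Tx else A.Ty := ⟨_, rfl⟩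
  have hr' : r ∉ ({A.t, A.m, A.b} : Set H) := by
    rw [hr]
    split_ifs
    · simpa using D.Tx
    · simpa using D.Ty
  have := death_recolor ht (σ := P.res (v3 a false false u)) (N := {A.t, A.m, A.b}) (ℓ := A.m)
    (b₀ := r) (by simp) hr' ?_ ?_ ?_ ?_ hg hm
  · convert this using 1
    ext κ
    rw [respects_res, k.cons_iff]
    simp only [Arcs.recolor_eq_fill]
    by_cases hc : Q.Cons u κ
    · simp [hc]
    · have : ∀ c, g (A.fill κ c c c) = 0 := fun c => by
        refine RootData.eq_zero_of_not_respects hg ?_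
        rw [respects_res, k.cons_iff, k.cons_fill]
        exact fun h => hc h.2
      simp [this]
  all_goals simp only [respects_res, k.cons_iff, Arcs.recolor_eq_fill, k.cons_fill]
  · rintro κ ⟨h, h'⟩
    refine ⟨?_, h'⟩
    obtain ⟨e1, e2, e3, e4, e5, e6, e7, e8, e9⟩ := Arcs.fill_vals κ (κ r) (κ r) (κ r) D
    unfold Arcs.Loc at h ⊢
    rw [e1, e2, e3, e4, e5, e6, e7, e8, e9]
    cases a <;> simp at h hr ⊢ <;> subst hr <;> grind
  · rintro κ c ⟨h, h'⟩
    refine ⟨?_, h'⟩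
    obtain ⟨e1, e2, e3, e4, e5, e6, e7, e8, e9⟩ := Arcs.fill_vals κ c c c D
    unfold Arcs.Loc at h ⊢
    rw [e1, e2, e3, e4, e5, e6, e7, e8, e9]
    cases a <;> simp at h hr ⊢ <;> grind
  · rintro κ ⟨h, h'⟩
    unfold Arcs.Loc at h
    rintro h (rfl | rfl | rfl) <;> cases a <;> simp at h hr ⊢ <;> grind
  · rintro κ ⟨h, h'⟩
    unfold Arcs.Loc at h
    rintro h (rfl | rfl | rfl) <;> cases a <;> simp at h hr ⊢ <;> subst hr <;> grind

end Triangle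

end PD

/-! ### Cancelling the closed triangle -/

namespace PD

theorem Arcs.loc_fill {H : Type*} {A : Arcs H} (D : A.Distinct) {a z x y t m b : Bool}
    {κ : H → Bool} : A.Loc a z x y (A.fill κ t m b) ↔
      (if z = a then m = b ∧ κ A.Mz = κ A.Bz else m = κ A.Bz ∧ κ A.Mz = b) ∧
      (if x = a then t = m ∧ κ A.Tx = κ A.Mx else κ A.Tx = m ∧ t = κ A.Mx) ∧
      (if y = (!a) then t = b ∧ κ A.Ty = κ A.By else t = κ A.By ∧ κ A.Ty = b) := by
  obtain ⟨e1, e2, e3, e4, e5, e6, e7, e8, e9⟩ := Arcs.fill_vals κ t m b D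
  rw [Arcs.Loc, e1, e2, e3, e4, e5, e6, e7, e8, e9]

/-- The coloring of the sides when `z` is not smoothed along the triangle. -/
def Arcs.ext {H : Type*} (A : Arcs H) (a x : Bool) (κ : H → Bool) : H → Bool :=
  A.fill κ (if x = a then κ A.Bz else κ A.Mx) (κ A.Bz) (κ A.Mz)

/-- The coloring of the sides when all three crossings are smoothed along the strands. -/
def Arcs.inner {H : Type*} (A : Arcs H) (κ : H → Bool) : H → Bool :=
  A.fill κ (κ A.Mx) (κ A.Tx) (κ A.Tx)

namespace Triangle

variable {I H : Type*} {P : PD (Option (Option (Option I))) H} {Q : PD I H} {A : Arcs H} {a : Bool}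
variable [Fintype I] [Finite H] {K : Type*} [Field K] {ω : RootData K}
  {T : I → I → Prop} {F : Type*} [Field F] [Algebra F K] {t lam : ℝ}

/-- Filtered cycles with respect to the first three crossings. -/
structure IsLocalCycle (P : PD (Option (Option (Option I))) H) (Q : PD I H) (A : Arcs H) (a : Bool)
    (ω : RootData K) (T : I → I → Prop) (F : Type*) [Field F] [Algebra F K] (t lam : ℝ)
    (Ψ : Bool → Bool → Bool → (I → Bool) → (H → Bool) → K) : Prop where
  mem : ∀ z x y u, Ψ z x y u ∈ ω.Lat F t (P.res (v3 z x y u)) (lam - height (v3 z x y u))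
  cycle : ∀ z x y u κ, A.Loc a z x y κ → Q.Cons u κ →
    (if z = true then ω.rt (κ A.m) * Ψ false x y u κ else 0) + sg K z *
      ((if x = true then ω.rt (κ A.t) * Ψ z false y u κ else 0) + sg K x *
      ((if y = true then ω.rt (κ A.t) * Ψ z x false u κ else 0) + sg K y *
      Q.der ω T κ u fun v => Ψ z x y v κ)) = 0

theorem IsLocalCycle.eq_zero (k : P.Triangle Q A a)
    {Ψ : Bool → Bool → Bool → (I → Bool) → (H → Bool) → K}
    (h : IsLocalCycle P Q A a ω T F t lam Ψ) {z x y : Bool} {u : I → Bool} {κ : H → Bool}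
    (hL : ¬ (A.Loc a z x y κ ∧ Q.Cons u κ)) : Ψ z x y u κ = 0 :=
  RootData.eq_zero_of_not_respects (h.mem z x y u) (by rwa [respects_res, k.cons_iff])

theorem good_iff (k : P.Triangle Q A a) : P.Good ω (optT (optT (optT T))) F t lam ↔
    ∃ Ψ, IsLocalCycle P Q A a ω T F t lam Ψ ∧
      ∃ z x y u κ, P.IsLee (v3 z x y u) κ ∧ Ψ z x y u κ ≠ 0 := by
  constructor
  · rintro ⟨φ, h1, h2, w, κ, h3, h4⟩
    refine ⟨fun z x y u κ => φ (v3 z x y u) κ, ⟨fun z x y u => h1 _, fun z x y u κ hL hc => ?_⟩, ?_⟩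
    · have h0 : ∀ (z x y : Bool) (u : I → Bool) (κ : H → Bool), ¬ A.Loc a z x y κ →
          φ (v3 z x y u) κ = 0 := fun z x y u κ hn => h1.eq_zero fun h => hn (k.cons_iff.1 h).1
      have := h2 (v3 z x y u) κ (k.cons_iff.2 ⟨hL, hc⟩)
      rwa [k.dif_eq h0 hL] at this
    · obtain ⟨z, w, rfl⟩ := exists_vcons w
      obtain ⟨x, w, rfl⟩ := exists_vcons w
      obtain ⟨y, u, rfl⟩ := exists_vcons w
      exact ⟨z, x, y, u, κ, h3, h4⟩
  · rintro ⟨Ψ, h, z, x, y, u, κ, h3, h4⟩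
    refine ⟨fun w κ => Ψ (w none) (w (some none)) (w (some (some none)))
      (fun i => w (some (some (some i)))) κ, fun w => ?_, fun w κ hκ => ?_, v3 z x y u, κ, h3, h4⟩
    · obtain ⟨z, w, rfl⟩ := exists_vcons w
      obtain ⟨x, w, rfl⟩ := exists_vcons w
      obtain ⟨y, u, rfl⟩ := exists_vcons w
      exact h.mem z x y u
    · obtain ⟨z, w, rfl⟩ := exists_vcons w
      obtain ⟨x, w, rfl⟩ := exists_vcons w
      obtain ⟨y, u, rfl⟩ := exists_vcons w
      rw [k.cons_iff] at hκ
      rw [k.dif_eq _ hκ.1]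
      · exact h.cycle z x y u κ hκ.1 hκ.2
      · exact fun z x y u κ hL => h.eq_zero k fun h' => hL h'.1

/-- The data that remain of a cycle after cancelling the resolutions with a closed triangle. -/
structure Reduced (P : PD (Option (Option (Option I))) H) (Q : PD I H) (A : Arcs H) (a : Bool)
    (ω : RootData K) (T : I → I → Prop) (F : Type*) [Field F] [Algebra F K] (t lam : ℝ)
    (s : (I → Bool) → (H → Bool) → K) (χ : Bool → Bool → (I → Bool) → (H → Bool) → K) : Prop where
  s_mem : ∀ u, s u ∈ ω.Lat F t (P.res (v3 a (!a) a u)) (lam - height (v3 a (!a) a u))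
  χ_mem : ∀ x y u, χ x y u ∈ ω.Lat F t (P.res (v3 (!a) x y u)) (lam - height (v3 (!a) x y u))
  -- The saddle at `z` leads from `z = 0` to `z = 1`. For `a = false` the reduced face with `s` is
  -- its source, so `s` appears as a term in the face of `χ`. For `a = true` it is the target, and
  -- the coupling appears in `side`.
  face : ∀ x y u κ, A.Loc a (!a) x y κ → Q.Cons u κ →
    (if x = true then ω.rt (κ A.t) * χ false y u κ else 0) + sg K x *
      ((if y = true then ω.rt (κ A.t) * χ x false u κ else 0) + sg K y *
      Q.der ω T κ u fun v => χ x y v κ) =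
    if a = false ∧ x ≠ y then ω.rt (κ A.Tx) * s u (A.inner κ) else 0
  side : ∀ u κ, A.Loc a a (!a) a κ → Q.Cons u κ → (Q.der ω T κ u fun v => s v κ) +
    (if a = true then ω.rt (κ A.Tx) *
      (χ false true u (A.ext a false κ) - χ true false u (A.ext a true κ)) else 0) = 0
  -- In the face `z = a` Lee colorings occur only at the resolution of `s` and at the closed
  -- triangle. The second alternative covers both: the colors of `Tx` and `t` differ in the former
  -- case and agree in the latter. For `a = true` the value at the closed triangle is governed by
  -- the difference of `s` and `χ`.
  lee : (∃ x y u κ, P.IsLee (v3 (!a) x y u) κ ∧ χ x y u κ ≠ 0) ∨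
    ∃ u κ, A.Loc a a (!a) a κ ∧ Q.IsLee u κ ∧ κ A.Mz = κ A.t ∧
      s u κ - (if a = true then χ true true u (A.ext a true κ) else 0) ≠ 0

namespace Reduced

variable {s : (I → Bool) → (H → Bool) → K} {χ : Bool → Bool → (I → Bool) → (H → Bool) → K}

theorem s_eq_zero (k : P.Triangle Q A a) (h : Reduced P Q A a ω T F t lam s χ) {u : I → Bool}
    {κ : H → Bool} (hL : ¬ (A.Loc a a (!a) a κ ∧ Q.Cons u κ)) : s u κ = 0 :=
  RootData.eq_zero_of_not_respects (h.s_mem u) (by rwa [respects_res, k.cons_iff])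

theorem χ_eq_zero (k : P.Triangle Q A a) (h : Reduced P Q A a ω T F t lam s χ) {x y : Bool}
    {u : I → Bool} {κ : H → Bool} (hL : ¬ (A.Loc a (!a) x y κ ∧ Q.Cons u κ)) : χ x y u κ = 0 :=
  RootData.eq_zero_of_not_respects (h.χ_mem x y u) (by rwa [respects_res, k.cons_iff])

end Reduced

theorem der_eq_zero (Q : PD I H) {κ : H → Bool} {u : I → Bool} (g : (I → Bool) → K)
    (h : ∀ v, g v = 0) : Q.der ω T κ u g = 0 := by
  rw [show g = 0 from funext h, map_zero]

theorem der_eq (Q : PD I H) {κ : H → Bool} {u : I → Bool} (c : K) (f g : (I → Bool) → K)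
    (h : ∀ v, g v = c * f v) : Q.der ω T κ u g = c * Q.der ω T κ u f := by
  rw [show g = c • f from funext h, map_smul, smul_eq_mul]

theorem der_eq₂ (Q : PD I H) {κ : H → Bool} {u : I → Bool} (c₁ c₂ : K) (f₁ f₂ g : (I → Bool) → K)
    (h : ∀ v, g v = c₁ * f₁ v + c₂ * f₂ v) :
    Q.der ω T κ u g = c₁ * Q.der ω T κ u f₁ + c₂ * Q.der ω T κ u f₂ := by
  rw [show g = c₁ • f₁ + c₂ • f₂ from funext h, map_add, map_smul, map_smul, smul_eq_mul, smul_eq_mul]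

theorem der_eq₃ (Q : PD I H) {κ : H → Bool} {u : I → Bool} (c₁ c₂ c₃ : K)
    (f₁ f₂ f₃ g : (I → Bool) → K) (h : ∀ v, g v = c₁ * f₁ v + c₂ * f₂ v + c₃ * f₃ v) :
    Q.der ω T κ u g =
      c₁ * Q.der ω T κ u f₁ + c₂ * Q.der ω T κ u f₂ + c₃ * Q.der ω T κ u f₃ := by
  rw [show g = c₁ • f₁ + c₂ • f₂ + c₃ • f₃ from funext h, map_add, map_add, map_smul, map_smul,
    map_smul, smul_eq_mul, smul_eq_mul, smul_eq_mul]

theorem der_eq_zero_of_isLee {Q : PD I H} {κ : H → Bool} {u : I → Bool}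
    (f : (I → Bool) → (H → Bool) → K) (h0 : ∀ v κ, ¬ Q.Cons v κ → f v κ = 0)
    (h : Q.IsLee u κ) : (Q.der ω T κ u fun v => f v κ) = 0 := by
  rw [← dif_eq_der]
  exact dif_eq_zero_of_isLee h0 h

/-- The face `z = 1` is the target of the saddle at `z`. Besides `s`, two components are added there
so that the cycle conditions hold: `ψO` at `(1, 0, 0)`, the death of what `χ` sends to the closed
triangle, and `ψE` at the closed triangle `(1, 1, 0)`, the birth of the difference of what arrives
at `(1, 1, 1)`. -/
theorem Reduced.good_of_true (ht : t ∈ Set.Icc (0 : ℝ) 2) (hP : P.Alternating)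
    (k : P.Triangle Q A true) {s : (I → Bool) → (H → Bool) → K}
    {χ : Bool → Bool → (I → Bool) → (H → Bool) → K}
    (h : Reduced P Q A true ω T F t lam s χ) : P.Good ω (optT (optT (optT T))) F t lam := by
  have D := k.distinct
  have hs0 : ∀ u κ, ¬ A.Loc true true false true κ → s u κ = 0 := fun u κ hn =>
    h.s_eq_zero k fun h' => hn h'.1
  have hχ0 : ∀ x y u κ, ¬ A.Loc true false x y κ → χ x y u κ = 0 := fun x y u κ hn =>
    h.χ_eq_zero k fun h' => hn h'.1
  have hrt := ω.rt_sq_true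
  have hrf := ω.rt_ne false
  have hrt' := ω.rt_ne true
  let ψO : (I → Bool) → (H → Bool) → K := fun u κ => if A.Loc true true false false κ then
    ∑ c, (if A.Loc true true true false (A.fill κ c c c) then
      ω.rt (A.fill κ c c c A.m) * χ true false u (A.fill κ c c c) else 0) / ω.rt c else 0
  let ψE : (I → Bool) → (H → Bool) → K := fun u κ => if A.Loc true true true false κ then
    ((if A.Loc true true true true (A.fill κ (κ A.By) (κ A.By) (κ A.By)) then
      ω.rt (A.fill κ (κ A.By) (κ A.By) (κ A.By) A.t) * s u (A.fill κ (κ A.By) (κ A.By) (κ A.By))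
        else 0) -
    (if A.Loc true true true true (A.fill κ (κ A.By) (κ A.By) (κ A.By)) then
      ω.rt (A.fill κ (κ A.By) (κ A.By) (κ A.By) A.m) *
        χ true true u (A.fill κ (κ A.By) (κ A.By) (κ A.By)) else 0)) / ω.rt (κ A.m) else 0
  have hO : ∀ u κ, ψO u κ = if A.Loc true true false false κ then
      χ true false u (A.fill κ true true true) + χ true false u (A.fill κ false false false)
      else 0 := by
    intro u κ
    refine if_congr Iff.rfl ?_ rfl
    rw [Fintype.sum_bool]
    have : ∀ c, (if A.Loc true true true false (A.fill κ c c c) then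
      ω.rt (A.fill κ c c c A.m) * χ true false u (A.fill κ c c c) else 0) / ω.rt c =
        χ true false u (A.fill κ c c c) := by
      intro c
      have := ω.rt_ne c
      split_ifs with hE
      · rw [Arcs.fill_m _ _ _ _ D]
        field_simp
      · rw [hχ0, zero_div]
        rw [Arcs.loc_fill D] at hE ⊢
        simp at hE ⊢
        grind
    rw [this, this]
  have hE : ∀ u κ, A.Loc true true true false κ → ψE u κ = ω.rt (κ A.By) / ω.rt (κ A.m) *
      (s u (A.fill κ (κ A.By) (κ A.By) (κ A.By)) -
        χ true true u (A.fill κ (κ A.By) (κ A.By) (κ A.By))) := by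
    intro u κ hL
    have : A.Loc true true true true (A.fill κ (κ A.By) (κ A.By) (κ A.By)) := by
      rw [Arcs.loc_fill D]
      simp [Arcs.Loc] at hL ⊢
      grind
    simp only [ψE]
    rw [if_pos hL, if_pos this, if_pos this, Arcs.fill_m _ _ _ _ D, Arcs.fill_t]
    ring
  rw [k.good_iff]
  refine ⟨fun z x y => if z = false then χ x y else if x = false then (if y = false then ψO else s)
    else if y = false then ψE else 0, ⟨fun z x y u => ?_, fun z x y u κ hL hQ => ?_⟩, ?_⟩
  · cases z
    · exact h.χ_mem x y u
    · cases x <;> cases y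
      · refine k.death_mem ht (k.saddle_z_mem ht hP (h.χ_mem true false u) le_rfl) ?_
        simp only [height_v3]
        push_cast
        simp
      · exact h.s_mem u
      · refine k.birth_mem (Submodule.sub_mem _ (k.saddle_x_mem ht hP (h.s_mem u) le_rfl)
          (RootData.Lat_anti ?_ (k.saddle_z_mem ht hP (h.χ_mem true true u) le_rfl))) ?_ A.By rfl
        · simp only [height_v3]
          push_cast
          simp
        · simp only [height_v3]
          push_cast
          simp
      · exact Submodule.zero_mem _
  · cases z
    · have := h.face x y u κ hL hQ
      simpa using this
    -- In the face `z = 0` the side `m` is joined to `Bz`, so filling the triangle uniformly with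
    -- the other color leaves the support of `χ`.
    · have hdB : ∀ x y d, d ≠ κ A.Bz → ∀ v, χ x y v (A.fill κ d d d) = 0 := by
        intro x y d hd v
        refine hχ0 _ _ _ _ fun h' => hd ?_
        rw [Arcs.loc_fill D] at h'
        simpa using h'.1.1
      obtain ⟨p, hp⟩ : ∃ p, p = κ A.Tx := ⟨_, rfl⟩
      obtain ⟨q, hq⟩ : ∃ q, q = κ A.By := ⟨_, rfl⟩
      obtain ⟨μ, hμ⟩ : ∃ μ, μ = κ A.Mz := ⟨_, rfl⟩
      obtain ⟨c, hc⟩ : ∃ c, c = κ A.m := ⟨_, rfl⟩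
      have hL' := hL
      cases x <;> cases y <;> simp [Arcs.Loc] at hL'
      · obtain ⟨⟨l1, l2⟩, ⟨l3, l4⟩, l5, l6⟩ := hL'
        have e1 : ∀ d, (Q.der ω T κ u fun v => χ true false v (A.fill κ d d d)) =
            ω.rt d * χ false false u (A.fill κ d d d) := by
          intro d
          by_cases hd : d = κ A.Bz
          · have := h.face true false u (A.fill κ d d d) (by
              rw [Arcs.loc_fill D]; simp; grind) (k.cons_fill.2 hQ)
            rw [k.der_fill, Arcs.fill_t] at this
            simp at this
            linear_combination -this
          · rw [hdB _ _ _ hd, der_eq_zero _ _ (hdB _ _ _ hd), mul_zero]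
        have e2 := der_eq₂ (ω := ω) (T := T) Q (κ := κ) (u := u) 1 1
          (fun v => χ true false v (A.fill κ true true true))
          (fun v => χ true false v (A.fill κ false false false)) (fun v => ψO v κ)
          (fun v => by rw [hO, if_pos hL]; ring)
        have e3 : ∀ d, d ≠ p → χ false false u (A.fill κ d d d) = 0 := by
          intro d hd
          refine hχ0 _ _ _ _ fun h' => hd ?_
          rw [Arcs.loc_fill D] at h'
          simp at h'
          grind
        have e4 : A.fill κ p p p = κ := Arcs.fill_eq (by grind) (by grind) (by grind)
        simp only [if_true, if_false, Bool.false_eq_true, Bool.true_eq_false, sg_true, sg_false, e2, e1, ← hc]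
        rw [show c = p by grind]
        cases p
        · rw [e3 true (by simp), e4]; ring
        · rw [e3 false (by simp), e4]; ring
      · obtain ⟨⟨l1, l2⟩, ⟨l3, l4⟩, l5, l6⟩ := hL'
        have e1 := h.side u κ hL hQ
        have e2 : χ false true u (A.ext true false κ) = χ false true u κ := by
          by_cases hd : κ A.Tx = κ A.Bz
          · rw [Arcs.ext, Arcs.fill_eq] <;> grind
          · rw [hχ0, hχ0]
            · simp [Arcs.Loc]; grind
            · rw [Arcs.ext, Arcs.loc_fill D]; simp; grind
        have e3 : ω.rt (κ A.t) * ψO u κ = ω.rt (κ A.Tx) * χ true false u (A.ext true true κ) := by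
          rw [hO]
          have e4 : A.ext true true κ = A.fill κ (κ A.Bz) (κ A.Bz) (κ A.Bz) := by
            rw [Arcs.ext, l2]; simp
          by_cases hd : κ A.Tx = κ A.t
          · rw [if_pos, hd, e4]
            · cases hB : κ A.Bz
              · rw [hdB _ _ true (by simp [hB]), zero_add]
              · rw [hdB _ _ false (by simp [hB]), add_zero]
            · simp [Arcs.Loc]; grind
          · rw [if_neg, hχ0]
            · simp
            · rw [e4, Arcs.loc_fill D]; simp; grind
            · simp [Arcs.Loc]; grind
        simp only [if_true, if_false, Bool.false_eq_true, Bool.true_eq_false, sg_true, sg_false, e3]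
        simp only [if_true, e2] at e1
        rw [← l3]
        linear_combination e1
      · obtain ⟨⟨l1, l2⟩, ⟨l3, l4⟩, l5, l6⟩ := hL'
        have e1 := der_eq₂ (ω := ω) (T := T) Q (κ := κ) (u := u) (ω.rt q / ω.rt c)
          (-(ω.rt q / ω.rt c)) (fun v => s v (A.fill κ q q q))
          (fun v => χ true true v (A.fill κ q q q)) (fun v => ψE v κ)
          (fun v => by rw [hE _ _ hL, hq, hc]; ring)
        have e2 : (Q.der ω T κ u fun v => s v (A.fill κ q q q)) = if p = q then
            - (ω.rt p * (χ false true u (A.fill κ p μ μ) - χ true false u (A.fill κ μ μ μ))) else 0 := by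
          split_ifs with hd
          · have := h.side u (A.fill κ q q q) (by rw [Arcs.loc_fill D]; simp; grind)
              (k.cons_fill.2 hQ)
            obtain ⟨f1, f2, f3, f4, f5, f6, f7, f8, f9⟩ := Arcs.fill_vals κ q q q D
            rw [k.der_fill, Arcs.ext, Arcs.ext, Arcs.fill_fill, Arcs.fill_fill, f4, f6, f7, f9] at this
            simp only [if_true, Bool.false_eq_true, if_false, ← l2, ← l4, ← hp, ← hμ] at this
            linear_combination this
          · refine der_eq_zero _ _ fun v => hs0 _ _ ?_
            rw [Arcs.loc_fill D]; simp; grind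
        have e3 : (Q.der ω T κ u fun v => χ true true v (A.fill κ q q q)) = if q = μ then
            ω.rt q * χ true false u (A.fill κ q q q) - ω.rt q * χ false true u (A.fill κ q q q)
            else 0 := by
          split_ifs with hd
          · have := h.face true true u (A.fill κ q q q) (by rw [Arcs.loc_fill D]; simp; grind)
              (k.cons_fill.2 hQ)
            rw [k.der_fill, Arcs.fill_t] at this
            simp at this
            linear_combination this
          · exact der_eq_zero _ _ (hdB _ _ _ (by grind))
        have e4 : ψO u κ = if c = p then χ true false u (A.fill κ μ μ μ) else 0 := by
          rw [hO]
          refine if_congr ?_ ?_ rfl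
          · simp [Arcs.Loc]; grind
          · cases hB : μ
            · rw [hdB _ _ true (by grind), zero_add]
            · rw [hdB _ _ false (by grind), add_zero]
        have e5 : A.fill κ c c c = κ := Arcs.fill_eq (by grind) (by grind) (by grind)
        have e6 : c ≠ μ → χ true false u κ = 0 := by
          intro hd
          rw [← e5]
          exact hdB _ _ _ (by grind) _
        have e7 : p ≠ μ → χ false true u (A.fill κ p μ μ) = 0 := by
          intro hd
          refine hχ0 _ _ _ _ ?_
          rw [Arcs.loc_fill D]; simp; grind
        have e8 : p ≠ q → χ false true u (A.fill κ q q q) = 0 := by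
          intro hd
          refine hχ0 _ _ _ _ ?_
          rw [Arcs.loc_fill D]; simp; grind
        simp only [if_true, if_false, Bool.false_eq_true, Bool.true_eq_false, sg_true, sg_false, e1,
          e2, e3, e4, ← hc, ← l3.trans hc.symm]
        have e9 : c = μ → χ true false u κ = χ true false u (A.fill κ μ μ μ) := by
          rintro rfl
          rw [e5]
        clear_value ψO ψE
        clear e1 e2 e3 e4 hO hE
        have l3' : κ A.t = c := by grind
        rw [l3']
        clear l1 l2 l3 l4 l5 l6 hL hs0 hχ0 hdB e5
        -- What remains is one identity in `K` for each choice of the colors of `Tx`, `By`, `Mz` and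
        -- the triangle; the supports `e6` to `e8` remove the unwanted terms.
        cases p <;> cases q <;> cases μ <;> cases c <;> simp at e6 e7 e8 e9 ⊢ <;>
          simp only [e6, e7, e8, e9] <;> try field_simp
        all_goals grind
      · obtain ⟨⟨l1, l2⟩, ⟨l3, l4⟩, l5, l6⟩ := hL'
        have e1 : A.fill κ (κ A.By) (κ A.By) (κ A.By) = κ :=
          Arcs.fill_eq (by grind) (by grind) (by grind)
        have e2 : A.Loc true true true false κ := by simp [Arcs.Loc]; grind
        have e3 := hE u κ e2
        rw [e1] at e3
        have e4 := ω.rt_ne (κ A.m)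
        have e5 := der_eq_zero (ω := ω) (T := T) Q (κ := κ) (u := u)
          (fun v => (0 : (I → Bool) → (H → Bool) → K) v κ) fun _ => rfl
        simp only [if_true, if_false, Bool.true_eq_false, sg_true, e3, e5]
        rw [← l5, l3]
        field_simp
        ring
  · rcases h.lee with ⟨x, y, u, κ, h1, h2⟩ | ⟨u, κ, h1, h2, h3, h4⟩
    · exact ⟨false, x, y, u, κ, h1, h2⟩
    · have h1' := h1
      simp [Arcs.Loc] at h1'
      obtain ⟨⟨l1, l2⟩, ⟨l3, l4⟩, l5, l6⟩ := h1'
      simp only [if_true] at h4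
      -- If these agree, all outer ends have one color, and the Lee coloring is the closed triangle
      -- with the opposite color. Otherwise `κ` itself is a Lee coloring at the resolution of `s`.
      by_cases hd : κ A.Tx = κ A.t
      · obtain ⟨f1, f2, f3, f4, f5, f6, f7, f8, f9⟩ :=
          Arcs.fill_vals κ (!κ A.Tx) (!κ A.Tx) (!κ A.Tx) D
        have hL : A.Loc true true true false (A.fill κ (!κ A.Tx) (!κ A.Tx) (!κ A.Tx)) := by
          rw [Arcs.loc_fill D]; simp; grind
        refine ⟨true, true, false, u, A.fill κ (!κ A.Tx) (!κ A.Tx) (!κ A.Tx), ?_, ?_⟩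
        · rw [k.isLee_iff, k.isLee_fill, f1, f2, f4, f5, f7]
          refine ⟨hL, ?_, ?_, ?_, h2⟩ <;> grind
        · simp only [if_true, Bool.true_eq_false, if_false]
          rw [hE _ _ hL, f8, f2, Arcs.fill_fill, Arcs.fill_eq]
          · refine mul_ne_zero (div_ne_zero (ω.rt_ne _) (ω.rt_ne _)) ?_
            rwa [Arcs.ext, Arcs.fill_eq] at h4 <;> grind
          all_goals grind
      · refine ⟨true, false, true, u, κ, ?_, ?_⟩
        · rw [k.isLee_iff]
          refine ⟨h1, ?_, ?_, ?_, h2⟩ <;> grind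
        · rw [hχ0 true true u (A.ext true true κ), sub_zero] at h4
          · exact h4
          · rw [Arcs.ext, Arcs.loc_fill D]; simp; grind

/-- The face `z = 0` is now the source. As for a bigon, `s` is completed at the closed triangle `(0,
0, 1)` by the birth after its saddle to `(0, 1, 1)`; the couplings in `face` say that `χ` absorbs
the image of this under the saddle at `z`. -/
theorem Reduced.good_of_false (ht : t ∈ Set.Icc (0 : ℝ) 2) (hP : P.Alternating)
    (k : P.Triangle Q A false) {s : (I → Bool) → (H → Bool) → K}
    {χ : Bool → Bool → (I → Bool) → (H → Bool) → K}
    (h : Reduced P Q A false ω T F t lam s χ) : P.Good ω (optT (optT (optT T))) F t lam := by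
  have D := k.distinct
  have hs0 : ∀ u κ, ¬ A.Loc false false true false κ → s u κ = 0 := fun u κ hn =>
    h.s_eq_zero k fun h' => hn h'.1
  let ψE : (I → Bool) → (H → Bool) → K := fun u κ => if A.Loc false false false true κ then
    (if A.Loc false false true true (A.fill κ (κ A.Mx) (κ A.Mx) (κ A.Mx)) then
      ω.rt (A.fill κ (κ A.Mx) (κ A.Mx) (κ A.Mx) A.t) * s u (A.fill κ (κ A.Mx) (κ A.Mx) (κ A.Mx))
        else 0) / ω.rt (κ A.m) else 0
  have hE : ∀ u κ, A.Loc false false false true κ → ψE u κ = ω.rt (κ A.Mx) / ω.rt (κ A.m) *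
      s u (A.fill κ (κ A.Mx) (κ A.Mx) (κ A.Mx)) := by
    intro u κ hL
    have : A.Loc false false true true (A.fill κ (κ A.Mx) (κ A.Mx) (κ A.Mx)) := by
      rw [Arcs.loc_fill D]
      simp [Arcs.Loc] at hL ⊢
      grind
    simp only [ψE]
    rw [if_pos hL, if_pos this, Arcs.fill_t]
    ring
  have hd0 : ∀ (κ : H → Bool) (u : I → Bool), (Q.der ω T κ u fun v =>
      (0 : (I → Bool) → (H → Bool) → K) v κ) = 0 := fun κ u => der_eq_zero _ _ fun _ => rfl
  rw [k.good_iff]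
  refine ⟨fun z x y => if z = true then χ x y else if x = true then (if y = true then 0 else s)
    else if y = true then ψE else 0, ⟨fun z x y u => ?_, fun z x y u κ hL hQ => ?_⟩, ?_⟩
  · cases z
    · cases x <;> cases y
      · exact Submodule.zero_mem _
      · refine k.birth_mem (k.saddle_y_mem ht hP (h.s_mem u) le_rfl) ?_ A.Mx rfl
        simp only [height_v3]
        push_cast
        simp
      · exact h.s_mem u
      · exact Submodule.zero_mem _
    · exact h.χ_mem x y u
  · cases z
    · have hL' := hL
      cases x <;> cases y <;> simp [Arcs.Loc] at hL'
      · have := hd0 κ u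
        simp only [Pi.zero_apply] at this
        simp [this]
      · obtain ⟨⟨l1, l2⟩, ⟨l3, l4⟩, l5, l6⟩ := hL'
        have e1 := der_eq (ω := ω) (T := T) Q (κ := κ) (u := u) (ω.rt (κ A.Mx) / ω.rt (κ A.m))
          (fun v => s v (A.fill κ (κ A.Mx) (κ A.Mx) (κ A.Mx))) (fun v => ψE v κ)
          (fun v => by rw [hE _ _ hL])
        have e2 : (Q.der ω T κ u fun v => s v (A.fill κ (κ A.Mx) (κ A.Mx) (κ A.Mx))) = 0 := by
          by_cases hd : A.Loc false false true false (A.fill κ (κ A.Mx) (κ A.Mx) (κ A.Mx))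
          · have := h.side u _ hd (k.cons_fill.2 hQ)
            rw [k.der_fill] at this
            simpa using this
          · exact der_eq_zero _ _ fun v => hs0 _ _ hd
        simp [e1, e2]
      · have := h.side u κ hL hQ
        simp at this
        simp [this]
      · obtain ⟨⟨l1, l2⟩, ⟨l3, l4⟩, l5, l6⟩ := hL'
        have e1 : A.fill κ (κ A.Mx) (κ A.Mx) (κ A.Mx) = κ :=
          Arcs.fill_eq (by grind) (by grind) (by grind)
        have e3 := hE u κ (by simp [Arcs.Loc]; grind)
        have e4 := ω.rt_ne (κ A.m)
        rw [e1] at e3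
        simp only [Bool.false_eq_true, if_false, if_true, sg_true, sg_false, hd0, e3]
        rw [show κ A.Mx = κ A.m by grind]
        field_simp
        ring
    · have hf := h.face x y u κ hL hQ
      have hL' := hL
      cases x <;> cases y <;> simp [Arcs.Loc] at hL' hf
      · simp [hf]
      · obtain ⟨⟨l1, l2⟩, ⟨l3, l4⟩, l5, l6⟩ := hL'
        have e1 : A.inner κ = A.fill κ (κ A.Mx) (κ A.Mx) (κ A.Mx) := by
          rw [Arcs.inner, l4]
        have e3 := hE u κ (by simp [Arcs.Loc]; grind)
        have e4 := ω.rt_ne (κ A.m)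
        rw [e1, l4] at hf
        simp only [Bool.false_eq_true, if_false, if_true, sg_true, sg_false, e3]
        field_simp
        linear_combination - hf
      · obtain ⟨⟨l1, l2⟩, ⟨l3, l4⟩, l5, l6⟩ := hL'
        have e1 : s u (A.inner κ) = s u κ := by
          by_cases hd : κ A.Tx = κ A.Mz
          · rw [Arcs.inner, Arcs.fill_eq] <;> grind
          · rw [hs0, hs0]
            · simp [Arcs.Loc]; grind
            · rw [Arcs.inner, Arcs.loc_fill D]; simp; grind
        rw [e1, l3] at hf
        simp only [Bool.false_eq_true, if_false, if_true, sg_true, sg_false]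
        linear_combination - hf
      · simp
        linear_combination - hf
  · rcases h.lee with ⟨x, y, u, κ, h1, h2⟩ | ⟨u, κ, h1, h2, h3, h4⟩
    · exact ⟨true, x, y, u, κ, h1, h2⟩
    · have h1' := h1
      simp [Arcs.Loc] at h1'
      obtain ⟨⟨l1, l2⟩, ⟨l3, l4⟩, l5, l6⟩ := h1'
      simp at h4
      by_cases hd : κ A.Tx = κ A.t
      · obtain ⟨f1, f2, f3, f4, f5, f6, f7, f8, f9⟩ :=
          Arcs.fill_vals κ (!κ A.Tx) (!κ A.Tx) (!κ A.Tx) D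
        have hL : A.Loc false false false true (A.fill κ (!κ A.Tx) (!κ A.Tx) (!κ A.Tx)) := by
          rw [Arcs.loc_fill D]; simp; grind
        refine ⟨false, false, true, u, A.fill κ (!κ A.Tx) (!κ A.Tx) (!κ A.Tx), ?_, ?_⟩
        · rw [k.isLee_iff, k.isLee_fill, f1, f2, f4, f5, f7]
          refine ⟨hL, ?_, ?_, ?_, h2⟩ <;> grind
        · simp only [if_true, Bool.false_eq_true, if_false]
          rw [hE _ _ hL, f6, f2, Arcs.fill_fill, Arcs.fill_eq]
          · exact mul_ne_zero (div_ne_zero (ω.rt_ne _) (ω.rt_ne _)) h4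
          all_goals grind
      · refine ⟨false, true, false, u, κ, ?_, by simpa using h4⟩
        rw [k.isLee_iff]
        refine ⟨h1, ?_, ?_, ?_, h2⟩ <;> grind

/-- The cancellation of the closed triangle. -/
theorem exists_reduced_of_true (ht : t ∈ Set.Icc (0 : ℝ) 2) (hP : P.Alternating)
    (k : P.Triangle Q A true) (h : P.Good ω (optT (optT (optT T))) F t lam) :
    ∃ s χ, Reduced P Q A true ω T F t lam s χ := by
  have D := k.distinct
  obtain ⟨Ψ, h, hlee⟩ := k.good_iff.1 h
  have h0 : ∀ z x y u κ, ¬ A.Loc true z x y κ → Ψ z x y u κ = 0 := fun z x y u κ hn =>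
    h.eq_zero k fun h' => hn h'.1
  have hsum : ∀ (f : Bool → K) (a : Bool), ∑ b, f b = f a + f (!a) := by
    intro f a
    cases a <;> simp [add_comm]
  -- The projection for the bigon in the face `z = 1`: the component at the closed triangle is
  -- subtracted after its death and the saddle at `y`. The source face `z = 0` is left unchanged.
  let s : (I → Bool) → (H → Bool) → K := fun u κ => Ψ true false true u κ -
    if A.Loc true true false true κ then ω.rt (κ A.t) *
      (if A.Loc true true false false κ then
        ∑ c, Ψ true true false u (A.fill κ c c c) / ω.rt c else 0) else 0
  have hs : ∀ u κ, A.Loc true true false true κ → s u κ = Ψ true false true u κ -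
      (if κ A.Tx = κ A.t then 1 else 0) * (Ψ true true false u (A.fill κ (κ A.t) (κ A.t) (κ A.t)) +
        ω.rt (κ A.t) / ω.rt (!κ A.t) *
          Ψ true true false u (A.fill κ (!κ A.t) (!κ A.t) (!κ A.t))) := by
    intro u κ hL
    have e1 := ω.rt_ne (κ A.t)
    simp only [s]
    rw [if_pos hL, hsum _ (κ A.t)]
    congr 1
    simp [Arcs.Loc] at hL
    split_ifs with h1 h2 h2
    · field_simp
    · simp [Arcs.Loc] at h1; grind
    · exact absurd (by simp [Arcs.Loc]; grind) h1
    · simp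
  refine ⟨s, fun x y => Ψ false x y, fun u => ?_, fun x y u => h.mem _ _ _ _,
    fun x y u κ hL hQ => ?_, fun u κ hL hQ => ?_, ?_⟩
  · refine Submodule.sub_mem _ (h.mem _ _ _ _) (k.saddle_y_mem ht hP
      (k.death_mem ht (h.mem true true false u) le_rfl) ?_)
    simp only [height_v3]
    push_cast
    simp
  · simpa using h.cycle false x y u κ hL hQ
  · have hL' := hL
    simp [Arcs.Loc] at hL'
    obtain ⟨⟨l1, l2⟩, ⟨l3, l4⟩, l5, l6⟩ := hL'
    have e1 := der_eq₃ (ω := ω) (T := T) Q (κ := κ) (u := u) 1 (-(if κ A.Tx = κ A.t then 1 else 0))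
      (-(if κ A.Tx = κ A.t then 1 else 0) * (ω.rt (κ A.t) / ω.rt (!κ A.t)))
      (fun v => Ψ true false true v κ)
      (fun v => Ψ true true false v (A.fill κ (κ A.t) (κ A.t) (κ A.t)))
      (fun v => Ψ true true false v (A.fill κ (!κ A.t) (!κ A.t) (!κ A.t)))
      (fun v => s v κ) (fun v => by rw [hs _ _ hL]; ring)
    have e2 := h.cycle true false true u κ hL hQ
    have e3 : Ψ false false true u κ = Ψ false false true u (A.ext true false κ) := by
      by_cases hd : κ A.Tx = κ A.Bz
      · rw [Arcs.ext, Arcs.fill_eq] <;> grind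
      · rw [h0, h0]
        · rw [Arcs.ext, Arcs.loc_fill D]; simp; grind
        · simp [Arcs.Loc]; grind
    rw [e3] at e2
    rw [e1]
    simp only [if_true, Bool.false_eq_true, if_false, sg_true, sg_false] at e2 ⊢
    rw [← l3] at e2
    by_cases hd : κ A.Tx = κ A.t
    · have e4 : ∀ c, (Q.der ω T κ u fun v => Ψ true true false v (A.fill κ c c c)) =
          ω.rt c * (Ψ true false false u (A.fill κ c c c) - Ψ false true false u (A.fill κ c c c)) := by
        intro c
        have := h.cycle true true false u (A.fill κ c c c) (by rw [Arcs.loc_fill D]; simp; grind)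
          (k.cons_fill.2 hQ)
        rw [k.der_fill, Arcs.fill_t, Arcs.fill_m _ _ _ _ D] at this
        simp at this
        linear_combination this
      have e5 : ∀ c, c ≠ κ A.Bz → Ψ false true false u (A.fill κ c c c) = 0 := by
        intro c hc
        refine h0 _ _ _ _ _ fun h' => hc ?_
        rw [Arcs.loc_fill D] at h'
        simpa using h'.1.1
      have e6 : Ψ true false false u (A.fill κ (!κ A.t) (!κ A.t) (!κ A.t)) = 0 := by
        refine h0 _ _ _ _ _ ?_
        rw [Arcs.loc_fill D]; simp; grind
      have e7 : A.fill κ (κ A.t) (κ A.t) (κ A.t) = κ :=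
        Arcs.fill_eq (by grind) (by grind) (by grind)
      have e8 : A.ext true true κ = A.fill κ (κ A.Bz) (κ A.Bz) (κ A.Bz) := by
        rw [Arcs.ext, l2]; simp
      have e9 := ω.rt_ne (!κ A.t)
      rw [e4, e4, e6, e8, if_pos hd, e7, hd]
      rw [hd] at e2
      by_cases hB : κ A.Bz = κ A.t
      · rw [e5 (!κ A.t) (by grind), hB, e7]
        field_simp
        linear_combination e2
      · have hB' : κ A.Bz = !κ A.t := Bool.eq_not_of_ne hB
        have := e5 (κ A.t) (Ne.symm hB)
        rw [e7] at this
        rw [this, hB']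
        field_simp
        linear_combination e2
    · rw [if_neg hd, h0 false true false u (A.ext true true κ)]
      · rw [h0 true false false] at e2
        · linear_combination e2
        · simp [Arcs.Loc]; grind
      · rw [Arcs.ext, Arcs.loc_fill D]; simp; grind
  · obtain ⟨z, x, y, u, κ, h1, h2⟩ := hlee
    cases z
    · exact Or.inl ⟨x, y, u, κ, h1, h2⟩
    · right
      rw [k.isLee_iff] at h1
      obtain ⟨h1, h3, h4, h5, h6⟩ := h1
      have hL' := h1
      cases x <;> cases y <;> simp [Arcs.Loc] at hL'
      · grind
      · refine ⟨u, κ, h1, h6, ?_, ?_⟩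
        · rw [Bool.eq_not_of_ne (Ne.symm h3), ← hL'.2.1.1, Bool.eq_not_of_ne h4]
        rw [hs _ _ h1, if_neg (by grind), if_pos rfl, h0 false true true]
        · simpa using h2
        · rw [Arcs.ext, Arcs.loc_fill D]; simp; grind
      · obtain ⟨f1, f2, f3, f4, f5, f6, f7, f8, f9⟩ :=
          Arcs.fill_vals κ (!κ A.t) (!κ A.t) (!κ A.t) D
        have hL : A.Loc true true false true (A.fill κ (!κ A.t) (!κ A.t) (!κ A.t)) := by
          rw [Arcs.loc_fill D]; simp; grind
        refine ⟨u, A.fill κ (!κ A.t) (!κ A.t) (!κ A.t), hL, k.isLee_fill.2 h6, by grind, ?_⟩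
        -- With the triangle colored like its surroundings, the cycle condition at `(1, 1, 1)`
        -- eliminates all values except the one at the closed triangle with its original color.
        have hc := h.cycle true true true u (A.fill κ (!κ A.t) (!κ A.t) (!κ A.t))
          (by rw [Arcs.loc_fill D]; simp; grind) (k.cons_fill.2 h6.1)
        rw [der_eq_zero_of_isLee _ _ (k.isLee_fill.2 h6)] at hc
        · have e1 : A.ext true true (A.fill κ (!κ A.t) (!κ A.t) (!κ A.t)) =
              A.fill κ (!κ A.t) (!κ A.t) (!κ A.t) := by
            rw [Arcs.ext, Arcs.fill_eq] <;> grind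
          have e2 : A.fill κ (κ A.t) (κ A.t) (κ A.t) = κ :=
            Arcs.fill_eq (by grind) (by grind) (by grind)
          rw [hs _ _ hL, if_pos (by grind), if_pos rfl, e1, f1, Arcs.fill_fill, Arcs.fill_fill,
            Bool.not_not, e2]
          rw [f1, f2] at hc
          have e3 := ω.rt_ne (!κ A.t)
          have e4 := ω.rt_ne (κ A.t)
          simp only [if_true, sg_true] at hc
          intro h7
          refine mul_ne_zero (div_ne_zero e3 e4) h2 ?_
          refine mul_left_cancel₀ e3 ?_
          linear_combination - ω.rt (!κ A.t) * h7 - hc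
        · exact fun v κ hv => h.eq_zero k fun h' => hv h'.2
      · grind

-- The closed triangle now lies in the source of the saddle at `z`, so cancelling it changes the
-- other face as well. The correction `corr` is this saddle applied to the contraction of the
-- cancelled part, which consists of the death from `(0, 0, 1)` to `(0, 0, 0)` and the birth from
-- `(0, 1, 1)` to `(0, 0, 1)`.
set_option maxHeartbeats 1000000 in
theorem exists_reduced_of_false (ht : t ∈ Set.Icc (0 : ℝ) 2) (hP : P.Alternating)
    (k : P.Triangle Q A false) (h : P.Good ω (optT (optT (optT T))) F t lam) :
    ∃ s χ, Reduced P Q A false ω T F t lam s χ := by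
  have D := k.distinct
  obtain ⟨Ψ, h, hlee⟩ := k.good_iff.1 h
  have h0 : ∀ z x y u κ, ¬ A.Loc false z x y κ → Ψ z x y u κ = 0 := fun z x y u κ hn =>
    h.eq_zero k fun h' => hn h'.1
  have hsum : ∀ (f : Bool → K) (a : Bool), ∑ b, f b = f a + f (!a) := by
    intro f a
    cases a <;> simp [add_comm]
  -- The death of the closed triangle followed by a saddle, written as a sum over the color of the
  -- triangle. It enters both `s` and `corr`.
  let Γ : (I → Bool) → (H → Bool) → K := fun u κ =>
    Ψ false false true u (A.fill κ (κ A.t) (κ A.t) (κ A.t)) + ω.rt (κ A.t) / ω.rt (!κ A.t) *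
      Ψ false false true u (A.fill κ (!κ A.t) (!κ A.t) (!κ A.t))
  have hΓ : ∀ u κ, ω.rt (κ A.t) * ∑ c, Ψ false false true u (A.fill κ c c c) / ω.rt c = Γ u κ := by
    intro u κ
    have := ω.rt_ne (κ A.t)
    rw [hsum _ (κ A.t)]
    simp only [Γ]
    field_simp
  let s : (I → Bool) → (H → Bool) → K := fun u κ => Ψ false true false u κ -
    if A.Loc false false true false κ then ω.rt (κ A.t) *
      (if A.Loc false false false false κ then
        ∑ c, Ψ false false true u (A.fill κ c c c) / ω.rt c else 0) else 0
  let corr : Bool → Bool → (I → Bool) → (H → Bool) → K := fun x y u κ =>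
    if x = true then 0 else if y = true then
      (if A.Loc false true false true κ then ω.rt (κ A.m) * (if A.Loc false false false true κ then
        Ψ false true true u (A.fill κ (κ A.Mx) (κ A.Mx) (κ A.Mx)) / ω.rt (κ A.m) else 0) else 0)
    else (if A.Loc false true false false κ then ω.rt (κ A.m) *
      (if A.Loc false false false false κ then
        ∑ c, Ψ false false true u (A.fill κ c c c) / ω.rt c else 0) else 0)
  have hs : ∀ u κ, A.Loc false false true false κ → s u κ = Ψ false true false u κ -
      (if κ A.Tx = κ A.t then 1 else 0) * Γ u κ := by
    intro u κ hL
    simp only [s]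
    rw [if_pos hL, ← hΓ]
    congr 1
    simp [Arcs.Loc] at hL
    split_ifs with h1 h2 h2
    · rw [one_mul]
    · simp [Arcs.Loc] at h1; grind
    · exact absurd (by simp [Arcs.Loc]; grind) h1
    · simp
  have hs0 : ∀ u κ, ¬ A.Loc false false true false κ → s u κ = 0 := by
    intro u κ hL
    simp only [s]
    rw [if_neg hL, h0 _ _ _ _ _ hL, sub_zero]
  have hc00 : ∀ u κ, A.Loc false true false false κ →
      corr false false u κ = (if κ A.Mz = κ A.t then 1 else 0) * Γ u κ := by
    intro u κ hL
    simp only [corr]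
    rw [if_neg (by simp), if_neg (by simp), if_pos hL, ← hΓ]
    simp [Arcs.Loc] at hL
    split_ifs with h1 h2 h2
    · rw [one_mul, hL.2.1.1]
    · simp [Arcs.Loc] at h1; grind
    · exact absurd (by simp [Arcs.Loc]; grind) h1
    · simp
  have hc01 : ∀ u κ, A.Loc false true false true κ → corr false true u κ =
      Ψ false true true u (A.fill κ (κ A.Mx) (κ A.Mx) (κ A.Mx)) := by
    intro u κ hL
    have := ω.rt_ne (κ A.m)
    simp only [corr, Bool.false_eq_true, if_false, if_true]
    rw [if_pos hL, if_pos]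
    · field_simp
    · simp [Arcs.Loc] at hL ⊢; grind
  have hc1 : ∀ y u κ, corr true y u κ = 0 := fun y u κ => if_pos rfl
  have hc0 : ∀ y u κ, ¬ A.Loc false true false y κ → corr false y u κ = 0 := by
    intro y u κ hL
    cases y <;> simp [corr, hL]
  have hO0 : ∀ (u : I → Bool) (κ : H → Bool) (c : Bool), c ≠ κ A.By →
      Ψ false false false u (A.fill κ c c c) = 0 := by
    intro u κ c hc
    refine h0 _ _ _ _ _ fun h' => hc ?_
    rw [Arcs.loc_fill D] at h'
    simp at h'
    exact h'.2.2.1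
  have hdΓ : ∀ u κ, Q.Cons u κ → κ A.Mz = κ A.Bz → κ A.Tx = κ A.Mx → κ A.Ty = κ A.By →
      κ A.t = κ A.By → (Q.der ω T κ u fun v => Γ v κ) =
        ω.rt (κ A.t) * Ψ false false false u (A.fill κ (κ A.t) (κ A.t) (κ A.t)) := by
    intro u κ hQ l1 l2 l3 l4
    have e1 : ∀ c, (Q.der ω T κ u fun v => Ψ false false true v (A.fill κ c c c)) =
        ω.rt c * Ψ false false false u (A.fill κ c c c) := by
      intro c
      have := h.cycle false false true u (A.fill κ c c c) (by rw [Arcs.loc_fill D]; simp; grind)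
        (k.cons_fill.2 hQ)
      rw [k.der_fill, Arcs.fill_t] at this
      simp at this
      linear_combination - this
    rw [der_eq₂ Q 1 (ω.rt (κ A.t) / ω.rt (!κ A.t)) _ _ (fun v => Γ v κ)
      (fun v => by rw [one_mul]), e1, e1, hO0 _ _ (!κ A.t) (by rw [l4]; simp)]
    ring
  refine ⟨s, fun x y u κ => Ψ true x y u κ - corr x y u κ, fun u => ?_, fun x y u => ?_,
    fun x y u κ hL hQ => ?_, fun u κ hL hQ => ?_, ?_⟩
  · refine Submodule.sub_mem _ (h.mem _ _ _ _) (k.saddle_x_mem ht hP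
      (k.death_mem ht (h.mem false false true u) le_rfl) ?_)
    simp only [height_v3]
    push_cast
    simp
  · refine Submodule.sub_mem _ (h.mem _ _ _ _) ?_
    cases x
    · cases y
      · refine k.saddle_z_mem ht hP (k.death_mem ht (h.mem false false true u) le_rfl) ?_
        simp only [height_v3]
        push_cast
        simp
      · refine k.saddle_z_mem ht hP (k.birth_mem (h.mem false true true u) le_rfl A.Mx rfl) ?_
        simp only [height_v3]
        push_cast
        simp
    · exact Submodule.zero_mem _
  · have hL' := hL
    have hc := h.cycle true x y u κ hL hQ
    cases x <;> cases y <;> simp [Arcs.Loc] at hL' <;>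
      simp only [Bool.false_eq_true, if_false, if_true, sg_true, sg_false, ne_eq,
        not_true, not_false_eq_true, and_false, true_and, Bool.true_eq_false] at hc ⊢ <;>
      obtain ⟨⟨l1, l2⟩, ⟨l3, l4⟩, l5, l6⟩ := hL'
    · have e1 := der_eq₂ (ω := ω) (T := T) Q (κ := κ) (u := u) 1 (-(if κ A.Mz = κ A.t then 1 else 0))
        (fun v => Ψ true false false v κ) (fun v => Γ v κ)
        (fun v => Ψ true false false v κ - corr false false v κ)
        (fun v => by rw [hc00 _ _ hL]; ring)
      rw [e1]
      by_cases hd : κ A.Mz = κ A.t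
      · rw [if_pos hd, hdΓ _ _ hQ (by grind) (by grind) (by grind) (by grind), Arcs.fill_eq rfl l3
          (by grind), l3]
        linear_combination - hc
      · rw [if_neg hd]
        rw [h0 false false false] at hc
        · linear_combination - hc
        · simp [Arcs.Loc]; grind
    · obtain ⟨p, hp⟩ : ∃ p, p = κ A.Mx := ⟨_, rfl⟩
      obtain ⟨q, hq⟩ : ∃ q, q = κ A.By := ⟨_, rfl⟩
      obtain ⟨c, hc'⟩ : ∃ c, c = κ A.t := ⟨_, rfl⟩
      have e1 := der_eq₂ (ω := ω) (T := T) Q (κ := κ) (u := u) 1 (-1)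
        (fun v => Ψ true false true v κ) (fun v => Ψ false true true v (A.fill κ p p p))
        (fun v => Ψ true false true v κ - corr false true v κ)
        (fun v => by rw [hc01 _ _ hL, hp]; ring)
      have e2 := h.cycle false true true u (A.fill κ p p p)
        (by rw [Arcs.loc_fill D]; simp; grind) (k.cons_fill.2 hQ)
      rw [k.der_fill, Arcs.fill_t] at e2
      simp only [Bool.false_eq_true, if_false, if_true, sg_true, sg_false] at e2
      have e3 : A.fill κ c c c = κ := Arcs.fill_eq (by grind) (by grind) (by grind)
      have e4 : A.inner κ = A.fill κ p p p := by rw [Arcs.inner, l4, hp]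
      have e5 : Ψ true false false u κ - corr false false u κ = if c = q then
          Ψ true false false u κ - (Ψ false false true u κ + ω.rt c / ω.rt (!c) *
            Ψ false false true u (A.fill κ (!c) (!c) (!c))) else 0 := by
        split_ifs with hd
        · rw [hc00 _ _ (by simp [Arcs.Loc]; grind), if_pos (by grind), one_mul]
          simp only [Γ, ← hc', e3]
        · rw [h0, hc0]
          · simp
          · simp [Arcs.Loc]; grind
          · simp [Arcs.Loc]; grind
      have e6 : c ≠ q → Ψ true false false u κ = 0 := fun hd => by
        rw [h0]; simp [Arcs.Loc]; grind
      have e7 : s u (A.fill κ p p p) = if p = q then Ψ false true false u (A.fill κ p p p) -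
          (Ψ false false true u (A.fill κ p p p) + ω.rt p / ω.rt (!p) *
            Ψ false false true u (A.fill κ (!p) (!p) (!p))) else 0 := by
        split_ifs with hd
        · rw [hs _ _ (by rw [Arcs.loc_fill D]; simp; grind), if_pos, one_mul]
          · simp only [Γ, Arcs.fill_t, Arcs.fill_fill]
          · rw [Arcs.fill_t, Arcs.fill_of_ne _ _ _ _ D.Tx, l4, hp]
        · rw [hs0]
          rw [Arcs.loc_fill D]; simp; grind
      have e8 : p ≠ q → Ψ false true false u (A.fill κ p p p) = 0 := fun hd => by
        rw [h0]; rw [Arcs.loc_fill D]; simp; grind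
      have e9 : Ψ false false true u κ = Ψ false false true u (A.fill κ c c c) := by rw [e3]
      have hrt := ω.rt_sq_true
      have hrf := ω.rt_ne false
      have hrt' := ω.rt_ne true
      rw [e1, e4, e5, e7]
      rw [← l3, ← hc'] at hc
      rw [l4, ← hp, ← hc']
      clear e1 e4 e5 e7 hc00 hc01 hc1 hc0 hO0 hdΓ hs hs0 hΓ hL e3
      clear_value Γ s corr
      rw [e9] at hc ⊢
      generalize Ψ true false true = X1 at *
      generalize (Q.der ω T κ u fun v => X1 v κ) = X2 at *
      generalize (Q.der ω T κ u fun v => Ψ false true true v (A.fill κ p p p)) = X3 at *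
      have hX2 : X2 = ω.rt c * Ψ true false false u κ -
        ω.rt c * Ψ false false true u (A.fill κ c c c) := by linear_combination hc
      have hX3 : X3 = ω.rt p * Ψ false true false u (A.fill κ p p p) -
        ω.rt p * Ψ false false true u (A.fill κ p p p) := by linear_combination e2
      rw [hX2, hX3]
      clear hc e2 hX2 hX3 e9
      -- After both cycle conditions have been solved for the derivatives, the claim is an identity
      -- for each choice of three colors.
      cases p <;> cases q <;> cases c <;> simp at e6 e8 ⊢ <;>
        (try simp only [e6, e8]) <;> try field_simp
      all_goals grind
    · have e1 : (Q.der ω T κ u fun v => Ψ true true false v κ - corr true false v κ) =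
          Q.der ω T κ u fun v => Ψ true true false v κ := by simp only [hc1, sub_zero]
      rw [e1]
      have e2 : Ψ true false false u κ - corr false false u κ = if κ A.Tx = κ A.t then
          Ψ true false false u κ - (if κ A.Mz = κ A.t then 1 else 0) * Γ u κ else 0 := by
        split_ifs with hd
        all_goals try rw [hc00 _ _ (by simp [Arcs.Loc]; grind)]
        · rw [if_pos (by assumption)]
        · rw [if_neg (by assumption)]
        · rw [h0, hc0, sub_zero]
          · simp [Arcs.Loc]; grind
          · simp [Arcs.Loc]; grind
      have e3 : s u (A.inner κ) = if κ A.Mz = κ A.Tx then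
          Ψ false true false u κ - (if κ A.Tx = κ A.t then 1 else 0) * Γ u κ else 0 := by
        by_cases hd : κ A.Mz = κ A.Tx
        · rw [if_pos hd, Arcs.inner, Arcs.fill_eq, hs] <;> try grind
          simp [Arcs.Loc]; grind
        · rw [if_neg hd, hs0]
          rw [Arcs.inner, Arcs.loc_fill D]; simp; grind
      rw [e2, e3]
      by_cases hd : κ A.Tx = κ A.t
      · by_cases hd' : κ A.Mz = κ A.Tx
        · rw [if_pos hd, if_pos hd', if_pos hd, if_pos (hd'.trans hd)]
          rw [← l3, hd] at hc
          rw [hd]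
          linear_combination - hc
        · rw [if_pos hd, if_neg hd', if_neg (by rwa [← hd])]
          rw [h0 false] at hc
          · linear_combination - hc
          · simp [Arcs.Loc]; grind
      · rw [h0 true false] at hc
        · by_cases hd' : κ A.Mz = κ A.Tx
          · rw [if_neg hd, if_pos hd', if_neg hd, l3]
            linear_combination - hc
          · rw [if_neg hd, if_neg hd']
            rw [h0 false] at hc
            · linear_combination - hc
            · simp [Arcs.Loc]; grind
        · simp [Arcs.Loc]; grind
    · have e1 : (Q.der ω T κ u fun v => Ψ true true true v κ - corr true true v κ) =
          Q.der ω T κ u fun v => Ψ true true true v κ := by simp only [hc1, sub_zero]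
      rw [e1, hc1, sub_zero]
      by_cases hd : κ A.Tx = κ A.t
      · rw [hc01 _ _ (by simp [Arcs.Loc]; grind), Arcs.fill_eq (by grind) (by grind) (by grind)]
        rw [show κ A.m = κ A.t by grind] at hc
        linear_combination - hc
      · rw [hc0 _ _ _ (by simp [Arcs.Loc]; grind), h0 true false _ _ _ (by simp [Arcs.Loc]; grind)]
        rw [h0 false _ _ _ _ (by simp [Arcs.Loc]; grind),
          h0 true false _ _ _ (by simp [Arcs.Loc]; grind)] at hc
        linear_combination - hc
  · have hL' := hL
    simp [Arcs.Loc] at hL'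
    obtain ⟨⟨l1, l2⟩, ⟨l3, l4⟩, l5, l6⟩ := hL'
    have e1 := der_eq₂ (ω := ω) (T := T) Q (κ := κ) (u := u) 1 (-(if κ A.Tx = κ A.t then 1 else 0))
      (fun v => Ψ false true false v κ) (fun v => Γ v κ) (fun v => s v κ)
      (fun v => by rw [hs _ _ hL]; ring)
    have hc := h.cycle false true false u κ hL hQ
    simp only [Bool.false_eq_true, if_false, if_true, sg_true, sg_false] at hc ⊢
    rw [e1]
    by_cases hd : κ A.Tx = κ A.t
    · rw [if_pos hd, hdΓ _ _ hQ (by grind) (by grind) (by grind) (by grind),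
        Arcs.fill_eq (by grind) (by grind) (by grind)]
      linear_combination - hc
    · rw [if_neg hd]
      rw [h0 false false false] at hc
      · linear_combination - hc
      · simp [Arcs.Loc]; grind
  · obtain ⟨z, x, y, u, κ, h1, h2⟩ := hlee
    rw [k.isLee_iff] at h1
    have h1' := h1
    obtain ⟨h1, h3, h4, h5, h6⟩ := h1
    have hL' := h1
    cases z
    · right
      cases x <;> cases y <;> simp [Arcs.Loc] at hL'
      · grind
      · obtain ⟨f1, f2, f3, f4, f5, f6, f7, f8, f9⟩ :=
          Arcs.fill_vals κ (!κ A.t) (!κ A.t) (!κ A.t) D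
        have hL : A.Loc false false true false (A.fill κ (!κ A.t) (!κ A.t) (!κ A.t)) := by
          rw [Arcs.loc_fill D]; simp; grind
        refine ⟨u, A.fill κ (!κ A.t) (!κ A.t) (!κ A.t), hL, k.isLee_fill.2 h6, by grind, ?_⟩
        -- The cycle condition at `(0, 1, 1)`, with the triangle colored like its surroundings,
        -- leaves only the value at the closed triangle with its original color.
        have hc := h.cycle false true true u (A.fill κ (!κ A.t) (!κ A.t) (!κ A.t))
          (by rw [Arcs.loc_fill D]; simp; grind) (k.cons_fill.2 h6.1)
        rw [der_eq_zero_of_isLee _ _ (k.isLee_fill.2 h6)] at hc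
        · have e2 : A.fill κ (κ A.t) (κ A.t) (κ A.t) = κ :=
            Arcs.fill_eq (by grind) (by grind) (by grind)
          rw [hs _ _ hL, if_pos (by grind), if_neg (by simp)]
          simp only [Γ, f1, Arcs.fill_fill, Bool.not_not, e2]
          rw [f1] at hc
          have e3 := ω.rt_ne (!κ A.t)
          have e4 := ω.rt_ne (κ A.t)
          simp only [if_true, sg_true, Bool.false_eq_true, if_false, sg_false] at hc
          intro h7
          refine mul_ne_zero (div_ne_zero e3 e4) h2 ?_
          refine mul_left_cancel₀ e3 ?_
          linear_combination - ω.rt (!κ A.t) * h7 - hc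
        · exact fun v κ hv => h.eq_zero k fun h' => hv h'.2
      · refine ⟨u, κ, h1, h6, ?_, ?_⟩
        · rw [Bool.eq_not_of_ne (Ne.symm h3), ← hL'.2.1.1, Bool.eq_not_of_ne h4]
        rw [hs _ _ h1, if_neg (by grind), if_neg (by simp)]
        simpa using h2
      · grind
    · left
      refine ⟨x, y, u, κ, k.isLee_iff.2 h1', ?_⟩
      cases x
      · cases y <;> simp [Arcs.Loc] at hL'
        · rw [hc00 _ _ h1, if_neg (by grind)]
          simpa using h2
        · grind
      · rwa [hc1, sub_zero]

end Triangle

end PD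

/-! ### Exchanging the two sides of a triangle move -/

namespace PD

namespace Arcs

variable {H : Type*} {A : Arcs H} {a x y : Bool} {κ : H → Bool}

theorem Distinct.swap (D : A.Distinct) : A.swap.Distinct :=
  ⟨D.tm, D.tb, D.mb, D.Ty, D.Tx, D.Mz, D.Mx, D.Bz, D.By⟩

theorem ext_fill (D : A.Distinct) (t m b : Bool) : A.ext a x (A.fill κ t m b) = A.ext a x κ := by
  obtain ⟨f1, f2, f3, f4, f5, f6, f7, f8, f9⟩ := fill_vals κ t m b D
  rw [ext, fill_fill, f6, f7, f9, ext]

theorem inner_fill (D : A.Distinct) (t m b : Bool) : A.inner (A.fill κ t m b) = A.inner κ := by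
  obtain ⟨f1, f2, f3, f4, f5, f6, f7, f8, f9⟩ := fill_vals κ t m b D
  rw [inner, fill_fill, f4, f6, inner]

/-- The sides have the colors of the strands through them. -/
def IsExt (A : Arcs H) (a x : Bool) (κ : H → Bool) : Prop :=
  κ A.m = κ A.Bz ∧ κ A.b = κ A.Mz ∧ κ A.t = if x = a then κ A.Bz else κ A.Mx

theorem IsExt.ext_eq (h : A.IsExt a x κ) : A.ext a x κ = κ :=
  fill_eq h.2.2.symm h.1.symm h.2.1.symm

theorem isExt_ext (D : A.Distinct) : A.IsExt a x (A.ext a x κ) := by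
  obtain ⟨f1, f2, f3, f4, f5, f6, f7, f8, f9⟩ :=
    fill_vals κ (if x = a then κ A.Bz else κ A.Mx) (κ A.Bz) (κ A.Mz) D
  rw [IsExt, ext, f1, f2, f3, f6, f7, f9]
  exact ⟨rfl, rfl, rfl⟩

theorem isExt_of_loc (h : A.Loc a (!a) x y κ) : A.IsExt a x κ := by
  cases a <;> cases x <;> simp [Loc, IsExt] at h ⊢ <;> grind

/-- When `z` is not smoothed along the triangle, the top strand can be slid across the resolved
crossing. Both sides of the move then have the same resolutions with `x` and `y` exchanged, and only
the colors of the three sides have to be recomputed from the outer ends. -/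
theorem swap_loc_iff (D : A.Distinct) : A.swap.Loc a (!a) x y κ ↔
    A.swap.IsExt a x κ ∧ A.Loc a (!a) y x (A.ext a y κ) := by
  rw [ext, loc_fill D]
  cases a <;> cases x <;> cases y <;> simp [Loc, IsExt, swap] <;> grind

/-- Along an edge in direction `x`: where the transported coloring also fits the source of the edge,
the edge factors on the two sides of the move agree. -/
theorem swap_loc_false_left (D : A.Distinct) (h : A.swap.Loc a (!a) true y κ)
    (h' : A.Loc a (!a) y false (A.ext a y κ)) :
    A.swap.IsExt a false κ ∧ κ A.t = A.ext a y κ A.t := by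
  rw [ext, loc_fill D] at h'
  rw [ext, fill_t]
  cases a <;> cases y <;> simp [Loc, IsExt, swap] at h h' ⊢ <;> grind

/-- Along an edge in direction `y` the recoloring itself depends on the smoothing, so the two
recolorings must be seen to coincide as well. -/
theorem swap_loc_false_right (D : A.Distinct) (h : A.swap.Loc a (!a) x true κ)
    (h' : A.Loc a (!a) false x (A.ext a true κ) ∨ A.Loc a (!a) false x (A.ext a false κ)) :
    A.ext a true κ = A.ext a false κ ∧ κ A.t = A.ext a true κ A.t := by
  have e : (if true = a then κ A.Bz else κ A.Mx) = (if false = a then κ A.Bz else κ A.Mx) ∧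
      κ A.t = if true = a then κ A.Bz else κ A.Mx := by
    rw [ext, ext, loc_fill D, loc_fill D] at h'
    cases a <;> cases x <;> simp [Loc, swap] at h h' ⊢ <;> grind
  refine ⟨?_, ?_⟩
  · rw [ext, ext, e.1]
  · rw [ext, fill_t, e.2]

/-- The sides have the colors of the strands along them. -/
def IsInner (A : Arcs H) (κ : H → Bool) : Prop :=
  κ A.m = κ A.Tx ∧ κ A.b = κ A.Tx ∧ κ A.t = κ A.Mx

theorem IsInner.inner_eq (h : A.IsInner κ) : A.inner κ = κ :=
  fill_eq h.2.2.symm h.1.symm h.2.1.symm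

theorem isInner_of_loc (h : A.Loc a a (!a) a κ) : A.IsInner κ := by
  cases a <;> simp [Loc, IsInner] at h ⊢ <;> grind

theorem swap_loc_inner_iff (D : A.Distinct) : A.swap.Loc a a (!a) a κ ↔
    A.swap.IsInner κ ∧ A.Loc a a (!a) a (A.inner κ) := by
  rw [inner, loc_fill D]
  cases a <;> simp [Loc, IsInner, swap] <;> grind

/-- The arcs with the colors of `ext`. -/
def extMap (A : Arcs H) (a x : Bool) (h : H) : H :=
  if h = A.t then (if x = a then A.Bz else A.Mx) else if h = A.m then A.Bz else
    if h = A.b then A.Mz else h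

theorem comp_extMap : κ ∘ A.extMap a x = A.ext a x κ := by
  ext h
  simp only [Function.comp_apply, extMap, ext, fill]
  split_ifs <;> rfl

/-- The arcs with the colors of `inner`. -/
def innerMap (A : Arcs H) (h : H) : H :=
  if h = A.t then A.Mx else if h = A.m then A.Tx else if h = A.b then A.Tx else h

theorem comp_innerMap : κ ∘ A.innerMap = A.inner κ := by
  ext h
  simp only [Function.comp_apply, innerMap, inner, fill]
  split_ifs <;> rfl

end Arcs

namespace Triangle

variable {I H : Type*} {P : PD (Option (Option (Option I))) H} {Q : PD I H} {A : Arcs H} {a : Bool}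
variable [Fintype I] [Finite H] {K : Type*} [Field K] {ω : RootData K}
  {T : I → I → Prop} {F : Type*} [Field F] [Algebra F K] {t lam : ℝ}

theorem smul_mem {σ : Setoid H} {g : (H → Bool) → K} (hg : g ∈ ω.Lat F t σ lam) {c : K}
    (hc : c = 1 ∨ c = -1) : (fun κ => c * g κ) ∈ ω.Lat F t σ lam := by
  rcases hc with rfl | rfl
  · simpa using hg
  · convert Submodule.neg_mem _ hg using 1
    ext κ
    simp

theorem ext_mem (k : P.Triangle Q A a) {P' : PD (Option (Option (Option I))) H}
    (k' : P'.Triangle Q A.swap a) {x y : Bool} {u : I → Bool} {g : (H → Bool) → K}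
    (hg : g ∈ ω.Lat F t (P.res (v3 (!a) y x u)) lam) :
    (fun κ => if A.swap.IsExt a x κ then g (A.ext a y κ) else 0) ∈
      ω.Lat F t (P'.res (v3 (!a) x y u)) lam := by
  have D := k.distinct
  have D' := k'.distinct
  have := RootData.pull_mem (σ' := P'.res (v3 (!a) x y u)) (A.extMap a y) (A.swap.extMap a x)
    (fun κ h => ?_) (fun κ h => ?_) (fun κ h h' => ?_) (fun κ h h' => ?_) hg
  · convert this using 1
    ext κ
    rw [respects_res, k'.cons_iff, Arcs.swap_loc_iff D, Arcs.comp_extMap]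
    by_cases h1 : A.swap.IsExt a x κ
    · rw [if_pos h1]
      split_ifs with h2
      · rfl
      · refine RootData.eq_zero_of_not_respects hg ?_
        rw [respects_res, k.cons_iff, Arcs.ext, k.cons_fill]
        exact fun h => h2 ⟨⟨h1, h.1⟩, h.2⟩
    · rw [if_neg h1, if_neg fun h => h1 h.1.1]
  · rw [respects_res, k'.cons_iff, Arcs.swap_loc_iff D] at h
    rw [Arcs.comp_extMap, respects_res, k.cons_iff, Arcs.ext, k.cons_fill]
    exact ⟨h.1.2, h.2⟩
  · rw [respects_res, k.cons_iff] at h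
    rw [Arcs.comp_extMap, respects_res, k'.cons_iff, Arcs.ext, k'.cons_fill, Arcs.swap_loc_iff D]
    refine ⟨⟨Arcs.isExt_ext D', ?_⟩, h.2⟩
    rw [← Arcs.ext, show A.ext a y (A.swap.ext a x κ) = A.ext a y κ from Arcs.ext_fill D _ _ _,
      (Arcs.isExt_of_loc h.1).ext_eq]
    exact h.1
  · rw [respects_res, k'.cons_iff] at h
    change ((κ ∘ A.extMap a y) ∘ A.swap.extMap a x) h' = κ h'
    rw [Arcs.comp_extMap, Arcs.comp_extMap, show A.swap.ext a x (A.ext a y κ) = A.swap.ext a x κ from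
      Arcs.ext_fill D' _ _ _, (Arcs.isExt_of_loc h.1).ext_eq]
  · rw [respects_res, k.cons_iff] at h
    change ((κ ∘ A.swap.extMap a x) ∘ A.extMap a y) h' = κ h'
    rw [Arcs.comp_extMap, Arcs.comp_extMap, show A.ext a y (A.swap.ext a x κ) = A.ext a y κ from
      Arcs.ext_fill D _ _ _, (Arcs.isExt_of_loc h.1).ext_eq]

theorem inner_mem (k : P.Triangle Q A a) {P' : PD (Option (Option (Option I))) H}
    (k' : P'.Triangle Q A.swap a) {u : I → Bool} {g : (H → Bool) → K}
    (hg : g ∈ ω.Lat F t (P.res (v3 a (!a) a u)) lam) :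
    (fun κ => if A.swap.IsInner κ then g (A.inner κ) else 0) ∈
      ω.Lat F t (P'.res (v3 a (!a) a u)) lam := by
  have D := k.distinct
  have D' := k'.distinct
  have := RootData.pull_mem (σ' := P'.res (v3 a (!a) a u)) A.innerMap A.swap.innerMap
    (fun κ h => ?_) (fun κ h => ?_) (fun κ h h' => ?_) (fun κ h h' => ?_) hg
  · convert this using 1
    ext κ
    rw [respects_res, k'.cons_iff, Arcs.swap_loc_inner_iff D, Arcs.comp_innerMap]
    by_cases h1 : A.swap.IsInner κ
    · rw [if_pos h1]
      split_ifs with h2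
      · rfl
      · refine RootData.eq_zero_of_not_respects hg ?_
        rw [respects_res, k.cons_iff, Arcs.inner, k.cons_fill]
        exact fun h => h2 ⟨⟨h1, h.1⟩, h.2⟩
    · rw [if_neg h1, if_neg fun h => h1 h.1.1]
  · rw [respects_res, k'.cons_iff, Arcs.swap_loc_inner_iff D] at h
    rw [Arcs.comp_innerMap, respects_res, k.cons_iff, Arcs.inner, k.cons_fill]
    exact ⟨h.1.2, h.2⟩
  · rw [respects_res, k.cons_iff] at h
    have h1 := (Arcs.swap_loc_inner_iff (A := A.swap) D').1 h.1
    rw [Arcs.comp_innerMap, respects_res, k'.cons_iff, Arcs.inner, k'.cons_fill]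
    exact ⟨h1.2, h.2⟩
  · rw [respects_res, k'.cons_iff] at h
    change ((κ ∘ A.innerMap) ∘ A.swap.innerMap) h' = κ h'
    rw [Arcs.comp_innerMap, Arcs.comp_innerMap, show A.swap.inner (A.inner κ) = A.swap.inner κ from
      Arcs.inner_fill D' _ _ _, (Arcs.isInner_of_loc h.1).inner_eq]
  · rw [respects_res, k.cons_iff] at h
    change ((κ ∘ A.swap.innerMap) ∘ A.innerMap) h' = κ h'
    rw [Arcs.comp_innerMap, Arcs.comp_innerMap, show A.inner (A.swap.inner κ) = A.inner κ from
      Arcs.inner_fill D _ _ _, (Arcs.isInner_of_loc h.1).inner_eq]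

/-- The reduced data on the other side of the move. -/
theorem Reduced.swap (k : P.Triangle Q A a) {P' : PD (Option (Option (Option I))) H}
    (k' : P'.Triangle Q A.swap a) {s : (I → Bool) → (H → Bool) → K}
    {χ : Bool → Bool → (I → Bool) → (H → Bool) → K} (h : Reduced P Q A a ω T F t lam s χ) :
    ∃ s' χ', Reduced P' Q A.swap a ω T F t lam s' χ' := by
  have D := k.distinct
  have D' := k'.distinct
  have hs0 : ∀ u κ, ¬ A.Loc a a (!a) a κ → s u κ = 0 := fun u κ hn =>
    h.s_eq_zero k fun h' => hn h'.1
  have hχ0 : ∀ x y u κ, ¬ A.Loc a (!a) x y κ → χ x y u κ = 0 := fun x y u κ hn =>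
    h.χ_eq_zero k fun h' => hn h'.1
  have ext_swap : ∀ κ x y, A.ext a y (A.swap.ext a x κ) = A.ext a y κ := fun κ x y =>
    Arcs.ext_fill D _ _ _
  -- Exchanging the order of `x` and `y` changes the sign at vertices where both are `1`. The
  -- coupling in `side`, for `a = true`, is antisymmetric under the exchange, so `s` changes its
  -- sign; the coupling in `face`, for `a = false`, is symmetric.
  refine ⟨fun u κ => (if a = true then -1 else 1) * if A.swap.IsInner κ then s u (A.inner κ) else 0,
    fun x y u κ => (if x = true ∧ y = true then -1 else 1) *
      if A.swap.IsExt a x κ then χ y x u (A.ext a y κ) else 0, fun u => ?_, fun x y u => ?_,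
    fun x y u κ hL hQ => ?_, fun u κ hL hQ => ?_, ?_⟩
  · exact smul_mem (inner_mem k k' (h.s_mem u)) (by split_ifs <;> simp)
  · refine smul_mem (ext_mem k k' (RootData.Lat_anti ?_ (h.χ_mem y x u))) (by split_ifs <;> simp)
    rw [height_v3, height_v3]
    push_cast
    linarith
  · obtain ⟨h1, h2⟩ := (Arcs.swap_loc_iff D).1 hL
    have hf := h.face y x u _ h2 (k.cons_fill.2 hQ)
    have e1 : (Q.der ω T (A.ext a y κ) u) = Q.der ω T κ u := k.der_fill _ _ _ _ _
    have e2 : x = true → ω.rt (κ A.t) * (if A.swap.IsExt a false κ then χ y false u (A.ext a y κ)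
        else 0) = ω.rt (A.ext a y κ A.t) * χ y false u (A.ext a y κ) := by
      rintro rfl
      by_cases h3 : A.Loc a (!a) y false (A.ext a y κ)
      · obtain ⟨h4, h5⟩ := Arcs.swap_loc_false_left D hL h3
        rw [if_pos h4, h5]
      · rw [hχ0 _ _ _ _ h3]
        simp
    have e3 : y = true → ω.rt (κ A.t) * (if A.swap.IsExt a x κ then χ false x u (A.ext a false κ)
        else 0) = ω.rt (A.ext a y κ A.t) * χ false x u (A.ext a y κ) := by
      rintro rfl
      rw [if_pos h1]
      by_cases h3 : A.Loc a (!a) false x (A.ext a true κ) ∨ A.Loc a (!a) false x (A.ext a false κ)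
      · obtain ⟨h4, h5⟩ := Arcs.swap_loc_false_right D hL h3
        rw [← h4, h5]
      · rw [not_or] at h3
        rw [hχ0 _ _ _ _ h3.1, hχ0 _ _ _ _ h3.2]
        simp
    have e4 : ω.rt (κ A.Ty) * s u (A.inner κ) = ω.rt (κ A.Tx) * s u (A.inner κ) := by
      by_cases h3 : κ A.Tx = κ A.Ty
      · rw [h3]
      · rw [hs0, mul_zero, mul_zero]
        rw [Arcs.inner, Arcs.loc_fill D]
        cases a <;> simp <;> grind
    have e5 : A.swap.IsInner (A.swap.inner κ) := by
      obtain ⟨f1, f2, f3, f4, f5, f6, f7, f8, f9⟩ :=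
        Arcs.fill_vals κ (κ A.swap.Mx) (κ A.swap.Tx) (κ A.swap.Tx) D'
      rw [Arcs.IsInner, Arcs.inner, f1, f2, f3, f4, f6]
      exact ⟨rfl, rfl, rfl⟩
    have e6 : A.inner (A.swap.inner κ) = A.inner κ := Arcs.inner_fill D _ _ _
    have e7 : A.inner (A.ext a y κ) = A.inner κ := Arcs.inner_fill D _ _ _
    have e8 : A.ext a y κ A.Tx = κ A.Tx := Arcs.fill_of_ne _ _ _ _ D.Tx
    have e9 := der_eq (ω := ω) (T := T) Q (κ := κ) (u := u) (if x = true ∧ y = true then -1 else 1)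
      (fun v => χ y x v (A.ext a y κ)) (fun v => (if x = true ∧ y = true then -1 else 1) *
      if A.swap.IsExt a x κ then χ y x v (A.ext a y κ) else 0)
      (fun v => by rw [if_pos h1])
    rw [e9]
    rw [e1, e7, e8] at hf
    rw [if_pos e5, e6]
    change _ = if a = false ∧ x ≠ y then ω.rt (κ A.Ty) * ((if a = true then -1 else 1) *
      s u (A.inner κ)) else 0
    change (if x = true then ω.rt (κ A.t) * _ else 0) + sg K x * ((if y = true then
      ω.rt (κ A.t) * _ else 0) + _) = _
    generalize (Q.der ω T κ u fun v => χ y x v (A.ext a y κ)) = Z at *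
    cases x <;> cases y <;> cases a <;>
      simp only [Bool.false_eq_true, if_false, if_true, sg_true, sg_false, ne_eq, not_true,
        not_false_eq_true, and_false, and_true, Bool.true_eq_false,
        and_self, one_mul, forall_const, false_implies] at hf e2 e3 e4 ⊢ <;>
      (try simp only [e2, e3, e4]) <;> first | linear_combination hf | linear_combination - hf
  · obtain ⟨h1, h2⟩ := (Arcs.swap_loc_inner_iff D).1 hL
    have hf := h.side u _ h2 (k.cons_fill.2 hQ)
    have e1 : (Q.der ω T (A.inner κ) u) = Q.der ω T κ u := k.der_fill _ _ _ _ _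
    have e2 : ∀ x, A.ext a x (A.inner κ) = A.ext a x κ := fun x => Arcs.ext_fill D _ _ _
    have e3 : A.inner κ A.Tx = κ A.Tx := Arcs.fill_of_ne _ _ _ _ D.Tx
    have e4 : κ A.swap.Tx = κ A.Tx := by
      cases a <;> simp [Arcs.Loc, Arcs.swap] at hL ⊢ <;> grind
    have e9 := der_eq (ω := ω) (T := T) Q (κ := κ) (u := u) (if a = true then -1 else 1)
      (fun v => s v (A.inner κ)) (fun v => (if a = true then -1 else 1) *
        if A.swap.IsInner κ then s v (A.inner κ) else 0)
      (fun v => by rw [if_pos h1])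
    rw [e9, e4, if_pos (Arcs.isExt_ext D'), if_pos (Arcs.isExt_ext D'), ext_swap, ext_swap]
    rw [e1, e2, e2, e3] at hf
    generalize (Q.der ω T κ u fun v => s v (A.inner κ)) = Z at *
    cases a <;> simp only [Bool.false_eq_true, if_false, if_true, and_false, false_and] at hf ⊢
    · linear_combination hf
    · linear_combination - hf
  · rcases h.lee with ⟨x, y, u, κ, h1, h2⟩ | ⟨u, κ, h1, h2, h3, h4⟩
    · left
      rw [k.isLee_iff] at h1
      have e1 := (Arcs.isExt_of_loc h1.1).ext_eq
      refine ⟨y, x, u, A.swap.ext a y κ, ?_, ?_⟩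
      · rw [k'.isLee_iff, Arcs.swap_loc_iff D, ext_swap, e1, Arcs.ext, k'.isLee_fill, ← Arcs.ext]
        refine ⟨⟨Arcs.isExt_ext D', h1.1⟩, ?_, ?_, ?_, h1.2.2.2.2⟩
        all_goals
          obtain ⟨f1, f2, f3, f4, f5, f6, f7, f8, f9⟩ := Arcs.fill_vals κ
            (if y = a then κ A.swap.Bz else κ A.swap.Mx) (κ A.swap.Bz) (κ A.swap.Mz) D'
          rw [Arcs.ext]
          simp only [f1, f2, f4, f5, f7]
          obtain ⟨l1, l2, l3, l4, l5⟩ := h1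
          have l6 : κ A.m ≠ κ A.Mz → κ A.t ≠ κ A.m → κ A.t ≠ κ A.Mz → False := by
            cases κ A.m <;> cases κ A.Mz <;> cases κ A.t <;> simp
          clear h2 e1 f1 f2 f3 f4 f5 f6 f7 f8 f9
          cases a <;> cases x <;> cases y <;> simp [Arcs.Loc, Arcs.swap] at l1 ⊢ <;> grind
      · rw [if_pos (Arcs.isExt_ext D'), ext_swap, e1]
        exact mul_ne_zero (by split_ifs <;> simp) h2
    · right
      have e1 : A.swap.IsInner κ ∧ κ A.swap.Mz = κ A.swap.t := by
        clear h4
        cases a <;> simp [Arcs.Loc, Arcs.IsInner, Arcs.swap] at h1 ⊢ <;> grind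
      have e2 := (Arcs.isInner_of_loc h1).inner_eq
      refine ⟨u, κ, (Arcs.swap_loc_inner_iff D).2 ⟨e1.1, by rwa [e2]⟩, h2, e1.2, ?_⟩
      rw [if_pos e1.1, e2, if_pos (Arcs.isExt_ext D'), ext_swap]
      intro h5
      apply h4
      cases a <;> simp only [Bool.false_eq_true, if_false, if_true, and_self] at h5 ⊢
      · linear_combination h5
      · linear_combination - h5

/-- The third Reidemeister move. -/
theorem good_of (ht : t ∈ Set.Icc (0 : ℝ) 2) (hP : P.Alternating)
    {P' : PD (Option (Option (Option I))) H} (hP' : P'.Alternating) (k : P.Triangle Q A a)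
    (k' : P'.Triangle Q A.swap a) (h : P.Good ω (optT (optT (optT T))) F t lam) :
    P'.Good ω (optT (optT (optT T))) F t lam := by
  cases a
  · obtain ⟨s, χ, h1⟩ := exists_reduced_of_false ht hP k h
    obtain ⟨s', χ', h2⟩ := h1.swap k k'
    exact h2.good_of_false ht hP' k'
  · obtain ⟨s, χ, h1⟩ := exists_reduced_of_true ht hP k h
    obtain ⟨s', χ', h2⟩ := h1.swap k k'
    exact h2.good_of_true ht hP' k'

end Triangle

end PD

/-! ## Resolutions of planar diagrams -/

section Permutations

variable {α : Type*} [Finite α] [DecidableEq α] {π : Equiv.Perm α} {x y : α}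

/-- Composing a permutation with a transposition of two elements of one cycle separates them. -/
theorem exists_separating (hxy : x ≠ y) (h : ∀ κ : α → Bool, (∀ s, κ (π s) = κ s) → κ x = κ y) :
    ∃ κ : α → Bool, (∀ s, κ (π (Equiv.swap x y s)) = κ s) ∧ κ x ≠ κ y := by
  have h1 : π.SameCycle x y := by
    have := h (fun s => decide (π.SameCycle x s)) fun s => by simp
    simpa [Equiv.Perm.SameCycle.refl] using this
  have h2 : ∃ m, 0 < m ∧ (π ^ m) x = y := by
    obtain ⟨i, hi, -, h⟩ := h1.exists_pow_eq''
    exact ⟨i, hi, h⟩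
  obtain ⟨h3, h4⟩ := Nat.find_spec h2
  have h5 := fun k => Nat.find_min h2 (m := k)
  set m := Nat.find h2
  -- The stretch of the cycle after `x` up to `y`; the transposition closes it up to a cycle that
  -- avoids `x`.
  let S : Set α := {s | ∃ k, 0 < k ∧ k ≤ m ∧ (π ^ k) x = s}
  have hx : x ∉ S := by
    rintro ⟨k, hk, hkm, hx⟩
    rcases hkm.lt_or_eq with hlt | rfl
    · refine h5 (m - k) (by omega) ⟨by omega, ?_⟩
      have : (π ^ (m - k)) ((π ^ k) x) = y := by
        rw [← Equiv.Perm.mul_apply, ← pow_add, Nat.sub_add_cancel hkm, h4]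
      rwa [hx] at this
    · exact hxy (hx.symm.trans h4)
  have hy : y ∈ S := ⟨m, h3, le_rfl, h4⟩
  have hS : ∀ s ∈ S, π (Equiv.swap x y s) ∈ S := by
    rintro s ⟨k, hk, hkm, rfl⟩
    rcases hkm.lt_or_eq with hlt | rfl
    · rw [Equiv.swap_apply_of_ne_of_ne]
      · exact ⟨k + 1, by omega, hlt, by rw [pow_succ', Equiv.Perm.mul_apply]⟩
      · exact fun h => hx ⟨k, hk, hkm, h⟩
      · exact fun h => h5 k hlt ⟨hk, h⟩
    · rw [h4, Equiv.swap_apply_right]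
      exact ⟨1, one_pos, h3, by rw [pow_one]⟩
  have hS' : ∀ s, π (Equiv.swap x y s) ∈ S → s ∈ S := by
    intro s hs
    have := Equiv.Perm.perm_symm_mapsTo_of_mapsTo (π * Equiv.swap x y) (s := S)
      (fun s hs => hS s hs) hs
    rwa [show π (Equiv.swap x y s) = (π * Equiv.swap x y) s from rfl,
      Equiv.symm_apply_apply] at this
  refine ⟨fun s => decide (s ∈ S), fun s => ?_, ?_⟩
  · simp only [decide_eq_decide]
    exact ⟨hS' s, hS s⟩
  · simp [hx, hy]

/-- Composing a permutation with a transposition of elements of two cycles joins these. -/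
theorem eq_of_invariant {κ₀ : α → Bool} (h0 : ∀ s, κ₀ (π s) = κ₀ s) (hne : κ₀ x ≠ κ₀ y)
    {κ : α → Bool} (h : ∀ s, κ (π (Equiv.swap x y s)) = κ s) : κ x = κ y := by
  have h1 : ∀ k, κ₀ ((π ^ k) x) = κ₀ x := by
    intro k
    induction k with
    | zero => rfl
    | succ k ih => rw [pow_succ', Equiv.Perm.mul_apply, h0, ih]
  -- After `y` the new permutation goes to `π x` and follows the old cycle of `x` until it returns
  -- to `x`; it does not meet `y` on the way, by `hne`.
  have h2 : ∀ k, κ ((π ^ (k + 1)) x) = κ y ∨ κ x = κ y := by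
    intro k
    induction k with
    | zero =>
      left
      rw [← h y, Equiv.swap_apply_right, zero_add, pow_one]
    | succ k ih =>
      rcases ih with ih | ih
      · by_cases hx : (π ^ (k + 1)) x = x
        · right
          rw [← ih, hx]
        · left
          rw [pow_succ', Equiv.Perm.mul_apply, ← ih, ← h ((π ^ (k + 1)) x),
            Equiv.swap_apply_of_ne_of_ne hx]
          intro hy
          apply hne
          rw [← hy, h1]
      · exact Or.inr ih
  have h3 := h2 (orderOf π - 1)
  rw [Nat.sub_add_cancel (orderOf_pos π), pow_orderOf_eq_one] at h3
  rcases h3 with h3 | h3 <;> exact h3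

end Permutations

/-! ### Euler's formula and checkerboard colorings -/

namespace GaussDiagram

variable (D : GaussDiagram)

/-- The arc of a half-edge. -/
def arcOf : D.HalfEdge → D.Passage
  | (s, true) => s
  | (s, false) => D.next.symm s

theorem opposite_opposite (h : D.HalfEdge) : D.opposite (D.opposite h) = h := by
  obtain ⟨s, _ | _⟩ := h <;> simp [opposite]

theorem arcOf_opposite (h : D.HalfEdge) : D.arcOf (D.opposite h) = D.arcOf h := by
  obtain ⟨s, _ | _⟩ := h <;> simp [opposite, arcOf]

/-- The crossing or marked point of a passage. -/
def vertexOf : D.Passage → Fin D.n ⊕ Fin D.m := Sum.map Prod.fst id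

theorem vertexOf_surjective : Function.Surjective D.vertexOf := by
  rintro (c | p)
  · exact ⟨Sum.inl (c, true), rfl⟩
  · exact ⟨Sum.inr p, rfl⟩

theorem rotate_bijective : Function.Bijective D.rotate := by
  refine (Finite.injective_iff_bijective).1 ?_
  rintro ⟨⟨c, b⟩ | p, d⟩ ⟨⟨c', b'⟩ | p', d'⟩ h <;> simp [rotate] at h ⊢
  · obtain ⟨⟨rfl, rfl⟩, h⟩ := h
    split_ifs at h <;> simp_all
  · exact h

theorem vertexOf_rotate (h : D.HalfEdge) : D.vertexOf (D.rotate h).1 = D.vertexOf h.1 := by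
  obtain ⟨⟨c, b⟩ | p, d⟩ := h <;> rfl

/-- The face to the side of a half-edge. -/
def faceOf (h : D.HalfEdge) : D.Face := Quot.mk _ h

theorem faceOf_rotate_opposite (h : D.HalfEdge) : D.faceOf (D.rotate (D.opposite h)) = D.faceOf h :=
  (Quot.sound (r := fun h h' => h' = D.rotate (D.opposite h)) rfl).symm

theorem faceOf_opposite (h : D.HalfEdge) : D.faceOf (D.opposite h) = D.faceOf (D.rotate h) := by
  rw [← D.faceOf_rotate_opposite (D.opposite h), D.opposite_opposite]

instance : Finite D.Face := Quot.finite _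

instance : Finite D.Component := Quot.finite _

/-- Functions on faces give functions on arcs: the sum over both sides. -/
def sides : (D.Face → ZMod 2) →ₗ[ZMod 2] (D.Passage → ZMod 2) where
  toFun f s := f (D.faceOf (s, true)) + f (D.faceOf (D.next s, false))
  map_add' f g := by ext s; simp only [Pi.add_apply]; ring
  map_smul' c f := by ext s; simp only [Pi.smul_apply, smul_eq_mul, RingHom.id_apply]; ring

/-- Functions on vertices give functionals: the sum over both ends. -/
def ends : (Fin D.n ⊕ Fin D.m → ZMod 2) →ₗ[ZMod 2] Module.Dual (ZMod 2) (D.Passage → ZMod 2) where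
  toFun g :=
    { toFun := fun e => ∑ s, e s * (g (D.vertexOf s) + g (D.vertexOf (D.next s)))
      map_add' := fun e e' => by
        rw [← Finset.sum_add_distrib]
        exact Finset.sum_congr rfl fun s _ => by simp only [Pi.add_apply]; ring
      map_smul' := fun c e => by
        rw [RingHom.id_apply, smul_eq_mul, Finset.mul_sum]
        exact Finset.sum_congr rfl fun s _ => by simp only [Pi.smul_apply, smul_eq_mul]; ring }
  map_add' g g' := by
    ext e
    simp only [LinearMap.coe_mk, AddHom.coe_mk, LinearMap.add_apply, Pi.add_apply,
      LinearMap.coe_comp, Function.comp_apply]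
    rw [← Finset.sum_add_distrib]
    exact Finset.sum_congr rfl fun s _ => by ring
  map_smul' c g := by
    ext e
    simp only [LinearMap.coe_mk, AddHom.coe_mk, LinearMap.smul_apply, Pi.smul_apply, smul_eq_mul,
      RingHom.id_apply, LinearMap.coe_comp, Function.comp_apply]
    rw [Finset.mul_sum]
    exact Finset.sum_congr rfl fun s _ => by ring

theorem two_eq_zero (a : ZMod 2) : a + a = 0 := CharTwo.add_self_eq_zero a

/-- The composition of two boundary maps modulo two: around a vertex, every corner is counted once
for each of the two half-edges next to it. -/
theorem ends_sides (g : Fin D.n ⊕ Fin D.m → ZMod 2) (f : D.Face → ZMod 2) :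
    D.ends g (D.sides f) = 0 := by
  have h1 : D.ends g (D.sides f) = ∑ h : D.HalfEdge,
      (f (D.faceOf h) + f (D.faceOf (D.rotate h))) * g (D.vertexOf h.1) := by
    rw [Fintype.sum_prod_type]
    simp only [Fintype.sum_bool, Finset.sum_add_distrib]
    rw [← Equiv.sum_comp D.next (fun s => (f (D.faceOf (s, false)) + f (D.faceOf (D.rotate (s, false)))) *
      g (D.vertexOf s)), ← Finset.sum_add_distrib]
    refine Finset.sum_congr rfl fun s _ => ?_
    simp only [sides, LinearMap.coe_mk, AddHom.coe_mk]
    have e1 : D.faceOf (D.rotate (s, true)) = D.faceOf (D.next s, false) := by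
      rw [← D.faceOf_opposite]; rfl
    have e2 : D.faceOf (D.rotate (D.next s, false)) = D.faceOf (s, true) := by
      rw [← D.faceOf_opposite]; simp [opposite]
    rw [e1, e2]
    ring
  have h2 : ∑ h : D.HalfEdge, f (D.faceOf (D.rotate h)) * g (D.vertexOf h.1) =
      ∑ h : D.HalfEdge, f (D.faceOf h) * g (D.vertexOf h.1) := by
    rw [← Equiv.sum_comp (Equiv.ofBijective _ D.rotate_bijective)
      (fun h => f (D.faceOf h) * g (D.vertexOf h.1))]
    exact Finset.sum_congr rfl fun h _ => by rw [Equiv.ofBijective_apply, D.vertexOf_rotate]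
  rw [h1]
  simp only [add_mul, Finset.sum_add_distrib, h2]
  exact two_eq_zero _

/-- A function with equal values on the two sides of every arc does not change around a vertex or
along an arc, so it is constant on components. -/
theorem finrank_ker_sides : Module.finrank (ZMod 2) (LinearMap.ker D.sides) ≤ Nat.card D.Component := by
  have key : ∀ f ∈ LinearMap.ker D.sides, ∀ h, f (D.faceOf (D.opposite h)) = f (D.faceOf h) := by
    intro f hf h
    have h1 : ∀ s, f (D.faceOf (s, true)) = f (D.faceOf (D.next s, false)) := fun s => by
      have := congrFun (LinearMap.mem_ker.1 hf) s
      exact CharTwo.add_eq_zero.1 this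
    obtain ⟨s, _ | _⟩ := h
    · simpa [opposite] using h1 (D.next.symm s)
    · exact (h1 s).symm
  have key2 : ∀ f ∈ LinearMap.ker D.sides, ∀ h, f (D.faceOf (D.rotate h)) = f (D.faceOf h) := by
    intro f hf h
    rw [← D.faceOf_opposite, key f hf]
  have key3 : ∀ f ∈ LinearMap.ker D.sides, ∀ s d, f (D.faceOf (s, d)) = f (D.faceOf (s, true)) := by
    intro f hf s d
    cases d
    · obtain ⟨c, b⟩ | p := s
      · have e1 := key2 f hf (Sum.inl (c, b), true)
        have e2 := key2 f hf (D.rotate (Sum.inl (c, b), true))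
        rw [e1] at e2
        rw [← e2]
        by_cases hb : b = D.sign c
        · simp [rotate, hb]
        · simp [rotate, Bool.eq_not_of_ne hb]
      · rw [← key2 f hf (Sum.inr p, true)]
        rfl
    · rfl
  let L : LinearMap.ker D.sides →ₗ[ZMod 2] (D.Component → ZMod 2) :=
    { toFun := fun f c => f.1 (D.faceOf (c.out, true))
      map_add' := fun f g => rfl
      map_smul' := fun c f => rfl }
  have hL : ∀ f (s : D.Passage), L f (Quot.mk _ s) = f.1 (D.faceOf (s, true)) := by
    intro f
    have h1 : ∀ s s', D.Adjacent s s' → f.1 (D.faceOf (s, true)) = f.1 (D.faceOf (s', true)) := by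
      intro s s' h
      rcases h with s | c
      · rw [← key3 f.1 f.2 (D.next s) false, ← key f.1 f.2 (s, true)]
        rfl
      · rw [← key2 f.1 f.2 (Sum.inl (c, true), true), ← key3 f.1 f.2 _ (if true = D.sign c then true else !true)]
        rfl
    intro s
    have := Quot.out_eq (Quot.mk D.Adjacent s)
    exact congrArg (Quot.lift (fun s => f.1 (D.faceOf (s, true))) h1) this
  have hinj : Function.Injective L := by
    intro f g hfg
    ext ⟨s, d⟩
    change f.1 (D.faceOf (s, d)) = g.1 (D.faceOf (s, d))
    rw [key3 f.1 f.2, key3 g.1 g.2, ← hL, ← hL, hfg]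
  have := Fintype.ofFinite D.Component
  have h := LinearMap.finrank_le_finrank_of_injective hinj
  rwa [Module.finrank_fintype_fun_eq_card, ← Nat.card_eq_fintype_card] at h

/-- Testing on single arcs shows that such a function has equal values at both ends of every arc. -/
theorem finrank_ker_ends : Module.finrank (ZMod 2) (LinearMap.ker D.ends) ≤ Nat.card D.Component := by
  have key : ∀ g ∈ LinearMap.ker D.ends, ∀ s, g (D.vertexOf s) = g (D.vertexOf (D.next s)) := by
    intro g hg s
    have := congrArg (fun φ => φ (Pi.single s 1)) (LinearMap.mem_ker.1 hg)
    simp only [ends, LinearMap.coe_mk, AddHom.coe_mk, LinearMap.zero_apply] at this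
    rw [Finset.sum_eq_single s] at this
    · rw [Pi.single_eq_same, one_mul] at this
      exact CharTwo.add_eq_zero.1 this
    · intro s' _ hs
      rw [Pi.single_eq_of_ne hs, zero_mul]
    · simp
  let L : LinearMap.ker D.ends →ₗ[ZMod 2] (D.Component → ZMod 2) :=
    { toFun := fun g c => g.1 (D.vertexOf c.out)
      map_add' := fun f g => rfl
      map_smul' := fun c f => rfl }
  have hL : ∀ g (s : D.Passage), L g (Quot.mk _ s) = g.1 (D.vertexOf s) := by
    intro g
    have h1 : ∀ s s', D.Adjacent s s' → g.1 (D.vertexOf s) = g.1 (D.vertexOf s') := by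
      intro s s' h
      rcases h with s | c
      · exact key g.1 g.2 s
      · rfl
    intro s
    have := Quot.out_eq (Quot.mk D.Adjacent s)
    exact congrArg (Quot.lift (fun s => g.1 (D.vertexOf s)) h1) this
  have hinj : Function.Injective L := by
    intro f g hfg
    ext v
    obtain ⟨s, rfl⟩ := D.vertexOf_surjective v
    rw [← hL, ← hL, hfg]
  have := Fintype.ofFinite D.Component
  have h := LinearMap.finrank_le_finrank_of_injective hinj
  rwa [Module.finrank_fintype_fun_eq_card, ← Nat.card_eq_fintype_card] at h

/-- The faces of a planar diagram have a checkerboard coloring. -/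
theorem exists_checkerboard (hD : D.IsPlanar) : ∃ b : D.HalfEdge → Bool,
    (∀ h, b (D.opposite h) = !b h) ∧ ∀ h, b (D.rotate h) = !b h := by
  have h1 : (1 : D.Passage → ZMod 2) ∈ LinearMap.range D.sides := by
    rw [← Subspace.forall_mem_dualAnnihilator_apply_eq_zero_iff]
    -- Vanishing of first cohomology with coefficients `ZMod 2`. One inclusion is `ends_sides`;
    -- equality of dimensions is Euler's formula together with the two bounds for the kernels.
    have h2 : LinearMap.range D.ends = (LinearMap.range D.sides).dualAnnihilator := by
      refine Submodule.eq_of_le_of_finrank_le ?_ ?_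
      · rintro _ ⟨g, rfl⟩
        rw [Submodule.mem_dualAnnihilator]
        rintro _ ⟨f, rfl⟩
        exact D.ends_sides g f
      · have := Fintype.ofFinite D.Face
        have e1 := Subspace.finrank_add_finrank_dualAnnihilator_eq (LinearMap.range D.sides)
        have e2 := LinearMap.finrank_range_add_finrank_ker D.sides
        have e3 := LinearMap.finrank_range_add_finrank_ker D.ends
        have e4 := D.finrank_ker_sides
        have e5 := D.finrank_ker_ends
        rw [Module.finrank_fintype_fun_eq_card] at e1 e2 e3
        have e6 : Fintype.card (Fin D.n ⊕ Fin D.m) = D.n + D.m := by simp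
        have e7 := hD
        unfold IsPlanar at e7
        rw [Nat.card_eq_fintype_card, Nat.card_eq_fintype_card] at e7
        omega
    rw [← h2]
    rintro _ ⟨g, rfl⟩
    -- On the constant function `1` the functional sums `g` over the starts and over the ends of all
    -- arcs. These sums agree, since `next` is a permutation.
    simp only [ends, LinearMap.coe_mk, AddHom.coe_mk, Pi.one_apply, one_mul, Finset.sum_add_distrib]
    rw [Equiv.sum_comp D.next fun s => g (D.vertexOf s)]
    exact two_eq_zero _
  obtain ⟨f, hf⟩ := h1
  have h2 : ∀ h, f (D.faceOf (D.opposite h)) = f (D.faceOf h) + 1 := by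
    have h3 : ∀ s, f (D.faceOf (s, true)) + f (D.faceOf (D.next s, false)) = 1 := fun s =>
      congrFun hf s
    have h4 : ∀ a b : ZMod 2, a + b = 1 → b = a + 1 := by decide
    rintro ⟨s, _ | _⟩
    · refine h4 _ _ ?_
      rw [add_comm]
      simpa [opposite] using h3 (D.next.symm s)
    · exact h4 _ _ (h3 s)
  have h5 : ∀ a : ZMod 2, decide (a + 1 = 0) = !decide (a = 0) := by decide
  refine ⟨fun h => decide (f (D.faceOf h) = 0), fun h => ?_, fun h => ?_⟩
  · dsimp only
    rw [h2, h5]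
  · dsimp only
    rw [← D.faceOf_opposite, h2, h5]

end GaussDiagram

/-! ### Circles of resolutions as cycles of permutations -/

namespace GaussDiagram

variable (D : GaussDiagram)

/-- The planar diagram data of a Gauss diagram; arcs are labelled by the passages they leave. -/
def pd : PD (Fin D.n) D.Passage where
  ov c e := D.arcOf (Sum.inl (c, true), e)
  un c e := D.arcOf (Sum.inl (c, false), e != D.sign c)
  glue a b := ∃ p, a = D.arcOf (Sum.inr p, false) ∧ b = D.arcOf (Sum.inr p, true)

variable {D}

/-- The half-edge that is joined with a given one at the common vertex. -/
def partner (u : D.Vertex) : D.HalfEdge → D.HalfEdge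
  | (Sum.inl (c, b), d) => (Sum.inl (c, !b), d ^^ (u c ^^ D.sign c))
  | (Sum.inr p, d) => (Sum.inr p, !d)

theorem partner_partner (u : D.Vertex) (h : D.HalfEdge) : partner u (partner u h) = h := by
  obtain ⟨⟨c, b⟩ | p, d⟩ := h <;> simp [partner]

theorem cons_iff {u : D.Vertex} {κ : D.Passage → Bool} :
    D.pd.Cons u κ ↔ ∀ h, κ (D.arcOf (partner u h)) = κ (D.arcOf h) := by
  have e : ∀ d v s : Bool, ((v ^^ d) != s) = (d ^^ (v ^^ s)) := by decide
  constructor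
  · rintro ⟨h1, h2⟩
    have h3 : ∀ c d, κ (D.arcOf (Sum.inl (c, true), d)) =
        κ (D.arcOf (Sum.inl (c, false), d ^^ (u c ^^ D.sign c))) := fun c d => by
      have := h1 c d
      simp only [pd] at this
      rw [this, e]
    rintro ⟨⟨c, _ | _⟩ | p, d⟩
    · rw [partner, Bool.not_false, h3, Bool.xor_assoc, Bool.xor_self, Bool.xor_false]
    · exact (h3 c d).symm
    · have := h2 _ _ ⟨p, rfl, rfl⟩
      cases d
      · exact this.symm
      · exact this
  · intro h
    refine ⟨fun c d => ?_, ?_⟩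
    · simp only [pd]
      rw [e]
      exact (h (Sum.inl (c, true), d)).symm
    · rintro _ _ ⟨p, rfl, rfl⟩
      exact h (Sum.inr p, true)

/-- A two-coloring of the faces, as a function of half-edges. -/
structure IsCheckerboard (b : D.HalfEdge → Bool) : Prop where
  opposite : ∀ h, b (D.opposite h) = !b h
  rotate : ∀ h, b (D.rotate h) = !b h

namespace IsCheckerboard

variable {b : D.HalfEdge → Bool}

theorem flip (hb : IsCheckerboard b) : IsCheckerboard fun h => !b h :=
  ⟨fun h => by rw [hb.opposite], fun h => by rw [hb.rotate]⟩

/-- Two quarter turns lead from one end of a strand at a crossing to the other end and change the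
color twice. -/
theorem crossing_eq (hb : IsCheckerboard b) (c : Fin D.n) (β d d' : Bool) :
    b (Sum.inl (c, β), d) = b (Sum.inl (c, β), d') := by
  have h1 : b (Sum.inl (c, β), !d) = b (Sum.inl (c, β), d) := by
    have h2 := hb.rotate (D.rotate (Sum.inl (c, β), d))
    rw [hb.rotate (Sum.inl (c, β), d), Bool.not_not] at h2
    rw [← h2]
    have : ∀ β d s : Bool, (if (!β) = s then (if β = s then d else !d)
        else !(if β = s then d else !d)) = !d := by decide
    simp only [GaussDiagram.rotate, Bool.not_not, this]
  cases d <;> cases d' <;> first | rfl | exact h1 | exact h1.symm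

theorem partner (hb : IsCheckerboard b) (u : D.Vertex) (h : D.HalfEdge) :
    b (partner u h) = !b h := by
  rw [← hb.rotate]
  obtain ⟨⟨c, β⟩ | p, d⟩ := h
  · exact hb.crossing_eq _ _ _ _
  · rfl

theorem eq_of_arcOf (hb : IsCheckerboard b) {h h' : D.HalfEdge} (e : D.arcOf h = D.arcOf h')
    (e' : b h = b h') : h = h' := by
  have key : h = h' ∨ h = D.opposite h' := by
    obtain ⟨s, _ | _⟩ := h <;> obtain ⟨s', _ | _⟩ := h' <;> simp_all [arcOf, GaussDiagram.opposite]
    rw [← e, Equiv.apply_symm_apply]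
  rcases key with rfl | rfl
  · rfl
  · rw [hb.opposite] at e'
    cases h : b h' <;> simp [h] at e'

variable (b) in
/-- The half-edge of an arc with `b = true`. -/
def head (s : D.Passage) : D.HalfEdge :=
  if b (s, true) = true then (s, true) else D.opposite (s, true)

theorem arcOf_head (s : D.Passage) : D.arcOf (head b s) = s := by
  unfold head
  split_ifs
  · rfl
  · rw [D.arcOf_opposite]; rfl

theorem apply_head (hb : IsCheckerboard b) (s : D.Passage) : b (head b s) = true := by
  unfold head
  split_ifs with h
  · exact h
  · rw [hb.opposite, Bool.eq_false_iff.2 h]; rfl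

theorem head_arcOf (hb : IsCheckerboard b) {h : D.HalfEdge} (e : b h = true) :
    head b (D.arcOf h) = h :=
  hb.eq_of_arcOf (arcOf_head _) ((hb.apply_head _).trans e.symm)

theorem succ_injective (hb : IsCheckerboard b) (u : D.Vertex) :
    Function.Injective fun s => D.arcOf (GaussDiagram.partner u (head b s)) := by
  intro s s' e
  have h1 := hb.eq_of_arcOf e (by rw [hb.partner, hb.partner, hb.apply_head, hb.apply_head])
  rw [← arcOf_head (b := b) s, ← partner_partner u (head b s), h1, partner_partner, arcOf_head]

/-- The circles of a resolution of a checkerboard colored diagram as cycles of a permutation. -/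
def succ (hb : IsCheckerboard b) (u : D.Vertex) : Equiv.Perm D.Passage :=
  Equiv.ofBijective _ (Finite.injective_iff_bijective.1 (hb.succ_injective u))

theorem succ_apply (hb : IsCheckerboard b) (u : D.Vertex) (s : D.Passage) :
    hb.succ u s = D.arcOf (GaussDiagram.partner u (head b s)) := rfl

theorem cons_iff (hb : IsCheckerboard b) {u : D.Vertex} {κ : D.Passage → Bool} :
    D.pd.Cons u κ ↔ ∀ s, κ (hb.succ u s) = κ s := by
  rw [GaussDiagram.cons_iff]
  constructor
  · intro h s
    rw [succ_apply, h, arcOf_head]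
  · intro h
    have h1 : ∀ x, b x = true → κ (D.arcOf (GaussDiagram.partner u x)) = κ (D.arcOf x) := by
      intro x hx
      have := h (D.arcOf x)
      rwa [succ_apply, hb.head_arcOf hx] at this
    intro x
    cases hx : b x
    · have := h1 (GaussDiagram.partner u x) (by rw [hb.partner, hx]; rfl)
      rw [partner_partner] at this
      exact this.symm
    · exact h1 x hx

/-- If the half-edges of the over-strand at `i` are heads, exactly two arcs run into the crossing,
and the new smoothing exchanges their continuations. -/
theorem succ_update (hb : IsCheckerboard b) {u u' : D.Vertex} {i : Fin D.n}
    (hi : u' i = !u i) (hne : ∀ j, j ≠ i → u' j = u j)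
    (h1 : b (Sum.inl (i, true), true) = true) (s : D.Passage) :
    hb.succ u' s =
      hb.succ u (Equiv.swap (D.pd.ov i false) (D.pd.ov i true) s) := by
  have h2 : ∀ d, b (Sum.inl (i, true), d) = true := fun d => (hb.crossing_eq _ _ _ _).trans h1
  have h3 : ∀ d, b (Sum.inl (i, false), d) = false := fun d => by
    have := hb.partner u (Sum.inl (i, true), d)
    rw [h2] at this
    exact (hb.crossing_eq _ _ _ _).trans this
  have h4 : ∀ d, head b (D.pd.ov i d) = (Sum.inl (i, true), d) := fun d => hb.head_arcOf (h2 d)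
  have h5 : ∀ d, GaussDiagram.partner u' (Sum.inl (i, true), d) =
      GaussDiagram.partner u (Sum.inl (i, true), !d) := fun d => by
    simp [GaussDiagram.partner, hi]
  rw [succ_apply, succ_apply]
  by_cases e1 : s = D.pd.ov i false
  · rw [e1, Equiv.swap_apply_left, h4, h4, h5]; rfl
  by_cases e2 : s = D.pd.ov i true
  · rw [e2, Equiv.swap_apply_right, h4, h4, h5]; rfl
  rw [Equiv.swap_apply_of_ne_of_ne e1 e2]
  have h6 := hb.apply_head s
  have h7 := arcOf_head (b := b) s
  generalize head b s = x at h6 h7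
  subst h7
  obtain ⟨⟨c, β⟩ | p, d⟩ := x
  · have hc : c ≠ i := by
      rintro rfl
      cases β
      · rw [h3] at h6
        exact Bool.noConfusion h6
      · cases d
        · exact e1 rfl
        · exact e2 rfl
    simp [GaussDiagram.partner, hne c hc]
  · rfl

/-- Composing a permutation with a transposition divides a cycle or joins two cycles. -/
theorem res_iff_not (hb : IsCheckerboard b) {u u' : D.Vertex} {i : Fin D.n}
    (hi : u' i = !u i) (hne : ∀ j, j ≠ i → u' j = u j) :
    D.pd.res u (D.pd.ov i false) (D.pd.ov i true) ↔
      ¬ D.pd.res u' (D.pd.ov i false) (D.pd.ov i true) := by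
  -- Inverting the checkerboard coloring exchanges heads and tails of all arcs.
  wlog h1 : b (Sum.inl (i, true), true) = true generalizing b
  · exact this hb.flip (by simpa using h1)
  have h2 : D.pd.ov i false ≠ D.pd.ov i true := by
    intro h
    have := hb.eq_of_arcOf (h := (Sum.inl (i, true), false)) (h' := (Sum.inl (i, true), true)) h (hb.crossing_eq _ _ _ _)
    simp at this
  have h3 : ∀ κ, D.pd.Cons u' κ ↔
      ∀ s, κ (hb.succ u (Equiv.swap (D.pd.ov i false) (D.pd.ov i true) s)) = κ s := fun κ => by
    rw [hb.cons_iff]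
    simp only [hb.succ_update hi hne h1]
  constructor
  · intro h hn
    obtain ⟨κ, hκ, hne⟩ := exists_separating (π := hb.succ u) h2 fun κ hκ => h κ (hb.cons_iff.2 hκ)
    exact hne (hn κ ((h3 κ).2 hκ))
  · intro h
    by_contra hn
    apply h
    obtain ⟨κ₀, h0⟩ := not_forall.1 hn
    obtain ⟨h0, hne⟩ := Classical.not_imp.1 h0
    exact fun κ hκ => eq_of_invariant (hb.cons_iff.1 h0) hne ((h3 κ).1 hκ)

theorem alternating (hb : IsCheckerboard b) : D.pd.Alternating := fun u i hi =>
  hb.res_iff_not (by simp [hi]) fun j hj => by simp [hj]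

end IsCheckerboard

theorem pd_alternating (hD : D.IsPlanar) : D.pd.Alternating := by
  obtain ⟨b, h1, h2⟩ := D.exists_checkerboard hD
  exact IsCheckerboard.alternating ⟨h1, h2⟩

end GaussDiagram

/-! ## The state spaces as functions on colorings -/

namespace RootData

variable {K : Type*} [Field K] (ω : RootData K)

/-- The value of a label at a color. -/
def lab (z k : Bool) : K := if z = true then ω.val k else 1

/-- Up to the factor `V - U`, the second factor is the inverse of the matrix of values of the labels
`1` and `X` at the two colors. -/
theorem sum_lab (z w : Bool) :
    ∑ k, ω.lab z k * (if w = true then (if k = true then 1 else -1) else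
      (if k = true then - ω.U else ω.V)) = if z = w then ω.V - ω.U else 0 := by
  cases z <;> cases w <;> simp [lab, val] <;> ring

/-- A square root datum over a ground field that is compatible with the ground ring `F[U, V]`. -/
structure IsOver (F : Type*) [Field F] [Algebra (R F) K] : Prop where
  U : algebraMap (R F) K (Khovanov.U F) = ω.U
  V : algebraMap (R F) K (Khovanov.V F) = ω.V
  inj : Function.Injective (algebraMap (R F) K)

section IsOver

variable {ω} {F : Type*} [Field F] [Algebra (R F) K] (hω : ω.IsOver F)

include hω

theorem IsOver.val_ne (k : Bool) : ω.val k ≠ 0 := by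
  cases k
  · rw [val, if_neg (by simp), ← hω.U, map_ne_zero_iff _ hω.inj]
    exact MvPolynomial.X_ne_zero _
  · rw [val, if_pos rfl, ← hω.V, map_ne_zero_iff _ hω.inj]
    exact MvPolynomial.X_ne_zero _

theorem IsOver.lab_ne (z k : Bool) : ω.lab z k ≠ 0 := by
  unfold lab
  split_ifs
  · exact hω.val_ne k
  · exact one_ne_zero

/-- Evaluation at a root is a ring homomorphism on `A`. -/
theorem IsOver.sum_mulCoeff (a b k : Bool) :
    ∑ c, algebraMap (R F) K (mulCoeff F a b c) * ω.lab c k = ω.lab a k * ω.lab b k := by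
  cases a <;> cases b <;> simp [mulCoeff, lab, hω.U, hω.V, ω.val_sq, sub_eq_add_neg]

/-- `Δ z` is `z` times `Δ 1`, and `Δ 1` lives on the diagonal with the derivative as its value. -/
theorem IsOver.sum_comulCoeff (z k l : Bool) :
    ∑ w : Bool × Bool, algebraMap (R F) K (comulCoeff F z w.1 w.2) * (ω.lab w.1 l * ω.lab w.2 k) =
      if k = l then ω.lab z k * ω.rt k ^ 2 else 0 := by
  rw [Fintype.sum_prod_type]
  cases z <;> cases k <;> cases l <;>
    simp [comulCoeff, lab, val, hω.U, hω.V, ω.rt_true, ω.rt_false] <;> ring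

end IsOver

variable {H : Type*} [Finite H]

/-- The basis element with the labels `z` on the classes of `σ` as a function on colorings. -/
def ev (σ : Setoid H) (z : Quotient σ → Bool) (κ : H → Bool) : K :=
  if Respects σ κ then ∏ c, ω.lab (z c) (κ c.out) / ω.rt (κ c.out) else 0

theorem ev_eq_zero {σ : Setoid H} {z : Quotient σ → Bool} {κ : H → Bool} (h : ¬ Respects σ κ) :
    ω.ev σ z κ = 0 := if_neg h

theorem ev_eq {σ : Setoid H} {z : Quotient σ → Bool} {κ : H → Bool} (h : Respects σ κ) :
    ω.ev σ z κ = ∏ c, ω.lab (z c) (κ c.out) / ω.rt (κ c.out) := if_pos h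

variable {ω} {F : Type*} [Field F] [Algebra (R F) K] (hω : ω.IsOver F)

include hω

/-- Only labelings that agree with `z` away from the united circle contribute. They are indexed by
the label of this circle, and the sum over it is a product in `A`, evaluated at the color. -/
theorem IsOver.sum_merge {σ τ : Setoid H} {a b : H} (m : Merges σ τ a b) {κ : H → Bool}
    (hκ : Respects τ κ) (z : Quotient σ → Bool) :
    ∑ z' : Quotient τ → Bool, algebraMap (R F) K (if ∀ h, ¬ σ h b → ¬ σ h a →
      z (Quotient.mk σ h) = z' (Quotient.mk τ h) then
        mulCoeff F (z (Quotient.mk σ b)) (z (Quotient.mk σ a)) (z' (Quotient.mk τ b)) else 0) *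
        ω.ev τ z' κ = ω.rt (κ a) * ω.ev σ z κ := by
  obtain ⟨hσ, hab⟩ := (m.respects_iff κ).1 hκ
  have hq : Quotient.mk τ b = Quotient.mk τ a := (Quotient.sound m.rel).symm
  let e : Bool → Quotient τ → Bool := fun w c =>
    if c = Quotient.mk τ a then w else z (Quotient.mk σ c.out)
  have ea : ∀ w, e w (Quotient.mk τ a) = w := fun w => if_pos rfl
  have ex : ∀ w x, ¬ τ a x → e w (Quotient.mk τ x) = z (Quotient.mk σ x) := fun w x hx => by
    have h1 : Quotient.mk τ x ≠ Quotient.mk τ a := fun h => hx (τ.symm (Quotient.exact h))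
    refine (if_neg h1).trans (congrArg z (Quotient.sound (σ.symm (m.rel_of_not ?_ hx))))
    exact τ.symm (Quotient.mk_out (s := τ) x)
  have hx' : ∀ x, ¬ τ a x ↔ ¬ σ x b ∧ ¬ σ x a := fun x => by
    rw [← not_or, not_iff_not]
    constructor
    · intro h
      rcases m.rel_cases h with h | h
      · exact Or.inr (σ.symm h)
      · exact Or.inl (σ.symm h)
    · rintro (h | h)
      · exact τ.trans m.rel (m.le (σ.symm h))
      · exact m.le (σ.symm h)
  rw [← Fintype.sum_of_injective e (fun w w' h => by rw [← ea w, h, ea]) (fun w =>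
    algebraMap (R F) K (mulCoeff F (z (Quotient.mk σ b)) (z (Quotient.mk σ a)) w) *
      ω.ev τ (e w) κ)]
  -- The untouched circles are expressed through `ev σ z` by dividing out the two old labels; their
  -- values are nonzero because `U` and `V` are.
  · have h1 : ∀ w, ω.ev τ (e w) κ = ω.lab w (κ a) * (ω.rt (κ a) * ω.ev σ z κ /
        (ω.lab (z (Quotient.mk σ b)) (κ a) * ω.lab (z (Quotient.mk σ a)) (κ a))) := by
      intro w
      rw [ω.ev_eq hκ, ω.ev_eq hσ]
      have := m.prod_eq (fun c => ω.lab (z c) (κ c.out) / ω.rt (κ c.out))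
        (fun c => ω.lab (e w c) (κ c.out) / ω.rt (κ c.out)) fun x hx => by
          rw [ex w x hx, hσ.out, hκ.out]
      rw [hσ.out, hσ.out, hκ.out, ea, ← hab] at this
      have n1 := hω.lab_ne (z (Quotient.mk σ b)) (κ a)
      have n2 := hω.lab_ne (z (Quotient.mk σ a)) (κ a)
      have n3 := ω.rt_ne (κ a)
      field_simp at this ⊢
      linear_combination -this
    simp only [h1, ← mul_assoc]
    rw [← Finset.sum_mul, hω.sum_mulCoeff]
    have n1 := hω.lab_ne (z (Quotient.mk σ b)) (κ a)
    have n2 := hω.lab_ne (z (Quotient.mk σ a)) (κ a)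
    field_simp
  · intro z' hz'
    rw [if_neg, map_zero, zero_mul]
    intro h
    refine hz' ⟨z' (Quotient.mk τ a), funext fun c => ?_⟩
    induction c using Quotient.ind with | _ x
    by_cases hx : τ a x
    · rw [← (Quotient.sound hx : Quotient.mk τ a = Quotient.mk τ x), ea]
    · rw [ex _ _ hx]
      exact h x ((hx' x).1 hx).1 ((hx' x).1 hx).2
  · intro w
    rw [if_pos, hq, ea]
    intro x h1 h2
    rw [ex _ _ ((hx' x).2 ⟨h1, h2⟩)]

/-- The contributing labelings are indexed by the labels of the two new circles. If these circles
have different colors, both sides vanish. -/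
theorem IsOver.sum_split {σ τ : Setoid H} {a b : H} (m : Merges τ σ a b) {κ : H → Bool}
    (hκ : Respects τ κ) (z : Quotient σ → Bool) :
    ∑ z' : Quotient τ → Bool, algebraMap (R F) K (if ∀ h, ¬ σ h b → ¬ σ h a →
      z (Quotient.mk σ h) = z' (Quotient.mk τ h) then
        comulCoeff F (z (Quotient.mk σ b)) (z' (Quotient.mk τ b)) (z' (Quotient.mk τ a)) else 0) *
        ω.ev τ z' κ = ω.rt (κ a) * ω.ev σ z κ := by
  have hq : Quotient.mk σ b = Quotient.mk σ a := (Quotient.sound m.rel).symm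
  have hne : Quotient.mk τ a ≠ Quotient.mk τ b := fun h => m.not_rel (Quotient.exact h)
  let e : Bool × Bool → Quotient τ → Bool := fun w c =>
    if c = Quotient.mk τ b then w.1 else if c = Quotient.mk τ a then w.2
      else z (Quotient.mk σ c.out)
  have eb : ∀ w, e w (Quotient.mk τ b) = w.1 := fun w => if_pos rfl
  have ea : ∀ w, e w (Quotient.mk τ a) = w.2 := fun w => (if_neg hne).trans (if_pos rfl)
  have ex : ∀ w x, ¬ σ a x → e w (Quotient.mk τ x) = z (Quotient.mk σ x) := fun w x hx => by
    have h1 : Quotient.mk τ x ≠ Quotient.mk τ b :=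
      fun h => hx (σ.trans m.rel (m.le (τ.symm (Quotient.exact h))))
    have h2 : Quotient.mk τ x ≠ Quotient.mk τ a := fun h => hx (m.le (τ.symm (Quotient.exact h)))
    refine (if_neg h1).trans ((if_neg h2).trans (congrArg z (Quotient.sound ?_)))
    exact m.le (Quotient.mk_out (s := τ) x)
  have hx' : ∀ x, ¬ σ a x ↔ ¬ σ x b ∧ ¬ σ x a := fun x => by
    rw [← not_or, not_iff_not]
    constructor
    · exact fun h => Or.inr (σ.symm h)
    · rintro (h | h)
      · exact σ.trans m.rel (σ.symm h)
      · exact σ.symm h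
  have hout : ∀ x, ¬ σ a x → κ (Quotient.mk σ x).out = κ x := fun x hx =>
    (hκ _ _ (m.rel_of_not (σ.symm (Quotient.mk_out (s := σ) x)) hx)).symm
  rw [← Fintype.sum_of_injective e (fun w w' h => Prod.ext (by rw [← eb w, h, eb])
    (by rw [← ea w, h, ea])) (fun w =>
    algebraMap (R F) K (comulCoeff F (z (Quotient.mk σ b)) w.1 w.2) * ω.ev τ (e w) κ)]
  -- Since `κ` need not respect `σ`, the untouched circles are collected in a product with factor
  -- `1` at the circle that is divided.
  · let G' : Quotient σ → K := fun c => if c = Quotient.mk σ a then 1 else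
      ω.lab (z c) (κ c.out) / ω.rt (κ c.out)
    have h1 : ∀ w, ω.ev τ (e w) κ = (ω.lab w.1 (κ b) * ω.lab w.2 (κ a)) *
        ((∏ c, G' c) / (ω.rt (κ a) * ω.rt (κ b))) := by
      intro w
      rw [ω.ev_eq hκ]
      have := m.prod_eq (fun c => ω.lab (e w c) (κ c.out) / ω.rt (κ c.out)) G' fun x hx => by
        have h1 : Quotient.mk σ x ≠ Quotient.mk σ a := fun h => hx (σ.symm (Quotient.exact h))
        simp only [G', if_neg h1]
        rw [ex w x hx, hκ.out, hout x hx]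
      rw [hκ.out, hκ.out, ea, eb, show G' (Quotient.mk σ a) = 1 from if_pos rfl, mul_one] at this
      rw [this]
      ring
    rw [Finset.sum_congr rfl fun w _ => by rw [h1 w, ← mul_assoc], ← Finset.sum_mul,
      hω.sum_comulCoeff]
    by_cases hab : κ a = κ b
    · have hσ : Respects σ κ := (m.respects_iff κ).2 ⟨hκ, hab⟩
      have h2 : ω.ev σ z κ = ω.lab (z (Quotient.mk σ a)) (κ a) / ω.rt (κ a) * ∏ c, G' c := by
        rw [ω.ev_eq hσ, ← Finset.mul_prod_erase _ _ (Finset.mem_univ (Quotient.mk σ a)),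
          ← Finset.mul_prod_erase _ G' (Finset.mem_univ (Quotient.mk σ a)),
          show G' (Quotient.mk σ a) = 1 from if_pos rfl, one_mul, hσ.out]
        congr 1
        exact Finset.prod_congr rfl fun c hc => (if_neg (Finset.ne_of_mem_erase hc)).symm
      rw [if_pos hab, h2, ← hab, hq]
      have n3 := ω.rt_ne (κ a)
      field_simp
    · rw [if_neg hab, zero_mul, ω.ev_eq_zero, mul_zero]
      exact fun h => hab ((m.respects_iff κ).1 h).2
  · intro z' hz'
    rw [if_neg, map_zero, zero_mul]
    intro h
    refine hz' ⟨(z' (Quotient.mk τ b), z' (Quotient.mk τ a)), funext fun c => ?_⟩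
    induction c using Quotient.ind with | _ x
    by_cases hx : σ a x
    · rcases (m.rel_cases hx) with hx | hx
      · rw [← (Quotient.sound hx : Quotient.mk τ a = Quotient.mk τ x), ea]
      · rw [← (Quotient.sound hx : Quotient.mk τ b = Quotient.mk τ x), eb]
    · rw [ex _ _ hx]
      exact h x ((hx' x).1 hx).1 ((hx' x).1 hx).2
  · intro w
    rw [if_pos, ea, eb]
    intro x h1 h2
    rw [ex _ _ ((hx' x).2 ⟨h1, h2⟩)]

omit hω in
-- The tensor power of `sum_lab`, obtained by expanding a product of sums.
theorem sum_prod_lab {ι : Type*} [Fintype ι] [DecidableEq ι] (z w : ι → Bool) :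
    ∑ k : ι → Bool, ∏ c, (ω.lab (z c) (k c) * (if w c = true then (if k c = true then 1 else -1)
      else (if k c = true then - ω.U else ω.V))) =
      if z = w then (ω.V - ω.U) ^ Fintype.card ι else 0 := by
  have := (Finset.prod_univ_sum (fun _ : ι => (Finset.univ : Finset Bool)) fun c k =>
    ω.lab (z c) k * (if w c = true then (if k = true then 1 else -1)
      else (if k = true then - ω.U else ω.V))).symm
  rw [Fintype.piFinset_univ] at this
  rw [this]
  simp only [sum_lab]
  split_ifs with h
  · subst h
    simp
  · obtain ⟨c, hc⟩ := Function.ne_iff.1 h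
    exact Finset.prod_eq_zero (Finset.mem_univ c) (if_neg hc)

omit hω in
/-- The functions of the basis elements are linearly independent. -/
theorem eq_zero_of_sum_ev {σ : Setoid H} {f : (Quotient σ → Bool) → K}
    (h : ∀ κ, Respects σ κ → ∑ z, f z * ω.ev σ z κ = 0) : f = 0 := by
  have h1 : ∀ k : Quotient σ → Bool, ∑ z, f z * ∏ c, ω.lab (z c) (k c) = 0 := by
    intro k
    have hk : Respects σ fun x => k (Quotient.mk σ x) := fun a b hab =>
      congrArg k (Quotient.sound hab)
    have h2 := h _ hk
    have h3 : ∀ z, ω.ev σ z (fun x => k (Quotient.mk σ x)) =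
        (∏ c, ω.lab (z c) (k c)) / ∏ c, ω.rt (k c) := fun z => by
      rw [ω.ev_eq hk, ← Finset.prod_div_distrib]
      exact Finset.prod_congr rfl fun c _ => by rw [Quotient.out_eq]
    simp only [h3, ← mul_div_assoc] at h2
    rw [← Finset.sum_div, div_eq_zero_iff] at h2
    exact h2.resolve_right (Finset.prod_ne_zero_iff.2 fun _ _ => ω.rt_ne _)
  funext w
  have h2 : ∑ k : Quotient σ → Bool, (∑ z, f z * ∏ c, ω.lab (z c) (k c)) *
      ∏ c, (if w c = true then (if k c = true then 1 else -1)
        else (if k c = true then - ω.U else ω.V)) = 0 :=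
    Finset.sum_eq_zero fun k _ => by rw [h1, zero_mul]
  simp only [Finset.sum_mul, mul_assoc, ← Finset.prod_mul_distrib] at h2
  rw [Finset.sum_comm] at h2
  simp only [← Finset.mul_sum, sum_prod_lab] at h2
  simp only [mul_ite, mul_zero, Finset.sum_ite_eq', Finset.mem_univ, if_true] at h2
  refine (mul_eq_zero.1 h2).resolve_right (pow_ne_zero _ fun h => ω.sub_ne ?_)
  linear_combination -h

end RootData

/-! ### Monomials and basis elements -/

namespace RootData

variable {K : Type*} [Field K] {ω : RootData K} {F : Type*} [Field F] [Algebra F K] {t : ℝ}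
  {H : Type*} [Finite H]

/-- The grading of the basis element with labels `z`, without the contribution of the vertex. -/
def labelGrading {C : Type*} [Fintype C] (z : C → Bool) : ℤ := ∑ c, if z c = true then -1 else 1

theorem labelGrading_update {C : Type*} [Fintype C] [DecidableEq C] (z : C → Bool) (c : C) (b : Bool) :
    labelGrading (Function.update z c b) =
      labelGrading z - (if z c = true then -1 else 1) + if b = true then -1 else 1 := by
  unfold labelGrading
  rw [← Finset.add_sum_erase _ _ (Finset.mem_univ c), ← Finset.add_sum_erase
    (Finset.univ : Finset C) (fun c => if z c = true then (-1 : ℤ) else 1) (Finset.mem_univ c),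
    Function.update_self]
  have : ∑ x ∈ Finset.univ.erase c, (if Function.update z c b x = true then (-1 : ℤ) else 1) =
      ∑ x ∈ Finset.univ.erase c, if z x = true then (-1 : ℤ) else 1 :=
    Finset.sum_congr rfl fun x hx => by rw [Function.update_of_ne (Finset.ne_of_mem_erase hx)]
  rw [this]
  ring

theorem labelGrading_eq {C : Type*} [Fintype C] (z : C → Bool) :
    labelGrading z = (Fintype.card C : ℤ) - 2 * (Finset.univ.filter fun c => z c = true).card := by
  have : ∀ c, (if z c = true then (-1 : ℤ) else 1) = 1 - 2 * if z c = true then 1 else 0 :=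
    fun c => by split_ifs <;> rfl
  simp only [labelGrading, this, Finset.sum_sub_distrib, ← Finset.mul_sum, Finset.sum_boole]
  simp

/-- The monomials without squares span the lattice. -/
theorem Lat_le_span (ht : t ∈ Set.Icc (0 : ℝ) 2) (σ : Setoid H) (lam : ℝ) : ω.Lat F t σ lam ≤
    Submodule.span F {g | ∃ (a b : ℕ) (z : Quotient σ → Bool),
      lam ≤ labelGrading z - (t * a + (2 - t) * b) ∧
      g = fun κ => ω.U ^ a * ω.V ^ b * ω.ev σ z κ} := by
  let N : ℝ → Submodule F ((H → Bool) → K) := fun lam =>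
    Submodule.span F {g | ∃ (a b : ℕ) (z : Quotient σ → Bool),
      lam ≤ labelGrading z - (t * a + (2 - t) * b) ∧
      g = fun κ => ω.U ^ a * ω.V ^ b * ω.ev σ z κ}
  have hN : ∀ {mu : ℝ} (a b : ℕ) (z : Quotient σ → Bool),
      mu ≤ labelGrading z - (t * a + (2 - t) * b) →
      (fun κ => ω.U ^ a * ω.V ^ b * ω.ev σ z κ) ∈ N mu := fun a b z h =>
    Submodule.subset_span ⟨a, b, z, h, rfl⟩
  have hev : ∀ (h : H) (z : Quotient σ → Bool) κ, z (Quotient.mk σ h) = false →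
      ω.ev σ (Function.update z (Quotient.mk σ h) true) κ = ω.val (κ h) * ω.ev σ z κ := by
    intro h z κ hz
    by_cases hκ : Respects σ κ
    · rw [ω.ev_eq hκ, ω.ev_eq hκ, ← Finset.mul_prod_erase _ _ (Finset.mem_univ (Quotient.mk σ h)),
        ← Finset.mul_prod_erase (Finset.univ : Finset (Quotient σ))
          (fun c => ω.lab (z c) (κ c.out) / ω.rt (κ c.out)) (Finset.mem_univ (Quotient.mk σ h)),
        Function.update_self, hz, hκ.out, ← mul_assoc]
      congr 1
      · simp [lab, div_eq_mul_inv]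
      · exact Finset.prod_congr rfl fun c hc => by
          rw [Function.update_of_ne (Finset.ne_of_mem_erase hc)]
    · rw [ω.ev_eq_zero hκ, ω.ev_eq_zero hκ, mul_zero]
  have hmul : ∀ (h : H) (mu : ℝ) (g : (H → Bool) → K), g ∈ N mu →
      (fun κ => ω.val (κ h) * g κ) ∈ N (mu - 2) := by
    intro h mu g hg
    let T : ((H → Bool) → K) →ₗ[F] ((H → Bool) → K) :=
      { toFun := fun g κ => ω.val (κ h) * g κ
        map_add' := fun g g' => funext fun κ => mul_add _ _ _
        map_smul' := fun c g => funext fun κ => mul_smul_comm _ _ _ }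
    have key : N mu ≤ (N (mu - 2)).comap T := by
      refine Submodule.span_le.2 ?_
      rintro _ ⟨a, b, z, hz, rfl⟩
      change (fun κ => ω.val (κ h) * (ω.U ^ a * ω.V ^ b * ω.ev σ z κ)) ∈ N (mu - 2)
      have hl := labelGrading_update z (Quotient.mk σ h)
      -- If the circle already has the label `X`, the product is rewritten by `X ^ 2 = (U + V) X - U
      -- V`. No term loses more than two: the first two lose `t` and `2 - t`, and in the last the
      -- regained label `1` offsets the cost of `U V`.
      by_cases hzh : z (Quotient.mk σ h) = true
      · set z' := Function.update z (Quotient.mk σ h) false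
        have hz' : Function.update z' (Quotient.mk σ h) true = z := by
          rw [Function.update_idem, ← hzh, Function.update_eq_self]
        have h1 := hN (mu := mu - 2) (a + 1) b z (by push_cast; linarith [ht.2])
        have h2 := hN (mu := mu - 2) a (b + 1) z (by push_cast; linarith [ht.1])
        have h3 := hN (mu := mu - 2) (a + 1) (b + 1) z' (by
          rw [show labelGrading z' = _ from hl false, if_pos hzh]
          push_cast
          linarith)
        convert Submodule.sub_mem _ (Submodule.add_mem _ h1 h2) h3 using 1
        ext κ
        have h4 := hev h z' κ (Function.update_self ..)
        rw [hz'] at h4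
        simp only [Pi.sub_apply, Pi.add_apply, h4]
        linear_combination (ω.U ^ a * ω.V ^ b * ω.ev σ z' κ) * ω.val_sq (κ h)
      · rw [Bool.not_eq_true] at hzh
        have h1 := hN (mu := mu - 2) a b (Function.update z (Quotient.mk σ h) true) (by
          rw [hl, hzh]
          push_cast
          simp only [if_true]
          linarith)
        convert h1 using 1
        ext κ
        rw [hev h z κ hzh]
        ring
    exact key hg
  refine Submodule.span_le.2 ?_
  rintro _ ⟨a, b, S, hS, rfl⟩
  induction S using Multiset.induction_on generalizing lam with
  | empty =>
    have h0 := hN (mu := lam) a b (fun _ => false) (by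
      rw [labelGrading_eq]
      simpa [numClasses] using hS)
    have h1 : ω.mono σ a b 0 = fun κ => ω.U ^ a * ω.V ^ b * ω.ev σ (fun _ => false) κ := ?_
    · rw [h1]
      exact h0
    ext κ
    by_cases hκ : Respects σ κ
    · simp [mono, hκ, ω.ev_eq hκ, lab, wt, div_eq_mul_inv, Finset.prod_inv_distrib]
    · simp [mono, hκ, ω.ev_eq_zero hκ]
  | cons h S ih =>
    have h1 := hmul h (lam + 2) _ (ih (lam + 2) (by
      rw [Multiset.card_cons] at hS
      push_cast at hS
      linarith))
    rw [add_sub_cancel_right] at h1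
    rw [mono_cons] at h1
    exact h1

/-- The function of a basis element as a monomial. -/
theorem ev_eq_mono (σ : Setoid H) (z : Quotient σ → Bool) (a b : ℕ) :
    (fun κ => ω.U ^ a * ω.V ^ b * ω.ev σ z κ) = ω.mono σ a b
      (((Finset.univ.filter fun c => z c = true).val).map Quotient.out) := by
  ext κ
  by_cases hκ : Respects σ κ
  · rw [mono, if_pos hκ, ω.ev_eq hκ, Finset.prod_div_distrib, Multiset.map_map, mul_div_assoc]
    congr 2
    unfold lab
    rw [← Finset.prod_filter]
    rfl
  · rw [mono, if_neg hκ, ω.ev_eq_zero hκ, mul_zero]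

theorem ev_mem (σ : Setoid H) (z : Quotient σ → Bool) (a b : ℕ) {lam : ℝ}
    (h : lam ≤ labelGrading z - (t * a + (2 - t) * b)) :
    (fun κ => ω.U ^ a * ω.V ^ b * ω.ev σ z κ) ∈ ω.Lat F t σ lam := by
  rw [ev_eq_mono]
  refine mono_mem ?_
  rw [labelGrading_eq] at h
  rw [Multiset.card_map, Finset.card_val]
  simpa [numClasses] using h

end RootData

/-! ### Circles as classes of arcs -/

namespace GaussDiagram

variable {D : GaussDiagram}

theorem circleOf_partner (u : D.Vertex) (h : D.HalfEdge) :
    D.circleOf u (partner u h) = D.circleOf u h := by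
  have hm : ∀ p, D.circleOf u (Sum.inr p, false) = D.circleOf u (Sum.inr p, true) := fun p =>
    Quot.sound (Joined.mark p)
  obtain ⟨⟨c, b⟩ | p, d⟩ := h
  · by_cases hc : u c = D.sign c
    · have hu : ∀ d, D.circleOf u (Sum.inl (c, true), d) = D.circleOf u (Sum.inl (c, false), d) :=
        fun d => Quot.sound (Joined.unoriented c d hc)
      simp only [partner, hc, Bool.xor_self, Bool.xor_false]
      cases b
      · exact hu d
      · exact (hu d).symm
    · have ho : ∀ b, D.circleOf u (Sum.inl (c, b), false) = D.circleOf u (Sum.inl (c, !b), true) :=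
        fun b => Quot.sound (Joined.oriented c b hc)
      have hx : (u c ^^ D.sign c) = true := by
        cases h1 : u c <;> cases h2 : D.sign c <;> simp_all
      simp only [partner, hx, Bool.xor_true]
      cases d
      · exact (ho b).symm
      · have := ho (!b)
        rwa [Bool.not_not] at this
  · cases d
    · exact (hm p).symm
    · exact hm p

theorem circleOf_arcOf (u : D.Vertex) (h : D.HalfEdge) :
    D.circleOf u (D.arcOf h, true) = D.circleOf u h := by
  obtain ⟨s, _ | _⟩ := h
  · have : D.circleOf u (D.next.symm s, true) = D.circleOf u (D.next (D.next.symm s), false) :=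
      Quot.sound (Joined.arc _)
    rwa [Equiv.apply_symm_apply] at this
  · rfl

/-- The indicator of a circle is a consistent coloring; conversely, each relation that generates the
circles forces equal colors on its arcs. -/
theorem res_arcOf {u : D.Vertex} {h h' : D.HalfEdge} :
    D.pd.res u (D.arcOf h) (D.arcOf h') ↔ D.circleOf u h = D.circleOf u h' := by
  constructor
  · intro hr
    have := hr (fun s => decide (D.circleOf u h = D.circleOf u (s, true))) (cons_iff.2 fun x => by
      simp only [circleOf_arcOf, circleOf_partner])
    simpa [circleOf_arcOf] using this
  · intro hc
    refine (PD.res_iff _).2 fun κ hκ => ?_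
    have hj : ∀ x y, D.Joined u x y → κ (D.arcOf x) = κ (D.arcOf y) := by
      intro x y hxy
      rcases hxy with s | p | ⟨c, b, hb⟩ | ⟨c, d, hd⟩
      · simp [arcOf]
      · exact (cons_iff.1 hκ (Sum.inr p, false)).symm
      · have := (cons_iff.1 hκ (Sum.inl (c, b), false)).symm
        have hx : (u c ^^ D.sign c) = true := by
          cases h1 : u c <;> cases h2 : D.sign c <;> simp_all
        simpa [partner, hx] using this
      · have := (cons_iff.1 hκ (Sum.inl (c, true), d)).symm
        simpa [partner, hd] using this
    exact congrArg (Quot.lift (fun x => κ (D.arcOf x)) hj) hc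

/-- The circles of a resolution as classes of arcs. -/
def circleEquiv (u : D.Vertex) : D.Circle u ≃ Quotient (D.pd.res u) where
  toFun := Quot.lift (fun h => Quotient.mk _ (D.arcOf h)) fun _ _ h =>
    Quotient.sound (res_arcOf.2 (Quot.sound h))
  invFun := Quotient.lift (fun s => D.circleOf u (s, true)) fun s s' h =>
    res_arcOf.1 (show D.pd.res u (D.arcOf (s, true)) (D.arcOf (s', true)) from h)
  left_inv := by
    rintro ⟨h⟩
    exact D.circleOf_arcOf u h
  right_inv := by
    rintro ⟨s⟩
    rfl

theorem circleEquiv_circleOf (u : D.Vertex) (h : D.HalfEdge) :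
    circleEquiv u (D.circleOf u h) = Quotient.mk _ (D.arcOf h) := rfl

end GaussDiagram

/-! ### Chains as functions on colorings -/

namespace GaussDiagram

variable {D : GaussDiagram}

/-- Labels of circles as labels of classes of arcs. -/
def classLabel {u : D.Vertex} (z : D.Circle u → Bool) : Quotient (D.pd.res u) → Bool :=
  fun c => z ((circleEquiv u).symm c)

theorem classLabel_arcOf {u : D.Vertex} (z : D.Circle u → Bool) (h : D.HalfEdge) :
    classLabel z (Quotient.mk _ (D.arcOf h)) = z (D.circleOf u h) := by
  rw [classLabel, ← circleEquiv_circleOf, Equiv.symm_apply_apply]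

theorem sum_classLabel {u : D.Vertex} {M : Type*} [AddCommMonoid M]
    (g : (Quotient (D.pd.res u) → Bool) → M) :
    ∑ z : D.Circle u → Bool, g (classLabel z) = ∑ z, g z :=
  Fintype.sum_equiv (Equiv.arrowCongr (circleEquiv u) (Equiv.refl Bool)) _ _ fun _ => rfl

theorem sum_gen {M : Type*} [AddCommMonoid M] (g : D.Gen → M) :
    ∑ x, g x = ∑ u, ∑ z, g ⟨u, z⟩ := by
  convert Fintype.sum_sigma g

theorem saddleCoeff_eq (F : Type*) [Field F] {i : Fin D.n} {v u : D.Vertex} (hv : v i = false)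
    (hu : u = Function.update v i true) (z : D.Circle v → Bool) (z' : D.Circle u → Bool) :
    D.saddleCoeff F i ⟨v, z⟩ ⟨u, z'⟩ =
      if ∀ s, ¬ D.pd.res v s (D.pd.ov i true) → ¬ D.pd.res v s (D.pd.ov i false) →
          classLabel z (Quotient.mk _ s) = classLabel z' (Quotient.mk _ s) then
        if ¬ D.pd.res v (D.pd.ov i true) (D.pd.ov i false) then
          mulCoeff F (classLabel z (Quotient.mk _ (D.pd.ov i true)))
            (classLabel z (Quotient.mk _ (D.pd.ov i false)))
            (classLabel z' (Quotient.mk _ (D.pd.ov i true)))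
        else
          comulCoeff F (classLabel z (Quotient.mk _ (D.pd.ov i true)))
            (classLabel z' (Quotient.mk _ (D.pd.ov i true)))
            (classLabel z' (Quotient.mk _ (D.pd.ov i false)))
      else 0 := by
  have h1 : (∀ s, ¬ D.pd.res v s (D.pd.ov i true) → ¬ D.pd.res v s (D.pd.ov i false) →
      classLabel z (Quotient.mk _ s) = classLabel z' (Quotient.mk _ s)) ↔
      ∀ h : D.HalfEdge, D.circleOf v h ≠ D.circleOf v (Sum.inl (i, true), true) →
        D.circleOf v h ≠ D.circleOf v (Sum.inl (i, true), false) →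
        z (D.circleOf v h) = z' (D.circleOf u h) := by
    constructor
    · intro h x h2 h3
      have := h (D.arcOf x) (fun h' => h2 (res_arcOf.1 h')) (fun h' => h3 (res_arcOf.1 h'))
      rwa [classLabel_arcOf, classLabel_arcOf] at this
    · intro h s h2 h3
      exact h (s, true)
        (fun h' => h2 (res_arcOf.2 h' : D.pd.res v (D.arcOf (s, true)) (D.arcOf _)))
        (fun h' => h3 (res_arcOf.2 h' : D.pd.res v (D.arcOf (s, true)) (D.arcOf _)))
  have h2 : D.pd.res v (D.pd.ov i true) (D.pd.ov i false) ↔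
      D.circleOf v (Sum.inl (i, true), true) = D.circleOf v (Sum.inl (i, true), false) :=
    res_arcOf (h := (Sum.inl (i, true), true)) (h' := (Sum.inl (i, true), false))
  have h3 : ∀ {w : D.Vertex} (x : D.Circle w → Bool) (d : Bool),
      classLabel x (Quotient.mk _ (D.pd.ov i d)) = x (D.circleOf w (Sum.inl (i, true), d)) :=
    fun x d => classLabel_arcOf x (Sum.inl (i, true), d)
  simp only [h3]
  by_cases c : ∀ h : D.HalfEdge, D.circleOf v h ≠ D.circleOf v (Sum.inl (i, true), true) →
      D.circleOf v h ≠ D.circleOf v (Sum.inl (i, true), false) →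
      z (D.circleOf v h) = z' (D.circleOf u h)
  · rw [if_pos (h1.2 c)]
    refine (if_pos ⟨hv, hu, c⟩).trans ?_
    simp only [h2, ne_eq]
  · rw [if_neg fun h => c (h1.1 h)]
    exact if_neg fun h => c h.2.2

variable {K : Type*} [Field K] {ω : RootData K} {F : Type*} [Field F] [Algebra (R F) K]

variable (ω) in
/-- Chains as functions on vertices and colorings. -/
def eval (f : D.Chain F) (u : D.Vertex) (κ : D.Passage → Bool) : K :=
  ∑ z : D.Circle u → Bool,
    algebraMap (R F) K (f ⟨u, z⟩) * ω.ev (D.pd.res u) (classLabel z) κ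

theorem eval_add (f g : D.Chain F) (u : D.Vertex) (κ : D.Passage → Bool) :
    eval ω (f + g) u κ = eval ω f u κ + eval ω g u κ := by
  simp only [eval, Pi.add_apply, map_add, add_mul, Finset.sum_add_distrib]

theorem eval_smul (r : R F) (f : D.Chain F) (u : D.Vertex) (κ : D.Passage → Bool) :
    eval ω (r • f) u κ = algebraMap (R F) K r * eval ω f u κ := by
  simp only [eval, Pi.smul_apply, smul_eq_mul, map_mul, mul_assoc, Finset.mul_sum]

theorem eval_single (r : R F) (v : D.Vertex) (z : D.Circle v → Bool) (u : D.Vertex)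
    (κ : D.Passage → Bool) : eval ω (Pi.single (⟨v, z⟩ : D.Gen) r) u κ =
      if u = v then algebraMap (R F) K r * ω.ev (D.pd.res v) (classLabel z) κ else 0 := by
  unfold eval
  split_ifs with h
  · subst h
    rw [Finset.sum_eq_single z]
    · rw [Pi.single_eq_same]
    · intro z' _ hz
      rw [Pi.single_eq_of_ne (by simpa using hz), map_zero, zero_mul]
    · simp
  · refine Finset.sum_eq_zero fun z' _ => ?_
    rw [Pi.single_eq_of_ne (by simp [h]), map_zero, zero_mul]

theorem eval_eq_zero {f : D.Chain F} {u : D.Vertex} {κ : D.Passage → Bool}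
    (h : ¬ D.pd.Cons u κ) : eval ω f u κ = 0 :=
  Finset.sum_eq_zero fun z _ => by
    rw [ω.ev_eq_zero (by rwa [D.pd.respects_res]), mul_zero]

/-- At each vertex the functions of the basis elements are independent over `K`, and the
coefficients embed in `K`. -/
theorem eq_zero_of_eval (hω : ω.IsOver F) {f : D.Chain F}
    (h : ∀ u κ, D.pd.Cons u κ → eval ω f u κ = 0) : f = 0 := by
  funext ⟨u, z⟩
  have h1 := RootData.eq_zero_of_sum_ev (ω := ω) (σ := D.pd.res u)
    (f := fun c => algebraMap (R F) K (f ⟨u, fun x => c (circleEquiv u x)⟩)) fun κ hκ => by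
      rw [← sum_classLabel (fun c => algebraMap (R F) K (f ⟨u, fun x => c (circleEquiv u x)⟩) *
        ω.ev (D.pd.res u) c κ)]
      rw [← h u κ ((D.pd.respects_res).1 hκ)]
      refine Finset.sum_congr rfl fun z _ => ?_
      simp only [classLabel, Equiv.symm_apply_apply]
  have h2 := congrFun h1 (classLabel z)
  simp only [classLabel, Equiv.symm_apply_apply, Pi.zero_apply] at h2
  exact (map_eq_zero_iff _ hω.inj).1 h2

/-- Alternation says that the edge is a merge or a split, and the normalization makes the two cases
give one formula. -/
theorem sum_saddleCoeff (hω : ω.IsOver F) (hD : D.pd.Alternating) (i : Fin D.n) (v u : D.Vertex)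
    (z : D.Circle v → Bool) {κ : D.Passage → Bool} (hκ : D.pd.Cons u κ) :
    ∑ z' : D.Circle u → Bool, algebraMap (R F) K (D.saddleCoeff F i ⟨v, z⟩ ⟨u, z'⟩) *
      ω.ev (D.pd.res u) (classLabel z') κ = if v i = false ∧ u = Function.update v i true then
        ω.rt (κ (D.pd.ov i false)) * ω.ev (D.pd.res v) (classLabel z) κ else 0 := by
  by_cases h : v i = false ∧ u = Function.update v i true
  · rw [if_pos h]
    obtain ⟨hv, hu⟩ := h
    have hs : RootData.Saddle (D.pd.res v) (D.pd.res u) (D.pd.ov i false) (D.pd.ov i true) := by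
      convert hD.saddle hv
      funext j
      by_cases hj : j = i
      · subst hj
        simp [hu]
      · simp [hu, hj]
    rw [← D.pd.respects_res] at hκ
    simp only [saddleCoeff_eq F hv hu]
    rcases hs with hs | hs
    · rw [← hω.sum_merge hs hκ, ← sum_classLabel]
      refine Finset.sum_congr rfl fun z' _ => ?_
      rw [if_pos fun h => hs.not_rel ((D.pd.res v).symm h)]
      congr!
    · rw [← hω.sum_split hs hκ, ← sum_classLabel]
      refine Finset.sum_congr rfl fun z' _ => ?_
      rw [if_neg (not_not.2 ((D.pd.res v).symm hs.rel))]
      congr!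
  · rw [if_neg h]
    refine Finset.sum_eq_zero fun z' _ => ?_
    rw [saddleCoeff, if_neg fun h' => h ⟨h'.1, h'.2.1⟩, map_zero, zero_mul]

theorem edgeSign_eq (v : D.Vertex) (i : Fin D.n) :
    algebraMap (R F) K (D.edgeSign F v i) = sgn K (· < ·) v i := by
  simp only [edgeSign, sgn, map_pow, map_neg, map_one]
  rw [← Finset.prod_const, Finset.prod_filter]
  congr!

theorem isTournament_lt {n : ℕ} : IsTournament fun i j : Fin n => i < j :=
  ⟨fun i => lt_irrefl i, fun i j h => by
    rw [not_lt]; exact ⟨le_of_lt, fun h' => lt_of_le_of_ne h' h⟩⟩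

theorem eval_differential (hω : ω.IsOver F) (hD : D.pd.Alternating) (f : D.Chain F) {u : D.Vertex}
    {κ : D.Passage → Bool} (hκ : D.pd.Cons u κ) :
    eval ω (D.differential F f) u κ = D.pd.dif ω (· < ·) (eval ω f) u κ := by
  have h1 : eval ω (D.differential F f) u κ = ∑ i, ∑ v, ∑ z, sgn K (· < ·) v i *
      algebraMap (R F) K (f ⟨v, z⟩) * (if v i = false ∧ u = Function.update v i true then
        ω.rt (κ (D.pd.ov i false)) * ω.ev (D.pd.res v) (classLabel z) κ else 0) := by
    simp only [← sum_saddleCoeff hω hD _ _ _ _ hκ, eval, differential, Matrix.mulVecLin_apply,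
      Matrix.mulVec, dotProduct, Matrix.of_apply, sum_gen, Finset.sum_mul, map_sum, map_mul,
      Finset.mul_sum, edgeSign_eq]
    rw [Finset.sum_comm, Finset.sum_comm (s := Finset.univ (α := Fin D.n))]
    refine Finset.sum_congr rfl fun v _ => ?_
    rw [Finset.sum_comm, Finset.sum_comm (s := Finset.univ (α := Fin D.n))]
    refine Finset.sum_congr rfl fun z _ => ?_
    rw [Finset.sum_comm]
    refine Finset.sum_congr rfl fun i _ => Finset.sum_congr rfl fun z' _ => ?_
    ring
  have h2 : D.pd.dif ω (· < ·) (eval ω f) u κ = ∑ i, if u i = true then sgn K (· < ·) u i *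
      (ω.rt (κ (D.pd.ov i false)) * eval ω f (Function.update u i false) κ) else 0 := by
    unfold PD.dif
    congr!
  rw [h1, h2]
  refine Finset.sum_congr rfl fun i _ => ?_
  by_cases hi : u i = true
  -- Only the vertex with `i` set back to `0` has an edge in direction `i` that ends at `u`.
  · rw [if_pos hi, Finset.sum_eq_single (Function.update u i false)]
    · have h2 : u = Function.update (Function.update u i false) i true := by
        rw [Function.update_idem, ← hi, Function.update_eq_self]
      simp only [Function.update_self, true_and, ← h2, if_true, eval, Finset.mul_sum]
      refine Finset.sum_congr rfl fun z _ => ?_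
      have h3 : sgn K (· < ·) (Function.update u i false) i = sgn K (· < ·) u i := by
        convert sgn_update_self isTournament_lt i false
      rw [h3]
      ring
    · intro v _ hv
      refine Finset.sum_eq_zero fun z _ => ?_
      rw [if_neg, mul_zero]
      rintro ⟨h4, rfl⟩
      apply hv
      rw [Function.update_idem, ← h4, Function.update_eq_self]
    · simp
  · rw [if_neg hi]
    refine Finset.sum_eq_zero fun v _ => ?_
    refine Finset.sum_eq_zero fun z _ => ?_
    rw [if_neg, mul_zero]
    rintro ⟨-, rfl⟩
    exact hi (Function.update_self ..)

end GaussDiagram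

/-! ### Comparison of filtrations and of torsion -/

namespace GaussDiagram

variable {D : GaussDiagram} {K : Type*} [Field K] {ω : RootData K} {F : Type*} [Field F]
  [Algebra (R F) K] [Algebra F K] [IsScalarTower F (R F) K] {t : ℝ}

variable (D) in
/-- The shift of the quantum grading. -/
def writheShift : ℝ := (D.nPos : ℝ) - 2 * (D.nNeg : ℝ)

theorem labelGrading_classLabel {u : D.Vertex} (z : D.Circle u → Bool) :
    RootData.labelGrading (classLabel z) = RootData.labelGrading z :=
  Fintype.sum_equiv (circleEquiv u).symm _ _ fun _ => rfl

theorem tGrading_eq (t : ℝ) (a b : ℕ) {u : D.Vertex} (z : D.Circle u → Bool) :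
    D.tGrading t a b ⟨u, z⟩ = RootData.labelGrading (classLabel z) - (t * a + (2 - t) * b) +
      height u + D.writheShift := by
  rw [labelGrading_classLabel]
  simp only [tGrading, qGrading, RootData.labelGrading, height, writheShift]
  push_cast
  ring

theorem eval_smul_field (c : F) (f : D.Chain F) (u : D.Vertex) (κ : D.Passage → Bool) :
    eval ω (c • f) u κ = c • eval ω f u κ := by
  rw [← algebraMap_smul (R F) c f, eval_smul, ← IsScalarTower.algebraMap_apply, Algebra.smul_def]

variable (ω D F) in
/-- Evaluation of chains as a linear map. -/
def evalLin (u : D.Vertex) : D.Chain F →ₗ[F] ((D.Passage → Bool) → K) where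
  toFun f := eval ω f u
  map_add' f g := funext fun κ => eval_add f g u κ
  map_smul' c f := funext fun κ => eval_smul_field c f u κ

theorem inFil_eval (hω : ω.IsOver F) {lam : ℝ} {f : D.Chain F} (hf : f ∈ D.tFiltration F t lam) :
    D.pd.InFil ω F t (lam - D.writheShift) (eval ω f) := by
  intro u
  have key : D.tFiltration F t lam ≤
      (ω.Lat F t (D.pd.res u) (lam - D.writheShift - height u)).comap (evalLin D ω F u) := by
    refine Submodule.span_le.2 ?_
    rintro _ ⟨a, b, ⟨v, z⟩, h, rfl⟩
    change eval (F := F) ω _ u ∈ ω.Lat F t (D.pd.res u) (lam - D.writheShift - height u)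
    by_cases hu : u = v
    · subst hu
      rw [tGrading_eq] at h
      have := RootData.ev_mem (ω := ω) (F := F) (t := t) (D.pd.res u) (classLabel z) a b
        (lam := lam - D.writheShift - height u) (by linarith)
      convert this using 1
      funext κ
      rw [eval_single, if_pos rfl, map_mul, map_pow, map_pow, hω.U, hω.V]
    · convert Submodule.zero_mem _ using 1
      funext κ
      rw [eval_single, if_neg hu, Pi.zero_apply]
  exact key hf

/-- Monomials reduce to basis elements without leaving the filtration step, so a filtered function
comes from a filtered chain over `F[U, V]`. The chain is assembled from pieces, one for each vertex,
that evaluate to zero at all other vertices. -/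
theorem exists_eval (ht : t ∈ Set.Icc (0 : ℝ) 2) (hω : ω.IsOver F) {lam : ℝ}
    {φ : D.Vertex → (D.Passage → Bool) → K} (hφ : D.pd.InFil ω F t lam φ) :
    ∃ f ∈ D.tFiltration F t (lam + D.writheShift), ∀ u κ, eval ω f u κ = φ u κ := by
  have key : ∀ v, ∃ f ∈ D.tFiltration F t (lam + D.writheShift), ∀ u κ,
      eval ω f u κ = if u = v then φ u κ else 0 := by
    intro v
    let N : Submodule F (D.Chain F) := D.tFiltration F t (lam + D.writheShift) ⊓
      ⨅ u : {u // u ≠ v}, LinearMap.ker (evalLin D ω F u.1)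
    have h1 : ω.Lat F t (D.pd.res v) (lam - height v) ≤ N.map (evalLin D ω F v) := by
      refine (RootData.Lat_le_span ht _ _).trans (Submodule.span_le.2 ?_)
      rintro _ ⟨a, b, z, h, rfl⟩
      let z' : D.Circle v → Bool := fun c => z (circleEquiv v c)
      have hz : classLabel z' = z := funext fun c => by
        simp only [classLabel, z', Equiv.apply_symm_apply]
      refine ⟨Pi.single ⟨v, z'⟩ (U F ^ a * V F ^ b), ⟨?_, ?_⟩, ?_⟩
      · refine Submodule.subset_span ⟨a, b, _, ?_, rfl⟩
        rw [tGrading_eq, hz]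
        linarith
      · simp only [Submodule.coe_iInf, Set.mem_iInter]
        rintro ⟨u, hu⟩
        refine LinearMap.mem_ker.2 (funext fun κ => ?_)
        change eval ω _ u κ = 0
        rw [eval_single, if_neg hu]
      · funext κ
        change eval ω _ v κ = _
        rw [eval_single, if_pos rfl, hz, map_mul, map_pow, map_pow, hω.U, hω.V]
    obtain ⟨f, ⟨hf, hf'⟩, hfv⟩ := h1 (hφ v)
    refine ⟨f, hf, fun u κ => ?_⟩
    split_ifs with hu
    · subst hu
      exact congrFun hfv κ
    · simp only [Submodule.coe_iInf, Set.mem_iInter] at hf'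
      exact congrFun (LinearMap.mem_ker.1 (hf' ⟨u, hu⟩)) κ
  choose g hg hg' using key
  refine ⟨∑ v, g v, Submodule.sum_mem _ fun v _ => hg v, fun u κ => ?_⟩
  have : eval ω (∑ v, g v) u = ∑ v, eval ω (g v) u := map_sum (evalLin D ω F u) _ _
  rw [this, Finset.sum_apply]
  simp only [hg', Finset.sum_ite_eq, Finset.mem_univ, if_true]

/-- If a nonzero multiple bounds, its Lee values vanish, and so do those of the cycle itself.
Conversely, if the Lee values vanish, a power of `U - V` turns the cycle into a boundary. -/
theorem mem_torsion_iff (ht : t ∈ Set.Icc (0 : ℝ) 2) (hω : ω.IsOver F) (hD : D.pd.Alternating)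
    {lam : ℝ} (f : LinearMap.ker (D.differential F)) (hf : f.1 ∈ D.tFiltration F t lam) :
    (Submodule.Quotient.mk f : Homology (D.differential F)) ∈
      Submodule.torsion (R F) (Homology (D.differential F)) ↔
      ∀ u κ, D.pd.IsLee u κ → eval ω f.1 u κ = 0 := by
  have hmk : ∀ r : R F, r • (Submodule.Quotient.mk f : Homology (D.differential F)) = 0 ↔
      ∃ g, D.differential F g = r • f.1 := by
    intro r
    rw [← Submodule.Quotient.mk_smul, Submodule.Quotient.mk_eq_zero]
    rfl
  rw [Submodule.mem_torsion_iff]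
  constructor
  · rintro ⟨⟨r, hr⟩, h⟩ u κ hL
    obtain ⟨g, hg⟩ := (hmk r).1 h
    have h1 := eval_differential hω hD g hL.1
    rw [hg, eval_smul, PD.dif_eq_zero_of_isLee (fun u κ h => eval_eq_zero h) hL] at h1
    refine (mul_eq_zero.1 h1).resolve_left fun h2 => ?_
    exact nonZeroDivisors.ne_zero hr ((map_eq_zero_iff _ hω.inj).1 h2)
  · intro h
    have hc : D.pd.IsCycle ω (· < ·) (eval ω f.1) := by
      intro u κ hκ
      rw [← eval_differential hω hD _ hκ, LinearMap.mem_ker.1 f.2]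
      simp [eval]
    obtain ⟨n, mu, ψ, hψ, hd⟩ := PD.exists_boundary ht hD isTournament_lt (inFil_eval hω hf) hc h
    -- The level `mu` is irrelevant; membership in some step of the filtration ensures that `ψ`
    -- comes from a chain with coefficients in `F[U, V]`.
    obtain ⟨g, -, hg⟩ := exists_eval ht hω hψ
    have hg' : eval ω g = ψ := funext fun u => funext fun κ => hg u κ
    have hne : (U F - V F) ^ n ≠ 0 := by
      refine pow_ne_zero _ fun h0 => ω.sub_ne ?_
      rw [← hω.U, ← hω.V, ← map_sub, h0, map_zero]
    refine ⟨⟨(U F - V F) ^ n, mem_nonZeroDivisors_of_ne_zero hne⟩, (hmk _).2 ⟨g, ?_⟩⟩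
    rw [← sub_eq_zero]
    refine eq_zero_of_eval hω fun u κ hκ => ?_
    have e1 : D.differential F g - (U F - V F) ^ n • f.1 =
        D.differential F g + (-(U F - V F) ^ n) • f.1 := by rw [neg_smul, sub_eq_add_neg]
    rw [e1, eval_add, eval_smul, eval_differential hω hD _ hκ, hg', hd u κ hκ, map_neg, map_pow,
      map_sub, hω.U, hω.V]
    ring

theorem exists_mem_homologyFiltration_iff (ht : t ∈ Set.Icc (0 : ℝ) 2) (hω : ω.IsOver F)
    (hD : D.pd.Alternating) (lam : ℝ) :
    (∃ m ≠ 0, m ∈ homologyFiltration (D.differential F) (D.tFiltration F t) lam) ↔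
      D.pd.Good ω (· < ·) F t (lam - D.writheShift) := by
  constructor
  · rintro ⟨m, hm, _, ⟨f, hf, rfl⟩, rfl⟩
    have hf' : f.1 ∈ D.tFiltration F t lam := hf
    have h1 : ¬ ∀ u κ, D.pd.IsLee u κ → eval ω f.1 u κ = 0 := by
      rw [← mem_torsion_iff ht hω hD f hf']
      exact fun h => hm ((Submodule.Quotient.mk_eq_zero _).2 h)
    push Not at h1
    refine ⟨eval ω f.1, inFil_eval hω hf', fun u κ hκ => ?_, h1⟩
    rw [← eval_differential hω hD _ hκ, LinearMap.mem_ker.1 f.2]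
    simp [eval]
  · rintro ⟨φ, hφ, hc, u, κ, hL, hne⟩
    obtain ⟨f, hf, hfe⟩ := exists_eval ht hω hφ
    rw [sub_add_cancel] at hf
    have hfe' : eval ω f = φ := funext fun u => funext fun κ => hfe u κ
    have hk : D.differential F f = 0 := eq_zero_of_eval hω fun u κ hκ => by
      rw [eval_differential hω hD _ hκ, hfe', hc u κ hκ]
    refine ⟨Submodule.Quotient.mk (Submodule.Quotient.mk ⟨f, hk⟩), fun h => hne ?_,
      _, ⟨⟨f, hk⟩, hf, rfl⟩, rfl⟩
    rw [← hfe]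
    exact (mem_torsion_iff ht hω hD ⟨f, hk⟩ hf).1 ((Submodule.Quotient.mk_eq_zero _).1 h) u κ hL

end GaussDiagram

theorem LinkDiagram.gr_eq {K : Type*} [Field K] {ω : RootData K} {F : Type*} [Field F]
    [Algebra (R F) K] [Algebra F K] [IsScalarTower F (R F) K] {t : ℝ}
    (ht : t ∈ Set.Icc (0 : ℝ) 2) (hω : ω.IsOver F) (D : LinkDiagram) :
    D.gr F t = ⨆ lam : ℝ, ⨆ _ : D.pd.Good ω (· < ·) F t (lam - D.writheShift), (lam : EReal) := by
  have hD := GaussDiagram.pd_alternating D.planar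
  simp only [← GaussDiagram.exists_mem_homologyFiltration_iff ht hω hD]
  unfold LinkDiagram.gr maxGradingOf gradingOf
  refine le_antisymm (iSup_le fun m => iSup_le fun hm => iSup_le fun lam => iSup_le fun h => ?_)
    (iSup_le fun lam => iSup_le fun ⟨m, hm, h⟩ => ?_)
  · exact le_iSup₂_of_le lam ⟨m, hm, h⟩ le_rfl
  · exact le_iSup₂_of_le m hm (le_iSup₂_of_le lam h le_rfl)

/-- Equality of the gradings of two diagrams from equality of the data that determine them. -/
theorem LinkDiagram.gr_congr.{v} {F : Type v} [Field F] {t : ℝ} (ht : t ∈ Set.Icc (0 : ℝ) 2)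
    (D D' : LinkDiagram)
    (h : ∀ (K : Type v) [Field K] [Algebra F K] (ω : RootData K) (lam : ℝ),
      D.pd.Good ω (· < ·) F t (lam - D.writheShift) ↔
        D'.pd.Good ω (· < ·) F t (lam - D'.writheShift)) : D.gr F t = D'.gr F t := by
  let L := FractionRing (R F)
  -- The closure supplies the square roots of `U - V` and `V - U`.
  let K := AlgebraicClosure L
  have hinj : Function.Injective (algebraMap (R F) K) := by
    rw [IsScalarTower.algebraMap_eq (R F) L K]
    exact (algebraMap L K).injective.comp (IsFractionRing.injective (R F) L)
  have hne : U F - V F ≠ 0 := by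
    intro h0
    have := (MvPolynomial.X_injective (R := F)) (sub_eq_zero.1 h0)
    exact absurd this (by decide)
  have hne' : algebraMap (R F) K (U F) - algebraMap (R F) K (V F) ≠ 0 := by
    rw [← map_sub, map_ne_zero_iff _ hinj]
    exact hne
  obtain ⟨r, hr⟩ := IsAlgClosed.exists_pow_nat_eq
    (algebraMap (R F) K (U F) - algebraMap (R F) K (V F)) (n := 2) two_pos
  obtain ⟨r', hr'⟩ := IsAlgClosed.exists_pow_nat_eq
    (algebraMap (R F) K (V F) - algebraMap (R F) K (U F)) (n := 2) two_pos
  let ω : RootData K :=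
    { U := algebraMap (R F) K (U F)
      V := algebraMap (R F) K (V F)
      rt := fun b => if b = true then r' else r
      rt_ne := by
        rintro (_ | _) h0
        · have h0 : r = 0 := h0
          rw [h0] at hr
          exact hne' (by rw [← hr]; ring)
        · have h0 : r' = 0 := h0
          rw [h0] at hr'
          exact hne' (by linear_combination hr')
      rt_false := hr
      rt_true := hr' }
  have hω : ω.IsOver F := ⟨rfl, rfl, hinj⟩
  rw [D.gr_eq ht hω, D'.gr_eq ht hω]
  simp only [h K ω]

/-! ### Relabelling and marked points -/

namespace GaussDiagram

variable {D D' : GaussDiagram}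

theorem arcOf_eq_iff {h : D.HalfEdge} {s : D.Passage} :
    D.arcOf h = s ↔ h = (s, true) ∨ h = (D.next s, false) := by
  obtain ⟨x, _ | _⟩ := h
  · simp [arcOf, Equiv.symm_apply_eq]
  · simp [arcOf]

theorem passageMap_injective {f : Fin D.n → Fin D'.n} {g : Fin D.m → Fin D'.m}
    (hf : Function.Injective f) (hg : Function.Injective g) :
    Function.Injective (passageMap f g : D.Passage → D'.Passage) :=
  Sum.map_injective.2 ⟨hf.prodMap Function.injective_id, hg⟩

/-- A map of arcs to the left of `passageMap` that is compatible with the ends of the arcs. -/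
structure Retraction (f : Fin D.n → Fin D'.n) (g : Fin D.m → Fin D'.m)
    (q : D'.Passage → D.Passage) : Prop where
  sign : ∀ c, D'.sign (f c) = D.sign c
  map : ∀ x, q (passageMap f g x) = x
  symm : ∀ x, q (D'.next.symm (passageMap f g x)) = D.next.symm x

namespace Retraction

variable {f : Fin D.n → Fin D'.n} {g : Fin D.m → Fin D'.m} {q : D'.Passage → D.Passage}

theorem arcOf (r : Retraction f g q) (x : D.Passage) (d : Bool) :
    q (D'.arcOf (passageMap f g x, d)) = D.arcOf (x, d) := by
  cases d
  · exact r.symm x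
  · exact r.map x

theorem ov (r : Retraction f g q) (i : Fin D.n) (e : Bool) :
    q (D'.pd.ov (f i) e) = D.pd.ov i e := r.arcOf (Sum.inl (i, true)) e

theorem un (r : Retraction f g q) (i : Fin D.n) (e : Bool) :
    q (D'.pd.un (f i) e) = D.pd.un i e := by
  simp only [pd, r.sign]
  exact r.arcOf (Sum.inl (i, false)) _

theorem collapse (r : Retraction f g q) (hg : Function.Surjective g) {N : Set D'.Passage}
    (hN : ∀ x d, D'.arcOf (passageMap f g x, d) ∉ N) :
    PD.Collapse D.pd ⟨fun i => D'.pd.ov (f i), fun i => D'.pd.un (f i), D'.pd.glue⟩ q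
      (passageMap f g) N where
  qp := r.map
  p_notMem x := hN x true
  ov := r.ov
  un := r.un
  ov_notMem i e := hN (Sum.inl (i, true)) e
  un_notMem i e := hN (Sum.inl (i, false)) _
  glue := by
    rintro _ _ ⟨p, rfl, rfl⟩
    exact ⟨_, _, ⟨g p, rfl, rfl⟩, r.arcOf (Sum.inr p) false, r.arcOf (Sum.inr p) true⟩
  glue' := by
    rintro _ _ ⟨p, rfl, rfl⟩
    obtain ⟨p, rfl⟩ := hg p
    exact ⟨⟨p, r.arcOf (Sum.inr p) false, r.arcOf (Sum.inr p) true⟩, hN (Sum.inr p) false,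
      hN (Sum.inr p) true⟩

/-- Apart from the images of old vertices only new marked points occur, and these merely force one
color on the pieces of an arc. -/
theorem equivalent {f : Fin D.n ≃ Fin D'.n} (r : Retraction f g q)
    (hp : ∀ p, p ∈ Set.range g ∨ q (D'.next.symm (Sum.inr p)) = q (Sum.inr p))
    (hκ : ∀ κ : D'.Passage → Bool, (∀ p, κ (D'.next.symm (Sum.inr p)) = κ (Sum.inr p)) →
      ∀ y, κ (passageMap f g (q y)) = κ y) :
    PD.Equivalent D.pd D'.pd f (passageMap f g) q := by
  have key : ∀ {u : D'.Vertex} {κ : D.Passage → Bool},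
      D'.pd.Cons u (κ ∘ q) ↔ D.pd.Cons (u ∘ f) κ := by
    intro u κ
    unfold PD.Cons PD.Smooth
    refine and_congr ?_ ?_
    · rw [f.symm.forall_congr_left]
      simp only [Equiv.symm_symm, Function.comp_apply, r.ov, r.un]
    · constructor
      · rintro h _ _ ⟨p, rfl, rfl⟩
        have := h _ _ ⟨g p, rfl, rfl⟩
        rwa [Function.comp_apply, Function.comp_apply,
          show q (D'.arcOf (Sum.inr (g p), false)) = _ from r.arcOf (Sum.inr p) false,
          show q (D'.arcOf (Sum.inr (g p), true)) = _ from r.arcOf (Sum.inr p) true] at this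
      · rintro h _ _ ⟨p, rfl, rfl⟩
        rcases hp p with ⟨p, rfl⟩ | hp
        · have := h _ _ ⟨p, rfl, rfl⟩
          rwa [Function.comp_apply, Function.comp_apply,
            show q (D'.arcOf (Sum.inr (g p), false)) = _ from r.arcOf (Sum.inr p) false,
            show q (D'.arcOf (Sum.inr (g p), true)) = _ from r.arcOf (Sum.inr p) true]
        · exact congrArg κ hp
  have hκ' : ∀ {u : D'.Vertex} {κ : D'.Passage → Bool}, D'.pd.Cons u κ →
      ∀ y, κ (passageMap f g (q y)) = κ y := fun h => hκ _ fun p => h.2 _ _ ⟨p, rfl, rfl⟩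
  refine ⟨fun u κ h => ?_, fun u κ h => key.2 h, fun u κ h => hκ' h,
    fun u κ _ x => congrArg κ (r.map x), fun u κ h i b => ?_⟩
  · rw [← key]
    convert h using 1
    funext y
    exact hκ' h y
  · rw [← hκ' h (D'.pd.ov (f i) b), r.ov]

end Retraction

theorem card_sign_equiv (f : Fin D.n ≃ Fin D'.n) (hf : ∀ c, D'.sign (f c) = D.sign c) (v : Bool) :
    (Finset.univ.filter fun c => D.sign c = v).card =
      (Finset.univ.filter fun c => D'.sign c = v).card := by
  refine Finset.card_equiv f fun c => ?_
  simp [hf]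

theorem writheShift_equiv (f : Fin D.n ≃ Fin D'.n) (hf : ∀ c, D'.sign (f c) = D.sign c) :
    D.writheShift = D'.writheShift := by
  unfold writheShift nPos nNeg
  rw [card_sign_equiv f hf, card_sign_equiv f hf]

variable (D) in
/-- The existence of cycles that are nonzero modulo torsion. -/
def Survives {K : Type*} [Field K] (ω : RootData K) (F : Type*) [Field F] [Algebra F K] (t lam : ℝ) :
    Prop := D.pd.Good ω (· < ·) F t (lam - D.writheShift)

variable {K : Type*} [Field K] {ω : RootData K} {F : Type*} [Field F] [Algebra F K] {t lam : ℝ}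

theorem survives_iff_of_equivalent {f : Fin D.n ≃ Fin D'.n} (hf : ∀ c, D'.sign (f c) = D.sign c)
    {p : D.Passage → D'.Passage} {q : D'.Passage → D.Passage}
    (E : PD.Equivalent D.pd D'.pd f p q) : D.Survives ω F t lam ↔ D'.Survives ω F t lam := by
  unfold Survives
  rw [writheShift_equiv f hf]
  constructor
  · intro h
    exact E.good (h.change_tournament isTournament_lt (isTournament_lt.comp f))
  · intro h
    exact E.symm.good (h.change_tournament isTournament_lt (isTournament_lt.comp f.symm))

theorem Relabel.survives_iff (h : D.Relabel D') : D.Survives ω F t lam ↔ D'.Survives ω F t lam := by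
  obtain ⟨f, g, hs, hn⟩ := h
  let q : D'.Passage → D.Passage := passageMap f.symm g.symm
  have h1 : ∀ x, q (passageMap f g x) = x := by
    rintro (⟨c, b⟩ | p) <;> simp [q, passageMap]
  have h2 : ∀ y, passageMap f g (q y) = y := by
    rintro (⟨c, b⟩ | p) <;> simp [q, passageMap]
  have r : Retraction f g q := ⟨hs, h1, fun x => by
    have : D'.next.symm (passageMap f g x) = passageMap f g (D.next.symm x) := by
      rw [Equiv.symm_apply_eq, hn, Equiv.apply_symm_apply]
    rw [this, h1]⟩
  exact survives_iff_of_equivalent hs (r.equivalent (fun p => Or.inl (g.surjective p))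
    fun κ _ y => congrArg κ (h2 y))

theorem Subdivide.survives_iff (h : D.Subdivide D') :
    D.Survives ω F t lam ↔ D'.Survives ω F t lam := by
  obtain ⟨f, g, p, s, hg, hs, hn1, hn2, hn⟩ := h
  have hinj := passageMap_injective (D := D) (D' := D') f.injective g.injective
  -- The arc leaving the new marked point is sent to the arc on which the point was put.
  let q : D'.Passage → D.Passage := Function.extend (passageMap f g) id fun _ => s
  have h1 : ∀ x, q (passageMap f g x) = x := fun x => hinj.extend_apply _ _ _
  have hp : ∀ x : D.Passage, passageMap f g x ≠ Sum.inr p := by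
    rintro (⟨c, b⟩ | p') h
    · simp [passageMap] at h
    · have : p ∈ Set.range g := ⟨p', by simpa [passageMap] using h⟩
      rw [hg] at this
      exact this rfl
  have h2 : q (Sum.inr p) = s := Function.extend_apply' _ _ _ fun ⟨x, hx⟩ => hp x hx
  have h3 : D'.next.symm (Sum.inr p) = passageMap f g s := by rw [Equiv.symm_apply_eq, hn1]
  have hr : ∀ y : D'.Passage, y = Sum.inr p ∨ ∃ x : D.Passage, passageMap f g x = y := by
    rintro (⟨c, b⟩ | p')
    · exact Or.inr ⟨Sum.inl (f.symm c, b), by simp [passageMap]⟩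
    · by_cases hp' : p' = p
      · exact Or.inl (by rw [hp'])
      · have : p' ∈ Set.range g := by rw [hg]; exact hp'
        obtain ⟨x, rfl⟩ := this
        exact Or.inr ⟨Sum.inr x, rfl⟩
  have r : Retraction f g q := ⟨hs, h1, fun x => by
    obtain ⟨y, rfl⟩ := D.next.surjective x
    rw [Equiv.symm_apply_apply]
    by_cases hy : y = s
    · rw [hy, ← hn2, Equiv.symm_apply_apply, h2]
    · rw [← hn y hy, Equiv.symm_apply_apply, h1]⟩
  refine survives_iff_of_equivalent hs (r.equivalent (fun p' => ?_) fun κ hκ y => ?_)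
  · by_cases hp' : p' = p
    · right
      rw [hp', h3, h1, h2]
    · left
      rw [hg]
      exact hp'
  · rcases hr y with rfl | ⟨x, rfl⟩
    · rw [h2, ← h3, hκ]
    · rw [h1]

end GaussDiagram

/-! ### The first Reidemeister move -/

namespace GaussDiagram

variable {D D' : GaussDiagram}

variable (D) in
/-- The planar diagram data with the passages permuted by `π`. -/
def twistedPd (π : Equiv.Perm D.Passage) : PD (Fin D.n) D.Passage where
  ov c e := D.arcOf (π (Sum.inl (c, true)), e)
  un c e := D.arcOf (π (Sum.inl (c, false)), e != D.sign c)
  glue a b := ∃ p, a = D.arcOf (π (Sum.inr p), false) ∧ b = D.arcOf (π (Sum.inr p), true)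

theorem smooth_twistedPd (π : Equiv.Perm D.Passage) (c : Fin D.n) (d e : Bool) {v : Bool}
    {κ : D.Passage → Bool} : (D.twistedPd π).Smooth v κ c ↔
      if v = (d ^^ e ^^ D.sign c) then
        κ (D.arcOf (π (Sum.inl (c, true)), d)) = κ (D.arcOf (π (Sum.inl (c, false)), e)) ∧
        κ (D.arcOf (π (Sum.inl (c, true)), !d)) = κ (D.arcOf (π (Sum.inl (c, false)), !e))
      else
        κ (D.arcOf (π (Sum.inl (c, true)), d)) = κ (D.arcOf (π (Sum.inl (c, false)), !e)) ∧
        κ (D.arcOf (π (Sum.inl (c, true)), !d)) = κ (D.arcOf (π (Sum.inl (c, false)), e)) := by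
  have key : ∀ (A B : Bool → Bool) (v s d e : Bool), (∀ x, A x = B ((v ^^ x) != s)) ↔
      if v = (d ^^ e ^^ s) then A d = B e ∧ A (!d) = B (!e) else A d = B (!e) ∧ A (!d) = B e := by
    intro A B v s d e
    rw [Bool.forall_bool]
    cases v <;> cases s <;> cases d <;> cases e <;> first | exact Iff.rfl | exact and_comm
  exact key (fun d => κ (D.arcOf (π (Sum.inl (c, true)), d)))
    (fun d => κ (D.arcOf (π (Sum.inl (c, false)), d))) v (D.sign c) d e

theorem smooth_pd (c : Fin D.n) (d e : Bool) {v : Bool} {κ : D.Passage → Bool} :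
    D.pd.Smooth v κ c ↔ if v = (d ^^ e ^^ D.sign c) then
        κ (D.arcOf (Sum.inl (c, true), d)) = κ (D.arcOf (Sum.inl (c, false), e)) ∧
        κ (D.arcOf (Sum.inl (c, true), !d)) = κ (D.arcOf (Sum.inl (c, false), !e))
      else
        κ (D.arcOf (Sum.inl (c, true), d)) = κ (D.arcOf (Sum.inl (c, false), !e)) ∧
        κ (D.arcOf (Sum.inl (c, true), !d)) = κ (D.arcOf (Sum.inl (c, false), e)) :=
  smooth_twistedPd 1 c d e

/-- An enumeration with one additional element. -/
def optionEquiv {ι N : Type*} (c : N) (f : ι → N) (hf : Function.Injective f)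
    (hr : Set.range f = {c}ᶜ) : Option ι ≃ N :=
  Equiv.ofBijective (fun o => o.elim c f) (by
    have hc : ∀ i, f i ≠ c := fun i h => by
      have : f i ∈ ({c} : Set N)ᶜ := hr ▸ ⟨i, rfl⟩
      exact this h
    constructor
    · rintro (_ | i) (_ | j) h
      · rfl
      · exact absurd h.symm (hc j)
      · exact absurd h (hc i)
      · exact congrArg some (hf h)
    · intro x
      by_cases hx : x = c
      · exact ⟨none, hx.symm⟩
      · have : x ∈ Set.range f := hr ▸ hx
        obtain ⟨i, rfl⟩ := this
        exact ⟨some i, rfl⟩)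

theorem card_optionEquiv {ι N : Type*} [Fintype ι] [Fintype N] (e : Option ι ≃ N) (p : N → Prop)
    [DecidablePred p] : (Finset.univ.filter p).card =
      (if p (e none) then 1 else 0) + (Finset.univ.filter fun i => p (e (some i))).card := by
  rw [Finset.card_filter, Finset.card_filter, ← e.sum_comp, Fintype.sum_option]

theorem writheShift_optionEquiv {ι : Type*} [Fintype ι] (e : Option ι ≃ Fin D.n) :
    D.writheShift = (if D.sign (e none) = true then 1 else -2) +
      (((Finset.univ.filter fun i => D.sign (e (some i)) = true).card : ℝ) -
        2 * (Finset.univ.filter fun i => D.sign (e (some i)) = false).card) := by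
  unfold writheShift nPos nNeg
  rw [card_optionEquiv e, card_optionEquiv e]
  cases D.sign (e none) <;> simp <;> ring

variable {K : Type*} [Field K] {ω : RootData K} {F : Type*} [Field F] [Algebra F K] {t lam : ℝ}

/-- The oriented smoothing splits off the loop; it is the `0`-smoothing at a positive and the
`1`-smoothing at a negative crossing. The shifts `-1` and `+2` of the two constructions cancel the
change of `n_+ - 2 n_-`. -/
theorem MoveOne.survives_iff (ht : t ∈ Set.Icc (0 : ℝ) 2) (h : D.MoveOne D') :
    D.Survives ω F t lam ↔ D'.Survives ω F t lam := by
  obtain ⟨f, g, c, s, b, hr, hs, hn1, hn2, hn3, hn⟩ := h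
  have hinj := passageMap_injective (D := D) (D' := D') f.injective g.injective
  have hfc : ∀ i, f i ≠ c := fun i h => by
    have : f i ∈ ({c} : Set (Fin D'.n))ᶜ := hr ▸ ⟨i, rfl⟩
    exact this h
  have hc : ∀ (x : D.Passage) β, passageMap f g x ≠ Sum.inl (c, β) := by
    rintro (⟨i, b⟩ | p') β h
    · simp only [passageMap, Sum.map_inl, Prod.map_apply, Sum.inl.injEq, Prod.mk.injEq] at h
      exact hfc i h.1
    · simp [passageMap] at h
  have hy : ∀ y : D'.Passage, (∃ β, y = Sum.inl (c, β)) ∨ ∃ x : D.Passage, passageMap f g x = y := by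
    rintro (⟨i, b⟩ | p')
    · by_cases hi : i = c
      · exact Or.inl ⟨b, by rw [hi]⟩
      · have : i ∈ Set.range f := hr ▸ hi
        obtain ⟨j, rfl⟩ := this
        exact Or.inr ⟨Sum.inl (j, b), rfl⟩
    · exact Or.inr ⟨Sum.inr (g.symm p'), by simp [passageMap]⟩
  let q : D'.Passage → D.Passage := Function.extend (passageMap f g) id fun _ => s
  have hq : ∀ x, q (passageMap f g x) = x := fun x => hinj.extend_apply _ _ _
  have hqc : ∀ β, q (Sum.inl (c, β)) = s := fun β =>
    Function.extend_apply' _ _ _ fun ⟨x, hx⟩ => hc x β hx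
  have hsymm : ∀ x, x ≠ s → D'.next.symm (passageMap f g (D.next x)) = passageMap f g x :=
    fun x hx => by rw [← hn x hx, Equiv.symm_apply_apply]
  have hsymm' : D'.next.symm (passageMap f g (D.next s)) = Sum.inl (c, !b) := by
    rw [← hn3, Equiv.symm_apply_apply]
  have r : Retraction f g q := ⟨hs, hq, fun x => by
    obtain ⟨y, rfl⟩ := D.next.surjective x
    rw [Equiv.symm_apply_apply]
    by_cases hy : y = s
    · rw [hy, hsymm', hqc]
    · rw [hsymm y hy, hq]⟩
  let e : Option (Fin D.n) ≃ Fin D'.n := optionEquiv c f f.injective hr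
  have a1 : D'.arcOf (Sum.inl (c, b), false) = passageMap f g s := by
    rw [arcOf, ← hn1, Equiv.symm_apply_apply]
  have a2 : D'.arcOf (Sum.inl (c, b), true) = Sum.inl (c, b) := rfl
  have a3 : D'.arcOf (Sum.inl (c, !b), false) = Sum.inl (c, b) := by
    rw [arcOf, ← hn2, Equiv.symm_apply_apply]
  have a4 : D'.arcOf (Sum.inl (c, !b), true) = Sum.inl (c, !b) := rfl
  -- The strand enters the kink by the arc of `s` and leaves it by the arc of the second passage
  -- through `c`; the loop is the arc of the first passage.
  have k : PD.Kink D.pd (D'.pd.reindex e) (!D'.sign c) q (passageMap f g) (passageMap f g s)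
      (Sum.inl (c, !b)) (Sum.inl (c, b)) := by
    refine ⟨r.collapse g.surjective fun x d => ?_, fun y hne => ?_, hc _ _, by simp, ?_, ?_, ?_⟩
    · simp only [Set.mem_singleton_iff]
      rw [arcOf_eq_iff, hn2]
      rintro (h | h)
      · exact hc _ _ (Prod.ext_iff.1 h).1
      · exact hc _ _ (Prod.ext_iff.1 h).1
    · rcases hy y with ⟨β, rfl⟩ | ⟨x, rfl⟩
      · have : β = !b := by
          cases β <;> cases b <;> simp_all
        subst this
        exact Or.inr ⟨Or.inr rfl, Or.inl (by rw [hqc])⟩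
      · exact Or.inl (by rw [hq])
    · rw [hq, hqc]
    · intro v κ
      change D'.pd.Smooth v κ c ↔ _
      cases b
      · rw [smooth_pd c true false]
        simp only [Bool.not_false, Bool.not_true] at a1 a2 a3 a4 ⊢
        rw [a1, a2, a3, a4]
        simp [eq_comm, and_comm]
      · rw [smooth_pd c false true]
        simp only [Bool.not_false, Bool.not_true] at a1 a2 a3 a4 ⊢
        rw [a1, a2, a3, a4]
        simp [eq_comm]
    · change (D'.arcOf (Sum.inl (c, true), false) = _ ∧ D'.arcOf (Sum.inl (c, true), true) = _) ∨
        (D'.arcOf (Sum.inl (c, true), false) = _ ∧ D'.arcOf (Sum.inl (c, true), true) = _)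
      cases b
      · exact Or.inr ⟨a3, a4⟩
      · exact Or.inl ⟨a1, a2⟩
  have hw := writheShift_optionEquiv e
  change _ = (if D'.sign c = true then (1 : ℝ) else -2) +
    (((Finset.univ.filter fun i => D'.sign (f i) = true).card : ℝ) -
      2 * (Finset.univ.filter fun i => D'.sign (f i) = false).card) at hw
  simp only [hs] at hw
  change _ = _ + D.writheShift at hw
  unfold Survives
  rw [← PD.good_reindex e (PD.optT_isTournament isTournament_lt) isTournament_lt]
  cases hsc : D'.sign c
  · rw [hsc] at hw k
    constructor
    · intro h
      have := k.good_of_true h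
      convert this using 1
      rw [hw]
      simp
      ring
    · intro h
      have := k.good_true_of ht h
      convert this using 1
      rw [hw]
      simp
      ring
  · rw [hsc] at hw k
    constructor
    · intro h
      have := k.good_of_false h
      convert this using 1
      rw [hw]
      simp
      ring
    · intro h
      have := k.good_false_of ht h
      convert this using 1
      rw [hw]
      simp
      ring

end GaussDiagram

/-! ### The second Reidemeister move -/

namespace GaussDiagram

variable {D D' : GaussDiagram}

theorem writheShift_eq_sum : D.writheShift = ∑ c, if D.sign c = true then (1 : ℝ) else -2 := by
  have : ∀ c, (if D.sign c = true then (1 : ℝ) else -2) =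
      (if D.sign c = true then 1 else 0) - 2 * if D.sign c = false then 1 else 0 := fun c => by
    cases D.sign c <;> simp
  simp only [this, Finset.sum_sub_distrib, ← Finset.mul_sum, Finset.sum_boole]
  rfl

variable {K : Type*} [Field K] {ω : RootData K} {F : Type*} [Field F] [Algebra F K] {t lam : ℝ}

/-- The new crossings have opposite signs and change `n_+ - 2 n_-` by `1 - 2 = -1`, which matches
the shift for bigons. -/
theorem MoveTwo.survives_iff (ht : t ∈ Set.Icc (0 : ℝ) 2) (hA : D'.pd.Alternating)
    (h : D.MoveTwo D') : D.Survives ω F t lam ↔ D'.Survives ω F t lam := by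
  obtain ⟨f, g, c₁, c₂, c₃, c₄, s, r, hne, hsr, h34, hrange, hs, hsg, hn1, hn2, hn3, hn4, hn5, hn6,
    hn⟩ := h
  have hinj := passageMap_injective (D := D) (D' := D') f.injective g.injective
  have hfc : ∀ i, f i ≠ c₁ ∧ f i ≠ c₂ := fun i => by
    have : f i ∈ ({c₁, c₂} : Set (Fin D'.n))ᶜ := hrange ▸ ⟨i, rfl⟩
    simpa using this
  have h3 : c₃ = c₁ ∨ c₃ = c₂ := by tauto
  have h4 : c₄ = c₁ ∨ c₄ = c₂ := by tauto
  have hc : ∀ (x : D.Passage) c β, c = c₁ ∨ c = c₂ → passageMap f g x ≠ Sum.inl (c, β) := by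
    rintro (⟨i, b⟩ | p') c β hc h
    · simp only [passageMap, Sum.map_inl, Prod.map_apply, Sum.inl.injEq, Prod.mk.injEq] at h
      rcases hc with rfl | rfl
      · exact (hfc i).1 h.1
      · exact (hfc i).2 h.1
    · simp [passageMap] at h
  have hy : ∀ y : D'.Passage, y = Sum.inl (c₁, true) ∨ y = Sum.inl (c₂, true) ∨
      y = Sum.inl (c₃, false) ∨ y = Sum.inl (c₄, false) ∨ ∃ x : D.Passage, passageMap f g x = y := by
    rintro (⟨i, b⟩ | p')
    · by_cases hi : i = c₁ ∨ i = c₂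
      · rcases h34 with ⟨rfl, rfl⟩ | ⟨rfl, rfl⟩ <;> rcases hi with rfl | rfl <;> cases b <;> simp
      · have : i ∈ Set.range f := hrange ▸ (by simpa using hi)
        obtain ⟨j, rfl⟩ := this
        exact Or.inr (Or.inr (Or.inr (Or.inr ⟨Sum.inl (j, b), rfl⟩)))
    · exact Or.inr (Or.inr (Or.inr (Or.inr ⟨Sum.inr (g.symm p'), by simp [passageMap]⟩)))
  -- Only the two arcs that leave the bigon matter here: they go to `s` and `r`. The value on the
  -- sides of the bigon is a default.
  let q : D'.Passage → D.Passage := Function.extend (passageMap f g) id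
    fun y => if y = Sum.inl (c₂, true) then s else r
  have hq : ∀ x, q (passageMap f g x) = x := fun x => hinj.extend_apply _ _ _
  have hqs : q (Sum.inl (c₂, true)) = s :=
    (Function.extend_apply' _ _ _ fun ⟨x, hx⟩ => hc x _ _ (Or.inr rfl) hx).trans (if_pos rfl)
  have hqr : q (Sum.inl (c₄, false)) = r :=
    (Function.extend_apply' _ _ _ fun ⟨x, hx⟩ => hc x _ _ h4 hx).trans (if_neg (by simp))
  have hsymm : ∀ x, x ≠ s → x ≠ r → D'.next.symm (passageMap f g (D.next x)) = passageMap f g x :=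
    fun x hx hx' => by rw [← hn x hx hx', Equiv.symm_apply_apply]
  have hsymm_s : D'.next.symm (passageMap f g (D.next s)) = Sum.inl (c₂, true) := by
    rw [← hn3, Equiv.symm_apply_apply]
  have hsymm_r : D'.next.symm (passageMap f g (D.next r)) = Sum.inl (c₄, false) := by
    rw [← hn6, Equiv.symm_apply_apply]
  have hret : Retraction f g q := ⟨hs, hq, fun x => by
    obtain ⟨y, rfl⟩ := D.next.surjective x
    rw [Equiv.symm_apply_apply]
    by_cases hys : y = s
    · rw [hys, hsymm_s, hqs]
    · by_cases hyr : y = r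
      · rw [hyr, hsymm_r, hqr]
      · rw [hsymm y hys hyr, hq]⟩
  set m₁ : D'.Passage := Sum.inl (c₁, true) with hm₁
  set m₂ : D'.Passage := Sum.inl (c₃, false) with hm₂
  have hN : ∀ x d, D'.arcOf (passageMap f g x, d) ∉ ({m₁, m₂} : Set D'.Passage) := by
    intro x d
    simp only [Set.mem_insert_iff, Set.mem_singleton_iff, not_or]
    rw [arcOf_eq_iff, arcOf_eq_iff, hn2, hn5]
    refine ⟨?_, ?_⟩ <;> rintro (h | h)
    · exact hc _ _ _ (Or.inl rfl) (Prod.ext_iff.1 h).1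
    · exact hc _ _ _ (Or.inr rfl) (Prod.ext_iff.1 h).1
    · exact hc _ _ _ h3 (Prod.ext_iff.1 h).1
    · exact hc _ _ _ h4 (Prod.ext_iff.1 h).1
  have hm : m₁ ≠ m₂ := by simp [hm₁, hm₂]
  have hso : (Sum.inl (c₂, true) : D'.Passage) ∉ ({m₁, m₂} : Set D'.Passage) := by
    simp [hm₁, hm₂, hne.symm]
  have hro : (Sum.inl (c₄, false) : D'.Passage) ∉ ({m₁, m₂} : Set D'.Passage) := by
    rcases h34 with ⟨rfl, rfl⟩ | ⟨rfl, rfl⟩ <;> simp [hm₁, hm₂, hne, hne.symm]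
  -- A `Bigon` needs a first crossing whose `1`-smoothing joins the sides and a second one whose
  -- `0`-smoothing does. Which of `c₁`, `c₂` plays which role depends on the signs and on the
  -- directions of the strands. The Booleans tell which half-edges border the bigon.
  have main : ∀ (k₁ k₂ : Fin D'.n) (d₁ e₁ d₂ e₂ : Bool) (s₁ s₂ r₁ r₂ : D'.Passage), k₁ ≠ k₂ →
      (k₁ = c₁ ∧ k₂ = c₂ ∨ k₁ = c₂ ∧ k₂ = c₁) →
      (s₁ = passageMap f g s ∧ s₂ = Sum.inl (c₂, true) ∨
        s₂ = passageMap f g s ∧ s₁ = Sum.inl (c₂, true)) →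
      (r₁ = passageMap f g r ∧ r₂ = Sum.inl (c₄, false) ∨
        r₂ = passageMap f g r ∧ r₁ = Sum.inl (c₄, false)) →
      D'.arcOf (Sum.inl (k₁, true), d₁) = m₁ → D'.arcOf (Sum.inl (k₁, true), !d₁) = s₁ →
      D'.arcOf (Sum.inl (k₁, false), e₁) = m₂ → D'.arcOf (Sum.inl (k₁, false), !e₁) = r₁ →
      D'.arcOf (Sum.inl (k₂, true), d₂) = m₁ → D'.arcOf (Sum.inl (k₂, true), !d₂) = s₂ →
      D'.arcOf (Sum.inl (k₂, false), e₂) = m₂ → D'.arcOf (Sum.inl (k₂, false), !e₂) = r₂ →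
      (d₁ ^^ e₁ ^^ D'.sign k₁) = true → (d₂ ^^ e₂ ^^ D'.sign k₂) = false →
      (D.Survives ω F t lam ↔ D'.Survives ω F t lam) := by
    intro k₁ k₂ d₁ e₁ d₂ e₂ s₁ s₂ r₁ r₂ hk hk' hs' hr' a1 a2 a3 a4 a5 a6 a7 a8 hv1 hv2
    have hk1 : ∀ i, f i ≠ k₁ := fun i => by
      rcases hk' with ⟨rfl, -⟩ | ⟨rfl, -⟩
      exacts [(hfc i).1, (hfc i).2]
    have hk2 : ∀ i, f i ≠ k₂ := fun i => by
      rcases hk' with ⟨-, rfl⟩ | ⟨-, rfl⟩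
      exacts [(hfc i).2, (hfc i).1]
    let e : Option (Option (Fin D.n)) ≃ Fin D'.n :=
      Equiv.ofBijective (fun o => o.elim k₁ fun o => o.elim k₂ f) (by
        constructor
        · rintro (_ | _ | i) (_ | _ | j) h
          · rfl
          · exact absurd h hk
          · exact absurd h.symm (hk1 j)
          · exact absurd h.symm hk
          · rfl
          · exact absurd h.symm (hk2 j)
          · exact absurd h (hk1 i)
          · exact absurd h (hk2 i)
          · exact congrArg (fun i => some (some i)) (f.injective h)
        · intro x
          by_cases h1 : x = k₁
          · exact ⟨none, h1.symm⟩
          by_cases h2 : x = k₂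
          · exact ⟨some none, h2.symm⟩
          have : x ∈ Set.range f := by
            rw [hrange]
            rcases hk' with ⟨rfl, rfl⟩ | ⟨rfl, rfl⟩ <;> simp [h1, h2]
          obtain ⟨i, rfl⟩ := this
          exact ⟨some (some i), rfl⟩)
    have B : PD.Bigon D.pd (D'.pd.reindex e) q (passageMap f g) s₁ s₂ r₁ r₂ m₁ m₂ := by
      refine ⟨hret.collapse g.surjective hN, fun y hyN => ?_, ?_, ?_, ?_, ?_, hm, ?_, ?_,
        fun v κ => ?_, fun v κ => ?_, ?_, ?_⟩
      · simp only [Set.mem_insert_iff, Set.mem_singleton_iff, not_or] at hyN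
        rcases hy y with h | rfl | h | rfl | ⟨x, rfl⟩
        · exact absurd h hyN.1
        · right; left
          rw [hqs]
          rcases hs' with ⟨rfl, rfl⟩ | ⟨rfl, rfl⟩ <;> simp
        · exact absurd h hyN.2
        · right; right
          rw [hqr]
          rcases hr' with ⟨rfl, rfl⟩ | ⟨rfl, rfl⟩ <;> simp
        · left
          rw [hq]
      · rcases hs' with ⟨rfl, rfl⟩ | ⟨rfl, rfl⟩
        exacts [hN s true, hso]
      · rcases hs' with ⟨rfl, rfl⟩ | ⟨rfl, rfl⟩
        exacts [hso, hN s true]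
      · rcases hr' with ⟨rfl, rfl⟩ | ⟨rfl, rfl⟩
        exacts [hN r true, hro]
      · rcases hr' with ⟨rfl, rfl⟩ | ⟨rfl, rfl⟩
        exacts [hro, hN r true]
      · rcases hs' with ⟨rfl, rfl⟩ | ⟨rfl, rfl⟩ <;> rw [hq, hqs]
      · rcases hr' with ⟨rfl, rfl⟩ | ⟨rfl, rfl⟩ <;> rw [hq, hqr]
      · change D'.pd.Smooth v κ k₁ ↔ _
        rw [smooth_pd k₁ d₁ e₁, hv1, a1, a2, a3, a4]
        split_ifs
        · exact and_comm
        · rw [and_comm, @eq_comm _ (κ r₁)]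
      · change D'.pd.Smooth v κ k₂ ↔ _
        rw [smooth_pd k₂ d₂ e₂, hv2, a5, a6, a7, a8]
        split_ifs
        · rfl
        · rw [@eq_comm _ (κ m₂)]
      · change (D'.arcOf (Sum.inl (k₁, true), false) = _ ∧ D'.arcOf (Sum.inl (k₁, true), true) = _) ∨
          (D'.arcOf (Sum.inl (k₁, true), false) = _ ∧ D'.arcOf (Sum.inl (k₁, true), true) = _)
        cases d₁
        exacts [Or.inr ⟨a1, a2⟩, Or.inl ⟨a2, a1⟩]
      · change (D'.arcOf (Sum.inl (k₂, true), false) = _ ∧ D'.arcOf (Sum.inl (k₂, true), true) = _) ∨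
          (D'.arcOf (Sum.inl (k₂, true), false) = _ ∧ D'.arcOf (Sum.inl (k₂, true), true) = _)
        cases d₂
        exacts [Or.inr ⟨a5, a6⟩, Or.inl ⟨a6, a5⟩]
    have hw : D'.writheShift = D.writheShift - 1 := by
      rw [writheShift_eq_sum, writheShift_eq_sum, ← e.sum_comp, Fintype.sum_option,
        Fintype.sum_option]
      change (if D'.sign k₁ = true then (1 : ℝ) else -2) + ((if D'.sign k₂ = true then (1 : ℝ) else -2) +
        ∑ i, if D'.sign (f i) = true then (1 : ℝ) else -2) = _
      simp only [hs]
      have hsum : (if D'.sign c₁ = true then (1 : ℝ) else -2) +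
          (if D'.sign c₂ = true then (1 : ℝ) else -2) = -1 := by
        rw [hsg]
        cases D'.sign c₁ <;> norm_num
      rcases hk' with ⟨rfl, rfl⟩ | ⟨rfl, rfl⟩ <;> linarith
    unfold Survives
    rw [← PD.good_reindex e
      (PD.optT_isTournament (PD.optT_isTournament isTournament_lt)) isTournament_lt, hw]
    have hA' := hA.reindex e
    constructor
    · intro h
      convert B.good_of ht hA' h using 1
      ring
    · intro h
      convert B.good_back ht hA' h using 1
      ring
  have b1 : D'.arcOf (Sum.inl (c₁, true), true) = m₁ := rfl
  have b2 : D'.arcOf (Sum.inl (c₁, true), false) = passageMap f g s := by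
    rw [arcOf, Equiv.symm_apply_eq, hn1]
  have b3 : D'.arcOf (Sum.inl (c₂, true), true) = Sum.inl (c₂, true) := rfl
  have b4 : D'.arcOf (Sum.inl (c₂, true), false) = m₁ := by
    rw [arcOf, Equiv.symm_apply_eq, hn2]
  have b5 : D'.arcOf (Sum.inl (c₃, false), true) = m₂ := rfl
  have b6 : D'.arcOf (Sum.inl (c₃, false), false) = passageMap f g r := by
    rw [arcOf, Equiv.symm_apply_eq, hn4]
  have b7 : D'.arcOf (Sum.inl (c₄, false), true) = Sum.inl (c₄, false) := rfl
  have b8 : D'.arcOf (Sum.inl (c₄, false), false) = m₂ := by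
    rw [arcOf, Equiv.symm_apply_eq, hn5]
  rcases h34 with ⟨h3, h4⟩ | ⟨h3, h4⟩
  · replace b5 : D'.arcOf (Sum.inl (c₁, false), true) = m₂ := by rw [← h3]; exact b5
    replace b6 : D'.arcOf (Sum.inl (c₁, false), false) = passageMap f g r := by
      rw [← h3]; exact b6
    replace b7 : D'.arcOf (Sum.inl (c₂, false), true) = Sum.inl (c₄, false) := by
      rw [← h4]; exact b7
    replace b8 : D'.arcOf (Sum.inl (c₂, false), false) = m₂ := by rw [← h4]; exact b8
    cases hv : D'.sign c₁ <;> rw [hv] at hsg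
    · exact main c₂ c₁ false false true true _ _ _ _ hne.symm (Or.inr ⟨rfl, rfl⟩)
        (Or.inr ⟨rfl, rfl⟩) (Or.inr ⟨rfl, rfl⟩) b4 b3 b8 b7 b1 b2 b5 b6 (by rw [hsg]; rfl)
        (by rw [hv]; rfl)
    · exact main c₁ c₂ true true false false _ _ _ _ hne (Or.inl ⟨rfl, rfl⟩)
        (Or.inl ⟨rfl, rfl⟩) (Or.inl ⟨rfl, rfl⟩) b1 b2 b5 b6 b4 b3 b8 b7 (by rw [hv]; rfl)
        (by rw [hsg]; rfl)
  · replace b5 : D'.arcOf (Sum.inl (c₂, false), true) = m₂ := by rw [← h3]; exact b5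
    replace b6 : D'.arcOf (Sum.inl (c₂, false), false) = passageMap f g r := by
      rw [← h3]; exact b6
    replace b7 : D'.arcOf (Sum.inl (c₁, false), true) = Sum.inl (c₄, false) := by
      rw [← h4]; exact b7
    replace b8 : D'.arcOf (Sum.inl (c₁, false), false) = m₂ := by rw [← h4]; exact b8
    cases hv : D'.sign c₁ <;> rw [hv] at hsg
    · exact main c₁ c₂ true false false true _ _ _ _ hne (Or.inl ⟨rfl, rfl⟩)
        (Or.inl ⟨rfl, rfl⟩) (Or.inr ⟨rfl, rfl⟩) b1 b2 b8 b7 b4 b3 b5 b6 (by rw [hv]; rfl)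
        (by rw [hsg]; rfl)
    · exact main c₂ c₁ false true true false _ _ _ _ hne.symm (Or.inr ⟨rfl, rfl⟩)
        (Or.inr ⟨rfl, rfl⟩) (Or.inl ⟨rfl, rfl⟩) b4 b3 b5 b6 b1 b2 b8 b7 (by rw [hsg]; rfl)
        (by rw [hv]; rfl)

end GaussDiagram

/-! ### Isomorphisms of diagram data -/

namespace PD

variable {I I' H H' : Type*}

/-- An isomorphism of diagram data. -/
structure Iso (P : PD I H) (P' : PD I' H') (e : I ≃ I') (c : H ≃ H') : Prop where
  ov : ∀ i b, P'.ov (e i) b = c (P.ov i b)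
  un : ∀ i b, P'.un (e i) b = c (P.un i b)
  glue : ∀ a b, P'.glue (c a) (c b) ↔ P.glue a b

variable {P : PD I H} {P' : PD I' H'} {e : I ≃ I'} {c : H ≃ H'}

theorem Iso.cons_iff (E : Iso P P' e c) {u : I' → Bool} {κ : H' → Bool} :
    P.Cons (u ∘ e) (κ ∘ c) ↔ P'.Cons u κ := by
  unfold Cons Smooth
  refine and_congr ?_ ?_
  · rw [e.forall_congr_left]
    simp only [Function.comp_apply, ← E.ov, ← E.un, Equiv.apply_symm_apply]
  · rw [c.forall_congr_left]
    refine forall_congr' fun a => ?_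
    rw [c.forall_congr_left]
    simp only [Function.comp_apply, ← E.glue, Equiv.apply_symm_apply]

theorem Iso.equivalent (E : Iso P P' e c) : Equivalent P P' e c c.symm where
  pull _ _ h := E.cons_iff.2 h
  push u κ h := by
    rw [← E.cons_iff]
    simpa [Function.comp_assoc] using h
  pq _ _ _ _ := by rw [c.apply_symm_apply]
  qp _ _ _ _ := by rw [c.symm_apply_apply]
  ov _ _ _ _ _ := by rw [E.ov]

theorem Iso.alternating (E : Iso P P' e c) (h : P'.Alternating) : P.Alternating := by
  have hres : ∀ (u : I → Bool) a b, P.res u a b ↔ P'.res (u ∘ e.symm) (c a) (c b) := by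
    intro u a b
    rw [res_iff, res_iff]
    constructor
    · intro h κ hκ
      have := h (κ ∘ c) (by
        have := E.cons_iff.2 hκ
        rwa [Function.comp_assoc, Equiv.symm_comp_self, Function.comp_id] at this)
      exact this
    · intro h κ hκ
      have := h (κ ∘ c.symm) (E.cons_iff.1 (by simpa [Function.comp_assoc] using hκ))
      simpa using this
  intro u i hi
  have := h (u ∘ e.symm) (e i) (by simpa using hi)
  have e2 : Function.update (u ∘ e.symm) (e i) true = Function.update u i true ∘ e.symm := by
    ext j
    by_cases hj : j = e i
    · subst hj; simp
    · have : e.symm j ≠ i := fun h => hj (by simp [← h])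
      simp [hj, this]
  rw [hres, hres, ← e2, ← E.ov, ← E.ov]
  exact this

end PD

/-! ### The third Reidemeister move -/

namespace GaussDiagram

variable {D D' : GaussDiagram}

variable (D) in
/-- The exchange of the two crossings on each of the three strands of a triangle. -/
def strandFlip (x y z : Fin D.n) : Equiv.Perm D.Passage :=
  Equiv.swap (Sum.inl (x, true)) (Sum.inl (y, true)) *
  Equiv.swap (Sum.inl (x, false)) (Sum.inl (z, true)) *
  Equiv.swap (Sum.inl (y, false)) (Sum.inl (z, false))

theorem strandFlip_inl {x y z : Fin D.n} (hxy : x ≠ y) (hyz : y ≠ z) (hxz : x ≠ z) :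
    D.strandFlip x y z (Sum.inl (x, true)) = Sum.inl (y, true) ∧
    D.strandFlip x y z (Sum.inl (y, true)) = Sum.inl (x, true) ∧
    D.strandFlip x y z (Sum.inl (x, false)) = Sum.inl (z, true) ∧
    D.strandFlip x y z (Sum.inl (z, true)) = Sum.inl (x, false) ∧
    D.strandFlip x y z (Sum.inl (y, false)) = Sum.inl (z, false) ∧
    D.strandFlip x y z (Sum.inl (z, false)) = Sum.inl (y, false) := by
  refine ⟨?_, ?_, ?_, ?_, ?_, ?_⟩ <;>
    simp [strandFlip, Equiv.swap_apply_def, hxy, hyz, hxz, hxy.symm, hyz.symm, hxz.symm]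

theorem strandFlip_of_ne {x y z i : Fin D.n} (hi : i ≠ x ∧ i ≠ y ∧ i ≠ z) (b : Bool) :
    D.strandFlip x y z (Sum.inl (i, b)) = Sum.inl (i, b) := by
  simp [strandFlip, Equiv.swap_apply_def, hi.1, hi.2.1, hi.2.2]

theorem strandFlip_inr {x y z : Fin D.n} (p : Fin D.m) :
    D.strandFlip x y z (Sum.inr p) = Sum.inr p := by
  simp [strandFlip, Equiv.swap_apply_def]

theorem strandFlip_strandFlip {x y z : Fin D.n} (hxy : x ≠ y) (hyz : y ≠ z) (hxz : x ≠ z)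
    (s : D.Passage) : D.strandFlip x y z (D.strandFlip x y z s) = s := by
  obtain ⟨h1, h2, h3, h4, h5, h6⟩ := strandFlip_inl hxy hyz hxz
  rcases s with ⟨i, b⟩ | p
  · by_cases hi : i ≠ x ∧ i ≠ y ∧ i ≠ z
    · rw [strandFlip_of_ne hi, strandFlip_of_ne hi]
    · have : i = x ∨ i = y ∨ i = z := by tauto
      rcases this with rfl | rfl | rfl <;> cases b <;> simp only [h1, h2, h3, h4, h5, h6]
  · rw [strandFlip_inr, strandFlip_inr]

/-- The successor map of `D'` is conjugate to that of `D` by the flip. So `D'` can be drawn on the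
arcs of `D` with the passages exchanged, and both sides of the move are compared on one set of arcs.
-/
theorem twistedPd_iso {f : Fin D.n ≃ Fin D'.n} {g : Fin D.m ≃ Fin D'.m}
    (hs : ∀ c, D'.sign (f c) = D.sign c) {π : Equiv.Perm D.Passage} (hπ : ∀ s, π (π s) = s)
    (hn : ∀ s, D'.next (passageMap f g s) = passageMap f g (π (D.next (π s)))) :
    PD.Iso (D.twistedPd π) D'.pd f
      (π.trans (Equiv.sumCongr (f.prodCongr (Equiv.refl Bool)) g)) := by
  set c := π.trans (Equiv.sumCongr (f.prodCongr (Equiv.refl Bool)) g)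
  have hc : ∀ s, c s = passageMap f g (π s) := fun _ => rfl
  have harc : ∀ w d, D'.arcOf (passageMap f g w, d) = c (D.arcOf (π w, d)) := by
    rintro w (_ | _)
    · rw [hc, arcOf, arcOf, Equiv.symm_apply_eq, hn, hπ, Equiv.apply_symm_apply, hπ]
    · rw [hc, arcOf, arcOf, hπ]
  refine ⟨fun i b => harc (Sum.inl (i, true)) b, fun i b => ?_, fun a b => ?_⟩
  · simp only [pd, hs]
    exact harc (Sum.inl (i, false)) _
  · have h1 : ∀ p d, D'.arcOf (Sum.inr (g p), d) = c (D.arcOf (π (Sum.inr p), d)) := fun p d =>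
      harc (Sum.inr p) d
    simp only [pd, twistedPd]
    rw [g.symm.exists_congr_left]
    simp only [Equiv.symm_symm, h1, c.injective.eq_iff]

theorem Consecutive.arcOf_eq {o : Bool} {a b : D.Passage} (h : D.Consecutive o a b) :
    D.arcOf (b, !o) = D.arcOf (a, o) := by
  cases o
  · have h : D.next b = a := h
    simp [arcOf, ← h]
  · have h : D.next a = b := h
    simp [arcOf, ← h]

theorem Consecutive.arcOf_eq_iff {o : Bool} {a b : D.Passage} (h : D.Consecutive o a b)
    {x : D.HalfEdge} : D.arcOf x = D.arcOf (a, o) ↔ x = (a, o) ∨ x = (b, !o) := by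
  rw [GaussDiagram.arcOf_eq_iff]
  cases o
  · have h : D.next b = a := h
    rw [arcOf, ← h, Equiv.symm_apply_apply]
    exact or_comm
  · have h : D.next a = b := h
    rw [arcOf, h]
    rfl

/-- Triangles in terms of the arcs at the three crossings. -/
theorem triangle_of_arcs {π : Equiv.Perm D.Passage} {I : Type*}
    {e : Option (Option (Option I)) ≃ Fin D.n} {x y z : Fin D.n} (hz : e none = z)
    (hx : e (some none) = x) (hy : e (some (some none)) = y) {A : PD.Arcs D.Passage}
    {Q : PD I D.Passage} (hQ : ((D.twistedPd π).reindex e).tail.tail.tail = Q)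
    (hav : Q.Avoids {A.t, A.m, A.b}) (hdist : A.Distinct) {a : Bool} (d₁ e₁ d₂ e₂ d₃ e₃ : Bool)
    (hx₁ : D.arcOf (π (Sum.inl (x, true)), d₁) = A.t)
    (hx₂ : D.arcOf (π (Sum.inl (x, true)), !d₁) = A.Tx)
    (hx₃ : D.arcOf (π (Sum.inl (x, false)), e₁) = A.m)
    (hx₄ : D.arcOf (π (Sum.inl (x, false)), !e₁) = A.Mx)
    (hy₁ : D.arcOf (π (Sum.inl (y, true)), d₂) = A.t)
    (hy₂ : D.arcOf (π (Sum.inl (y, true)), !d₂) = A.Ty)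
    (hy₃ : D.arcOf (π (Sum.inl (y, false)), e₂) = A.b)
    (hy₄ : D.arcOf (π (Sum.inl (y, false)), !e₂) = A.By)
    (hz₁ : D.arcOf (π (Sum.inl (z, true)), d₃) = A.m)
    (hz₂ : D.arcOf (π (Sum.inl (z, true)), !d₃) = A.Mz)
    (hz₃ : D.arcOf (π (Sum.inl (z, false)), e₃) = A.b)
    (hz₄ : D.arcOf (π (Sum.inl (z, false)), !e₃) = A.Bz)
    (hxa : (d₁ ^^ e₁ ^^ D.sign x) = a) (hya : (d₂ ^^ e₂ ^^ D.sign y) = !a)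
    (hza : (d₃ ^^ e₃ ^^ D.sign z) = a) : ((D.twistedPd π).reindex e).Triangle Q A a := by
  have hstrand : ∀ (c : Fin D.n) (d : Bool) (p q : D.Passage),
      D.arcOf (π (Sum.inl (c, true)), d) = p → D.arcOf (π (Sum.inl (c, true)), !d) = q →
      ((D.twistedPd π).ov c false = p ∧ (D.twistedPd π).ov c true = q) ∨
        ((D.twistedPd π).ov c false = q ∧ (D.twistedPd π).ov c true = p) := by
    rintro c (_ | _) p q h1 h2
    exacts [Or.inl ⟨h1, h2⟩, Or.inr ⟨h2, h1⟩]
  refine ⟨hQ, hav, hdist, fun v κ => ?_, fun v κ => ?_, fun v κ => ?_, ?_, ?_, ?_⟩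
  · change (D.twistedPd π).Smooth v κ (e none) ↔ _
    rw [hz, smooth_twistedPd π z d₃ e₃, hza, hz₁, hz₂, hz₃, hz₄]
  · change (D.twistedPd π).Smooth v κ (e (some none)) ↔ _
    rw [hx, smooth_twistedPd π x d₁ e₁, hxa, hx₁, hx₂, hx₃, hx₄, and_comm (a := κ A.t = κ A.Mx)]
  · change (D.twistedPd π).Smooth v κ (e (some (some none))) ↔ _
    rw [hy, smooth_twistedPd π y d₂ e₂, hya, hy₁, hy₂, hy₃, hy₄]
  · rw [← hz] at hz₁ hz₂
    exact hstrand _ _ _ _ hz₁ hz₂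
  · rw [← hx] at hx₁ hx₂
    exact (hstrand _ _ _ _ hx₁ hx₂).symm
  · rw [← hy] at hy₁ hy₂
    exact hstrand _ _ _ _ hy₁ hy₂

variable {K : Type*} [Field K] {ω : RootData K} {F : Type*} [Field F] [Algebra F K] {t lam : ℝ}

/-- On the arcs of `D` both diagrams are triangles with the same further crossings, and their arcs
differ by `PD.Arcs.swap`. Signs are kept, so no shift occurs. -/
theorem MoveThree.survives_iff (ht : t ∈ Set.Icc (0 : ℝ) 2) (hA : D.pd.Alternating)
    (hA' : D'.pd.Alternating) (h : D.MoveThree D') :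
    D.Survives ω F t lam ↔ D'.Survives ω F t lam := by
  obtain ⟨f, g, x, y, z, o₁, o₂, o₃, hxy, hyz, hxz, hc1, hc2, hc3, hs1, hs2, hs, hn⟩ := h
  replace hn : ∀ s, D'.next (passageMap f g s) =
      passageMap f g (D.strandFlip x y z (D.next (D.strandFlip x y z s))) := hn
  have E := twistedPd_iso hs (strandFlip_strandFlip hxy hyz hxz) hn
  set π := D.strandFlip x y z
  obtain ⟨p1, p2, p3, p4, p5, p6⟩ := strandFlip_inl hxy hyz hxz
  let A : PD.Arcs D.Passage :=
    { t := D.arcOf (Sum.inl (x, true), o₁)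
      m := D.arcOf (Sum.inl (x, false), o₂)
      b := D.arcOf (Sum.inl (y, false), o₃)
      Tx := D.arcOf (Sum.inl (x, true), !o₁)
      Ty := D.arcOf (Sum.inl (y, true), o₁)
      Mx := D.arcOf (Sum.inl (x, false), !o₂)
      Mz := D.arcOf (Sum.inl (z, true), o₂)
      By := D.arcOf (Sum.inl (y, false), !o₃)
      Bz := D.arcOf (Sum.inl (z, false), o₃) }
  let e : Option (Option (Option {i // i ≠ x ∧ i ≠ y ∧ i ≠ z})) ≃ Fin D.n :=
    Equiv.ofBijective (fun o => o.elim z fun o => o.elim x fun o => o.elim y Subtype.val) (by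
      constructor
      · rintro (_ | _ | _ | i) (_ | _ | _ | j) h
        · rfl
        · exact absurd h hxz.symm
        · exact absurd h hyz.symm
        · exact absurd h.symm j.2.2.2
        · exact absurd h hxz
        · rfl
        · exact absurd h hxy
        · exact absurd h.symm j.2.1
        · exact absurd h hyz
        · exact absurd h hxy.symm
        · rfl
        · exact absurd h.symm j.2.2.1
        · exact absurd h i.2.2.2
        · exact absurd h i.2.1
        · exact absurd h i.2.2.1
        · exact congrArg (fun i => some (some (some i))) (Subtype.ext h)
      · intro i
        by_cases h1 : i = z
        · exact ⟨none, h1.symm⟩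
        by_cases h2 : i = x
        · exact ⟨some none, h2.symm⟩
        by_cases h3 : i = y
        · exact ⟨some (some none), h3.symm⟩
        exact ⟨some (some (some ⟨i, h2, h3, h1⟩)), rfl⟩)
  have e1 : e none = z := rfl
  have e2 : e (some none) = x := rfl
  have e3 : e (some (some none)) = y := rfl
  let Q := (D.pd.reindex e).tail.tail.tail
  have hdist : A.Distinct := by
    constructor <;>
      simp only [A, ne_eq, hc1.arcOf_eq_iff, hc2.arcOf_eq_iff, hc3.arcOf_eq_iff] <;>
      simp [hxy, hyz, hxz, hxy.symm, hyz.symm, hxz.symm]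
  have hav : Q.Avoids {A.t, A.m, A.b} := by
    have key : ∀ (w : D.Passage) d, (∀ i β, w = Sum.inl (i, β) → i ≠ x ∧ i ≠ y ∧ i ≠ z) →
        D.arcOf (w, d) ∉ ({A.t, A.m, A.b} : Set D.Passage) := by
      intro w d hw
      simp only [A, Set.mem_insert_iff, Set.mem_singleton_iff, hc1.arcOf_eq_iff, hc2.arcOf_eq_iff,
        hc3.arcOf_eq_iff, Prod.mk.injEq]
      rintro ((⟨rfl, -⟩ | ⟨rfl, -⟩) | (⟨rfl, -⟩ | ⟨rfl, -⟩) | (⟨rfl, -⟩ | ⟨rfl, -⟩))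
      exacts [(hw _ _ rfl).1 rfl, (hw _ _ rfl).2.1 rfl, (hw _ _ rfl).1 rfl, (hw _ _ rfl).2.2 rfl,
        (hw _ _ rfl).2.1 rfl, (hw _ _ rfl).2.2 rfl]
    refine ⟨fun i d => key _ _ ?_, fun i d => key _ _ ?_, ?_⟩
    · rintro j β h
      obtain ⟨rfl, -⟩ := Prod.ext_iff.1 (Sum.inl.inj h)
      exact i.2
    · rintro j β h
      obtain ⟨rfl, -⟩ := Prod.ext_iff.1 (Sum.inl.inj h)
      exact i.2
    · rintro _ _ ⟨p, rfl, rfl⟩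
      exact ⟨key _ _ fun i β h => by simp at h, key _ _ fun i β h => by simp at h⟩
  have hQ' : ((D.twistedPd π).reindex e).tail.tail.tail = Q := by
    have h1 : ∀ (i : {i // i ≠ x ∧ i ≠ y ∧ i ≠ z}) β,
        π (Sum.inl (i.1, β)) = Sum.inl (i.1, β) := fun i β => strandFlip_of_ne i.2 β
    have h2 : ∀ p, π (Sum.inr p) = Sum.inr p := strandFlip_inr
    change PD.mk (fun (i : {i // i ≠ x ∧ i ≠ y ∧ i ≠ z}) d => D.arcOf (π (Sum.inl (i.1, true)), d))
      (fun (i : {i // i ≠ x ∧ i ≠ y ∧ i ≠ z}) d => D.arcOf (π (Sum.inl (i.1, false)), d != D.sign i.1))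
      (fun a b => ∃ p, a = D.arcOf (π (Sum.inr p), false) ∧ b = D.arcOf (π (Sum.inr p), true)) = _
    simp only [h1, h2]
    rfl
  -- The two conditions on orders and signs say precisely that the smoothings cutting off the
  -- corners agree at `x` and `z` and are opposite at `y`.
  have hsign : (o₁ ^^ o₂ ^^ D.sign x) = (o₂ ^^ o₃ ^^ D.sign z) ∧
      ((!o₁) ^^ o₃ ^^ D.sign y) = !(o₁ ^^ o₂ ^^ D.sign x) := by
    have key : ∀ o₁ o₂ o₃ a b c : Bool, (o₁ = o₂ ↔ b = c) → (o₁ = o₃ ↔ a = c) →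
        (o₁ ^^ o₂ ^^ a) = (o₂ ^^ o₃ ^^ c) ∧ ((!o₁) ^^ o₃ ^^ b) = !(o₁ ^^ o₂ ^^ a) := by decide
    exact key _ _ _ _ _ _ hs1 hs2
  have k : (D.pd.reindex e).Triangle Q A (o₁ ^^ o₂ ^^ D.sign x) := by
    refine triangle_of_arcs (π := 1) e1 e2 e3 rfl hav hdist o₁ o₂ (!o₁) o₃ (!o₂) (!o₃) rfl rfl rfl rfl
      hc1.arcOf_eq ?_ rfl rfl hc2.arcOf_eq ?_ hc3.arcOf_eq ?_ rfl hsign.2 ?_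
    · rw [Bool.not_not]; rfl
    · rw [Bool.not_not]; rfl
    · rw [Bool.not_not]; rfl
    · rw [hsign.1]; simp
  have k' : ((D.twistedPd π).reindex e).Triangle Q A.swap (o₁ ^^ o₂ ^^ D.sign x) := by
    refine triangle_of_arcs (A := A.swap) e1 e2 e3 hQ' hav hdist.swap (!o₁) (!o₂) o₁ (!o₃) o₂ o₃ ?_ ?_ ?_ ?_ ?_ ?_ ?_ ?_
      ?_ ?_ ?_ ?_ ?_ ?_ ?_
    · rw [p1]; exact hc1.arcOf_eq
    · rw [p1, Bool.not_not]; rfl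
    · rw [p3]; exact hc2.arcOf_eq
    · rw [p3, Bool.not_not]; rfl
    · rw [p2]; rfl
    · rw [p2]; rfl
    · rw [p5]; exact hc3.arcOf_eq
    · rw [p5, Bool.not_not]; rfl
    · rw [p4]; rfl
    · rw [p4]; rfl
    · rw [p6]; rfl
    · rw [p6]; rfl
    · simp
    · rw [← hsign.2]; simp
    · rw [← hsign.1]
  have hT : IsTournament fun i j : {i // i ≠ x ∧ i ≠ y ∧ i ≠ z} => i.1 < j.1 :=
    ⟨fun i => isTournament_lt.irrefl _, fun i j h => isTournament_lt.total _ _ fun h' =>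
      h (Subtype.ext h')⟩
  have hT3 := PD.optT_isTournament (PD.optT_isTournament (PD.optT_isTournament hT))
  have hAe := hA.reindex e
  have hAe' := (E.alternating hA').reindex e
  have main : D.pd.Good ω (· < ·) F t (lam - D.writheShift) ↔
      (D.twistedPd π).Good ω (· < ·) F t (lam - D.writheShift) := by
    rw [← PD.good_reindex e hT3 isTournament_lt, ← PD.good_reindex e hT3 isTournament_lt]
    exact ⟨k.good_of ht hAe hAe' k', k'.good_of ht hAe' hAe k⟩
  unfold Survives
  rw [main, writheShift_equiv f hs]
  constructor
  · intro h
    exact E.equivalent.good (h.change_tournament isTournament_lt (isTournament_lt.comp f))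
  · intro h
    exact E.equivalent.symm.good (h.change_tournament isTournament_lt (isTournament_lt.comp f.symm))

end GaussDiagram

/-! ### Invariance of the grading -/

namespace LinkDiagram

variable {F : Type*} [Field F] {t : ℝ}

theorem Same.gr_eq (ht : t ∈ Set.Icc (0 : ℝ) 2) {D D' : LinkDiagram} (h : D.Same D') :
    D.gr F t = D'.gr F t := by
  induction h with
  | rel D D' h =>
    refine gr_congr ht D D' fun K _ _ ω lam => ?_
    rcases h with h | h
    · exact h.survives_iff
    · exact h.survives_iff
  | refl => rfl
  | symm _ _ _ ih => exact ih.symm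
  | trans _ _ _ _ _ ih ih' => exact ih.trans ih'

theorem Move.gr_eq (ht : t ∈ Set.Icc (0 : ℝ) 2) {D D' : LinkDiagram} (h : D.Move D') :
    D.gr F t = D'.gr F t := by
  refine gr_congr ht D D' fun K _ _ ω lam => ?_
  have hD := GaussDiagram.pd_alternating D.planar
  have hD' := GaussDiagram.pd_alternating D'.planar
  rcases h with h | h | h
  · exact h.survives_iff ht
  · exact h.survives_iff ht hD'
  · exact h.survives_iff ht hD hD'

theorem ReidemeisterMove.gr_eq (ht : t ∈ Set.Icc (0 : ℝ) 2) {D D' : LinkDiagram}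
    (h : D.ReidemeisterMove D') : D.gr F t = D'.gr F t := by
  obtain ⟨E, E', h1, h2 | h2, h3⟩ := h
  · rw [h1.gr_eq ht, h2.gr_eq ht, h3.gr_eq ht]
  · rw [h1.gr_eq ht, ← h2.gr_eq ht, h3.gr_eq ht]

theorem Step.gr_eq (ht : t ∈ Set.Icc (0 : ℝ) 2) {D D' : LinkDiagram} (h : D.Step D') :
    D.gr F t = D'.gr F t := by
  rcases h with h | h
  · exact h.gr_eq ht
  · exact h.gr_eq ht

end LinkDiagram

end Khovanov

end

theorem proposition3p5 (F : Type*) [Field F] (t : ℝ) (ht : t ∈ Set.Icc (0 : ℝ) 2) :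
    (∀ D D' : Khovanov.LinkDiagram, D.ReidemeisterMove D' → D.gr F t = D'.gr F t) ∧
    (∀ D D' : Khovanov.LinkDiagram, D.link = D'.link →
      D.gr F t = D'.gr F t ∧ D.sInv F t = D'.sInv F t) ∧
    (∃ grL sL : Khovanov.Link → EReal, ∀ D : Khovanov.LinkDiagram,
      grL D.link = D.gr F t ∧ sL D.link = D.sInv F t) := by
  have h : ∃ grL sL : Khovanov.Link → EReal, ∀ D : Khovanov.LinkDiagram,
      grL D.link = D.gr F t ∧ sL D.link = D.sInv F t :=
    ⟨Quot.lift (fun D => D.gr F t) fun _ _ h => h.gr_eq ht,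
      Quot.lift (fun D => D.sInv F t) fun _ _ h => congrArg (· - 1) (h.gr_eq ht),
      fun D => ⟨rfl, rfl⟩⟩
  refine ⟨fun D D' h => h.gr_eq ht, fun D D' hD => ?_, h⟩
  obtain ⟨grL, sL, h⟩ := h
  rw [← (h D).1, ← (h D).2, ← (h D').1, ← (h D').2, hD]
  exact ⟨rfl, rfl⟩
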